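/- **Setting.** Let $d\in\{2,3\}$, $T>0$, let $\Omega=\prod_{i=1}^d \mathbb R/L_i\mathbb Z$ be a flat torus, and let $c_v,\kappa,\mu>0$, $\lambda\ge 0$, $0<\varepsilon<1$ be constants. Put $p=\varrho\vartheta$, $e=c_v\vartheta$, $s=\log(\vartheta^{c_v}/\varrho)$, $\mathbb S(\mathbf D)=2\mu\mathbf D+\lambda\,\mathrm{tr}(\mathbf D)\,\mathbb I$. The Navier–Stokes–Fourier system is $$\partial_t\varrho+\mathrm{div}(\varrho u)=0,\quad \partial_t(\varrho u)+\mathrm{div}(\varrho u\otimes u)+\nabla p=\mathrm{div}\,\mathbb S(\mathbf D(u)),\quad \partial_t(\varrho e)+\mathrm{div}(\varrho e u)-\mathrm{div}(\kappa\nabla\vartheta)=\mathbb S(\mathbf D(u)):\mathbf D(u)-p\,\mathrm{div}\,u .$$ **Scheme.** Let $\mathcal T$ be a uniform mesh of $\Omega$ by cubes $K$ with edges of length $h$ parallel to the axes, $\mathcal E$ the set of faces, $Q_h$ the functions that are constant on each cell and $\Pi_{\mathcal T}$ the cellwise mean. At a face $\sigma$ with unit normal $n$ let $r^{\rm in},r^{\rm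 out}$ be the one-sided values, $\overline r=(r^{\rm in}+r^{\rm out})/2$, $[[r]]=r^{\rm out}-r^{\rm in}$, and $$F_h(r,u)=r^{\rm in}[\overline u\cdot n]^++r^{\rm out}[\overline u\cdot n]^--h^\varepsilon[[r]],\qquad [f]^\pm=(f\pm|f|)/2$$ (componentwise if $r$ is a vector). Let $(\nabla_h r)_K=\frac1h\sum_{\sigma\subset\partial K}\overline r\,n$ with outer normals $n$, $\mathrm{div}_h v=\sum_i(\nabla_h v_i)_i$, $\mathbf D_h(v)=\frac12(\nabla_h v+\nabla_h^Tv)$, and let $\nabla_{\mathcal E}r$ be the vector whose $i$-th component equals $(r_L-r_K)/h$ on the dual cell (the union of the two adjacent half cells) of the face between $K$ and $L=K+he_i$. Let $\Delta t$ be a time step with $N\Delta t=T$, $N\in\mathbb N$, and $D_tv^k=(v^k-v^{k-1})/\Delta t$. A solution of the scheme with initial data $(\varrho_0,\vartheta_0,u_0)\in L^1(\Omega)$ is a sequence $(\varrho^k_h,\vartheta_h^k,u_h^k)\in Q_h$, $0\le k\le N$, starting from $(\varrho_h^0,\vartheta_h^0,u_h^0)=(\Pi_{\mathcal T}\varrho_0,\Pi_{\mathcal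 T}\vartheta_0,\Pi_{\mathcal T}u_0)$ and satisfying, with $p_h^k=\varrho_h^k\vartheta_h^k$, for $k=1,\dots,N$ and all (scalar, vector and scalar, respectively) $\phi_h\in Q_h$, $$\int_\Omega D_t\varrho_h^k\,\phi_h-\sum_{\sigma\in\mathcal E}\int_\sigma F_h(\varrho_h^k,u_h^k)[[\phi_h]]=0,$$ $$\int_\Omega D_t(\varrho_h^ku_h^k)\cdot\phi_h-\sum_{\sigma\in\mathcal E}\int_\sigma F_h(\varrho_h^ku_h^k,u_h^k)\cdot[[\phi_h]]-\int_\Omega p_h^k\,\mathrm{div}_h\phi_h=-2\mu\int_\Omega\mathbf D_h(u_h^k):\mathbf D_h(\phi_h)-\lambda\int_\Omega\mathrm{div}_hu_h^k\,\mathrm{div}_h\phi_h,$$ $$c_v\int_\Omega D_t(\varrho_h^k\vartheta_h^k)\phi_h-c_v\sum_{\sigma\in\mathcal E}\int_\sigma F_h(\varrho_h^k\vartheta_h^k,u_h^k)[[\phi_h]]+\kappa\int_\Omega\nabla_{\mathcal E}\vartheta_h^k\cdot\nabla_{\mathcal E}\phi_h=\int_\Omega\big(2\mu|\mathbf D_h(u_h^k)|^2+\lambda|\mathrm{div}_hu_h^k|^2-p_h^k\,\mathrm{div}_hu_h^k\big)\phi_h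 .$$ Write $\varrho_h(t)=\varrho_h^k$ for $t\in[k\Delta t,(k+1)\Delta t)$, and similarly $\vartheta_h,u_h$. **DMV solutions.** Let $\mathcal F$ be the set of $(\varrho,\vartheta,u,\mathbf D_u,\mathbf D_\vartheta)$ with $\varrho,\vartheta\ge0$, $u,\mathbf D_\vartheta\in\mathbb R^d$, $\mathbf D_u\in\mathbb R^{d\times d}_{\rm sym}$. A weakly-(*) measurable family $\{\mathcal V_{t,x}\}_{(t,x)\in(0,T)\times\Omega}$ of probability measures on $\mathcal F$ is a dissipative measure-valued (DMV) solution with initial condition $\{\mathcal V_{0,x}\}_{x\in\Omega}$ (probability measures in $(\varrho,\vartheta,u)$) and concentration defect $\nu_C\in\mathcal M([0,T]\times\Omega;\mathbb R^{d\times d})$ if all pairings below are defined a.e. and integrable, and, with $C^1$ meaning $C^1([0,T]\times\Omega)$: * (compatibility) $-\int_0^T\!\int_\Omega\langle\mathcal V_{t,x};u\rangle\cdot\mathrm{div}\,\mathbb T=\int_0^T\!\int_\Omega\langle\mathcal V_{t,x};\mathbf D_u\rangle:\mathbb T$ for all symmetric-matrix-valued $\mathbb T\in C^1$, and $-\int_0^T\!\int_\Omega\langle\mathcal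 V_{t,x};\vartheta\rangle\,\mathrm{div}\,\varphi=\int_0^T\!\int_\Omega\langle\mathcal V_{t,x};\mathbf D_\vartheta\rangle\cdot\varphi$ for all $\mathbb R^d$-valued $\varphi\in C^1$; * (mass) for a.a. $\tau\in[0,T]$ and all $\varphi\in C^1$, $\big[\int_\Omega\langle\mathcal V_{t,x};\varrho\rangle\varphi\big]_{t=0}^{t=\tau}=\int_0^\tau\!\int_\Omega\langle\mathcal V_{t,x};\varrho\rangle\partial_t\varphi+\langle\mathcal V_{t,x};\varrho u\rangle\cdot\nabla\varphi$; * (momentum) for a.a. $\tau$ and all $\mathbb R^d$-valued $\varphi\in C^1$, $\big[\int_\Omega\langle\mathcal V_{t,x};\varrho u\rangle\cdot\varphi\big]_{t=0}^{t=\tau}=\int_0^\tau\!\int_\Omega\langle\mathcal V_{t,x};\varrho u\rangle\cdot\partial_t\varphi+\langle\mathcal V_{t,x};\varrho u\otimes u\rangle:\nabla\varphi+\langle\mathcal V_{t,x};p\rangle\,\mathrm{div}\,\varphi-\int_0^\tau\!\int_\Omega\langle\mathcal V_{t,x};\mathbb S(\mathbf D_u)\rangle:\nabla\varphi+\int_0^\tau\!\int_\Omega\nabla\varphi:d\nu_C$;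 * (energy) for a.a. $\tau$, $\int_\Omega\langle\mathcal V_{\tau,x};\frac12\varrho|u|^2+\varrho e\rangle\le\int_\Omega\langle\mathcal V_{0,x};\frac12\varrho|u|^2+\varrho e\rangle$; * (entropy) for a.a. $\tau$ and all $0\le\varphi\in C^1$, $\big[\int_\Omega\langle\mathcal V_{t,x};\varrho s\rangle\varphi\big]_{t=0}^{t=\tau}\ge\int_0^\tau\!\int_\Omega\langle\mathcal V_{t,x};\varrho s\rangle\partial_t\varphi+\langle\mathcal V_{t,x};\varrho su-\kappa\mathbf D_\vartheta/\vartheta\rangle\cdot\nabla\varphi+\int_0^\tau\!\int_\Omega\big\langle\mathcal V_{t,x};\tfrac1\vartheta\big(\mathbb S(\mathbf D_u):\mathbf D_u+\tfrac{\kappa|\mathbf D_\vartheta|^2}{\vartheta}\big)\big\rangle\varphi$; * (defects) the dissipation defect $\mathcal D(\tau)=\int_\Omega\langle\mathcal V_{0,x};\frac12\varrho|u|^2+\varrho e\rangle-\int_\Omega\langle\mathcal V_{\tau,x};\frac12\varrho|u|^2+\varrho e\rangle$ is $\ge0$ for a.a. $\tau$, and for some $c>0$, $\int_{[0,T]\times\Omega}\psi(t)\,d|\nu_C|\le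 c\int_0^T\psi\,\mathcal D\,dt$ for all $0\le\psi\in C([0,T])$. **Theorem 5.1 (Convergence to a DMV solution).** Let $\underline\varrho,\overline\varrho,\underline\vartheta,\overline\vartheta,\overline u$ be positive constants and $\varrho_0,\vartheta_0,u_0\in L^1(\Omega)$. Consider meshes and time steps with $h\to0$ and $\Delta t\approx h$ (that is, $ah\le\Delta t\le bh$ with $a,b>0$ independent of $h$), and let $\underline\varrho\le\Pi_{\mathcal T}\varrho_0\le\overline\varrho$, $\underline\vartheta\le\Pi_{\mathcal T}\vartheta_0\le\overline\vartheta$, $\|\Pi_{\mathcal T}u_0\|_{L^2}\le\overline u$ for all these meshes. Let $(\varrho_h,\vartheta_h,u_h)$ be solutions of the scheme with initial data $(\varrho_0,\vartheta_0,u_0)$ such that $$\underline\varrho\le\varrho_h(t)\le\overline\varrho,\qquad\underline\vartheta\le\vartheta_h(t)\le\overline\vartheta\qquad\text{for all }t\in(0,T)\text{ and all }h.$$ Then, for a subsequence $h\to0$, the family $U_h=(\varrho_h,\vartheta_h,u_h,\mathbf D_h(u_h),\nabla_{\mathcal E}\vartheta_h)$ generates a Young measure $\{\mathcal V_{t,x}\}_{(t,x)\in(0,T)\times\Omega}$,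 that is, $G(U_h)\to\langle\mathcal V_{t,x};G\rangle$ weakly-(*) in $L^\infty((0,T)\times\Omega)$ for all $G\in C_c(\mathcal F)$. For a.a. $(t,x)$ the measure $\mathcal V_{t,x}$ is supported in $\{\underline\varrho\le\varrho\le\overline\varrho,\ \underline\vartheta\le\vartheta\le\overline\vartheta\}$, and $\{\mathcal V_{t,x}\}$ is a DMV solution of the Navier–Stokes–Fourier system with the initial condition $\mathcal V_{0,x}=\delta_{(\varrho_0(x),\vartheta_0(x),u_0(x))}$ and concentration defect $\nu_C=0$. -/

import Mathlib

open MeasureTheory Filter Topology Set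

noncomputable section

namespace NSF

/-- The constants of the fluid: specific heat at constant volume `cv`, heat conductivity `κ`,
viscosity coefficients `μ` and `lam`. -/
structure Fluid where
  cv : ℝ
  κ : ℝ
  μ : ℝ
  lam : ℝ
  cv_pos : 0 < cv
  κ_pos : 0 < κ
  μ_pos : 0 < μ
  lam_nonneg : 0 ≤ lam

/-! ### Constitutive relations -/

/-- Pressure of the perfect gas. -/
def pressure (ρ θ : ℝ) : ℝ := ρ * θ

/-- Specific internal energy. -/
def internalEnergy (P : Fluid) (θ : ℝ) : ℝ := P.cv * θ

/-- Specific entropy. -/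
def entropy (P : Fluid) (ρ θ : ℝ) : ℝ := Real.log (θ ^ P.cv / ρ)

/-- Total energy density. -/
def energyDensity {d : ℕ} (P : Fluid) (ρ θ : ℝ) (u : Fin d → ℝ) : ℝ :=
  1 / 2 * ρ * (∑ i, u i ^ 2) + ρ * internalEnergy P θ

/-- Viscous stress tensor as a function of the symmetric velocity gradient `D`. -/
def stress {d : ℕ} (P : Fluid) (D : Fin d → Fin d → ℝ) (i j : Fin d) : ℝ :=
  2 * P.μ * D i j + if i = j then P.lam * ∑ k, D k k else 0

/-- Entropy production rate. -/
def entropyProduction {d : ℕ} (P : Fluid) (θ : ℝ) (D : Fin d → Fin d → ℝ) (g : Fin d → ℝ) : ℝ :=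
  1 / θ * ((∑ i, ∑ j, stress P D i j * D i j) + P.κ * (∑ i, g i ^ 2) / θ)

/-! ### The flat torus

The torus with periods `L i` is represented by the fundamental box `∏ [0, L i)`; functions on the
torus that have to be differentiated are periodic functions on `ℝ^d`. -/

/-- Fundamental box of the torus. -/
def torus {d : ℕ} (L : Fin d → ℝ) : Set (Fin d → ℝ) := Set.univ.pi fun i => Ico 0 (L i)

/-- Lebesgue measure on `(0, T) × Ω`. -/
def spaceTime {d : ℕ} (L : Fin d → ℝ) (T : ℝ) : Measure (ℝ × (Fin d → ℝ)) :=
  volume.restrict (Ioo 0 T ×ˢ torus L)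

/-- Test functions of class `C¹([0, T] × Ω)`. Every such function is the restriction to `[0, T]`
of a `C¹` function defined for all times, so the latter are used. -/
def IsTest {d : ℕ} {E : Type*} [NormedAddCommGroup E] [NormedSpace ℝ E] (L : Fin d → ℝ)
    (φ : ℝ → (Fin d → ℝ) → E) : Prop :=
  ContDiff ℝ 1 (fun p : ℝ × (Fin d → ℝ) => φ p.1 p.2) ∧
    ∀ t x i, φ t (x + Pi.single i (L i)) = φ t x

/-- Time derivative. -/
def dt {d : ℕ} (φ : ℝ → (Fin d → ℝ) → ℝ) (t : ℝ) (x : Fin d → ℝ) : ℝ :=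
  deriv (fun s => φ s x) t

/-- Partial derivative in the spatial direction `j`. -/
def dx {d : ℕ} (j : Fin d) (φ : ℝ → (Fin d → ℝ) → ℝ) (t : ℝ) (x : Fin d → ℝ) : ℝ :=
  fderiv ℝ (φ t) x (Pi.single j 1)

/-! ### The mesh and the discrete operators -/

/-- A uniform mesh of the torus by cubes of edge `h`, with `M i` cells in direction `i`, together
with a uniform partition of `[0, T]` into `N` time steps of length `Δt`. -/
structure Mesh (d : ℕ) (L : Fin d → ℝ) (T : ℝ) where
  h : ℝ
  Δt : ℝ
  M : Fin d → ℕ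
  N : ℕ
  h_pos : 0 < h
  Δt_pos : 0 < Δt
  cells_fit : ∀ i, M i * h = L i
  steps_fit : N * Δt = T

/-- Cells are labelled by `K ∈ ℤ^d`, the cell `K` being `∏ [K i h, (K i + 1) h)`; labels that agree
modulo `M` are the same cell of the torus. -/
abbrev Cell (d : ℕ) := Fin d → ℤ

/-- The neighbour offset in direction `i`. -/
def e {d : ℕ} (i : Fin d) : Cell d := Pi.single i 1

/-- The label of the cell of edge `h` containing `x`. -/
def cellOf {d : ℕ} (h : ℝ) (x : Fin d → ℝ) : Cell d := fun i => ⌊x i / h⌋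

/-- The cell with label `K`, as a set. -/
def cellSet {d : ℕ} (h : ℝ) (K : Cell d) : Set (Fin d → ℝ) :=
  Set.univ.pi fun i => Ico ((K i : ℝ) * h) (((K i : ℝ) + 1) * h)

/-- The face between `K` and `K + e i`, with normal `n = e i`, is labelled by `(i, K)`.
`avg` and `jump` are the average and the jump (outer minus inner value) at that face. -/
def avg {d : ℕ} (r : Cell d → ℝ) (i : Fin d) (K : Cell d) : ℝ := (r K + r (K + e i)) / 2

/-- Jump at the face `(i, K)`. -/
def jump {d : ℕ} (r : Cell d → ℝ) (i : Fin d) (K : Cell d) : ℝ := r (K + e i) - r K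

/-- The `i`-th component of the discrete gradient `∇_h r` in the cell `K`: the sum over the two
faces of `K` orthogonal to the `i`-th direction of `(|σ| / |K|)` times average times normal. -/
def gradH {d : ℕ} (h : ℝ) (r : Cell d → ℝ) (i : Fin d) (K : Cell d) : ℝ :=
  1 / h * (avg r i K - avg r i (K - e i))

/-- Discrete divergence `div_h v`. -/
def divH {d : ℕ} (h : ℝ) (v : Cell d → Fin d → ℝ) (K : Cell d) : ℝ :=
  ∑ i, gradH h (fun J => v J i) i K

/-- Discrete symmetric velocity gradient `D_h(v)`. -/
def symGradH {d : ℕ} (h : ℝ) (v : Cell d → Fin d → ℝ) (K : Cell d) (i j : Fin d) : ℝ :=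
  (gradH h (fun J => v J i) j K + gradH h (fun J => v J j) i K) / 2

/-- The `i`-th component of the edge gradient `∇_E r`, at the face `(i, K)`. -/
def gradE {d : ℕ} (h : ℝ) (r : Cell d → ℝ) (i : Fin d) (K : Cell d) : ℝ := jump r i K / h

/-- Upwind flux `Up[r, u]` through the face `(i, K)`. -/
def upwind {d : ℕ} (r : Cell d → ℝ) (u : Cell d → Fin d → ℝ) (i : Fin d) (K : Cell d) : ℝ :=
  r K * ((avg (fun J => u J i) i K + |avg (fun J => u J i) i K|) / 2) +
    r (K + e i) * ((avg (fun J => u J i) i K - |avg (fun J => u J i) i K|) / 2)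

/-- Diffusive upwind flux `F_h(r, u) = Up[r, u] - h^ε [[r]]` through the face `(i, K)`. -/
def flux {d : ℕ} (h ε : ℝ) (r : Cell d → ℝ) (u : Cell d → Fin d → ℝ) (i : Fin d) (K : Cell d) :
    ℝ :=
  upwind r u i K - h ^ ε * jump r i K

namespace Mesh

variable {d : ℕ} {L : Fin d → ℝ} {T : ℝ}

/-- One label for each cell of the torus. -/
def cells (G : Mesh d L T) : Finset (Cell d) :=
  Fintype.piFinset fun i => Finset.Ico (0 : ℤ) (G.M i)

/-- Membership in `Q_h`: a function of the labels that is a function of the cells of the torus. -/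
def InQ (G : Mesh d L T) {E : Type*} (r : Cell d → E) : Prop :=
  ∀ K i, r (K + Pi.single i (G.M i : ℤ)) = r K

/-- `∫_Ω f dx` for `f` piecewise constant on the cells (or on the dual cells of a direction). -/
def intCells (G : Mesh d L T) (f : Cell d → ℝ) : ℝ := G.h ^ d * ∑ K ∈ G.cells, f K

/-- `∑_σ ∫_σ f dS` for `f` constant on each face. -/
def intFaces (G : Mesh d L T) (f : Fin d → Cell d → ℝ) : ℝ :=
  G.h ^ (d - 1) * ∑ i, ∑ K ∈ G.cells, f i K

/-- The projection `Π_T` onto piecewise constant functions: the mean of `f` over the cell `K`. -/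
def proj (G : Mesh d L T) (f : (Fin d → ℝ) → ℝ) (K : Cell d) : ℝ :=
  1 / G.h ^ d * ∫ x in cellSet G.h K, f x

end Mesh

/-! ### The finite volume scheme -/

/-- `(ρ k, θ k, u k)`, `k = 0, …, N`, is a solution of the finite volume scheme (in its weak
formulation) on the mesh `G` with numerical diffusion parameter `ε` and the initial data
`(ρ₀, θ₀, u₀)`. -/
structure IsSchemeSolution {d : ℕ} {L : Fin d → ℝ} {T : ℝ} (P : Fluid) (ε : ℝ) (G : Mesh d L T)
    (ρ₀ θ₀ : (Fin d → ℝ) → ℝ) (u₀ : (Fin d → ℝ) → Fin d → ℝ)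
    (ρ θ : ℕ → Cell d → ℝ) (u : ℕ → Cell d → Fin d → ℝ) : Prop where
  ρ_mem : ∀ k ≤ G.N, G.InQ (ρ k)
  θ_mem : ∀ k ≤ G.N, G.InQ (θ k)
  u_mem : ∀ k ≤ G.N, G.InQ (u k)
  ρ_init : ∀ K ∈ G.cells, ρ 0 K = G.proj ρ₀ K
  θ_init : ∀ K ∈ G.cells, θ 0 K = G.proj θ₀ K
  u_init : ∀ K ∈ G.cells, ∀ i, u 0 K i = G.proj (fun x => u₀ x i) K
  continuity : ∀ k < G.N, ∀ φ : Cell d → ℝ, G.InQ φ →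
    G.intCells (fun K => (ρ (k + 1) K - ρ k K) / G.Δt * φ K)
      - G.intFaces (fun i K => flux G.h ε (ρ (k + 1)) (u (k + 1)) i K * jump φ i K) = 0
  momentum : ∀ k < G.N, ∀ φ : Cell d → Fin d → ℝ, G.InQ φ →
    G.intCells (fun K =>
        ∑ j, (ρ (k + 1) K * u (k + 1) K j - ρ k K * u k K j) / G.Δt * φ K j)
      - G.intFaces (fun i K =>
          ∑ j, flux G.h ε (fun J => ρ (k + 1) J * u (k + 1) J j) (u (k + 1)) i K
            * jump (fun J => φ J j) i K)
      - G.intCells (fun K => pressure (ρ (k + 1) K) (θ (k + 1) K) * divH G.h φ K)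
    = - 2 * P.μ * G.intCells (fun K =>
          ∑ i, ∑ j, symGradH G.h (u (k + 1)) K i j * symGradH G.h φ K i j)
      - P.lam * G.intCells (fun K => divH G.h (u (k + 1)) K * divH G.h φ K)
  energy : ∀ k < G.N, ∀ φ : Cell d → ℝ, G.InQ φ →
    P.cv * G.intCells (fun K =>
        (ρ (k + 1) K * θ (k + 1) K - ρ k K * θ k K) / G.Δt * φ K)
      - P.cv * G.intFaces (fun i K =>
          flux G.h ε (fun J => ρ (k + 1) J * θ (k + 1) J) (u (k + 1)) i K * jump φ i K)
      + P.κ * G.intCells (fun K => ∑ i, gradE G.h (θ (k + 1)) i K * gradE G.h φ i K)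
    = G.intCells (fun K =>
        (2 * P.μ * (∑ i, ∑ j, symGradH G.h (u (k + 1)) K i j ^ 2)
          + P.lam * divH G.h (u (k + 1)) K ^ 2
          - pressure (ρ (k + 1) K) (θ (k + 1) K) * divH G.h (u (k + 1)) K) * φ K)

/-! ### Phase space and the approximate solutions as functions of `(t, x)` -/

/-- Ambient space of the variables `(ρ, θ, u, D_u, D_θ)`. -/
abbrev Phase (d : ℕ) := ℝ × ℝ × (Fin d → ℝ) × (Fin d → Fin d → ℝ) × (Fin d → ℝ)

/-- Density. -/
def Phase.ρ {d : ℕ} (U : Phase d) : ℝ := U.1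
/-- Temperature. -/
def Phase.θ {d : ℕ} (U : Phase d) : ℝ := U.2.1
/-- Velocity. -/
def Phase.u {d : ℕ} (U : Phase d) : Fin d → ℝ := U.2.2.1
/-- Symmetric velocity gradient. -/
def Phase.D {d : ℕ} (U : Phase d) : Fin d → Fin d → ℝ := U.2.2.2.1
/-- Temperature gradient. -/
def Phase.g {d : ℕ} (U : Phase d) : Fin d → ℝ := U.2.2.2.2

/-- The (closed) phase space: nonnegative density and temperature, symmetric `D_u`. -/
def phaseSpace (d : ℕ) : Set (Phase d) :=
  {U | 0 ≤ U.ρ ∧ 0 ≤ U.θ ∧ ∀ i j, U.D i j = U.D j i}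

/-- Ambient space of the initial states `(ρ, θ, u)`. -/
abbrev State (d : ℕ) := ℝ × ℝ × (Fin d → ℝ)

/-- The value at `(t, x)` of a sequence of piecewise constant functions, extended to be piecewise
constant in time: it is `r k` for `t ∈ [k Δt, (k + 1) Δt)`. -/
def Mesh.recon {d : ℕ} {L : Fin d → ℝ} {T : ℝ} (G : Mesh d L T) {E : Type*} (r : ℕ → Cell d → E)
    (t : ℝ) (x : Fin d → ℝ) : E :=
  r ⌊t / G.Δt⌋₊ (cellOf G.h x)

/-- The function `(ρ_h, θ_h, u_h, D_h(u_h), ∇_E θ_h)`. The `i`-th component of `∇_E θ_h` is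
constant on the dual cells of the faces orthogonal to direction `i`; the dual cell of the face
`(i, K)` is the cell `K` shifted by `h / 2` in direction `i`. -/
def Mesh.approx {d : ℕ} {L : Fin d → ℝ} {T : ℝ} (G : Mesh d L T)
    (ρ θ : ℕ → Cell d → ℝ) (u : ℕ → Cell d → Fin d → ℝ) (t : ℝ) (x : Fin d → ℝ) : Phase d :=
  (G.recon ρ t x, G.recon θ t x, G.recon u t x, G.recon (fun k => symGradH G.h (u k)) t x,
    fun i => G.recon (fun k => gradE G.h (θ k) i) t (x - Pi.single i (G.h / 2)))

/-! ### Young measures -/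

/-- `V` is a weakly-(*) measurable family of probability measures, indexed by the points of a
measure space, that are carried by the closed set `F`. (Compactly supported continuous functions
on the closed set `F` are the restrictions of those on the ambient space.) -/
structure IsYoungMeasure {X Y : Type*} [MeasurableSpace X] [TopologicalSpace Y] [MeasurableSpace Y]
    (m : Measure X) (F : Set Y) (V : X → Measure Y) : Prop where
  prob : ∀ᵐ p ∂m, IsProbabilityMeasure (V p)
  carried : ∀ᵐ p ∂m, V p Fᶜ = 0
  meas : ∀ g : Y → ℝ, Continuous g → HasCompactSupport g →
    AEStronglyMeasurable (fun p => ∫ y, g y ∂(V p)) m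

/-- The sequence `U n` generates the Young measure `V`: for every compactly supported continuous
`g`, `g (U n) → ⟨V; g⟩` weakly-(*) in `L^∞`. -/
def Generates {X Y : Type*} [MeasurableSpace X] [TopologicalSpace Y] [MeasurableSpace Y]
    (m : Measure X) (U : ℕ → X → Y) (V : X → Measure Y) : Prop :=
  ∀ g : Y → ℝ, Continuous g → HasCompactSupport g → ∀ w : X → ℝ, Integrable w m →
    Tendsto (fun n => ∫ p, w p * g (U n p) ∂m) atTop (𝓝 (∫ p, w p * ∫ y, g y ∂(V p) ∂m))

/-- The pairing `⟨V_p; f⟩` is defined for almost all `p` and is integrable in `p`. -/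
def Pairs {X Y : Type*} [MeasurableSpace X] [MeasurableSpace Y]
    (m : Measure X) (V : X → Measure Y) (f : Y → ℝ) : Prop :=
  (∀ᵐ p ∂m, Integrable f (V p)) ∧ Integrable (fun p => ∫ y, f y ∂(V p)) m

/-! ### Dissipative measure-valued solutions -/

/-- Integral of a function over a set with respect to a signed measure. -/
def signedIntegral {X : Type*} [MeasurableSpace X] (ν : SignedMeasure X) (A : Set X) (f : X → ℝ) :
    ℝ :=
  (∫ p in A, f p ∂ν.toJordanDecomposition.posPart)
    - ∫ p in A, f p ∂ν.toJordanDecomposition.negPart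

/-- The dissipation defect at time `τ`. -/
def dissipationDefect {d : ℕ} (P : Fluid) (L : Fin d → ℝ) (V₀ : (Fin d → ℝ) → Measure (State d))
    (V : ℝ × (Fin d → ℝ) → Measure (Phase d)) (τ : ℝ) : ℝ :=
  (∫ x in torus L, ∫ W, energyDensity P W.1 W.2.1 W.2.2 ∂(V₀ x))
    - ∫ x in torus L, ∫ U, energyDensity P U.ρ U.θ U.u ∂(V (τ, x))

/-- `V` is a dissipative measure-valued solution on `(0, T) × Ω` of the Navier–Stokes–Fourier
system with the initial condition `V₀` and the concentration defect measure `νC`, a tensor-valued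
signed measure given by its components (its values on `[0, T] × Ω` are the only ones that matter).
The last field uses the sum of the total variations of the components, which is comparable to the
total variation for any norm on tensors. -/
structure IsDMVSolution {d : ℕ} (P : Fluid) (L : Fin d → ℝ) (T : ℝ)
    (V₀ : (Fin d → ℝ) → Measure (State d)) (V : ℝ × (Fin d → ℝ) → Measure (Phase d))
    (νC : Fin d → Fin d → SignedMeasure (ℝ × (Fin d → ℝ))) : Prop where
  young : IsYoungMeasure (spaceTime L T) (phaseSpace d) V
  young_init : IsYoungMeasure (volume.restrict (torus L)) {W : State d | 0 ≤ W.1 ∧ 0 ≤ W.2.1} V₀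
  -- all pairings that occur below are defined and integrable
  pairs_u : ∀ i, Pairs (spaceTime L T) V fun U => U.u i
  pairs_θ : Pairs (spaceTime L T) V fun U => U.θ
  pairs_D : ∀ i j, Pairs (spaceTime L T) V fun U => U.D i j
  pairs_g : ∀ i, Pairs (spaceTime L T) V fun U => U.g i
  pairs_ρ : Pairs (spaceTime L T) V fun U => U.ρ
  pairs_ρu : ∀ i, Pairs (spaceTime L T) V fun U => U.ρ * U.u i
  pairs_ρuu : ∀ i j, Pairs (spaceTime L T) V fun U => U.ρ * U.u i * U.u j
  pairs_p : Pairs (spaceTime L T) V fun U => pressure U.ρ U.θ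
  pairs_stress : ∀ i j, Pairs (spaceTime L T) V fun U => stress P U.D i j
  pairs_energy : Pairs (spaceTime L T) V fun U => energyDensity P U.ρ U.θ U.u
  pairs_ρs : Pairs (spaceTime L T) V fun U => U.ρ * entropy P U.ρ U.θ
  pairs_entropyFlux : ∀ i, Pairs (spaceTime L T) V fun U =>
    U.ρ * entropy P U.ρ U.θ * U.u i - P.κ * U.g i / U.θ
  pairs_production : Pairs (spaceTime L T) V fun U => entropyProduction P U.θ U.D U.g
  pairs_init_ρ : Pairs (volume.restrict (torus L)) V₀ fun W => W.1
  pairs_init_ρu : ∀ i, Pairs (volume.restrict (torus L)) V₀ fun W => W.1 * W.2.2 i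
  pairs_init_energy : Pairs (volume.restrict (torus L)) V₀ fun W =>
    energyDensity P W.1 W.2.1 W.2.2
  pairs_init_ρs : Pairs (volume.restrict (torus L)) V₀ fun W => W.1 * entropy P W.1 W.2.1
  -- compatibility of the velocity and its symmetric gradient
  compat_u : ∀ S : ℝ → (Fin d → ℝ) → Fin d → Fin d → ℝ, IsTest L S →
    (∀ t x i j, S t x i j = S t x j i) →
    - (∫ t in (0 : ℝ)..T, ∫ x in torus L,
        ∑ i, (∫ U, U.u i ∂(V (t, x))) * ∑ j, dx j (fun t x => S t x i j) t x)
      = ∫ t in (0 : ℝ)..T, ∫ x in torus L, ∑ i, ∑ j, (∫ U, U.D i j ∂(V (t, x))) * S t x i j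
  -- compatibility of the temperature and its gradient
  compat_θ : ∀ φ : ℝ → (Fin d → ℝ) → Fin d → ℝ, IsTest L φ →
    - (∫ t in (0 : ℝ)..T, ∫ x in torus L,
        (∫ U, U.θ ∂(V (t, x))) * ∑ i, dx i (fun t x => φ t x i) t x)
      = ∫ t in (0 : ℝ)..T, ∫ x in torus L, ∑ i, (∫ U, U.g i ∂(V (t, x))) * φ t x i
  -- conservation of mass
  mass : ∀ᵐ τ ∂(volume.restrict (Icc 0 T)), ∀ φ : ℝ → (Fin d → ℝ) → ℝ, IsTest L φ →
    (∫ x in torus L, (∫ U, U.ρ ∂(V (τ, x))) * φ τ x)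
        - (∫ x in torus L, (∫ W, W.1 ∂(V₀ x)) * φ 0 x)
      = ∫ t in (0 : ℝ)..τ, ∫ x in torus L,
          ((∫ U, U.ρ ∂(V (t, x))) * dt φ t x
            + ∑ i, (∫ U, U.ρ * U.u i ∂(V (t, x))) * dx i φ t x)
  -- balance of momentum
  momentum : ∀ᵐ τ ∂(volume.restrict (Icc 0 T)), ∀ φ : ℝ → (Fin d → ℝ) → Fin d → ℝ, IsTest L φ →
    (∫ x in torus L, ∑ i, (∫ U, U.ρ * U.u i ∂(V (τ, x))) * φ τ x i)
        - (∫ x in torus L, ∑ i, (∫ W, W.1 * W.2.2 i ∂(V₀ x)) * φ 0 x i)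
      = (∫ t in (0 : ℝ)..τ, ∫ x in torus L,
          ((∑ i, (∫ U, U.ρ * U.u i ∂(V (t, x))) * dt (fun t x => φ t x i) t x)
            + (∑ i, ∑ j, (∫ U, U.ρ * U.u i * U.u j ∂(V (t, x))) * dx j (fun t x => φ t x i) t x)
            + (∫ U, pressure U.ρ U.θ ∂(V (t, x))) * ∑ i, dx i (fun t x => φ t x i) t x))
        - (∫ t in (0 : ℝ)..τ, ∫ x in torus L,
            ∑ i, ∑ j, (∫ U, stress P U.D i j ∂(V (t, x))) * dx j (fun t x => φ t x i) t x)
        + ∑ i, ∑ j, signedIntegral (νC i j) (Icc 0 τ ×ˢ torus L)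
            (fun p => dx j (fun t x => φ t x i) p.1 p.2)
  -- energy inequality
  energy : ∀ᵐ τ ∂(volume.restrict (Icc 0 T)),
    (∫ x in torus L, ∫ U, energyDensity P U.ρ U.θ U.u ∂(V (τ, x)))
      ≤ ∫ x in torus L, ∫ W, energyDensity P W.1 W.2.1 W.2.2 ∂(V₀ x)
  -- entropy inequality
  entropy : ∀ᵐ τ ∂(volume.restrict (Icc 0 T)), ∀ φ : ℝ → (Fin d → ℝ) → ℝ, IsTest L φ →
    (∀ t ∈ Icc 0 T, ∀ x, 0 ≤ φ t x) →
    (∫ t in (0 : ℝ)..τ, ∫ x in torus L,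
        ((∫ U, U.ρ * NSF.entropy P U.ρ U.θ ∂(V (t, x))) * dt φ t x
          + ∑ i, (∫ U, (U.ρ * NSF.entropy P U.ρ U.θ * U.u i - P.κ * U.g i / U.θ) ∂(V (t, x)))
              * dx i φ t x))
      + (∫ t in (0 : ℝ)..τ, ∫ x in torus L,
          (∫ U, entropyProduction P U.θ U.D U.g ∂(V (t, x))) * φ t x)
      ≤ (∫ x in torus L, (∫ U, U.ρ * NSF.entropy P U.ρ U.θ ∂(V (τ, x))) * φ τ x)
        - ∫ x in torus L, (∫ W, W.1 * NSF.entropy P W.1 W.2.1 ∂(V₀ x)) * φ 0 x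
  -- the dissipation defect is nonnegative and controls the concentration defect
  defect_nonneg : ∀ᵐ τ ∂(volume.restrict (Icc 0 T)), 0 ≤ dissipationDefect P L V₀ V τ
  defect : ∃ c : ℝ, 0 < c ∧ ∀ ψ : ℝ → ℝ, ContinuousOn ψ (Icc 0 T) → (∀ t ∈ Icc 0 T, 0 ≤ ψ t) →
    ∑ i, ∑ j, ∫ p in Icc 0 T ×ˢ torus L, ψ p.1 ∂(νC i j).totalVariation
      ≤ c * ∫ t in (0 : ℝ)..T, ψ t * dissipationDefect P L V₀ V t

end NSF

end

/-!
# Convergence of an upwind finite volume scheme for the Navier–Stokes–Fourier system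

*Estimates.* Testing the momentum equation with the velocity and the continuity equation with half
its square turns the scheme into a kinetic energy balance in each cell; together with the energy
equation, the total energy decreases and controls the jumps of the velocity (`energy_step`). The
entropy `ρ s` is concave in `ρ` and `ρ θ`, so that upwinding and the `h ^ ε` diffusion produce
entropy (`entropy_cell`). As `ρ` and `θ` stay between positive constants, the total entropy is
bounded and controls the gradients of temperature and velocity (`entropy_step`); the renormalized
continuity equation controls the jumps of the density (`density_step`). Summation over the time
levels gives the bounds `UniformBounds`. The jumps of the velocity and of the density are
`O(h ^ (1 - ε))` in the squared space-time `L²` norm, those of the temperature `O(h²)`.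

*No concentration.* A discrete Korn inequality (`Mesh.korn`) bounds the central differences of the
velocity. The mean of the velocity over nearby cells at even distance is bounded in `L^∞` by the
energy, and the deviation from it is small in `L²` by Korn, so that `|u|²` is equi-integrable
(`integral_sq_u_truncated_le`); the gradients are bounded in `L²`. Hence every function of the state
bounded by `growth U = 1 + |u|² + |D| + |g|` is equi-integrable along the sequence, which makes the
concentration defect zero.

*Young measure.* The graph measures of the states are tight, and a weak limit is disintegrated over
space-time (`exists_young_measure`). Bounded continuous functions of the state converge to their
pairings by construction, those of the growth of `growth` by equi-integrability
(`IsApproximation.weakConv`). Gradients are set to zero in the first time step, where the scheme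
gives no estimate; this changes neither the generated measure nor any limit.

*Balance laws.* The numerical flux of `r` differs from `r u` by terms with a factor that is a jump,
so that both have the same weak limit (`weakConv_flux`). Discrete integration by parts puts the
differences on the test function, where they converge uniformly. In the entropy inequality the
production is only bounded in `L¹`; it is truncated at height `R` before the limit is taken, and
the truncation is removed by dominated convergence (`entropy_balance`). The energy inequality
needs that the energy of the projected data does not exceed the energy of the data in the limit,
which is Jensen's inequality for the kinetic energy (`eventually_kinetic_proj_le`).

*Almost every time.* Test functions that vanish at the final time give, for a fixed test function,
the balance up to almost every time `τ` (`ae_balance`). The exceptional set is the same for all test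
functions, because the jets of test functions form a separable subset of a space of continuous
functions (`ae_forall_balance`).
-/

namespace NSF

open Finset (abs_sum_le_sum_abs mul_sum single_le_sum sum_add_distrib sum_comm sum_congr sum_const
  sum_const_zero sum_div sum_insert sum_ite_eq sum_le_sum sum_mul sum_neg_distrib sum_nonneg
  sum_range_succ sum_sub_distrib)

variable {d : ℕ}

/-- The space containing the torus. -/
local notation "ℝᵈ" => Fin d → ℝ

variable {L : Fin d → ℝ} {T : ℝ} {P : Fluid} {ε : ℝ} {ρ₀ θ₀ : (Fin d → ℝ) → ℝ}
  {u₀ : (Fin d → ℝ) → Fin d → ℝ} {ρlo ρhi θlo θhi uhi : ℝ}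

lemma sq_le_sum_sq {ι : Type*} [Fintype ι] (f : ι → ℝ) (i : ι) : f i ^ 2 ≤ ∑ j, f j ^ 2 :=
  single_le_sum (f := fun j => f j ^ 2) (fun _ _ => sq_nonneg _) (Finset.mem_univ i)

/-! ### Periodic grid functions and summation by parts -/

namespace Mesh

variable (G : Mesh d L T)

/-- The label in `G.cells` of the cell of the torus with label `K`. -/
def wrapCell (K : Cell d) : Cell d := fun i => K i % G.M i

lemma L_pos_M (hL : ∀ i, 0 < L i) (i : Fin d) : 0 < G.M i := by
  rcases Nat.eq_zero_or_pos (G.M i) with h | h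
  · have h1 := G.cells_fit i
    have h2 := hL i
    rw [h] at h1
    simp at h1
    linarith
  · exact h

lemma mem_cells {K : Cell d} : K ∈ G.cells ↔ ∀ i, 0 ≤ K i ∧ K i < G.M i := by
  simp [cells, Fintype.mem_piFinset]

lemma wrapCell_mem (hL : ∀ i, 0 < L i) (K : Cell d) : G.wrapCell K ∈ G.cells := by
  rw [mem_cells]
  intro i
  have h : (0 : ℤ) < G.M i := by exact_mod_cast G.L_pos_M hL i
  exact ⟨Int.emod_nonneg _ h.ne', Int.emod_lt_of_pos _ h⟩

lemma wrapCell_of_mem {K : Cell d} (hK : K ∈ G.cells) : G.wrapCell K = K := by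
  rw [mem_cells] at hK
  funext i
  exact Int.emod_eq_of_lt (hK i).1 (hK i).2

variable {G}

lemma InQ.single_mul {E : Type*} {r : Cell d → E} (hr : G.InQ r) (K : Cell d) (i : Fin d) (z : ℤ) :
    r (K + Pi.single i (z * G.M i)) = r K := by
  have step : ∀ z : ℤ, r (K + Pi.single i ((z + 1) * G.M i)) = r (K + Pi.single i (z * G.M i)) := by
    intro z
    have h := hr (K + Pi.single i (z * (G.M i : ℤ))) i
    rw [add_assoc, ← Pi.single_add] at h
    rw [← h, add_mul, one_mul]
  induction z using Int.induction_on with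
  | zero => simp
  | succ n ih => rw [step, ih]
  | pred n ih =>
    rw [← ih, ← step, sub_add_cancel]

lemma InQ.mul {E : Type*} {r : Cell d → E} (hr : G.InQ r) (K z : Cell d) :
    r (K + fun i => z i * G.M i) = r K := by
  have key : ∀ s : Finset (Fin d), r (K + ∑ i ∈ s, Pi.single i (z i * (G.M i : ℤ))) = r K := by
    intro s
    induction s using Finset.induction_on with
    | empty => simp
    | insert a s ha ih =>
      rw [sum_insert ha, add_comm (Pi.single a _), ← add_assoc, hr.single_mul, ih]
  have := key Finset.univ
  rwa [Finset.univ_sum_single (fun i => z i * (G.M i : ℤ))] at this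

lemma InQ.wrapCell {E : Type*} {r : Cell d → E} (hr : G.InQ r) (K : Cell d) :
    r (G.wrapCell K) = r K := by
  rw [← hr.mul (G.wrapCell K) (fun i => K i / G.M i)]
  congr 1
  funext i
  simp only [Pi.add_apply, Mesh.wrapCell]
  rw [mul_comm]
  exact Int.emod_add_mul_ediv _ _

lemma InQ.shift {E : Type*} {r : Cell d → E} (hr : G.InQ r) (c : Cell d) :
    G.InQ fun K => r (K + c) := fun K i => by
  simpa [add_right_comm] using hr (K + c) i

lemma InQ.shift_sub {E : Type*} {r : Cell d → E} (hr : G.InQ r) (c : Cell d) :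
    G.InQ fun K => r (K - c) := by
  simpa [sub_eq_add_neg] using hr.shift (-c)

lemma InQ.comp {E F : Type*} {r : Cell d → E} (hr : G.InQ r) (f : E → F) :
    G.InQ fun K => f (r K) := fun K i => by
  simp only [hr K i]

lemma InQ.comp₂ {E E' F : Type*} {r : Cell d → E} {r' : Cell d → E'} (hr : G.InQ r)
    (hr' : G.InQ r') (f : E → E' → F) : G.InQ fun K => f (r K) (r' K) := fun K i => by
  simp only [hr K i, hr' K i]

lemma InQ.add {r s : Cell d → ℝ} (hr : G.InQ r) (hs : G.InQ s) :
    G.InQ fun K => r K + s K := hr.comp₂ hs (· + ·)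
lemma InQ.sub {r s : Cell d → ℝ} (hr : G.InQ r) (hs : G.InQ s) :
    G.InQ fun K => r K - s K := hr.comp₂ hs (· - ·)
lemma InQ.fmul {r s : Cell d → ℝ} (hr : G.InQ r) (hs : G.InQ s) :
    G.InQ fun K => r K * s K := hr.comp₂ hs (· * ·)
lemma InQ.const_mul {r : Cell d → ℝ} (c : ℝ) (hr : G.InQ r) :
    G.InQ fun K => c * r K := hr.comp (c * ·)
lemma InQ.pow {r : Cell d → ℝ} (hr : G.InQ r) (n : ℕ) : G.InQ fun K => r K ^ n := hr.comp (· ^ n)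
lemma InQ.sum {ι : Type*} {s : Finset ι} {r : ι → Cell d → ℝ} (hr : ∀ j ∈ s, G.InQ (r j)) :
    G.InQ fun K => ∑ j ∈ s, r j K := fun K i => sum_congr rfl fun j hj => hr j hj K i

lemma InQ.of_components {r : Cell d → ℝᵈ} (hr : ∀ j, G.InQ fun K => r K j) : G.InQ r :=
  fun K i => funext fun j => hr j K i

lemma InQ.component {r : Cell d → ℝᵈ} (hr : G.InQ r) (j : Fin d) :
    G.InQ fun K => r K j := hr.comp fun v => v j

lemma InQ.avg {r : Cell d → ℝ} (hr : G.InQ r) (i : Fin d) : G.InQ (NSF.avg r i) :=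
  hr.comp₂ (hr.shift (e i)) fun a b => (a + b) / 2

lemma InQ.jump {r : Cell d → ℝ} (hr : G.InQ r) (i : Fin d) : G.InQ (NSF.jump r i) :=
  (hr.shift (e i)).sub hr

lemma InQ.gradH {r : Cell d → ℝ} (hr : G.InQ r) (h : ℝ) (i : Fin d) : G.InQ (NSF.gradH h r i) :=
  ((hr.avg i).sub ((hr.avg i).shift_sub (e i))).const_mul _

lemma InQ.gradE {r : Cell d → ℝ} (hr : G.InQ r) (h : ℝ) (i : Fin d) : G.InQ (NSF.gradE h r i) :=
  (hr.jump i).comp (· / h)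

lemma InQ.divH {v : Cell d → ℝᵈ} (hv : G.InQ v) (h : ℝ) : G.InQ (NSF.divH h v) :=
  InQ.sum fun i _ => (hv.component i).gradH h i

lemma InQ.symGradH {v : Cell d → ℝᵈ} (hv : G.InQ v) (h : ℝ) (i j : Fin d) :
    G.InQ fun K => NSF.symGradH h v K i j :=
  ((hv.component i).gradH h j).comp₂ ((hv.component j).gradH h i) fun a b => (a + b) / 2

lemma InQ.upwind {r : Cell d → ℝ} {u : Cell d → ℝᵈ} (hr : G.InQ r) (hu : G.InQ u)
    (i : Fin d) : G.InQ (NSF.upwind r u i) := by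
  have hu' := (hu.component i).avg i
  exact (hr.fmul (hu'.comp fun a => (a + |a|) / 2)).add
    ((hr.shift (e i)).fmul (hu'.comp fun a => (a - |a|) / 2))

lemma InQ.flux {r : Cell d → ℝ} {u : Cell d → ℝᵈ} (hr : G.InQ r) (hu : G.InQ u)
    (h ε : ℝ) (i : Fin d) : G.InQ (NSF.flux h ε r u i) :=
  (hr.upwind hu i).sub ((hr.jump i).const_mul _)

lemma sum_cells_add (hL : ∀ i, 0 < L i) {f : Cell d → ℝ} (hf : G.InQ f) (c : Cell d) :
    ∑ K ∈ G.cells, f (K + c) = ∑ K ∈ G.cells, f K := by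
  have hw : ∀ K ∈ G.cells, ∀ a : Cell d, G.wrapCell (G.wrapCell (K + a) - a) = K := by
    intro K hK a
    conv_rhs => rw [← G.wrapCell_of_mem hK]
    funext i
    simp only [wrapCell, Pi.sub_apply, Pi.add_apply]
    rw [Int.emod_sub_emod, add_sub_cancel_right]
  refine Finset.sum_nbij' (fun K => G.wrapCell (K + c)) (fun K => G.wrapCell (K - c))
    (fun K _ => G.wrapCell_mem hL _) (fun K _ => G.wrapCell_mem hL _)
    (fun K hK => hw K hK c) (fun K hK => by simpa [sub_eq_add_neg] using hw K hK (-c))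
    (fun K _ => (hf.wrapCell _).symm)

lemma sum_cells_sub (hL : ∀ i, 0 < L i) {f : Cell d → ℝ} (hf : G.InQ f) (c : Cell d) :
    ∑ K ∈ G.cells, f (K - c) = ∑ K ∈ G.cells, f K := by
  simpa [sub_eq_add_neg] using sum_cells_add hL hf (-c)

lemma intCells_shift (hL : ∀ i, 0 < L i) {f : Cell d → ℝ} (hf : G.InQ f) (c : Cell d) :
    G.intCells (fun K => f (K + c)) = G.intCells f := by
  simp only [intCells, sum_cells_add hL hf c]

lemma intCells_shift_sub (hL : ∀ i, 0 < L i) {f : Cell d → ℝ} (hf : G.InQ f) (c : Cell d) :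
    G.intCells (fun K => f (K - c)) = G.intCells f := by
  simp only [intCells, sum_cells_sub hL hf c]

lemma intCells_add (f g : Cell d → ℝ) :
    G.intCells (fun K => f K + g K) = G.intCells f + G.intCells g := by
  simp only [intCells, sum_add_distrib, mul_add]

lemma intCells_sub (f g : Cell d → ℝ) :
    G.intCells (fun K => f K - g K) = G.intCells f - G.intCells g := by
  simp only [intCells, sum_sub_distrib, mul_sub]

lemma intCells_neg (f : Cell d → ℝ) : G.intCells (fun K => -f K) = -G.intCells f := by
  simp only [intCells, sum_neg_distrib, mul_neg]

lemma intCells_const_mul (c : ℝ) (f : Cell d → ℝ) :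
    G.intCells (fun K => c * f K) = c * G.intCells f := by
  simp only [intCells, ← mul_sum]; ring

lemma intCells_sum {ι : Type*} (s : Finset ι) (f : ι → Cell d → ℝ) :
    G.intCells (fun K => ∑ j ∈ s, f j K) = ∑ j ∈ s, G.intCells (f j) := by
  simp only [intCells, mul_sum]
  rw [sum_comm]

lemma intCells_mono {f g : Cell d → ℝ} (h : ∀ K, f K ≤ g K) : G.intCells f ≤ G.intCells g :=
  mul_le_mul_of_nonneg_left (sum_le_sum fun K _ => h K) (pow_nonneg G.h_pos.le _)

lemma intCells_nonneg {f : Cell d → ℝ} (h : ∀ K, 0 ≤ f K) : 0 ≤ G.intCells f :=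
  mul_nonneg (pow_nonneg G.h_pos.le _) (sum_nonneg fun K _ => h K)

lemma eq_zero_of_intCells_sq (hL : ∀ i, 0 < L i) {A : Cell d → ℝ} (hA : G.InQ A)
    (h0 : G.intCells (fun K => A K * A K) = 0) (K : Cell d) : A K = 0 := by
  have h1 : ∑ K ∈ G.cells, A K * A K = 0 := by
    rcases mul_eq_zero.1 h0 with h | h
    · exact absurd h (pow_ne_zero _ G.h_pos.ne')
    · exact h
  rw [Finset.sum_eq_zero_iff_of_nonneg fun K _ => mul_self_nonneg _] at h1
  rw [← hA.wrapCell]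
  exact mul_self_eq_zero.1 (h1 _ (G.wrapCell_mem hL K))

end Mesh

/-- The discrete divergence of a face flux: the net outflow of the cell `K` per volume. -/
noncomputable def divFlux (h : ℝ) (F : Fin d → Cell d → ℝ) (K : Cell d) : ℝ :=
  1 / h * ∑ i, (F i K - F i (K - e i))

namespace Mesh

variable {G : Mesh d L T}

lemma InQ.divFlux {F : Fin d → Cell d → ℝ} (hF : ∀ i, G.InQ (F i)) (h : ℝ) :
    G.InQ (NSF.divFlux h F) :=
  (InQ.sum fun i _ => (hF i).sub ((hF i).shift_sub (e i))).const_mul _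

/-- Summation by parts for a backward difference. -/
lemma intCells_backward_mul (hL : ∀ i, 0 < L i) {f g : Cell d → ℝ} (hf : G.InQ f) (hg : G.InQ g)
    (c : Cell d) :
    G.intCells (fun K => (f K - f (K - c)) * g K)
      = -G.intCells (fun K => f K * (g (K + c) - g K)) := by
  have h1 : G.intCells (fun K => f (K - c) * g K) = G.intCells (fun K => f K * g (K + c)) := by
    rw [← intCells_shift_sub hL (hf.fmul (hg.shift c)) c]
    simp
  simp only [sub_mul, mul_sub, intCells_sub, h1]
  ring

lemma intCells_divFlux_mul (hL : ∀ i, 0 < L i) {F : Fin d → Cell d → ℝ} (hF : ∀ i, G.InQ (F i))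
    {g : Cell d → ℝ} (hg : G.InQ g) :
    G.intCells (fun K => NSF.divFlux G.h F K * g K)
      = -(1 / G.h * ∑ i, G.intCells (fun K => F i K * NSF.jump g i K)) := by
  have : (fun K => NSF.divFlux G.h F K * g K)
      = fun K => 1 / G.h * ∑ i, (F i K - F i (K - e i)) * g K := by
    funext K; rw [NSF.divFlux, mul_assoc, sum_mul]
  rw [this, intCells_const_mul, intCells_sum]
  simp only [intCells_backward_mul hL (hF _) hg, NSF.jump]
  rw [sum_neg_distrib, mul_neg]

lemma intFaces_jump (hL : ∀ i, 0 < L i) (hd : d ≠ 0) {F : Fin d → Cell d → ℝ}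
    (hF : ∀ i, G.InQ (F i)) {g : Cell d → ℝ} (hg : G.InQ g) :
    G.intFaces (fun i K => F i K * NSF.jump g i K)
      = -G.intCells (fun K => NSF.divFlux G.h F K * g K) := by
  rw [intCells_divFlux_mul hL hF hg, neg_neg]
  obtain ⟨n, rfl⟩ := Nat.exists_eq_succ_of_ne_zero hd
  simp only [intFaces, intCells, ← mul_sum]
  have := G.h_pos.ne'
  field_simp
  simp only [Nat.succ_eq_add_one, Nat.add_sub_cancel]
  ring

lemma intCells_divFlux (hL : ∀ i, 0 < L i) {F : Fin d → Cell d → ℝ} (hF : ∀ i, G.InQ (F i)) :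
    G.intCells (NSF.divFlux G.h F) = 0 := by
  have h := intCells_divFlux_mul (g := fun _ => 1) hL hF (fun _ _ => rfl)
  simpa [NSF.jump, intCells] using h

lemma gradH_eq (h : ℝ) (r : Cell d → ℝ) (i : Fin d) (K : Cell d) :
    NSF.gradH h r i K = (r (K + e i) - r (K - e i)) / (2 * h) := by
  simp only [NSF.gradH, avg, sub_add_cancel]
  rcases eq_or_ne h 0 with rfl | hh
  · simp
  · field_simp; ring

/-- The central difference is skew-symmetric. -/
lemma intCells_gradH_mul (hL : ∀ i, 0 < L i) {f g : Cell d → ℝ} (hf : G.InQ f) (hg : G.InQ g)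
    (i : Fin d) :
    G.intCells (fun K => NSF.gradH G.h f i K * g K)
      = -G.intCells (fun K => f K * NSF.gradH G.h g i K) := by
  have h1 : G.intCells (fun K => f (K - e i) * g K) = G.intCells (fun K => f K * g (K + e i)) := by
    rw [← intCells_shift_sub hL (hf.fmul (hg.shift (e i))) (e i)]
    simp
  have h2 : G.intCells (fun K => f (K + e i) * g K) = G.intCells (fun K => f K * g (K - e i)) := by
    rw [← intCells_shift hL (hf.fmul (hg.shift_sub (e i))) (e i)]
    simp
  have e1 : (fun K => NSF.gradH G.h f i K * g K)
      = fun K => (1 / (2 * G.h)) * (f (K + e i) * g K - f (K - e i) * g K) := by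
    funext K; rw [gradH_eq]; ring
  have e2 : (fun K => f K * NSF.gradH G.h g i K)
      = fun K => (1 / (2 * G.h)) * (f K * g (K + e i) - f K * g (K - e i)) := by
    funext K; rw [gradH_eq]; ring
  rw [e1, e2, intCells_const_mul, intCells_const_mul, intCells_sub, intCells_sub, h1, h2]
  ring

lemma gradH_comm (h : ℝ) (r : Cell d → ℝ) (i j : Fin d) (K : Cell d) :
    NSF.gradH h (NSF.gradH h r i) j K = NSF.gradH h (NSF.gradH h r j) i K := by
  simp only [gradH_eq]
  have h1 : K + e j + e i = K + e i + e j := add_right_comm _ _ _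
  have h2 : K + e j - e i = K - e i + e j := by abel
  have h3 : K - e j + e i = K + e i - e j := by abel
  have h4 : K - e j - e i = K - e i - e j := by abel
  rw [h1, h2, h3, h4]
  ring

end Mesh

/-! ### The scheme as a system of equations in the cells -/

section Strong

variable {G : Mesh d L T}
  {ρ θ : ℕ → Cell d → ℝ} {u : ℕ → Cell d → Fin d → ℝ}

/-- Continuity equation in a cell. -/
lemma IsSchemeSolution.continuity_cell (hd : d ≠ 0) (hL : ∀ i, 0 < L i)
    (hs : IsSchemeSolution P ε G ρ₀ θ₀ u₀ ρ θ u) {k : ℕ} (hk : k < G.N) (K : Cell d) :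
    (ρ (k + 1) K - ρ k K) / G.Δt + divFlux G.h (flux G.h ε (ρ (k + 1)) (u (k + 1))) K = 0 := by
  have hρ := hs.ρ_mem k hk.le
  have hρ' := hs.ρ_mem (k + 1) hk
  have hu' := hs.u_mem (k + 1) hk
  have hF : ∀ i, G.InQ (flux G.h ε (ρ (k + 1)) (u (k + 1)) i) := fun i => hρ'.flux hu' _ _ i
  set A : Cell d → ℝ := fun K =>
    (ρ (k + 1) K - ρ k K) / G.Δt + divFlux G.h (flux G.h ε (ρ (k + 1)) (u (k + 1))) K with hA
  have hAQ : G.InQ A := ((hρ'.sub hρ).comp (· / G.Δt)).add (Mesh.InQ.divFlux hF _)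
  refine Mesh.eq_zero_of_intCells_sq hL hAQ ?_ K
  have h := hs.continuity k hk A hAQ
  rw [Mesh.intFaces_jump hL hd hF hAQ, sub_neg_eq_add, ← Mesh.intCells_add] at h
  rw [← h]
  congr 1
  funext K
  simp only [hA]
  ring

/-- Energy equation in a cell. -/
lemma IsSchemeSolution.energy_cell (hd : d ≠ 0) (hL : ∀ i, 0 < L i)
    (hs : IsSchemeSolution P ε G ρ₀ θ₀ u₀ ρ θ u) {k : ℕ} (hk : k < G.N) (K : Cell d) :
    P.cv * ((ρ (k + 1) K * θ (k + 1) K - ρ k K * θ k K) / G.Δt)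
      + P.cv * divFlux G.h (flux G.h ε (fun J => ρ (k + 1) J * θ (k + 1) J) (u (k + 1))) K
      - P.κ * divFlux G.h (gradE G.h (θ (k + 1))) K
      - (2 * P.μ * (∑ i, ∑ j, symGradH G.h (u (k + 1)) K i j ^ 2)
          + P.lam * divH G.h (u (k + 1)) K ^ 2
          - pressure (ρ (k + 1) K) (θ (k + 1) K) * divH G.h (u (k + 1)) K) = 0 := by
  have hρ := hs.ρ_mem k hk.le
  have hρ' := hs.ρ_mem (k + 1) hk
  have hθ := hs.θ_mem k hk.le
  have hθ' := hs.θ_mem (k + 1) hk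
  have hu' := hs.u_mem (k + 1) hk
  have hF : ∀ i, G.InQ (flux G.h ε (fun J => ρ (k + 1) J * θ (k + 1) J) (u (k + 1)) i) :=
    fun i => (hρ'.fmul hθ').flux hu' _ _ i
  have hE : ∀ i, G.InQ (gradE G.h (θ (k + 1)) i) := fun i => hθ'.gradE _ i
  set A : Cell d → ℝ := fun K =>
    P.cv * ((ρ (k + 1) K * θ (k + 1) K - ρ k K * θ k K) / G.Δt)
      + P.cv * divFlux G.h (flux G.h ε (fun J => ρ (k + 1) J * θ (k + 1) J) (u (k + 1))) K
      - P.κ * divFlux G.h (gradE G.h (θ (k + 1))) K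
      - (2 * P.μ * (∑ i, ∑ j, symGradH G.h (u (k + 1)) K i j ^ 2)
          + P.lam * divH G.h (u (k + 1)) K ^ 2
          - pressure (ρ (k + 1) K) (θ (k + 1) K) * divH G.h (u (k + 1)) K) with hA
  have hAQ : G.InQ A := by
    refine ((((((hρ'.fmul hθ').sub (hρ.fmul hθ)).comp (· / G.Δt)).const_mul _).add
      ((Mesh.InQ.divFlux hF _).const_mul _)).sub ((Mesh.InQ.divFlux hE _).const_mul _)).sub ?_
    refine (((Mesh.InQ.sum fun i _ => Mesh.InQ.sum fun j _ =>
      (hu'.symGradH _ i j).pow 2).const_mul _).add (((hu'.divH _).pow 2).const_mul _)).sub ?_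
    exact (hρ'.fmul hθ').fmul (hu'.divH _)
  refine Mesh.eq_zero_of_intCells_sq hL hAQ ?_ K
  have h := hs.energy k hk A hAQ
  rw [Mesh.intFaces_jump hL hd hF hAQ] at h
  have h2 : G.intCells (fun K => ∑ i, gradE G.h (θ (k + 1)) i K * gradE G.h A i K)
      = -G.intCells (fun K => divFlux G.h (gradE G.h (θ (k + 1))) K * A K) := by
    rw [Mesh.intCells_divFlux_mul hL hE hAQ, neg_neg, ← Mesh.intCells_sum,
      ← Mesh.intCells_const_mul]
    congr 1
    funext K
    rw [mul_sum]
    refine sum_congr rfl fun i _ => ?_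
    simp only [gradE]
    ring
  rw [h2, mul_neg, mul_neg, sub_neg_eq_add, ← Mesh.intCells_const_mul, ← Mesh.intCells_const_mul,
    ← Mesh.intCells_const_mul, ← Mesh.intCells_add, ← Mesh.intCells_neg, ← Mesh.intCells_add,
    ← sub_eq_zero, ← Mesh.intCells_sub] at h
  rw [← h]
  congr 1
  funext K
  simp only [hA]
  ring

/-- The viscous part of the weak formulation, with all differences on the velocity. -/
lemma Mesh.intCells_stress (hL : ∀ i, 0 < L i) {v φ : Cell d → ℝᵈ} (hv : G.InQ v) (hφ : G.InQ φ) :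
    G.intCells (fun K => ∑ i, ∑ j, symGradH G.h v K i j * symGradH G.h φ K i j)
      = -G.intCells (fun K =>
          ∑ j, (∑ i, gradH G.h (fun J => symGradH G.h v J i j) i K) * φ K j) := by
  have e1 : (fun K => ∑ i, ∑ j, symGradH G.h v K i j * symGradH G.h φ K i j)
      = fun K => ∑ j, ∑ i, symGradH G.h v K i j * gradH G.h (fun J => φ J j) i K := by
    funext K
    have hsw : ∑ i, ∑ j, symGradH G.h v K i j * gradH G.h (fun J => φ J i) j K
        = ∑ i, ∑ j, symGradH G.h v K i j * gradH G.h (fun J => φ J j) i K := by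
      rw [sum_comm]
      refine sum_congr rfl fun i _ => sum_congr rfl fun j _ => ?_
      simp only [symGradH]; ring
    have : ∑ i, ∑ j, symGradH G.h v K i j * symGradH G.h φ K i j
        = (∑ i, ∑ j, symGradH G.h v K i j * gradH G.h (fun J => φ J i) j K
          + ∑ i, ∑ j, symGradH G.h v K i j * gradH G.h (fun J => φ J j) i K) / 2 := by
      rw [← sum_add_distrib, sum_div]
      refine sum_congr rfl fun i _ => ?_
      rw [← sum_add_distrib, sum_div]
      refine sum_congr rfl fun j _ => ?_
      simp only [symGradH]; ring
    rw [this, hsw, sum_comm]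
    ring
  rw [e1, ← Mesh.intCells_neg]
  simp only [sum_mul, ← sum_neg_distrib]
  simp only [Mesh.intCells_sum, Mesh.intCells_neg]
  refine sum_congr rfl fun j _ => sum_congr rfl fun i _ => ?_
  rw [Mesh.intCells_gradH_mul hL (hv.symGradH _ i j) (hφ.component j), neg_neg]

lemma Mesh.intCells_mul_divH (hL : ∀ i, 0 < L i) {q : Cell d → ℝ} {φ : Cell d → ℝᵈ}
    (hq : G.InQ q) (hφ : G.InQ φ) :
    G.intCells (fun K => q K * divH G.h φ K)
      = -G.intCells (fun K => ∑ j, gradH G.h q j K * φ K j) := by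
  simp only [divH, mul_sum, Mesh.intCells_sum]
  rw [← sum_neg_distrib]
  refine sum_congr rfl fun j _ => ?_
  rw [Mesh.intCells_gradH_mul hL hq (hφ.component j), neg_neg]

/-- Momentum equation in a cell. -/
lemma IsSchemeSolution.momentum_cell (hd : d ≠ 0) (hL : ∀ i, 0 < L i)
    (hs : IsSchemeSolution P ε G ρ₀ θ₀ u₀ ρ θ u) {k : ℕ} (hk : k < G.N) (j : Fin d) (K : Cell d) :
    (ρ (k + 1) K * u (k + 1) K j - ρ k K * u k K j) / G.Δt
      + divFlux G.h (flux G.h ε (fun J => ρ (k + 1) J * u (k + 1) J j) (u (k + 1))) K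
      + gradH G.h (fun J => pressure (ρ (k + 1) J) (θ (k + 1) J)) j K
      - 2 * P.μ * ∑ i, gradH G.h (fun J => symGradH G.h (u (k + 1)) J i j) i K
      - P.lam * gradH G.h (divH G.h (u (k + 1))) j K = 0 := by
  have hρ := hs.ρ_mem k hk.le
  have hρ' := hs.ρ_mem (k + 1) hk
  have hθ' := hs.θ_mem (k + 1) hk
  have hu := hs.u_mem k hk.le
  have hu' := hs.u_mem (k + 1) hk
  have hp : G.InQ fun J => pressure (ρ (k + 1) J) (θ (k + 1) J) := hρ'.comp₂ hθ' pressure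
  have hF : ∀ j i, G.InQ (flux G.h ε (fun J => ρ (k + 1) J * u (k + 1) J j) (u (k + 1)) i) :=
    fun j i => (hρ'.fmul (hu'.component j)).flux hu' _ _ i
  set A : Cell d → ℝᵈ := fun K j =>
    (ρ (k + 1) K * u (k + 1) K j - ρ k K * u k K j) / G.Δt
      + divFlux G.h (flux G.h ε (fun J => ρ (k + 1) J * u (k + 1) J j) (u (k + 1))) K
      + gradH G.h (fun J => pressure (ρ (k + 1) J) (θ (k + 1) J)) j K
      - 2 * P.μ * ∑ i, gradH G.h (fun J => symGradH G.h (u (k + 1)) J i j) i K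
      - P.lam * gradH G.h (divH G.h (u (k + 1))) j K with hA
  have hAj : ∀ j, G.InQ fun K => A K j := fun j =>
    (((((((hρ'.fmul (hu'.component j)).sub (hρ.fmul (hu.component j))).comp (· / G.Δt)).add
      (Mesh.InQ.divFlux (hF j) _)).add (hp.gradH _ j)).sub
      ((Mesh.InQ.sum fun i _ => (hu'.symGradH _ i j).gradH _ i).const_mul _)).sub
      (((hu'.divH _).gradH _ j).const_mul _))
  have hAQ : G.InQ A := Mesh.InQ.of_components hAj
  have key : G.intCells (fun K => ∑ j, A K j * A K j) = 0 := by
    have h := hs.momentum k hk A hAQ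
    have e1 : G.intFaces (fun i K =>
          ∑ j, flux G.h ε (fun J => ρ (k + 1) J * u (k + 1) J j) (u (k + 1)) i K
            * jump (fun J => A J j) i K)
        = -G.intCells (fun K => ∑ j, divFlux G.h
            (flux G.h ε (fun J => ρ (k + 1) J * u (k + 1) J j) (u (k + 1))) K * A K j) := by
      rw [Mesh.intCells_sum, ← sum_neg_distrib]
      simp only [← Mesh.intFaces_jump hL hd (hF _) (hAj _), Mesh.intFaces, ← mul_sum]
      congr 1
      refine Eq.trans ?_ sum_comm
      exact sum_congr rfl fun i _ => sum_comm
    rw [e1, Mesh.intCells_mul_divH hL hp hAQ, Mesh.intCells_mul_divH hL (hu'.divH _) hAQ,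
      Mesh.intCells_stress hL hu' hAQ, ← sub_eq_zero] at h
    rw [← h]
    simp only [sub_neg_eq_add, mul_neg, neg_mul, neg_neg]
    simp only [← Mesh.intCells_const_mul, ← Mesh.intCells_add, ← Mesh.intCells_sub]
    congr 1
    funext K
    simp only [mul_sum, ← sum_add_distrib, ← sum_sub_distrib]
    refine sum_congr rfl fun j _ => ?_
    simp only [hA]
    ring
  rw [Mesh.intCells_sum] at key
  rw [Finset.sum_eq_zero_iff_of_nonneg
    fun j _ => Mesh.intCells_nonneg fun K => mul_self_nonneg _] at key
  exact Mesh.eq_zero_of_intCells_sq hL (hAj j) (key j (Finset.mem_univ j)) K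

end Strong

/-! ### The upwind flux -/

section Upwind

/-- The weight of the downstream neighbour `K + e i` in the upwind flux, a nonnegative number. -/
noncomputable def weightRight (h ε : ℝ) (u : Cell d → ℝᵈ) (i : Fin d) (K : Cell d) : ℝ :=
  h ^ ε - (avg (fun J => u J i) i K - |avg (fun J => u J i) i K|) / 2

/-- The weight of the neighbour `K - e i` in the upwind flux. -/
noncomputable def weightLeft (h ε : ℝ) (u : Cell d → ℝᵈ) (i : Fin d) (K : Cell d) : ℝ :=
  h ^ ε + (avg (fun J => u J i) i (K - e i) + |avg (fun J => u J i) i (K - e i)|) / 2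

lemma le_weightRight (h ε : ℝ) (u : Cell d → ℝᵈ) (i : Fin d) (K : Cell d) :
    h ^ ε ≤ weightRight h ε u i K := by
  have := le_abs_self (avg (fun J => u J i) i K)
  simp only [weightRight]; linarith

lemma le_weightLeft (h ε : ℝ) (u : Cell d → ℝᵈ) (i : Fin d) (K : Cell d) :
    h ^ ε ≤ weightLeft h ε u i K := by
  have := neg_abs_le (avg (fun J => u J i) i (K - e i))
  simp only [weightLeft]; linarith

/-- The discrete diffusion operator that upwinding and the `h ^ ε` term add to the transport. -/
noncomputable def upwindDiffusion (h ε : ℝ) (u : Cell d → ℝᵈ) (r : Cell d → ℝ)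
    (K : Cell d) : ℝ :=
  1 / h * ∑ i, (weightRight h ε u i K * (r (K + e i) - r K)
    + weightLeft h ε u i K * (r (K - e i) - r K))

lemma divFlux_flux (h ε : ℝ) (r : Cell d → ℝ) (u : Cell d → ℝᵈ) (K : Cell d) :
    divFlux h (flux h ε r u) K = r K * divH h u K - upwindDiffusion h ε u r K := by
  simp only [divFlux, divH, upwindDiffusion, gradH, mul_sum, ← sum_sub_distrib]
  refine sum_congr rfl fun i _ => ?_
  simp only [flux, upwind, jump, weightRight, weightLeft, sub_add_cancel]
  ring

/-- A pointwise linear relation between neighbouring values passes to the upwind diffusion. -/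
lemma upwindDiffusion_mono {h ε : ℝ} (hh : 0 < h) (u : Cell d → ℝᵈ) {r s : Cell d → ℝ}
    {K : Cell d} (hrs : ∀ J, r J - r K ≤ s J - s K) :
    upwindDiffusion h ε u r K ≤ upwindDiffusion h ε u s K := by
  have hp : 0 ≤ h ^ ε := (Real.rpow_pos_of_pos hh _).le
  refine mul_le_mul_of_nonneg_left (sum_le_sum fun i _ => ?_) (by positivity)
  exact add_le_add
    (mul_le_mul_of_nonneg_left (hrs _) (hp.trans (le_weightRight h ε u i K)))
    (mul_le_mul_of_nonneg_left (hrs _) (hp.trans (le_weightLeft h ε u i K)))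

lemma upwindDiffusion_linear (h ε : ℝ) (u : Cell d → ℝᵈ) (a b : ℝ) (r s : Cell d → ℝ) (K : Cell d) :
    upwindDiffusion h ε u (fun J => a * r J + b * s J) K
      = a * upwindDiffusion h ε u r K + b * upwindDiffusion h ε u s K := by
  simp only [upwindDiffusion, mul_sum, ← sum_add_distrib]
  refine sum_congr rfl fun i _ => ?_
  ring

/-- The upwind diffusion of a squared distance to the value in `K` dominates the squared jumps. -/
lemma le_upwindDiffusion_sq {h ε : ℝ} (hh : 0 < h) (u : Cell d → ℝᵈ) {r w : Cell d → ℝ}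
    {c : ℝ} (hc : ∀ J, c ≤ w J) (hc0 : 0 ≤ c) (K : Cell d) :
    h ^ ε / h * c * ∑ i, ((r (K + e i) - r K) ^ 2 + (r (K - e i) - r K) ^ 2)
      ≤ upwindDiffusion h ε u (fun J => w J * (r J - r K) ^ 2) K := by
  have hp : 0 ≤ h ^ ε := (Real.rpow_pos_of_pos hh _).le
  simp only [upwindDiffusion, mul_sum]
  refine sum_le_sum fun i _ => ?_
  have h1 : h ^ ε * (c * (r (K + e i) - r K) ^ 2)
      ≤ weightRight h ε u i K * (w (K + e i) * (r (K + e i) - r K) ^ 2) :=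
    mul_le_mul (le_weightRight h ε u i K) (mul_le_mul_of_nonneg_right (hc _) (sq_nonneg _))
      (by positivity) (hp.trans (le_weightRight h ε u i K))
  have h2 : h ^ ε * (c * (r (K - e i) - r K) ^ 2)
      ≤ weightLeft h ε u i K * (w (K - e i) * (r (K - e i) - r K) ^ 2) :=
    mul_le_mul (le_weightLeft h ε u i K) (mul_le_mul_of_nonneg_right (hc _) (sq_nonneg _))
      (by positivity) (hp.trans (le_weightLeft h ε u i K))
  have h3 : 0 ≤ 1 / h := by positivity
  calc h ^ ε / h * c * ((r (K + e i) - r K) ^ 2 + (r (K - e i) - r K) ^ 2)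
      = 1 / h * (h ^ ε * (c * (r (K + e i) - r K) ^ 2)
          + h ^ ε * (c * (r (K - e i) - r K) ^ 2)) := by
        ring
    _ ≤ _ := by
        refine mul_le_mul_of_nonneg_left ?_ h3
        simpa using add_le_add h1 h2

end Upwind

/-- The square of the Frobenius norm of the discrete symmetric gradient. -/
local notation:max "𝔇" h:max v:max K:max => ∑ i, ∑ j, symGradH h v K i j ^ 2

/-! ### Energy, entropy and density estimates in one time step -/

/-- A solution of the scheme whose density and temperature stay between positive constants up to
the last time level before `T`, and whose initial velocity is bounded in `L²`. -/
structure IsBoundedSolution (P : Fluid) (ε : ℝ) (G : Mesh d L T)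
    (ρ₀ θ₀ : ℝᵈ → ℝ) (u₀ : ℝᵈ → ℝᵈ)
    (ρ θ : ℕ → Cell d → ℝ) (u : ℕ → Cell d → ℝᵈ) (ρlo ρhi θlo θhi uhi : ℝ) : Prop
    extends IsSchemeSolution P ε G ρ₀ θ₀ u₀ ρ θ u where
  dim_ne : d ≠ 0
  L_pos : ∀ i, 0 < L i
  ρlo_pos : 0 < ρlo
  θlo_pos : 0 < θlo
  ρ_bd : ∀ k < G.N, ∀ K, ρlo ≤ ρ k K ∧ ρ k K ≤ ρhi
  θ_bd : ∀ k < G.N, ∀ K, θlo ≤ θ k K ∧ θ k K ≤ θhi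
  u_bd : G.intCells (fun K => ∑ i, u 0 K i ^ 2) ≤ uhi ^ 2

lemma Mesh.intCells_sq_neighbours {G : Mesh d L T}
    (hL : ∀ i, 0 < L i) {r : Cell d → ℝ} (hr : G.InQ r) :
    G.intCells (fun K => ∑ i, ((r (K + e i) - r K) ^ 2 + (r (K - e i) - r K) ^ 2))
      = 2 * ∑ i, G.intCells (fun K => jump r i K ^ 2) := by
  rw [Mesh.intCells_sum, mul_sum]
  refine sum_congr rfl fun i _ => ?_
  rw [Mesh.intCells_add, two_mul]
  congr 1
  rw [← Mesh.intCells_shift_sub hL ((hr.jump i).pow 2) (e i)]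
  congr 1
  funext K
  simp only [jump, sub_add_cancel]
  ring

lemma upwindDiffusion_kinetic (h ε : ℝ) (u : Cell d → ℝᵈ) (r v : Cell d → ℝ) (K : Cell d) :
    upwindDiffusion h ε u (fun J => r J / 2 * (v J - v K) ^ 2) K
      = upwindDiffusion h ε u (fun J => r J / 2 * v J ^ 2) K
        - v K * upwindDiffusion h ε u (fun J => r J * v J) K
        + v K ^ 2 / 2 * upwindDiffusion h ε u r K := by
  simp only [upwindDiffusion, mul_sum, ← sum_add_distrib, ← sum_sub_distrib]
  refine sum_congr rfl fun i _ => ?_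
  ring

lemma entropy_eq (P : Fluid) {r t : ℝ} (hr : 0 < r) (ht : 0 < t) :
    entropy P r t = P.cv * Real.log t - Real.log r := by
  rw [entropy, Real.log_div (Real.rpow_pos_of_pos ht _).ne' hr.ne', Real.log_rpow ht]

/-- The entropy `ρ s(ρ, θ)` is a concave function of `ρ` and `ρ θ`: it lies below its tangents. -/
lemma entropy_le_tangent (P : Fluid) {r t r' t' : ℝ} (hr : 0 < r) (ht : 0 < t)
    (hr' : 0 < r') (ht' : 0 < t') :
    r * entropy P r t ≤ r' * entropy P r' t'
      - (Real.log r' - P.cv * Real.log t' + P.cv + 1) * (r - r')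
      + P.cv / t' * (r * t - r' * t') := by
  rw [entropy_eq P hr ht, entropy_eq P hr' ht']
  have h1 : Real.log r' - Real.log r ≤ r' / r - 1 := by
    rw [← Real.log_div hr'.ne' hr.ne']
    exact Real.log_le_sub_one_of_pos (by positivity)
  have h2 : Real.log t - Real.log t' ≤ t / t' - 1 := by
    rw [← Real.log_div ht.ne' ht'.ne']
    exact Real.log_le_sub_one_of_pos (by positivity)
  have h3 := mul_le_mul_of_nonneg_left h1 hr.le
  have h4 := mul_le_mul_of_nonneg_left h2 (mul_pos hr P.cv_pos).le
  have h5 : r * (r' / r - 1) = r' - r := by field_simp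
  have h6 : P.cv / t' * (r * t - r' * t') = r * P.cv * (t / t') - P.cv * r' := by field_simp
  rw [h5] at h3
  rw [h6]
  linarith

lemma gradE_inv_mul {h x y : ℝ} (hx : 0 < x) (hy : 0 < y) :
    (y - x) / h * ((1 / y - 1 / x) / h) = -(((y - x) / h) ^ 2 / (x * y)) := by
  rcases eq_or_ne h 0 with rfl | hh
  · simp
  · field_simp; ring

namespace IsBoundedSolution

variable {G : Mesh d L T}
  {ρ θ : ℕ → Cell d → ℝ} {u : ℕ → Cell d → Fin d → ℝ}
  (hs : IsBoundedSolution P ε G ρ₀ θ₀ u₀ ρ θ u ρlo ρhi θlo θhi uhi)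

include hs

/-- Kinetic energy balance of one velocity component in a cell, from the momentum equation
multiplied by the velocity and the continuity equation multiplied by half its square. -/
lemma kinetic_cell {k : ℕ} (hk : k + 1 < G.N) (j : Fin d) (K : Cell d) :
    (ρ (k + 1) K / 2 * u (k + 1) K j ^ 2 - ρ k K / 2 * u k K j ^ 2) / G.Δt
      + divFlux G.h (flux G.h ε (fun J => ρ (k + 1) J / 2 * u (k + 1) J j ^ 2) (u (k + 1))) K
      + G.h ^ ε / G.h * (ρlo / 2) * ∑ i, ((u (k + 1) (K + e i) j - u (k + 1) K j) ^ 2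
          + (u (k + 1) (K - e i) j - u (k + 1) K j) ^ 2)
      + gradH G.h (fun J => pressure (ρ (k + 1) J) (θ (k + 1) J)) j K * u (k + 1) K j
      - 2 * P.μ * ((∑ i, gradH G.h (fun J => symGradH G.h (u (k + 1)) J i j) i K) * u (k + 1) K j)
      - P.lam * (gradH G.h (divH G.h (u (k + 1))) j K * u (k + 1) K j) ≤ 0 := by
  have hC := hs.continuity_cell hs.dim_ne hs.L_pos (Nat.lt_of_succ_lt hk) K
  have hM := hs.momentum_cell hs.dim_ne hs.L_pos (Nat.lt_of_succ_lt hk) j K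
  have hD := le_upwindDiffusion_sq (ε := ε) G.h_pos (u (k + 1)) (r := fun J => u (k + 1) J j)
    (w := fun J => ρ (k + 1) J / 2) (c := ρlo / 2)
    (fun J => by have := (hs.ρ_bd (k + 1) hk J).1; linarith)
    (by have := hs.ρlo_pos; linarith) K
  rw [upwindDiffusion_kinetic] at hD
  rw [divFlux_flux] at hC hM ⊢
  have hΔ := G.Δt_pos
  have ht : (ρ (k + 1) K / 2 * u (k + 1) K j ^ 2 - ρ k K / 2 * u k K j ^ 2) / G.Δt
      ≤ u (k + 1) K j * ((ρ (k + 1) K * u (k + 1) K j - ρ k K * u k K j) / G.Δt)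
        - u (k + 1) K j ^ 2 / 2 * ((ρ (k + 1) K - ρ k K) / G.Δt) := by
    have h1 : 0 ≤ ρ k K / 2 * (u (k + 1) K j - u k K j) ^ 2 / G.Δt := by
      have := hs.ρlo_pos.le.trans (hs.ρ_bd k (Nat.lt_of_succ_lt hk) K).1
      positivity
    have h2 : u (k + 1) K j * ((ρ (k + 1) K * u (k + 1) K j - ρ k K * u k K j) / G.Δt)
        - u (k + 1) K j ^ 2 / 2 * ((ρ (k + 1) K - ρ k K) / G.Δt)
        = (ρ (k + 1) K / 2 * u (k + 1) K j ^ 2 - ρ k K / 2 * u k K j ^ 2) / G.Δt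
          + ρ k K / 2 * (u (k + 1) K j - u k K j) ^ 2 / G.Δt := by ring
    linarith
  have hM' := congrArg (fun x => u (k + 1) K j * x) hM
  have hC' := congrArg (fun x => u (k + 1) K j ^ 2 / 2 * x) hC
  simp only [mul_zero] at hM' hC'
  linarith

/-- The total energy does not increase, and its decrease controls the jumps of the velocity. -/
lemma energy_step {k : ℕ} (hk : k + 1 < G.N) :
    G.intCells (fun K => energyDensity P (ρ (k + 1) K) (θ (k + 1) K) (u (k + 1) K))
      + G.Δt * (G.h ^ ε / G.h * ρlo
          * ∑ j, ∑ i, G.intCells (fun K => jump (fun J => u (k + 1) J j) i K ^ 2))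
      ≤ G.intCells (fun K => energyDensity P (ρ k K) (θ k K) (u k K)) := by
  have hL := hs.L_pos
  have hρ := hs.ρ_mem (k + 1) hk.le
  have hθ := hs.θ_mem (k + 1) hk.le
  have hu := hs.u_mem (k + 1) hk.le
  have hp : G.InQ fun J => pressure (ρ (k + 1) J) (θ (k + 1) J) := hρ.comp₂ hθ pressure
  have hΔ := G.Δt_pos
  have hcell : ∀ K, (1 / G.Δt) * (energyDensity P (ρ (k + 1) K) (θ (k + 1) K) (u (k + 1) K)
          - energyDensity P (ρ k K) (θ k K) (u k K))
        + ∑ j, divFlux G.h (flux G.h ε (fun J => ρ (k + 1) J / 2 * u (k + 1) J j ^ 2)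
            (u (k + 1))) K
        + G.h ^ ε / G.h * (ρlo / 2) * ∑ j, ∑ i, ((u (k + 1) (K + e i) j - u (k + 1) K j) ^ 2
            + (u (k + 1) (K - e i) j - u (k + 1) K j) ^ 2)
        + ∑ j, gradH G.h (fun J => pressure (ρ (k + 1) J) (θ (k + 1) J)) j K * u (k + 1) K j
        - 2 * P.μ * ∑ j, (∑ i, gradH G.h (fun J => symGradH G.h (u (k + 1)) J i j) i K)
            * u (k + 1) K j
        - P.lam * ∑ j, gradH G.h (divH G.h (u (k + 1))) j K * u (k + 1) K j
        + P.cv * divFlux G.h (flux G.h ε (fun J => ρ (k + 1) J * θ (k + 1) J) (u (k + 1))) K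
        - P.κ * divFlux G.h (gradE G.h (θ (k + 1))) K
        - (2 * P.μ * (∑ i, ∑ j, symGradH G.h (u (k + 1)) K i j * symGradH G.h (u (k + 1)) K i j)
            + P.lam * (divH G.h (u (k + 1)) K * divH G.h (u (k + 1)) K)
            - pressure (ρ (k + 1) K) (θ (k + 1) K) * divH G.h (u (k + 1)) K) ≤ 0 := by
    intro K
    have h1 := Finset.sum_nonpos fun j (_ : j ∈ Finset.univ) => hs.kinetic_cell hk j K
    have h2 := hs.energy_cell hs.dim_ne hL (Nat.lt_of_succ_lt hk) K
    simp only [sum_add_distrib, sum_sub_distrib, ← mul_sum,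
      ← sum_div] at h1
    have h3 : (1 / G.Δt) * (energyDensity P (ρ (k + 1) K) (θ (k + 1) K) (u (k + 1) K)
          - energyDensity P (ρ k K) (θ k K) (u k K))
        = (ρ (k + 1) K / 2 * ∑ j, u (k + 1) K j ^ 2 - ρ k K / 2 * ∑ j, u k K j ^ 2) / G.Δt
          + P.cv * ((ρ (k + 1) K * θ (k + 1) K - ρ k K * θ k K) / G.Δt) := by
      simp only [energyDensity, internalEnergy]
      ring
    simp only [pow_two, sum_add_distrib] at h1 h2 h3 ⊢
    linarith
  have hsum := Mesh.intCells_mono (G := G) hcell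
  have z0 : G.intCells (fun _ => (0 : ℝ)) = 0 := by simp [Mesh.intCells]
  rw [z0] at hsum
  simp only [Mesh.intCells_add, Mesh.intCells_sub, Mesh.intCells_const_mul] at hsum
  rw [Mesh.intCells_stress hL hu hu, Mesh.intCells_mul_divH hL hp hu,
    Mesh.intCells_mul_divH hL (hu.divH _) hu,
    Mesh.intCells_divFlux hL (fun i => (hρ.fmul hθ).flux hu _ _ i),
    Mesh.intCells_divFlux hL (fun i => hθ.gradE _ i), Mesh.intCells_sum _ fun j K =>
      divFlux G.h (flux G.h ε (fun J => ρ (k + 1) J / 2 * u (k + 1) J j ^ 2) (u (k + 1))) K,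
    Finset.sum_eq_zero fun j _ => Mesh.intCells_divFlux hL
      (F := flux G.h ε (fun J => ρ (k + 1) J / 2 * u (k + 1) J j ^ 2) (u (k + 1)))
      (fun i => Mesh.InQ.flux (hρ.comp₂ (hu.component j) fun a b => a / 2 * b ^ 2) hu _ _ i),
    Mesh.intCells_sum _ fun j K => ∑ i, ((u (k + 1) (K + e i) j - u (k + 1) K j) ^ 2
            + (u (k + 1) (K - e i) j - u (k + 1) K j) ^ 2),
    sum_congr rfl fun j _ => Mesh.intCells_sq_neighbours hL (hu.component j),
    ← mul_sum] at hsum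
  have h5 : (1 / G.Δt) * (G.intCells (fun K =>
        energyDensity P (ρ (k + 1) K) (θ (k + 1) K) (u (k + 1) K))
        - G.intCells (fun K => energyDensity P (ρ k K) (θ k K) (u k K)))
      + G.h ^ ε / G.h * ρlo
          * ∑ j, ∑ i, G.intCells (fun K => jump (fun J => u (k + 1) J j) i K ^ 2) ≤ 0 := by
    linarith
  have h6 := mul_le_mul_of_nonneg_left h5 hΔ.le
  rw [mul_zero, mul_add, ← mul_assoc, mul_one_div_cancel hΔ.ne', one_mul] at h6
  linarith

/-- Entropy inequality in a cell. It is the sum of the continuity equation and the energy equation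
with the partial derivatives of the entropy as factors; concavity makes the numerical terms
nonnegative. -/
lemma entropy_cell {k : ℕ} (hk : k + 1 < G.N) (K : Cell d) :
    1 / θ (k + 1) K * (P.κ * divFlux G.h (gradE G.h (θ (k + 1))) K
        + (2 * P.μ * 𝔇 G.h (u (k + 1)) K
          + P.lam * divH G.h (u (k + 1)) K ^ 2))
      ≤ (ρ (k + 1) K * entropy P (ρ (k + 1) K) (θ (k + 1) K)
            - ρ k K * entropy P (ρ k K) (θ k K)) / G.Δt
        + divFlux G.h (flux G.h ε (fun J => ρ (k + 1) J * entropy P (ρ (k + 1) J) (θ (k + 1) J))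
            (u (k + 1))) K := by
  have hk' := Nat.lt_of_succ_lt hk
  have hC := hs.continuity_cell hs.dim_ne hs.L_pos hk' K
  have hE := hs.energy_cell hs.dim_ne hs.L_pos hk' K
  have pρ : ∀ m < G.N, ∀ J, 0 < ρ m J := fun m hm J => hs.ρlo_pos.trans_le (hs.ρ_bd m hm J).1
  have pθ : ∀ m < G.N, ∀ J, 0 < θ m J := fun m hm J => hs.θlo_pos.trans_le (hs.θ_bd m hm J).1
  have hΔ := G.Δt_pos
  set a := Real.log (ρ (k + 1) K) - P.cv * Real.log (θ (k + 1) K) + P.cv + 1 with ha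
  set b := P.cv / θ (k + 1) K with hb
  have hflux := upwindDiffusion_mono (ε := ε) G.h_pos (u (k + 1)) (K := K)
    (r := fun J => ρ (k + 1) J * entropy P (ρ (k + 1) J) (θ (k + 1) J))
    (s := fun J => -a * ρ (k + 1) J + b * (ρ (k + 1) J * θ (k + 1) J)) (fun J => by
      have := entropy_le_tangent P (pρ _ hk J) (pθ _ hk J) (pρ _ hk K) (pθ _ hk K)
      simp only [← ha, ← hb] at this ⊢
      linarith)
  rw [upwindDiffusion_linear G.h ε (u (k + 1)) (-a) b (ρ (k + 1))
    (fun J => ρ (k + 1) J * θ (k + 1) J) K] at hflux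
  have htime := entropy_le_tangent P (pρ _ hk' K) (pθ _ hk' K) (pρ _ hk K) (pθ _ hk K)
  rw [← ha, ← hb] at htime
  have htime' : -a * ((ρ (k + 1) K - ρ k K) / G.Δt)
      + b * ((ρ (k + 1) K * θ (k + 1) K - ρ k K * θ k K) / G.Δt)
      ≤ (ρ (k + 1) K * entropy P (ρ (k + 1) K) (θ (k + 1) K)
            - ρ k K * entropy P (ρ k K) (θ k K)) / G.Δt := by
    rw [← mul_div_assoc, ← mul_div_assoc, ← add_div]
    refine div_le_div_of_nonneg_right ?_ hΔ.le
    linarith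
  have hS : ρ (k + 1) K * entropy P (ρ (k + 1) K) (θ (k + 1) K) + a * ρ (k + 1) K
      = (P.cv + 1) * ρ (k + 1) K := by
    rw [entropy, Real.log_div (Real.rpow_pos_of_pos (pθ _ hk K) _).ne' (pρ _ hk K).ne',
      Real.log_rpow (pθ _ hk K), ha]
    ring
  have hbp : b * (ρ (k + 1) K * θ (k + 1) K) = P.cv * ρ (k + 1) K := by
    have := (pθ _ hk K).ne'
    rw [hb]; field_simp
  have hE' := congrArg (fun x => 1 / θ (k + 1) K * x) hE
  have hC' := congrArg (fun x => a * x) hC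
  rw [divFlux_flux] at hC' hE' ⊢
  simp only [mul_zero] at hC' hE'
  have hprod : 1 / θ (k + 1) K * (pressure (ρ (k + 1) K) (θ (k + 1) K) * divH G.h (u (k + 1)) K)
      = ρ (k + 1) K * divH G.h (u (k + 1)) K := by
    have := (pθ _ hk K).ne'
    rw [pressure]; field_simp
  have hbb : b = 1 / θ (k + 1) K * P.cv := by rw [hb]; ring
  have hS' := congrArg (fun x => x * divH G.h (u (k + 1)) K) hS
  have hbp' := congrArg (fun x => x * divH G.h (u (k + 1)) K) hbp
  rw [hbb] at htime' hflux hbp'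
  linarith

/-- The total entropy controls the gradients of velocity and temperature. -/
lemma entropy_step {k : ℕ} (hk : k + 1 < G.N) :
    G.intCells (fun K => ρ k K * entropy P (ρ k K) (θ k K))
      + G.Δt * (P.κ / θhi ^ 2 * ∑ i, G.intCells (fun K => gradE G.h (θ (k + 1)) i K ^ 2)
        + 2 * P.μ / θhi * G.intCells (fun K => 𝔇 G.h (u (k + 1)) K))
      ≤ G.intCells (fun K => ρ (k + 1) K * entropy P (ρ (k + 1) K) (θ (k + 1) K)) := by
  have hL := hs.L_pos
  have hρ := hs.ρ_mem (k + 1) hk.le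
  have hθ := hs.θ_mem (k + 1) hk.le
  have hu := hs.u_mem (k + 1) hk.le
  have pθ : ∀ J, 0 < θ (k + 1) J := fun J => hs.θlo_pos.trans_le (hs.θ_bd _ hk J).1
  have bθ : ∀ J, θ (k + 1) J ≤ θhi := fun J => (hs.θ_bd _ hk J).2
  have hθhi : 0 < θhi := (pθ 0).trans_le (bθ 0)
  have hΔ := G.Δt_pos
  have hS : G.InQ fun J => ρ (k + 1) J * entropy P (ρ (k + 1) J) (θ (k + 1) J) :=
    hρ.comp₂ hθ fun a b => a * entropy P a b
  have hcell : ∀ K, P.κ * (divFlux G.h (gradE G.h (θ (k + 1))) K * (1 / θ (k + 1) K))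
      + 2 * P.μ / θhi * 𝔇 G.h (u (k + 1)) K
      ≤ 1 / G.Δt * (ρ (k + 1) K * entropy P (ρ (k + 1) K) (θ (k + 1) K)
            - ρ k K * entropy P (ρ k K) (θ k K))
        + divFlux G.h (flux G.h ε (fun J => ρ (k + 1) J * entropy P (ρ (k + 1) J) (θ (k + 1) J))
            (u (k + 1))) K := by
    intro K
    have h1 := hs.entropy_cell hk K
    have hD : 0 ≤ 𝔇 G.h (u (k + 1)) K :=
      sum_nonneg fun i _ => sum_nonneg fun j _ => sq_nonneg _
    have h2 : 2 * P.μ / θhi * 𝔇 G.h (u (k + 1)) K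
        ≤ 1 / θ (k + 1) K * (2 * P.μ * 𝔇 G.h (u (k + 1)) K
          + P.lam * divH G.h (u (k + 1)) K ^ 2) := by
      have h3 : 1 / θhi ≤ 1 / θ (k + 1) K := one_div_le_one_div_of_le (pθ K) (bθ K)
      have h4 : 0 ≤ 1 / θhi := by positivity
      have h5 := P.μ_pos
      have h6 := mul_nonneg P.lam_nonneg (sq_nonneg (divH G.h (u (k + 1)) K))
      calc 2 * P.μ / θhi * 𝔇 G.h (u (k + 1)) K
          = 1 / θhi * (2 * P.μ * 𝔇 G.h (u (k + 1)) K) := by ring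
        _ ≤ _ := mul_le_mul h3 (by linarith) (by positivity) (h4.trans h3)
    rw [mul_add] at h1
    rw [one_div_mul_eq_div]
    linarith
  have hsum := Mesh.intCells_mono (G := G) hcell
  simp only [Mesh.intCells_add, Mesh.intCells_sub, Mesh.intCells_const_mul] at hsum
  rw [Mesh.intCells_divFlux hL (fun i => hS.flux hu _ _ i),
    Mesh.intCells_divFlux_mul hL (fun i => hθ.gradE _ i) (hθ.comp fun t => 1 / t)] at hsum
  have hgrad : 1 / θhi ^ 2 * ∑ i, G.intCells (fun K => gradE G.h (θ (k + 1)) i K ^ 2)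
      ≤ -(1 / G.h * ∑ i, G.intCells (fun K => gradE G.h (θ (k + 1)) i K
          * jump (fun K => 1 / θ (k + 1) K) i K)) := by
    rw [mul_sum, mul_sum, ← sum_neg_distrib]
    refine sum_le_sum fun i _ => ?_
    rw [← Mesh.intCells_const_mul, ← Mesh.intCells_const_mul, ← Mesh.intCells_neg]
    refine Mesh.intCells_mono fun K => ?_
    have h1 := gradE_inv_mul (h := G.h) (pθ K) (pθ (K + e i))
    have h2 : -(1 / G.h * (gradE G.h (θ (k + 1)) i K * jump (fun K => 1 / θ (k + 1) K) i K))
        = ((θ (k + 1) (K + e i) - θ (k + 1) K) / G.h) ^ 2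
          / (θ (k + 1) K * θ (k + 1) (K + e i)) := by
      simp only [gradE, jump]
      linear_combination -h1
    rw [h2, gradE, jump, one_div_mul_eq_div]
    refine div_le_div_of_nonneg_left (sq_nonneg _) (mul_pos (pθ _) (pθ _)) ?_
    rw [pow_two]
    exact mul_le_mul (bθ _) (bθ _) (pθ _).le hθhi.le
  have h7 := mul_le_mul_of_nonneg_left hgrad P.κ_pos.le
  have h8 : P.κ / θhi ^ 2 * ∑ i, G.intCells (fun K => gradE G.h (θ (k + 1)) i K ^ 2) + 2 * P.μ / θhi
          * G.intCells (fun K => 𝔇 G.h (u (k + 1)) K)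
      ≤ 1 / G.Δt * (G.intCells (fun K => ρ (k + 1) K * entropy P (ρ (k + 1) K) (θ (k + 1) K))
        - G.intCells (fun K => ρ k K * entropy P (ρ k K) (θ k K))) := by
    have : P.κ * (1 / θhi ^ 2 * ∑ i, G.intCells (fun K => gradE G.h (θ (k + 1)) i K ^ 2))
      = P.κ / θhi ^ 2 * ∑ i, G.intCells (fun K => gradE G.h (θ (k + 1)) i K ^ 2) := by ring
    linarith
  have h9 := mul_le_mul_of_nonneg_left h8 hΔ.le
  rw [← mul_assoc G.Δt (1 / G.Δt), mul_one_div_cancel hΔ.ne', one_mul] at h9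
  linarith

/-- The squared density, renormalized: the numerical diffusion controls the density jumps. -/
lemma density_step {k : ℕ} (hk : k + 1 < G.N) : G.intCells (fun K => ρ (k + 1) K ^ 2)
      + G.Δt * (2 * (G.h ^ ε / G.h) * ∑ i, G.intCells (fun K => jump (ρ (k + 1)) i K ^ 2)
        + G.intCells (fun K => ρ (k + 1) K ^ 2 * divH G.h (u (k + 1)) K))
      ≤ G.intCells (fun K => ρ k K ^ 2) := by
  have hL := hs.L_pos
  have hρ := hs.ρ_mem (k + 1) hk.le
  have hu := hs.u_mem (k + 1) hk.le
  have hΔ := G.Δt_pos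
  have hcell : ∀ K, 1 / G.Δt * (ρ (k + 1) K ^ 2 - ρ k K ^ 2)
      + divFlux G.h (flux G.h ε (fun J => ρ (k + 1) J ^ 2) (u (k + 1))) K
      + G.h ^ ε / G.h * 1 * (∑ i, ((ρ (k + 1) (K + e i) - ρ (k + 1) K) ^ 2
            + (ρ (k + 1) (K - e i) - ρ (k + 1) K) ^ 2))
      + ρ (k + 1) K ^ 2 * divH G.h (u (k + 1)) K ≤ 0 := by
    intro K
    have hC := hs.continuity_cell hs.dim_ne hL (Nat.lt_of_succ_lt hk) K
    have hD := le_upwindDiffusion_sq (ε := ε) G.h_pos (u (k + 1)) (r := ρ (k + 1))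
      (w := fun _ => 1) (c := 1) (fun _ => le_rfl) zero_le_one K
    have hx : upwindDiffusion G.h ε (u (k + 1)) (fun J => 1 * (ρ (k + 1) J - ρ (k + 1) K) ^ 2) K
        = upwindDiffusion G.h ε (u (k + 1)) (fun J => ρ (k + 1) J ^ 2) K
          - 2 * ρ (k + 1) K * upwindDiffusion G.h ε (u (k + 1)) (ρ (k + 1)) K := by
      simp only [upwindDiffusion, mul_sum, ← sum_sub_distrib]
      refine sum_congr rfl fun i _ => ?_
      ring
    rw [hx] at hD
    rw [divFlux_flux] at hC ⊢
    have hC' := congrArg (fun x => 2 * ρ (k + 1) K * x) hC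
    simp only [mul_zero] at hC'
    have ht : 1 / G.Δt * (ρ (k + 1) K ^ 2 - ρ k K ^ 2)
        = 2 * ρ (k + 1) K * ((ρ (k + 1) K - ρ k K) / G.Δt)
          - (ρ (k + 1) K - ρ k K) ^ 2 / G.Δt := by ring
    have h0 : 0 ≤ (ρ (k + 1) K - ρ k K) ^ 2 / G.Δt := by positivity
    linarith
  have hsum := Mesh.intCells_mono (G := G) hcell
  have z0 : G.intCells (fun _ => (0 : ℝ)) = 0 := by simp [Mesh.intCells]
  rw [z0] at hsum
  simp only [Mesh.intCells_add, Mesh.intCells_sub, Mesh.intCells_const_mul] at hsum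
  rw [Mesh.intCells_divFlux hL (fun i => (hρ.pow 2).flux hu _ _ i),
    Mesh.intCells_sq_neighbours hL hρ] at hsum
  have h6 := mul_le_mul_of_nonneg_left hsum hΔ.le
  simp only [mul_add, mul_zero, add_zero] at h6
  rw [← mul_assoc G.Δt (1 / G.Δt), mul_one_div_cancel hΔ.ne', one_mul] at h6
  linarith

end IsBoundedSolution

/-! ### Discrete Korn inequality and equi-integrability -/

namespace Mesh

variable {G : Mesh d L T}

lemma intCells_const (c : ℝ) : G.intCells (fun _ => c) = c * ∏ i, L i := by
  simp only [intCells, cells, sum_const, Fintype.card_piFinset, Int.card_Ico, sub_zero,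
    Int.toNat_natCast, nsmul_eq_mul, ← G.cells_fit, Finset.prod_mul_distrib, Finset.prod_const,
    Finset.card_univ, Fintype.card_fin]
  push_cast
  ring

/-- Discrete Korn inequality: central differences commute, so the mixed products in `|D_h v|²` sum
up to `|div_h v|²`. -/
lemma korn (hL : ∀ i, 0 < L i) {v : Cell d → ℝᵈ} (hv : G.InQ v) :
    ∑ j, ∑ i, G.intCells (fun K => gradH G.h (fun J => v J j) i K ^ 2)
      ≤ 2 * G.intCells (fun K => 𝔇 G.h v K) := by
  have hc := fun j => hv.component j
  have hmix : ∀ i j, G.intCells (fun K => gradH G.h (fun J => v J i) j K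
        * gradH G.h (fun J => v J j) i K)
      = G.intCells (fun K => gradH G.h (fun J => v J i) i K * gradH G.h (fun J => v J j) j K) := by
    intro i j
    rw [intCells_gradH_mul hL (hc i) ((hc j).gradH _ i), intCells_gradH_mul hL (hc i)
      ((hc j).gradH _ j)]
    simp only [gradH_comm G.h (fun J => v J j) i j]
  have hdiv : G.intCells (fun K => divH G.h v K ^ 2)
      = ∑ i, ∑ j, G.intCells (fun K => gradH G.h (fun J => v J i) j K
        * gradH G.h (fun J => v J j) i K) := by
    rw [sum_congr rfl fun i _ => sum_congr rfl fun j _ => hmix i j]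
    simp only [divH, pow_two, Finset.sum_mul_sum, intCells_sum]
  have hdiv0 : 0 ≤ G.intCells (fun K => divH G.h v K ^ 2) := intCells_nonneg fun K => sq_nonneg _
  have hexp : 2 * G.intCells (fun K => 𝔇 G.h v K)
      = ∑ j, ∑ i, G.intCells (fun K => gradH G.h (fun J => v J j) i K ^ 2)
        + ∑ i, ∑ j, G.intCells (fun K => gradH G.h (fun J => v J i) j K
        * gradH G.h (fun J => v J j) i K) := by
    have e1 : ∀ i j, (fun K => symGradH G.h v K i j ^ 2)
        = fun K => (1 / 4) * (gradH G.h (fun J => v J i) j K ^ 2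
          + gradH G.h (fun J => v J j) i K ^ 2) + (1 / 2) * (gradH G.h (fun J => v J i) j K
        * gradH G.h (fun J => v J j) i K) := by
      intro i j; funext K; simp only [symGradH]; ring
    simp only [intCells_sum]
    simp only [e1, intCells_add, intCells_const_mul, sum_add_distrib, ← mul_sum]
    rw [sum_comm (f := fun i j => G.intCells (fun K => gradH G.h (fun J => v J j) i K ^ 2))]
    ring
  rw [hexp, ← hdiv]
  linarith

/-- The `L²` distance of a grid function to its translate by `c` cells. -/
noncomputable def shiftDist (G : Mesh d L T) (f : Cell d → ℝ) (c : Cell d) : ℝ :=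
  √(∑ K ∈ G.cells, (f (K + c) - f K) ^ 2)

lemma shiftDist_add (hL : ∀ i, 0 < L i) {f : Cell d → ℝ} (hf : G.InQ f) (a b : Cell d) :
    G.shiftDist f (a + b) ≤ G.shiftDist f a + G.shiftDist f b := by
  have h1 : ∑ K ∈ G.cells, (f (K + a) - f K) ^ 2 = ∑ K ∈ G.cells, (f (K + b + a) - f (K + b)) ^ 2 :=
    (sum_cells_add hL ((((hf.shift a).sub hf)).pow 2) b).symm
  unfold shiftDist
  rw [h1]
  set x := fun K => f (K + b + a) - f (K + b) with hx
  set y := fun K => f (K + b) - f K with hy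
  have h2 : ∀ K, f (K + (a + b)) - f K = x K + y K := by
    intro K
    have : K + (a + b) = K + b + a := by abel
    simp only [hx, hy, this]; ring
  simp only [h2]
  have hcs := Real.sum_mul_le_sqrt_mul_sqrt G.cells x y
  have hx0 : 0 ≤ ∑ K ∈ G.cells, x K ^ 2 := sum_nonneg fun K _ => sq_nonneg _
  have hy0 : 0 ≤ ∑ K ∈ G.cells, y K ^ 2 := sum_nonneg fun K _ => sq_nonneg _
  refine Real.sqrt_le_iff.2 ⟨by positivity, ?_⟩
  have h3 : ∑ K ∈ G.cells, (x K + y K) ^ 2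
      = ∑ K ∈ G.cells, x K ^ 2 + 2 * ∑ K ∈ G.cells, x K * y K + ∑ K ∈ G.cells, y K ^ 2 := by
    rw [mul_sum, ← sum_add_distrib, ← sum_add_distrib]
    exact sum_congr rfl fun K _ => by ring
  rw [h3, add_sq, Real.sq_sqrt hx0, Real.sq_sqrt hy0]
  linarith

lemma shiftDist_zero (f : Cell d → ℝ) : G.shiftDist f 0 = 0 := by simp [shiftDist]

lemma shiftDist_nsmul (hL : ∀ i, 0 < L i) {f : Cell d → ℝ} (hf : G.InQ f) (n : ℕ) (a : Cell d) :
    G.shiftDist f (n • a) ≤ n * G.shiftDist f a := by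
  induction n with
  | zero => simp [shiftDist_zero]
  | succ n ih =>
    rw [succ_nsmul]
    push_cast
    linarith [shiftDist_add hL hf (n • a) a]

lemma shiftDist_sum (hL : ∀ i, 0 < L i) {f : Cell d → ℝ} (hf : G.InQ f) (s : Finset (Fin d))
    (a : Fin d → Cell d) :
    G.shiftDist f (∑ i ∈ s, a i) ≤ ∑ i ∈ s, G.shiftDist f (a i) := by
  induction s using Finset.induction_on with
  | empty => simp [shiftDist_zero]
  | insert j s hj ih =>
    rw [sum_insert hj, sum_insert hj]
    linarith [shiftDist_add hL hf (a j) (∑ i ∈ s, a i)]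

lemma shiftDist_two (hL : ∀ i, 0 < L i) {f : Cell d → ℝ} (hf : G.InQ f) (i : Fin d) :
    G.shiftDist f (e i + e i) = 2 * G.h * √(∑ K ∈ G.cells, gradH G.h f i K ^ 2) := by
  have h0 := G.h_pos
  have h1 : ∑ K ∈ G.cells, gradH G.h f i K ^ 2 = ∑ K ∈ G.cells, gradH G.h f i (K + e i) ^ 2 :=
    (sum_cells_add hL ((hf.gradH G.h i).pow 2) (e i)).symm
  have h2 : ∑ K ∈ G.cells, (f (K + (e i + e i)) - f K) ^ 2
      = (2 * G.h) ^ 2 * ∑ K ∈ G.cells, gradH G.h f i (K + e i) ^ 2 := by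
    rw [mul_sum]
    refine sum_congr rfl fun K _ => ?_
    rw [gradH_eq, add_sub_cancel_right, ← add_assoc]
    field_simp
  rw [shiftDist, h1, h2, Real.sqrt_mul (by positivity), Real.sqrt_sq (by positivity)]

/-- Translations by an even number of cells are controlled by the central difference gradient. -/
lemma shiftDist_even_sq (hL : ∀ i, 0 < L i) {f : Cell d → ℝ} (hf : G.InQ f) {m : ℕ}
    {k : Fin d → ℕ} (hk : ∀ i, k i ≤ m) :
    G.shiftDist f (fun i => 2 * (k i : ℤ)) ^ 2
      ≤ (2 * (m * G.h)) ^ 2 * d * ∑ i, ∑ K ∈ G.cells, gradH G.h f i K ^ 2 := by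
  have h0 := G.h_pos
  have e1 : (fun i => 2 * (k i : ℤ) : Cell d) = ∑ i, k i • (e i + e i) := by
    funext j
    simp [Finset.sum_apply, e, Pi.single_apply, sum_add_distrib, two_mul]
  have h1 : G.shiftDist f (fun i => 2 * (k i : ℤ))
      ≤ ∑ i, (2 * (m * G.h)) * √(∑ K ∈ G.cells, gradH G.h f i K ^ 2) := by
    rw [e1]
    refine (shiftDist_sum hL hf _ _).trans (sum_le_sum fun i _ => ?_)
    refine (shiftDist_nsmul hL hf _ _).trans ?_
    rw [shiftDist_two hL hf]
    have : (k i : ℝ) ≤ m := by exact_mod_cast hk i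
    calc (k i : ℝ) * (2 * G.h * √(∑ K ∈ G.cells, gradH G.h f i K ^ 2))
        ≤ m * (2 * G.h * √(∑ K ∈ G.cells, gradH G.h f i K ^ 2)) :=
          mul_le_mul_of_nonneg_right this (by positivity)
      _ = _ := by ring
  rw [← mul_sum] at h1
  refine (pow_le_pow_left₀ (Real.sqrt_nonneg _) h1 2).trans ?_
  rw [mul_pow, mul_assoc]
  refine mul_le_mul_of_nonneg_left ?_ (sq_nonneg _)
  refine (sq_sum_le_card_mul_sum_sq).trans ?_
  rw [Finset.card_univ, Fintype.card_fin]
  refine mul_le_mul_of_nonneg_left (sum_le_sum fun i _ => ?_) (Nat.cast_nonneg _)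
  rw [Real.sq_sqrt (sum_nonneg fun K _ => sq_nonneg _)]

/-- The translates of a cell by `2 k`, `0 ≤ k i < m`, are distinct cells of the torus as long as
`2 m ≤ M i`. -/
lemma sum_even_shifts_le (hL : ∀ i, 0 < L i) {g : Cell d → ℝ} (hg : G.InQ g) (hg0 : ∀ K, 0 ≤ g K)
    {m : ℕ} (hm : ∀ i, 2 * m ≤ G.M i) (K : Cell d) :
    ∑ k ∈ Fintype.piFinset (fun _ : Fin d => Finset.range m), g (K + fun i => 2 * (k i : ℤ))
      ≤ ∑ K ∈ G.cells, g K := by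
  set B := Fintype.piFinset (fun _ : Fin d => Finset.range m) with hB
  set F : (Fin d → ℕ) → Cell d := fun k => G.wrapCell (K + fun i => 2 * (k i : ℤ)) with hF
  have hinj : Set.InjOn F B := by
    intro k hk k' hk' h
    funext i
    have h1 : (K i + 2 * (k i : ℤ)) % G.M i = (K i + 2 * (k' i : ℤ)) % G.M i := congrFun h i
    simp only [hB, Finset.mem_coe, Fintype.mem_piFinset, Finset.mem_range] at hk hk'
    have h3 : ((G.M i : ℤ)) ∣ (K i + 2 * (k' i : ℤ)) - (K i + 2 * (k i : ℤ)) := Int.ModEq.dvd h1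
    have h4 := hk i
    have h5 := hk' i
    have h6 := hm i
    have h7 : (K i + 2 * (k' i : ℤ)) - (K i + 2 * (k i : ℤ)) = 0 := by
      refine Int.eq_zero_of_abs_lt_dvd h3 ?_
      rw [abs_lt]; constructor <;> omega
    omega
  calc ∑ k ∈ B, g (K + fun i => 2 * (k i : ℤ)) = ∑ k ∈ B, g (F k) :=
        sum_congr rfl fun k _ => (hg.wrapCell _).symm
    _ = ∑ J ∈ B.image F, g J := (Finset.sum_image hinj).symm
    _ ≤ ∑ K ∈ G.cells, g K := by
        refine Finset.sum_le_sum_of_subset_of_nonneg ?_ fun J _ _ => hg0 J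
        intro J hJ
        obtain ⟨k, -, rfl⟩ := Finset.mem_image.1 hJ
        exact G.wrapCell_mem hL _

/-- Equi-integrability of `f ^ 2` for grid functions with bounded central difference gradient: the
average `v` of `f` over the `m ^ d` cells `K + 2 k` is bounded, and `f - v` is small in `L²`. Only
even translations occur because the central difference does not see oscillations between
neighbouring cells. -/
lemma intCells_sq_truncated_le (hL : ∀ i, 0 < L i) {f : Cell d → ℝ} (hf : G.InQ f) {m : ℕ}
    (hm0 : 0 < m) (hm : ∀ i, 2 * m ≤ G.M i) {E R : ℝ} (hE : G.intCells (fun K => f K ^ 2) ≤ E)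
    (hR : 2 * E / (m * G.h) ^ d ≤ R) :
    G.intCells (fun K => max (f K ^ 2 - R) 0)
      ≤ 2 * ((2 * (m * G.h)) ^ 2 * d) * ∑ i, G.intCells (fun K => gradH G.h f i K ^ 2) := by
  have h0 := G.h_pos
  set B := Fintype.piFinset (fun _ : Fin d => Finset.range m) with hB
  have hcard : (B.card : ℝ) = (m : ℝ) ^ d := by rw [hB, Fintype.card_piFinset]; simp
  have hmpos : (0 : ℝ) < m := by exact_mod_cast hm0
  have hBpos : (0 : ℝ) < B.card := by rw [hcard]; positivity
  set sh : (Fin d → ℕ) → Cell d := fun k i => 2 * (k i : ℤ) with hsh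
  set v : Cell d → ℝ := fun K => (∑ k ∈ B, f (K + sh k)) / B.card with hv
  set w : Cell d → ℝ := fun K => (∑ k ∈ B, (f (K + sh k) - f K)) / B.card with hw
  have hvw : ∀ K, f K = v K - w K := by
    intro K
    simp only [hv, hw, sum_sub_distrib, sum_const, nsmul_eq_mul]
    rw [sub_div, mul_div_cancel_left₀ _ hBpos.ne']
    ring
  have jensen : ∀ g : (Fin d → ℕ) → ℝ,
      ((∑ k ∈ B, g k) / B.card) ^ 2 ≤ (∑ k ∈ B, g k ^ 2) / B.card := by
    intro g
    rw [div_pow, div_le_div_iff₀ (pow_pos hBpos 2) hBpos]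
    have := sq_sum_le_card_mul_sum_sq (s := B) (f := g)
    calc (∑ k ∈ B, g k) ^ 2 * B.card ≤ (B.card * ∑ k ∈ B, g k ^ 2) * B.card :=
          mul_le_mul_of_nonneg_right this hBpos.le
      _ = _ := by ring
  have hvb : ∀ K, 2 * v K ^ 2 ≤ R := by
    intro K
    have h1 : v K ^ 2 ≤ (∑ K ∈ G.cells, f K ^ 2) / B.card := by
      refine (jensen _).trans (div_le_div_of_nonneg_right ?_ hBpos.le)
      exact sum_even_shifts_le hL (hf.pow 2) (fun K => sq_nonneg _) hm K
    have h2 : (∑ K ∈ G.cells, f K ^ 2) / B.card ≤ E / (m * G.h) ^ d := by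
      rw [hcard, mul_pow, div_le_div_iff₀ (by positivity) (by positivity)]
      simp only [intCells] at hE
      calc (∑ K ∈ G.cells, f K ^ 2) * ((m : ℝ) ^ d * G.h ^ d)
          = (G.h ^ d * ∑ K ∈ G.cells, f K ^ 2) * (m : ℝ) ^ d := by ring
        _ ≤ E * (m : ℝ) ^ d := mul_le_mul_of_nonneg_right hE (by positivity)
    have h3 : 2 * E / (m * G.h) ^ d = 2 * (E / (m * G.h) ^ d) := by ring
    linarith
  have hwb : ∑ K ∈ G.cells, w K ^ 2
      ≤ (2 * (m * G.h)) ^ 2 * d * ∑ i, ∑ K ∈ G.cells, gradH G.h f i K ^ 2 := by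
    calc ∑ K ∈ G.cells, w K ^ 2 ≤ ∑ K ∈ G.cells, (∑ k ∈ B, (f (K + sh k) - f K) ^ 2) / B.card :=
          sum_le_sum fun K _ => jensen _
      _ = (∑ k ∈ B, G.shiftDist f (sh k) ^ 2) / B.card := by
          rw [← sum_div, sum_comm]
          congr 1
          refine sum_congr rfl fun k _ => ?_
          rw [shiftDist, Real.sq_sqrt (sum_nonneg fun K _ => sq_nonneg _)]
      _ ≤ (∑ k ∈ B, (2 * (m * G.h)) ^ 2 * d * ∑ i, ∑ K ∈ G.cells, gradH G.h f i K ^ 2)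
            / B.card := by
          refine div_le_div_of_nonneg_right (sum_le_sum fun k hk => ?_) hBpos.le
          refine shiftDist_even_sq hL hf fun i => ?_
          simp only [hB, Fintype.mem_piFinset, Finset.mem_range] at hk
          exact (hk i).le
      _ = _ := by rw [sum_const, nsmul_eq_mul, mul_div_cancel_left₀ _ hBpos.ne']
  have hpt : ∀ K, max (f K ^ 2 - R) 0 ≤ 2 * w K ^ 2 := by
    intro K
    refine max_le ?_ (by positivity)
    have h1 := hvb K
    rw [hvw K]
    nlinarith [sq_nonneg (v K + w K)]
  calc G.intCells (fun K => max (f K ^ 2 - R) 0)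
      ≤ G.intCells (fun K => 2 * w K ^ 2) := intCells_mono hpt
    _ = 2 * (G.h ^ d * ∑ K ∈ G.cells, w K ^ 2) := by rw [intCells_const_mul]; rfl
    _ ≤ 2 * (G.h ^ d * ((2 * (m * G.h)) ^ 2 * d * ∑ i, ∑ K ∈ G.cells, gradH G.h f i K ^ 2)) := by
        gcongr
    _ = _ := by
        simp only [intCells, ← mul_sum]
        ring

end Mesh

/-! ### Uniform bounds -/

lemma sum_telescope_le {a D : ℕ → ℝ} {c : ℝ} {N : ℕ}
    (h : ∀ k, k + 1 < N → a (k + 1) + c * D (k + 1) ≤ a k) :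
    ∀ n, n < N → ∑ k ∈ Finset.range n, c * D (k + 1) ≤ a 0 - a n := by
  intro n hn
  induction n with
  | zero => simp
  | succ n ih =>
    rw [sum_range_succ]
    have h1 := ih (by omega)
    have h2 := h n hn
    linarith

/-- The bounds, uniform in the mesh, that hold for bounded solutions of the scheme. The gradients
are only bounded from the first time step on: nothing is known about those of the initial data. -/
structure UniformBounds (ε : ℝ) (G : Mesh d L T)
    (ρ θ : ℕ → Cell d → ℝ) (u : ℕ → Cell d → ℝᵈ) (C : ℝ) : Prop where
  velocity : ∀ k < G.N, G.intCells (fun K => ∑ j, u k K j ^ 2) ≤ C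
  gradE_θ : ∑ k ∈ Finset.range (G.N - 1),
    G.Δt * ∑ i, G.intCells (fun K => gradE G.h (θ (k + 1)) i K ^ 2) ≤ C
  symGrad_u : ∑ k ∈ Finset.range (G.N - 1),
    G.Δt * G.intCells (fun K => 𝔇 G.h (u (k + 1)) K) ≤ C
  grad_u : ∑ k ∈ Finset.range (G.N - 1),
    G.Δt * ∑ j, ∑ i, G.intCells (fun K => gradH G.h (fun J => u (k + 1) J j) i K ^ 2) ≤ C
  jump_u : ∑ k ∈ Finset.range (G.N - 1),
    G.Δt * ∑ j, ∑ i, G.intCells (fun K => jump (fun J => u (k + 1) J j) i K ^ 2)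
      ≤ C * (G.h / G.h ^ ε)
  jump_ρ : ∑ k ∈ Finset.range (G.N - 1),
    G.Δt * ∑ i, G.intCells (fun K => jump (ρ (k + 1)) i K ^ 2) ≤ C * (G.h / G.h ^ ε)

/-- A bound for `|ρ s|` when density and temperature lie between positive constants. -/
noncomputable def entropyBound (P : Fluid) (ρlo ρhi θlo θhi : ℝ) : ℝ :=
  ρhi * (P.cv * (|Real.log θlo| + |Real.log θhi|) + (|Real.log ρlo| + |Real.log ρhi|))

lemma abs_log_le {a b x : ℝ} (ha : 0 < a) (hx : a ≤ x ∧ x ≤ b) :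
    |Real.log x| ≤ |Real.log a| + |Real.log b| := by
  have h1 := Real.log_le_log ha hx.1
  have h2 := Real.log_le_log (ha.trans_le hx.1) hx.2
  rw [abs_le]
  constructor
  · linarith [neg_abs_le (Real.log a), abs_nonneg (Real.log b)]
  · linarith [le_abs_self (Real.log b), abs_nonneg (Real.log a)]

lemma abs_entropy_le (P : Fluid) {ρlo ρhi θlo θhi r t : ℝ} (hρ : 0 < ρlo) (hθ : 0 < θlo)
    (hr : ρlo ≤ r ∧ r ≤ ρhi) (ht : θlo ≤ t ∧ t ≤ θhi) :
    |r * entropy P r t| ≤ entropyBound P ρlo ρhi θlo θhi := by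
  have hr0 := hρ.trans_le hr.1
  rw [entropy_eq P hr0 (hθ.trans_le ht.1), abs_mul, abs_of_pos hr0, entropyBound]
  have h1 := abs_log_le hρ hr
  have h2 := abs_log_le hθ ht
  have h3 : |P.cv * Real.log t - Real.log r| ≤ P.cv * |Real.log t| + |Real.log r| := by
    refine (abs_sub _ _).trans ?_
    rw [abs_mul, abs_of_pos P.cv_pos]
  have h4 := mul_le_mul_of_nonneg_left h2 P.cv_pos.le
  exact mul_le_mul hr.2 (by linarith) (abs_nonneg _) (hr0.le.trans hr.2)

section Bounds

/-- The compression term in the balance of `ρ²` is controlled by the symmetric gradient. -/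
lemma IsBoundedSolution.neg_intCells_sq_mul_divH_le {G : Mesh d L T}
    {ρ θ : ℕ → Cell d → ℝ} {u : ℕ → Cell d → ℝᵈ}
    (hs : IsBoundedSolution P ε G ρ₀ θ₀ u₀ ρ θ u ρlo ρhi θlo θhi uhi) {k : ℕ} (hk : k < G.N) :
    -G.intCells (fun K => ρ k K ^ 2 * divH G.h (u k) K) ≤ ρhi ^ 2 * (∏ i, L i
        + d * G.intCells (fun K => 𝔇 G.h (u k) K)) := by
  have h1 : ∀ K, -(ρ k K ^ 2 * divH G.h (u k) K)
      ≤ ρhi ^ 2 * (1 + d * 𝔇 G.h (u k) K) := by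
    intro K
    have hr := hs.ρ_bd k hk K
    have hr2 : ρ k K ^ 2 ≤ ρhi ^ 2 := pow_le_pow_left₀ (hs.ρlo_pos.le.trans hr.1) hr.2 2
    have hdv : divH G.h (u k) K ^ 2 ≤ d * 𝔇 G.h (u k) K := by
      have e1 : divH G.h (u k) K = ∑ i, symGradH G.h (u k) K i i := by
        simp only [divH, symGradH, add_self_div_two]
      rw [e1]
      refine (sq_sum_le_card_mul_sum_sq).trans ?_
      rw [Finset.card_univ, Fintype.card_fin]
      refine mul_le_mul_of_nonneg_left (sum_le_sum fun i _ => ?_) (Nat.cast_nonneg _)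
      exact sq_le_sum_sq (symGradH G.h (u k) K i) i
    have hd1 : -divH G.h (u k) K ≤ 1 + divH G.h (u k) K ^ 2 := by
      nlinarith [sq_nonneg (divH G.h (u k) K + 1)]
    calc -(ρ k K ^ 2 * divH G.h (u k) K) = ρ k K ^ 2 * (-divH G.h (u k) K) := by ring
      _ ≤ ρ k K ^ 2 * (1 + d * 𝔇 G.h (u k) K) :=
        mul_le_mul_of_nonneg_left (by linarith) (sq_nonneg _)
      _ ≤ _ := mul_le_mul_of_nonneg_right hr2 (by
        have := (sq_nonneg _).trans hdv
        linarith)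
  have h2 := Mesh.intCells_mono (G := G) h1
  rw [Mesh.intCells_neg, Mesh.intCells_const_mul, Mesh.intCells_add, Mesh.intCells_const,
    Mesh.intCells_const_mul, one_mul] at h2
  exact h2

set_option maxHeartbeats 1000000 in
/-- The estimates of one time step, summed over the time levels. Only levels below `N` occur: the
hypotheses bound the functions of time on `(0, T)`, which do not see the level `N`. The constant
depends on the data and not on the mesh. -/
theorem exists_uniformBounds (P : Fluid) (ε : ℝ) (L : ℝᵈ) (T : ℝ)
    (ρ₀ θ₀ : ℝᵈ → ℝ) (u₀ : ℝᵈ → ℝᵈ) (ρlo ρhi θlo θhi uhi : ℝ) :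
    ∃ C : ℝ, ∀ (G : Mesh d L T) (ρ θ : ℕ → Cell d → ℝ) (u : ℕ → Cell d → ℝᵈ),
      IsBoundedSolution P ε G ρ₀ θ₀ u₀ ρ θ u ρlo ρhi θlo θhi uhi →
      UniformBounds ε G ρ θ u C := by
  set V := ∏ i, L i with hV
  set E₀ := ρhi / 2 * uhi ^ 2 + ρhi * (P.cv * θhi) * V with hE₀
  set S₀ := entropyBound P ρlo ρhi θlo θhi * V
  set Cu := E₀ / (ρlo / 2)
  set Cg := 2 * S₀ / (P.κ / θhi ^ 2)
  set Cd := 2 * S₀ / (2 * P.μ / θhi)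
  set Cj := E₀ / ρlo
  set Cρ := (ρhi ^ 2 * V + ρhi ^ 2 * (T * V + d * Cd)) / 2 with hCρ
  obtain ⟨C, hC, q1, q2, q3, q4, q5⟩ :
      ∃ C, 0 ≤ C ∧ Cu ≤ C ∧ Cg ≤ C ∧ 2 * |Cd| ≤ C ∧ Cj ≤ C ∧ Cρ ≤ C := by
    refine ⟨|Cu| + |Cg| + 2 * |Cd| + |Cj| + |Cρ|, by positivity, ?_⟩
    have p1 := abs_nonneg Cu
    have p2 := abs_nonneg Cg
    have p3 := abs_nonneg Cd
    have p4 := abs_nonneg Cj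
    have p5 := abs_nonneg Cρ
    exact ⟨by linarith [le_abs_self Cu], by linarith [le_abs_self Cg], by linarith,
      by linarith [le_abs_self Cj], by linarith [le_abs_self Cρ]⟩
  refine ⟨C, fun G ρ θ u hs => ?_⟩
  have hL := hs.L_pos
  have hΔ := G.Δt_pos
  have hρlo := hs.ρlo_pos
  have hθlo := hs.θlo_pos
  have hc : 0 < G.h ^ ε / G.h := div_pos (Real.rpow_pos_of_pos G.h_pos _) G.h_pos
  have hc' : 0 < G.h / G.h ^ ε := by rw [← inv_div]; exact inv_pos.2 hc
  rcases Nat.eq_zero_or_pos G.N with hN | hN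
  · constructor <;> simp [hN] <;> positivity
  have hρhi : 0 < ρhi := hρlo.trans_le ((hs.ρ_bd 0 hN 0).1.trans (hs.ρ_bd 0 hN 0).2)
  have hθhi : 0 < θhi := hθlo.trans_le ((hs.θ_bd 0 hN 0).1.trans (hs.θ_bd 0 hN 0).2)
  have hμ := P.μ_pos
  have hκ := P.κ_pos
  have hcv := P.cv_pos
  have hN1 : G.N - 1 < G.N := by omega
  have hsum : ∀ (a b : ℝ) (x y : ℕ → ℝ), ∑ k ∈ Finset.range (G.N - 1), G.Δt * (a * x k + b * y k)
      = a * (∑ k ∈ Finset.range (G.N - 1), G.Δt * x k)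
        + b * ∑ k ∈ Finset.range (G.N - 1), G.Δt * y k := by
    intro a b x y
    rw [mul_sum, mul_sum, ← sum_add_distrib]
    exact sum_congr rfl fun k _ => by ring
  -- the energy controls the velocity and its jumps
  set E : ℕ → ℝ := fun k => G.intCells (fun K => energyDensity P (ρ k K) (θ k K) (u k K)) with hE
  set X : ℕ → ℝ := fun k =>
    ∑ j, ∑ i, G.intCells (fun K => jump (fun J => u k J j) i K ^ 2)
  have hX0 : ∀ k, 0 ≤ X k := fun k =>
    sum_nonneg fun j _ => sum_nonneg fun i _ => Mesh.intCells_nonneg fun K => sq_nonneg _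
  have hEtel := sum_telescope_le (a := E) (D := fun k => G.h ^ ε / G.h * ρlo * X k) (c := G.Δt)
    (N := G.N) fun k hk => hs.energy_step hk
  have hE0 : E 0 ≤ E₀ := by
    have h1 : E 0 ≤ G.intCells (fun K => ρhi / 2 * (∑ i, u 0 K i ^ 2) + ρhi * (P.cv * θhi)) := by
      refine Mesh.intCells_mono fun K => ?_
      have hr := hs.ρ_bd 0 hN K
      have ht := hs.θ_bd 0 hN K
      have ht0 := hθlo.le.trans ht.1
      simp only [energyDensity, internalEnergy]
      rw [one_div_mul_eq_div]
      gcongr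
      exacts [hr.2, hr.2, ht.2]
    rw [Mesh.intCells_add, Mesh.intCells_const_mul, Mesh.intCells_const] at h1
    have h2 := mul_le_mul_of_nonneg_left hs.u_bd (by positivity : 0 ≤ ρhi / 2)
    rw [hE₀]; linarith
  have hElow : ∀ k < G.N, ρlo / 2 * G.intCells (fun K => ∑ j, u k K j ^ 2) ≤ E k := by
    intro k hk
    rw [← Mesh.intCells_const_mul]
    refine Mesh.intCells_mono fun K => ?_
    have hr := hs.ρ_bd k hk K
    have ht := hθlo.le.trans (hs.θ_bd k hk K).1
    have hr0 := hρlo.le.trans hr.1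
    simp only [energyDensity, internalEnergy]
    rw [one_div_mul_eq_div]
    refine le_add_of_le_of_nonneg ?_ (by positivity)
    gcongr
    exact hr.1
  have hvel : ∀ k < G.N, G.intCells (fun K => ∑ j, u k K j ^ 2) ≤ Cu := by
    intro k hk
    refine (le_div_iff₀' (half_pos hρlo)).2 ((hElow k hk).trans ?_)
    have h3 : 0 ≤ ∑ k ∈ Finset.range k, G.Δt * (G.h ^ ε / G.h * ρlo * X (k + 1)) :=
      sum_nonneg fun k _ => mul_nonneg hΔ.le (mul_nonneg (by positivity) (hX0 _))
    linarith [hEtel k hk]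
  have hju : ∑ k ∈ Finset.range (G.N - 1), G.Δt * X (k + 1) ≤ Cj * (G.h / G.h ^ ε) := by
    have h1 := hEtel _ hN1
    have h2 : 0 ≤ E (G.N - 1) := le_trans (mul_nonneg (by positivity)
      (Mesh.intCells_nonneg fun K => sum_nonneg fun j _ => sq_nonneg _)) (hElow _ hN1)
    have h3 := hsum (G.h ^ ε / G.h * ρlo) 0 (fun k => X (k + 1)) 0
    simp only [zero_mul, add_zero] at h3
    rw [show Cj * (G.h / G.h ^ ε) = E₀ / (G.h ^ ε / G.h * ρlo) by
      rw [mul_comm _ ρlo, ← div_div, ← inv_div (G.h ^ ε) G.h, ← div_eq_mul_inv],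
      le_div_iff₀' (by positivity)]
    linarith
  -- the entropy controls the gradients
  set S : ℕ → ℝ := fun k => -G.intCells (fun K => ρ k K * entropy P (ρ k K) (θ k K)) with hS
  set Dg : ℕ → ℝ := fun k => ∑ i, G.intCells (fun K => gradE G.h (θ k) i K ^ 2) with hDg
  set Du : ℕ → ℝ := fun k => G.intCells (fun K => 𝔇 G.h (u k) K) with hDu
  have hDg0 : 0 ≤ ∑ k ∈ Finset.range (G.N - 1), G.Δt * Dg (k + 1) := sum_nonneg fun k _ =>
    mul_nonneg hΔ.le (sum_nonneg fun i _ => Mesh.intCells_nonneg fun K => sq_nonneg _)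
  have hDu0 : 0 ≤ ∑ k ∈ Finset.range (G.N - 1), G.Δt * Du (k + 1) := sum_nonneg fun k _ =>
    mul_nonneg hΔ.le (Mesh.intCells_nonneg fun K =>
      sum_nonneg fun i _ => sum_nonneg fun j _ => sq_nonneg _)
  have hSb : ∀ k < G.N, |S k| ≤ S₀ := by
    intro k hk
    have h1 : ∀ K, |ρ k K * entropy P (ρ k K) (θ k K)| ≤ entropyBound P ρlo ρhi θlo θhi :=
      fun K => abs_entropy_le P hρlo hθlo (hs.ρ_bd k hk K) (hs.θ_bd k hk K)
    have h2 := Mesh.intCells_mono (G := G) fun K => neg_le_of_abs_le (h1 K)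
    have h3 := Mesh.intCells_mono (G := G) fun K => le_of_abs_le (h1 K)
    rw [Mesh.intCells_const, ← hV] at h2 h3
    rw [hS, abs_neg, abs_le]
    constructor <;> linarith
  have hSS := sum_telescope_le (a := S) (D := fun k => P.κ / θhi ^ 2 * Dg k
      + 2 * P.μ / θhi * Du k) (c := G.Δt) (N := G.N) (fun k hk => by
    have := hs.entropy_step hk
    simp only [hS, hDg, hDu]
    linarith) (G.N - 1) hN1
  rw [hsum _ _ (fun k => Dg (k + 1)) fun k => Du (k + 1)] at hSS
  have hb1 := abs_le.1 (hSb 0 hN)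
  have hb2 := abs_le.1 (hSb _ hN1)
  have hκ' : 0 < P.κ / θhi ^ 2 := by positivity
  have hμ' : 0 < 2 * P.μ / θhi := by positivity
  have hg : ∑ k ∈ Finset.range (G.N - 1), G.Δt * Dg (k + 1) ≤ Cg :=
    (le_div_iff₀' hκ').2 (by linarith [mul_nonneg hμ'.le hDu0])
  have hu : ∑ k ∈ Finset.range (G.N - 1), G.Δt * Du (k + 1) ≤ Cd :=
    (le_div_iff₀' hμ').2 (by linarith [mul_nonneg hκ'.le hDg0])
  have hCd := le_abs_self Cd
  -- Korn: the symmetric gradient controls the gradient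
  have hkorn : ∑ k ∈ Finset.range (G.N - 1),
      G.Δt * ∑ j, ∑ i, G.intCells (fun K => gradH G.h (fun J => u (k + 1) J j) i K ^ 2)
      ≤ 2 * Cd := by
    refine (sum_le_sum fun k hk => mul_le_mul_of_nonneg_left
      (Mesh.korn hL (hs.u_mem (k + 1) (by have := Finset.mem_range.1 hk; omega))) hΔ.le).trans ?_
    have h1 := hsum 2 0 (fun k => Du (k + 1)) 0
    simp only [zero_mul, add_zero] at h1
    linarith
  -- the renormalized continuity equation controls the jumps of the density
  set R : ℕ → ℝ := fun k => ∑ i, G.intCells (fun K => jump (ρ k) i K ^ 2)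
  set W : ℕ → ℝ := fun k => G.intCells (fun K => ρ k K ^ 2 * divH G.h (u k) K)
  have hρtel := sum_telescope_le (a := fun k => G.intCells (fun K => ρ k K ^ 2))
    (D := fun k => 2 * (G.h ^ ε / G.h) * R k + W k) (c := G.Δt) (N := G.N)
    (fun k hk => hs.density_step hk) (G.N - 1) hN1
  have hjρ : ∑ k ∈ Finset.range (G.N - 1), G.Δt * R (k + 1) ≤ Cρ * (G.h / G.h ^ ε) := by
    have h0 : G.intCells (fun K => ρ 0 K ^ 2) ≤ ρhi ^ 2 * V := by
      rw [← Mesh.intCells_const (G := G)]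
      exact Mesh.intCells_mono fun K => pow_le_pow_left₀ (hρlo.le.trans (hs.ρ_bd 0 hN K).1)
        (hs.ρ_bd 0 hN K).2 2
    have h1 : 0 ≤ G.intCells (fun K => ρ (G.N - 1) K ^ 2) :=
      Mesh.intCells_nonneg fun K => sq_nonneg _
    have h2 : ∑ k ∈ Finset.range (G.N - 1), G.Δt * -W (k + 1) ≤ ρhi ^ 2 * (T * V + d * Cd) := by
      have hV0 : 0 < V := Finset.prod_pos fun i _ => hL i
      have hT : (G.N - 1 : ℕ) * G.Δt ≤ T := le_trans
        (mul_le_mul_of_nonneg_right (by exact_mod_cast Nat.sub_le _ _) hΔ.le) G.steps_fit.le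
      refine (sum_le_sum fun k hk => mul_le_mul_of_nonneg_left (hs.neg_intCells_sq_mul_divH_le
        (k := k + 1) (by have := Finset.mem_range.1 hk; omega)) hΔ.le).trans ?_
      have h1 := hsum (ρhi ^ 2 * V) (ρhi ^ 2 * d) 1 fun k => Du (k + 1)
      simp only [Pi.one_apply, mul_one, sum_const, Finset.card_range, nsmul_eq_mul] at h1
      simp only [mul_add, ← mul_assoc] at h1 ⊢
      rw [h1]
      nlinarith [mul_le_mul_of_nonneg_left hT (by positivity : 0 ≤ ρhi ^ 2 * V),
        mul_le_mul_of_nonneg_left hu (by positivity : 0 ≤ ρhi ^ 2 * d)]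
    have h3 := hsum (2 * (G.h ^ ε / G.h)) (-1) (fun k => R (k + 1)) fun k => -W (k + 1)
    simp only [neg_one_mul, neg_neg] at h3
    rw [show Cρ * (G.h / G.h ^ ε) = 2 * Cρ / (2 * (G.h ^ ε / G.h)) by
      rw [mul_div_mul_left _ _ two_ne_zero, div_div_eq_mul_div, mul_div_assoc],
      le_div_iff₀' (by positivity)]
    linarith
  exact ⟨fun k hk => (hvel k hk).trans q1, hg.trans q2, hu.trans (by linarith [abs_nonneg Cd]),
    hkorn.trans (by linarith), hju.trans (mul_le_mul_of_nonneg_right q4 hc'.le),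
    hjρ.trans (mul_le_mul_of_nonneg_right q5 hc'.le)⟩

end Bounds

/-! ### Translations of the torus -/

section Torus

/-- Periodicity with respect to the torus. -/
def TorusPeriodic {E : Type*} (L : ℝᵈ) (f : ℝᵈ → E) : Prop := ∀ x i, f (x + Pi.single i (L i)) = f x

/-- The representative in the fundamental box. -/
noncomputable def wrap (L : ℝᵈ) (x : ℝᵈ) : ℝᵈ := fun i => x i - L i * ⌊x i / L i⌋

lemma TorusPeriodic.single_mul {E : Type*} {L : ℝᵈ} {f : ℝᵈ → E}
    (hf : TorusPeriodic L f) (x : ℝᵈ) (i : Fin d) (z : ℤ) :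
    f (x + Pi.single i (L i * z)) = f x := by
  have step : ∀ z : ℤ, f (x + Pi.single i (L i * ((z + 1 : ℤ) : ℝ)))
      = f (x + Pi.single i (L i * (z : ℝ))) := by
    intro z
    have h := hf (x + Pi.single i (L i * (z : ℝ))) i
    rw [add_assoc, ← Pi.single_add] at h
    rw [← h]
    push_cast
    rw [mul_add, mul_one]
  induction z using Int.induction_on with
  | zero => simp
  | succ n ih => rw [step, ih]
  | pred n ih => rw [← ih, ← step, sub_add_cancel]

lemma TorusPeriodic.wrap {E : Type*} {L : ℝᵈ} {f : ℝᵈ → E}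
    (hf : TorusPeriodic L f) (x : ℝᵈ) : f (wrap L x) = f x := by
  have key : ∀ s : Finset (Fin d),
      f (NSF.wrap L x + ∑ i ∈ s, Pi.single i (L i * (⌊x i / L i⌋ : ℝ))) = f (NSF.wrap L x) := by
    intro s
    induction s using Finset.induction_on with
    | empty => simp
    | insert a s ha ih =>
      rw [sum_insert ha, add_comm (Pi.single a _), ← add_assoc, hf.single_mul, ih]
  rw [← key Finset.univ, Finset.univ_sum_single (fun i => L i * (⌊x i / L i⌋ : ℝ))]
  congr 1
  funext i
  simp [NSF.wrap]

lemma wrap_mem {L : ℝᵈ} (hL : ∀ i, 0 < L i) (x : ℝᵈ) : wrap L x ∈ torus L := by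
  rw [torus, Set.mem_univ_pi]
  intro i
  have h1 := Int.floor_le (x i / L i)
  have h2 := Int.lt_floor_add_one (x i / L i)
  rw [le_div_iff₀ (hL i)] at h1
  rw [div_lt_iff₀ (hL i)] at h2
  simp only [wrap, Set.mem_Ico]
  constructor <;> linarith

/-- In one dimension, translation modulo the period preserves Lebesgue measure on the period. -/
lemma measurePreserving_wrap_one {l : ℝ} (hl : 0 < l) (c : ℝ) :
    MeasurePreserving (fun x : ℝ => x + c - l * ⌊(x + c) / l⌋)
      (volume.restrict (Ico 0 l)) (volume.restrict (Ico 0 l)) := by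
  have hmeas : Measurable fun x : ℝ => x - l * ⌊x / l⌋ :=
    measurable_id.sub (measurable_const.mul
      ((measurable_of_countable (fun z : ℤ => (z : ℝ))).comp
        (Int.measurable_floor.comp (measurable_id.div_const l))))
  have hmeas' : Measurable fun x : ℝ => x + c - l * ⌊(x + c) / l⌋ :=
    hmeas.comp (measurable_id.add_const c)
  refine ⟨hmeas', Measure.ext fun s hs => ?_⟩
  rw [Measure.map_apply hmeas' hs, Measure.restrict_apply (hmeas' hs), Measure.restrict_apply hs]
  set A : Set ℝ := (fun x : ℝ => x - l * ⌊x / l⌋) ⁻¹' s with hA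
  have hAm : MeasurableSet A := hmeas hs
  have hfd : ∀ a : ℝ, IsAddFundamentalDomain (AddSubgroup.zmultiples l) (Ico a (a + l)) volume := by
    intro a
    refine IsAddFundamentalDomain.mk' measurableSet_Ico.nullMeasurableSet fun x => ?_
    have : Function.Bijective (Set.codRestrict (fun n : ℤ => n • l) (AddSubgroup.zmultiples l) _) :=
      (Equiv.ofInjective (fun n : ℤ => n • l) (zsmul_left_strictMono hl).injective).bijective
    refine this.existsUnique_iff.2 ?_
    have h := existsUnique_add_zsmul_mem_Ico hl x a
    simp only [add_comm x] at h
    exact h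
  have hinv : ∀ g : AddSubgroup.zmultiples l, (fun x => g +ᵥ x) ⁻¹' A = A := by
    rintro ⟨g, hg⟩
    obtain ⟨n, rfl⟩ := AddSubgroup.mem_zmultiples_iff.1 hg
    ext x
    simp only [hA, Set.mem_preimage]
    have : (n • l + x) / l = x / l + n := by rw [zsmul_eq_mul]; field_simp; ring
    have h2 : (⟨n • l, hg⟩ : AddSubgroup.zmultiples l) +ᵥ x = n • l + x := rfl
    rw [h2, this, Int.floor_add_intCast]
    have : n • l + x - l * ((⌊x / l⌋ + n : ℤ) : ℝ) = x - l * ⌊x / l⌋ := by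
      push_cast; rw [zsmul_eq_mul]; ring
    rw [this]
  have h1 : volume (A ∩ Ico c (c + l)) = volume (A ∩ Ico 0 (0 + l)) :=
    (hfd c).measure_set_eq (hfd 0) hAm hinv
  have h2 : (fun x : ℝ => x + c - l * ⌊(x + c) / l⌋) ⁻¹' s ∩ Ico 0 l
      = (fun x => x + c) ⁻¹' (A ∩ Ico c (c + l)) := by
    ext x
    simp only [hA, Set.mem_inter_iff, Set.mem_preimage, Set.mem_Ico]
    constructor
    · rintro ⟨h, h3, h4⟩; exact ⟨h, by linarith, by linarith⟩
    · rintro ⟨h, h3, h4⟩; exact ⟨h, by linarith, by linarith⟩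
  have h3 : A ∩ Ico 0 (0 + l) = s ∩ Ico 0 l := by
    ext x
    simp only [hA, Set.mem_inter_iff, Set.mem_preimage, zero_add, and_congr_left_iff]
    intro hx
    have : ⌊x / l⌋ = 0 := Int.floor_eq_zero_iff.2
      ⟨div_nonneg hx.1 hl.le, (div_lt_one hl).2 hx.2⟩
    simp [this]
  rw [h2, measure_preimage_add_right, h1, h3]

lemma restrict_torus (L : ℝᵈ) : (volume.restrict (torus L) : Measure ℝᵈ)
      = Measure.pi fun i => volume.restrict (Ico 0 (L i)) := by
  rw [torus, volume_pi, Measure.restrict_pi_pi]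

lemma measurableSet_torus (L : ℝᵈ) : MeasurableSet (torus L) :=
  MeasurableSet.univ_pi fun _ => measurableSet_Ico

lemma ae_torus_mem (L : ℝᵈ) : ∀ᵐ x ∂volume.restrict (torus L), x ∈ torus L :=
  ae_restrict_mem (measurableSet_torus L)

instance isFiniteMeasure_torus (L : ℝᵈ) :
    IsFiniteMeasure (volume.restrict (torus L) : Measure ℝᵈ) := by
  rw [restrict_torus]; infer_instance

lemma measurePreserving_torus {L : ℝᵈ} (hL : ∀ i, 0 < L i) (c : ℝᵈ) :
    MeasurePreserving (fun x => wrap L (x + c)) (volume.restrict (torus L))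
      (volume.restrict (torus L)) := by
  rw [restrict_torus]
  exact measurePreserving_pi _ _ fun i => measurePreserving_wrap_one (hL i) (c i)

lemma spaceTime_eq_prod (L : ℝᵈ) (T : ℝ) :
    spaceTime L T = (volume.restrict (Ioo 0 T)).prod (volume.restrict (torus L)) := by
  rw [spaceTime, Measure.prod_restrict]; rfl

instance isFiniteMeasure_spaceTime (L : ℝᵈ) (T : ℝ) : IsFiniteMeasure (spaceTime L T) := by
  have : IsFiniteMeasure (volume.restrict (Ioo (0 : ℝ) T)) := ⟨by simp [Real.volume_Ioo]⟩
  rw [spaceTime_eq_prod]; infer_instance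

lemma ae_spaceTime_mem (L : ℝᵈ) (T : ℝ) : ∀ᵐ p ∂(spaceTime L T), p.1 ∈ Ioo 0 T := by
  have := ae_restrict_mem (μ := volume) ((measurableSet_Ioo (a := (0 : ℝ)) (b := T)).prod
    (measurableSet_torus L))
  filter_upwards [this] with p hp using hp.1

lemma measurePreserving_spaceTime {L : ℝᵈ} (hL : ∀ i, 0 < L i) (T : ℝ) (c : ℝᵈ) :
    MeasurePreserving (fun p : ℝ × ℝᵈ => (p.1, wrap L (p.2 + c))) (spaceTime L T)
      (spaceTime L T) := by
  rw [spaceTime_eq_prod]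
  exact (MeasurePreserving.id _).prod (measurePreserving_torus hL c)

end Torus

/-! ### Periodic functions on space-time -/

section SpaceTime

/-- Periodicity in space, for times in `(0, T)`. -/
def SpacePeriodic (L : ℝᵈ) (T : ℝ) (f : ℝ × ℝᵈ → ℝ) : Prop :=
  ∀ t ∈ Ioo 0 T, TorusPeriodic L fun x => f (t, x)

lemma SpacePeriodic.comp_wrap {f : ℝ × ℝᵈ → ℝ} (hf : SpacePeriodic L T f) (c : ℝᵈ) :
    (fun p => f (p.1, p.2 + c)) =ᵐ[spaceTime L T] fun p => f (p.1, wrap L (p.2 + c)) := by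
  filter_upwards [ae_spaceTime_mem L T] with p hp
  exact ((hf p.1 hp).wrap _).symm

/-- Integrals over space-time are invariant under spatial translations. -/
lemma integral_translate (hL : ∀ i, 0 < L i) {f : ℝ × ℝᵈ → ℝ} (hm : Measurable f)
    (hf : SpacePeriodic L T f) (c : ℝᵈ) :
    ∫ p, f (p.1, p.2 + c) ∂(spaceTime L T) = ∫ p, f p ∂(spaceTime L T) := by
  rw [integral_congr_ae (hf.comp_wrap c)]
  have hmp := measurePreserving_spaceTime hL T c
  conv_rhs => rw [← hmp.map_eq]
  rw [integral_map hmp.measurable.aemeasurable hm.aestronglyMeasurable]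

/-- The functions on space-time that occur: measurable, periodic in space and bounded. -/
structure Admissible (L : ℝᵈ) (T : ℝ) (f : ℝ × ℝᵈ → ℝ) : Prop where
  meas : Measurable f
  per : SpacePeriodic L T f
  bdd : ∃ C : ℝ, ∀ t ∈ Ioo 0 T, ∀ x, |f (t, x)| ≤ C

namespace Admissible

variable {f g : ℝ × (Fin d → ℝ) → ℝ}

lemma integrable (hf : Admissible L T f) : Integrable f (spaceTime L T) := by
  obtain ⟨C, hC⟩ := hf.bdd
  refine Integrable.of_bound hf.meas.aestronglyMeasurable C ?_
  filter_upwards [ae_spaceTime_mem L T] with p hp using hC p.1 hp p.2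

lemma const (c : ℝ) : Admissible L T fun _ => c :=
  ⟨measurable_const, fun _ _ _ _ => rfl, |c|, fun _ _ _ => le_rfl⟩

lemma add (hf : Admissible L T f) (hg : Admissible L T g) : Admissible L T fun p => f p + g p := by
  obtain ⟨C, hC⟩ := hf.bdd
  obtain ⟨D, hD⟩ := hg.bdd
  exact ⟨hf.meas.add hg.meas, fun t ht x i => congrArg₂ (· + ·) (hf.per t ht x i) (hg.per t ht x i),
    C + D, fun t ht x => (abs_add_le _ _).trans (add_le_add (hC t ht x) (hD t ht x))⟩

lemma mul (hf : Admissible L T f) (hg : Admissible L T g) : Admissible L T fun p => f p * g p := by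
  obtain ⟨C, hC⟩ := hf.bdd
  obtain ⟨D, hD⟩ := hg.bdd
  refine ⟨hf.meas.mul hg.meas, fun t ht x i =>
    congrArg₂ (· * ·) (hf.per t ht x i) (hg.per t ht x i), C * D, fun t ht x => ?_⟩
  rw [abs_mul]
  exact mul_le_mul (hC t ht x) (hD t ht x) (abs_nonneg _) ((abs_nonneg _).trans (hC t ht x))

lemma const_mul (c : ℝ) (hf : Admissible L T f) : Admissible L T fun p => c * f p :=
  (const c).mul hf

lemma neg (hf : Admissible L T f) : Admissible L T fun p => -f p := by simpa using hf.const_mul (-1)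

lemma sub (hf : Admissible L T f) (hg : Admissible L T g) : Admissible L T fun p => f p - g p := by
  simpa [sub_eq_add_neg] using hf.add hg.neg

lemma div_const (hf : Admissible L T f) (c : ℝ) : Admissible L T fun p => f p / c := by
  simpa [div_eq_mul_inv, mul_comm] using hf.const_mul c⁻¹

lemma sum {ι : Type*} {s : Finset ι} {f : ι → ℝ × ℝᵈ → ℝ}
    (hf : ∀ i ∈ s, Admissible L T (f i)) : Admissible L T fun p => ∑ i ∈ s, f i p := by
  classical
  induction s using Finset.induction_on with
  | empty => simpa using const 0
  | insert a s ha ih =>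
    simp only [sum_insert ha]
    exact (hf a (Finset.mem_insert_self _ _)).add
      (ih fun i hi => hf i (Finset.mem_insert_of_mem hi))

lemma abs (hf : Admissible L T f) : Admissible L T fun p => |f p| := by
  obtain ⟨C, hC⟩ := hf.bdd
  exact ⟨continuous_abs.measurable.comp hf.meas, fun t ht x i => congrArg _ (hf.per t ht x i),
    C, fun t ht x => by rw [abs_abs]; exact hC t ht x⟩

lemma pow (hf : Admissible L T f) (n : ℕ) : Admissible L T fun p => f p ^ n := by
  induction n with
  | zero => simpa using const 1
  | succ n ih => simpa [pow_succ] using ih.mul hf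

lemma translate (hf : Admissible L T f) (c : ℝᵈ) : Admissible L T fun p => f (p.1, p.2 + c) := by
  obtain ⟨C, hC⟩ := hf.bdd
  refine ⟨hf.meas.comp (measurable_fst.prodMk (measurable_snd.add_const c)), fun t ht x i => ?_,
    C, fun t ht x => hC t ht _⟩
  simpa [add_right_comm] using hf.per t ht (x + c) i

lemma ite_le (hf : Admissible L T f) (a : ℝ) :
    Admissible L T fun p => if a ≤ p.1 then f p else 0 := by
  obtain ⟨C, hC⟩ := hf.bdd
  refine ⟨Measurable.ite (measurableSet_le measurable_const measurable_fst) hf.meas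
    measurable_const, fun t ht x i => ?_, C, fun t ht x => ?_⟩
  · have := hf.per t ht x i
    simp only at this
    simp [this]
  · simp only
    split_ifs
    · exact hC t ht x
    · simpa using (abs_nonneg _).trans (hC t ht x)

lemma max_const (hf : Admissible L T f) (c : ℝ) : Admissible L T fun p => max (f p) c := by
  obtain ⟨C, hC⟩ := hf.bdd
  refine ⟨hf.meas.max measurable_const, fun t ht x i => by
    simp only [show f (t, x + Pi.single i (L i)) = f (t, x) from hf.per t ht x i],
    C + |c|, fun t ht x => ?_⟩
  have h1 := hC t ht x
  have h2 := abs_nonneg c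
  have h3 := abs_nonneg (f (t, x))
  rcases max_choice (f (t, x)) c with h | h <;> rw [h] <;> linarith

/-- Translations move from one factor of an integrated product to the other. -/
lemma integral_translate_mul (hL : ∀ i, 0 < L i) (hf : Admissible L T f) (hg : Admissible L T g)
    (c : ℝᵈ) :
    ∫ p, f (p.1, p.2 + c) * g p ∂(spaceTime L T)
      = ∫ p, f p * g (p.1, p.2 + -c) ∂(spaceTime L T) := by
  have h := hf.mul (hg.translate (-c))
  rw [← integral_translate hL h.meas h.per c]
  simp

end Admissible

end SpaceTime

/-! ### Grid functions as functions on space-time -/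

namespace Mesh

/-- The piecewise constant function with the values `r k` in the `k`-th time step, set to zero in
the time step of the initial data. -/
noncomputable def late (G : Mesh d L T) (r : ℕ → Cell d → ℝ) (p : ℝ × ℝᵈ) : ℝ :=
  if G.Δt ≤ p.1 then G.recon r p.1 p.2 else 0

variable {G : Mesh d L T}

lemma L_pos_of_N {t : ℝ} (ht : t ∈ Ioo 0 T) : ⌊t / G.Δt⌋₊ < G.N := by
  have hΔ := G.Δt_pos
  rw [Nat.floor_lt (div_nonneg ht.1.le hΔ.le), div_lt_iff₀ hΔ]
  exact ht.2.trans_le G.steps_fit.ge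

lemma cellOf_add_e {h : ℝ} (hh : 0 < h) (x : ℝᵈ) (i : Fin d) :
    cellOf h (x + Pi.single i h) = cellOf h x + e i := by
  funext j
  by_cases hj : j = i
  · subst hj
    simp only [cellOf, e, Pi.add_apply, Pi.single_eq_same]
    rw [add_div, div_self hh.ne', Int.floor_add_one]
  · simp [cellOf, e, hj]

lemma cellOf_sub_e {h : ℝ} (hh : 0 < h) (x : ℝᵈ) (i : Fin d) :
    cellOf h (x + -Pi.single i h) = cellOf h x - e i := by
  rw [eq_sub_iff_add_eq, ← cellOf_add_e hh]
  simp

lemma cellOf_period (G : Mesh d L T) (x : ℝᵈ) (i : Fin d) :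
    cellOf G.h (x + Pi.single i (L i)) = cellOf G.h x + Pi.single i (G.M i : ℤ) := by
  have hh := G.h_pos
  funext j
  by_cases hj : j = i
  · subst hj
    simp only [cellOf, Pi.add_apply, Pi.single_eq_same, ← G.cells_fit j]
    rw [add_div, mul_div_cancel_right₀ _ hh.ne', ← Int.floor_add_natCast]
  · simp [cellOf, hj]

lemma measurable_recon (G : Mesh d L T) (r : ℕ → Cell d → ℝ) :
    Measurable fun p : ℝ × ℝᵈ => G.recon r p.1 p.2 := by
  have h1 : Measurable fun p : ℝ × ℝᵈ => (⌊p.1 / G.Δt⌋₊, cellOf G.h p.2) := by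
    refine (Nat.measurable_floor.comp (measurable_fst.div_const _)).prodMk ?_
    refine measurable_pi_lambda _ fun i => ?_
    exact Int.measurable_floor.comp
      (((measurable_pi_apply i).comp measurable_snd).div_const _)
  exact (measurable_of_countable fun q : ℕ × Cell d => r q.1 q.2).comp h1

lemma InQ.exists_bound (hL : ∀ i, 0 < L i) {r : Cell d → ℝ} (hr : G.InQ r) :
    ∃ C, ∀ K, |r K| ≤ C := by
  refine ⟨∑ K ∈ G.cells, |r K|, fun K => ?_⟩
  rw [← hr.wrapCell]
  exact single_le_sum (f := fun K => |r K|) (fun J _ => abs_nonneg _) (G.wrapCell_mem hL K)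

lemma admissible_recon (hL : ∀ i, 0 < L i) {r : ℕ → Cell d → ℝ} (hr : ∀ k < G.N, G.InQ (r k)) :
    Admissible L T fun p => G.recon r p.1 p.2 := by
  refine ⟨G.measurable_recon r, fun t ht x i => ?_, ?_⟩
  · simp only [recon, cellOf_period]
    exact hr _ (L_pos_of_N ht) _ i
  · have h1 : ∀ k, ∃ C, 0 ≤ C ∧ (k < G.N → ∀ K, |r k K| ≤ C) := by
      intro k
      by_cases hk : k < G.N
      · obtain ⟨C, hC⟩ := (hr k hk).exists_bound hL
        exact ⟨C, (abs_nonneg _).trans (hC 0), fun _ => hC⟩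
      · exact ⟨0, le_rfl, fun h => absurd h hk⟩
    choose C hC0 hC using h1
    refine ⟨∑ k ∈ Finset.range G.N, C k, fun t ht x => ?_⟩
    have hk := L_pos_of_N (G := G) ht
    exact (hC _ hk _).trans (single_le_sum (f := C) (fun k _ => hC0 k)
      (Finset.mem_range.2 hk))

lemma admissible_late (hL : ∀ i, 0 < L i) {r : ℕ → Cell d → ℝ} (hr : ∀ k < G.N, G.InQ (r k)) :
    Admissible L T (G.late r) :=
  (admissible_recon hL hr).ite_le _

lemma mem_cellSet {h : ℝ} (hh : 0 < h) {x : ℝᵈ} {K : Cell d} :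
    x ∈ cellSet h K ↔ cellOf h x = K := by
  simp only [cellSet, Set.mem_univ_pi, Set.mem_Ico, funext_iff, cellOf, Int.floor_eq_iff,
    le_div_iff₀ hh, div_lt_iff₀ hh]

lemma measurableSet_cellSet (h : ℝ) (K : Cell d) : MeasurableSet (cellSet h K) :=
  MeasurableSet.univ_pi fun _ => measurableSet_Ico

lemma volume_cellSet (G : Mesh d L T) (K : Cell d) :
    (volume (cellSet G.h K)) = ENNReal.ofReal (G.h ^ d) := by
  rw [cellSet, volume_pi_pi]
  simp only [Real.volume_Ico]
  have : ∀ i, ((K i : ℝ) + 1) * G.h - K i * G.h = G.h := fun i => by ring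
  simp only [this, Finset.prod_const, Finset.card_univ, Fintype.card_fin]
  rw [ENNReal.ofReal_pow G.h_pos.le]

lemma cellOf_mem_cells {x : ℝᵈ} : cellOf G.h x ∈ G.cells ↔ x ∈ torus L := by
  have hh := G.h_pos
  rw [mem_cells, torus, Set.mem_univ_pi]
  refine forall_congr' fun i => ?_
  rw [cellOf, Int.floor_nonneg, Set.mem_Ico, Int.floor_lt, div_lt_iff₀ hh, ← G.cells_fit i]
  refine and_congr ⟨fun h => ?_, fun h => div_nonneg h hh.le⟩ (by simp)
  by_contra hx
  exact absurd h (not_le.2 (div_neg_of_neg_of_pos (not_le.1 hx) hh))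

lemma torus_eq_biUnion (G : Mesh d L T) : torus L = ⋃ K ∈ G.cells, cellSet G.h K := by
  ext x
  simp only [Set.mem_iUnion, exists_prop, mem_cellSet G.h_pos, exists_eq_right', cellOf_mem_cells]

lemma disjoint_cellSet (G : Mesh d L T) :
    Set.PairwiseDisjoint (↑G.cells) (cellSet G.h : Cell d → Set ℝᵈ) := by
  intro K _ J _ hKJ
  refine Set.disjoint_left.2 fun x hx hx' => hKJ ?_
  rw [mem_cellSet G.h_pos] at hx hx'
  rw [← hx, ← hx']

lemma integral_torus_eq_sum {f : ℝᵈ → ℝ} (hf : IntegrableOn f (torus L)) :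
    ∫ x in torus L, f x = ∑ K ∈ G.cells, ∫ x in cellSet G.h K, f x := by
  rw [G.torus_eq_biUnion]
  refine integral_biUnion_finset _ (fun K _ => measurableSet_cellSet _ _) G.disjoint_cellSet
    fun K hK => hf.mono_set ?_
  rw [G.torus_eq_biUnion]
  exact Set.subset_biUnion_of_mem (u := fun K => cellSet G.h K) hK

lemma integral_cellSet_const (G : Mesh d L T) (K : Cell d) (c : ℝ) :
    ∫ _ in cellSet G.h K, c = G.h ^ d * c := by
  rw [setIntegral_const, smul_eq_mul, Measure.real, volume_cellSet,
    ENNReal.toReal_ofReal (pow_nonneg G.h_pos.le _)]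

lemma measurable_cellOf (h : ℝ) : Measurable (cellOf h : ℝᵈ → Cell d) :=
  measurable_pi_lambda _ fun i => Int.measurable_floor.comp ((measurable_pi_apply i).div_const _)

lemma integrableOn_cellOf (G : Mesh d L T) (f : Cell d → ℝ) :
    IntegrableOn (fun x => f (cellOf G.h x)) (torus L) := by
  refine Integrable.of_bound
    ((measurable_of_countable f).comp (measurable_cellOf G.h)).aestronglyMeasurable
    (∑ K ∈ G.cells, |f K|) ?_
  filter_upwards [ae_torus_mem L] with x hx
  exact single_le_sum (f := fun K => |f K|) (fun J _ => abs_nonneg _)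
    (cellOf_mem_cells.2 hx)

lemma integral_cellOf (G : Mesh d L T) (f : Cell d → ℝ) :
    ∫ x in torus L, f (cellOf G.h x) = G.intCells f := by
  rw [integral_torus_eq_sum (G.integrableOn_cellOf f), intCells, mul_sum]
  refine sum_congr rfl fun K _ => ?_
  rw [← integral_cellSet_const]
  refine setIntegral_congr_fun (measurableSet_cellSet _ _) fun x hx => ?_
  simp only [(mem_cellSet G.h_pos).1 hx]

lemma floor_eq_of_mem {Δ t : ℝ} (hΔ : 0 < Δ) {k : ℕ} (ht : t ∈ Ico (k * Δ) ((k + 1) * Δ)) :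
    ⌊t / Δ⌋₊ = k := by
  rw [Nat.floor_eq_iff (div_nonneg ((by positivity : 0 ≤ (k : ℝ) * Δ).trans ht.1) hΔ.le),
    le_div_iff₀ hΔ, div_lt_iff₀ hΔ]
  exact ht

lemma integral_steps {Δ : ℝ} (hΔ : 0 < Δ) (a : ℕ → ℝ) (N : ℕ) :
    IntervalIntegrable (fun t => a ⌊t / Δ⌋₊) volume 0 (N * Δ) ∧
      ∫ t in (0 : ℝ)..(N * Δ), a ⌊t / Δ⌋₊ = ∑ k ∈ Finset.range N, Δ * a k := by
  have hae : ∀ k : ℕ, ∀ᵐ t ∂(volume : Measure ℝ), t ∈ Set.uIoc ((k : ℝ) * Δ) ((k + 1) * Δ) →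
      a k = a ⌊t / Δ⌋₊ := by
    intro k
    have hne : ∀ᵐ t ∂(volume : Measure ℝ), t ≠ (k + 1) * Δ := by simp [ae_iff]
    filter_upwards [hne] with t ht hmem
    rw [uIoc_of_le (by nlinarith)] at hmem
    rw [floor_eq_of_mem hΔ ⟨hmem.1.le, lt_of_le_of_ne hmem.2 ht⟩]
  induction N with
  | zero => simp
  | succ n ih =>
    have hi : IntervalIntegrable (fun t => a ⌊t / Δ⌋₊) volume (n * Δ) ((n + 1) * Δ) := by
      refine (intervalIntegrable_const (c := a n)).congr_ae ?_
      exact (ae_restrict_iff' measurableSet_uIoc).2 (hae n)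
    have h2 : ∫ t in (n * Δ)..((n + 1) * Δ), a ⌊t / Δ⌋₊ = Δ * a n := by
      rw [← intervalIntegral.integral_congr_ae (hae n), intervalIntegral.integral_const,
        smul_eq_mul]
      ring
    push_cast
    refine ⟨ih.1.trans hi, ?_⟩
    rw [← intervalIntegral.integral_add_adjacent_intervals ih.1 hi, ih.2, h2, sum_range_succ]

/-- Space-time integral of a piecewise constant function. -/
lemma integral_late (hL : ∀ i, 0 < L i) {r : ℕ → Cell d → ℝ} (hr : ∀ k < G.N, G.InQ (r k)) :
    ∫ p, G.late r p ∂(spaceTime L T)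
      = ∑ k ∈ Finset.range (G.N - 1), G.Δt * G.intCells (r (k + 1)) := by
  have hi := (admissible_late hL hr).integrable
  rw [spaceTime_eq_prod] at hi ⊢
  rw [integral_prod _ hi]
  set a : ℕ → ℝ := fun k => if k = 0 then 0 else G.intCells (r k) with ha
  have hΔ := G.Δt_pos
  have h1 : ∀ t ∈ Ioo 0 T, ∫ x in torus L, G.late r (t, x) = a ⌊t / G.Δt⌋₊ := by
    intro t ht
    simp only [late, recon, ha]
    by_cases hle : G.Δt ≤ t
    · have : ⌊t / G.Δt⌋₊ ≠ 0 := by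
        rw [Ne, Nat.floor_eq_zero, not_lt, le_div_iff₀ hΔ, one_mul]; exact hle
      simp only [hle, if_true, this, if_false]
      exact G.integral_cellOf _
    · have : ⌊t / G.Δt⌋₊ = 0 := by
        rw [Nat.floor_eq_zero, div_lt_iff₀ hΔ, one_mul]; exact not_le.1 hle
      simp [hle, this]
  rw [setIntegral_congr_fun measurableSet_Ioo h1, ← integral_Ioc_eq_integral_Ioo]
  have hT : (G.N : ℝ) * G.Δt = T := G.steps_fit
  have hT0 : 0 ≤ T := by rw [← hT]; positivity
  have h2 := (integral_steps hΔ a G.N).2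
  rw [hT, intervalIntegral.integral_of_le hT0] at h2
  rw [h2]
  rcases Nat.eq_zero_or_pos G.N with h0 | h0
  · simp [h0]
  · obtain ⟨n, hn⟩ := Nat.exists_eq_succ_of_ne_zero h0.ne'
    rw [hn, Finset.sum_range_succ']
    simp [ha]

end Mesh

/-- Lebesgue measure on the space-time cylinder. -/
local notation "𝒬" => spaceTime L T

lemma integrable_mul_of_bound {X : Type*} [MeasurableSpace X] {m : Measure X} {f w : X → ℝ}
    (hf : Integrable f m) (C : ℝ) (hw : AEStronglyMeasurable w m) (hC : ∀ᵐ p ∂m, |w p| ≤ C) :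
    Integrable (fun p => f p * w p) m :=
  hf.mul_bdd hw hC

lemma abs_integral_mul_le {X : Type*} [MeasurableSpace X] {m : Measure X} {f w : X → ℝ}
    (hf : Integrable f m) {C : ℝ} (hC : ∀ᵐ p ∂m, |w p| ≤ C) :
    |∫ p, f p * w p ∂m| ≤ C * ∫ p, |f p| ∂m := by
  rw [← integral_const_mul, ← Real.norm_eq_abs]
  refine norm_integral_le_of_norm_le (hf.abs.const_mul C) ?_
  filter_upwards [hC] with p hp
  rw [norm_mul, mul_comm]
  exact mul_le_mul_of_nonneg_right hp (abs_nonneg _)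

/-! ### Generation of Young measures -/

lemma tendsto_of_forall_approx {a : ℕ → ℝ} {b : ℝ} (h : ∀ η > 0, ∃ (a' : ℕ → ℝ) (b' : ℝ),
    Tendsto a' atTop (𝓝 b') ∧ |b - b'| ≤ η ∧ ∀ᶠ n in atTop, |a n - a' n| ≤ η) :
    Tendsto a atTop (𝓝 b) := by
  refine Metric.tendsto_nhds.2 fun η hη => ?_
  obtain ⟨a', b', h1, h2, h3⟩ := h (η / 4) (by positivity)
  filter_upwards [h3, Metric.tendsto_nhds.1 h1 (η / 4) (by positivity)] with n h4 h5
  rw [Real.dist_eq] at h5 ⊢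
  rw [abs_le] at h2 h4
  rw [abs_lt] at h5 ⊢
  constructor <;> linarith [h2.1, h2.2, h4.1, h4.2, h5.1, h5.2]

section Young

open ProbabilityTheory BoundedContinuousFunction
open scoped ENNReal

variable {X Y : Type*} [TopologicalSpace X] [PolishSpace X] [MeasurableSpace X] [BorelSpace X]
  [NormedAddCommGroup Y] [ProperSpace Y] [MeasurableSpace Y] [BorelSpace Y]

/-- The fundamental theorem on Young measures. The measures carried by the graphs of the functions
`U n` are tight; a weak limit is disintegrated over the base space. -/
theorem exists_young_measure (m : Measure X) [IsFiniteMeasure m] (U : ℕ → X → Y)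
    (hU : ∀ n, Measurable (U n)) (C : ℝ≥0∞) (hC : C ≠ ∞) (hbd : ∀ n, ∫⁻ p, ‖U n p‖ₑ ∂m ≤ C) :
    ∃ (sub : ℕ → ℕ) (V : Kernel X Y), StrictMono sub ∧ IsMarkovKernel V ∧
      ∀ (g : Y →ᵇ ℝ) (w : X → ℝ), Integrable w m →
        Tendsto (fun n => ∫ p, w p * g (U (sub n) p) ∂m) atTop
          (𝓝 (∫ p, w p * ∫ y, g y ∂(V p) ∂m)) := by
  have : SecondCountableTopology Y := inferInstance
  rcases eq_or_ne m 0 with rfl | hm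
  · refine ⟨id, Kernel.const X (Measure.dirac 0), strictMono_id, inferInstance, fun g w _ => ?_⟩
    simp
  have hm0 : m univ ≠ 0 := by simpa using hm
  have hmt : m univ ≠ ∞ := measure_ne_top m univ
  set Q : Measure X := (m univ)⁻¹ • m with hQ
  have hQp : IsProbabilityMeasure Q := ⟨by
    rw [hQ, Measure.smul_apply, smul_eq_mul, ENNReal.inv_mul_cancel hm0 hmt]⟩
  have hmQ : m = m univ • Q := by rw [hQ, smul_smul, ENNReal.mul_inv_cancel hm0 hmt, one_smul]
  have hgraph : ∀ n, Measurable fun p => (p, U n p) := fun n => measurable_id.prodMk (hU n)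
  set μ : ℕ → ProbabilityMeasure (X × Y) := fun n =>
    ⟨Q.map fun p => (p, U n p), Measure.isProbabilityMeasure_map (hgraph n).aemeasurable⟩ with hμ
  have htight : IsTightMeasureSet {((ν : ProbabilityMeasure (X × Y)) : Measure (X × Y)) |
      ν ∈ Set.range μ} := by
    rw [isTightMeasureSet_iff_exists_isCompact_measure_compl_le]
    intro δ hδ
    have hδ2 : δ / 2 ≠ 0 := (ENNReal.half_pos hδ.ne').ne'
    obtain ⟨K₁, hK₁, hK₁'⟩ := isTightMeasureSet_iff_exists_isCompact_measure_compl_le.1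
      (isTightMeasureSet_singleton (μ := Q)) (δ / 2) (ENNReal.half_pos hδ.ne')
    have hD : (m univ)⁻¹ * C / (δ / 2) ≠ ∞ ∨ δ = ∞ := by
      by_cases h : δ = ∞
      · exact Or.inr h
      · left
        exact ENNReal.div_ne_top (ENNReal.mul_ne_top (ENNReal.inv_ne_top.2 hm0) hC) hδ2
    rcases hD with hD | hD
    swap
    · exact ⟨∅, isCompact_empty, fun ν _ => by rw [hD]; exact le_top⟩
    set R : ℝ := ((m univ)⁻¹ * C / (δ / 2)).toReal + 1 with hR
    have hR0 : 0 < R := by positivity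
    refine ⟨K₁ ×ˢ Metric.closedBall 0 R, hK₁.prod (isCompact_closedBall _ _), ?_⟩
    rintro _ ⟨_, ⟨n, rfl⟩, rfl⟩
    have hsub : (fun p => (p, U n p)) ⁻¹' (K₁ ×ˢ Metric.closedBall 0 R)ᶜ
        ⊆ K₁ᶜ ∪ {p | ENNReal.ofReal R ≤ ‖U n p‖ₑ} := by
      intro p hp
      by_cases h : p ∈ K₁
      · right
        have h2 : U n p ∉ Metric.closedBall 0 R := fun h2 => hp ⟨h, h2⟩
        rw [mem_closedBall_zero_iff, not_le] at h2
        change ENNReal.ofReal R ≤ ‖U n p‖ₑ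
        rw [← ofReal_norm]
        exact ENNReal.ofReal_le_ofReal h2.le
      · exact Or.inl h
    have hcl : MeasurableSet (K₁ ×ˢ Metric.closedBall (0 : Y) R)ᶜ :=
      (hK₁.prod (isCompact_closedBall _ _)).isClosed.measurableSet.compl
    change (Q.map fun p => (p, U n p)) _ ≤ δ
    rw [Measure.map_apply (hgraph n) hcl]
    refine (measure_mono hsub).trans ((measure_union_le _ _).trans ?_)
    rw [← ENNReal.add_halves δ]
    refine add_le_add (hK₁' _ rfl) ?_
    have hRne : ENNReal.ofReal R ≠ 0 := by simpa using hR0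
    refine (meas_ge_le_lintegral_div (hU n).enorm.aemeasurable hRne ENNReal.ofReal_ne_top).trans ?_
    rw [hQ, lintegral_smul_measure, smul_eq_mul]
    refine ENNReal.div_le_of_le_mul ?_
    have h3 : (m univ)⁻¹ * C / (δ / 2) ≤ ENNReal.ofReal R := by
      rw [← ENNReal.ofReal_toReal hD]
      exact ENNReal.ofReal_le_ofReal (by rw [hR]; linarith)
    have h4 : (m univ)⁻¹ * C ≤ ENNReal.ofReal R * (δ / 2) :=
      (ENNReal.div_le_iff_le_mul (Or.inl hδ2) (Or.inr hRne)).1 h3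
    rw [mul_comm (δ / 2)]
    exact (mul_le_mul_right (hbd n) _).trans h4
  have hcomp := isCompact_closure_of_isTightMeasureSet htight
  obtain ⟨ν, -, sub, hsub, hlim⟩ := hcomp.tendsto_subseq
    (fun n => subset_closure (Set.mem_range_self n) : ∀ n, μ n ∈ closure (Set.range μ))
  rw [ProbabilityMeasure.tendsto_iff_forall_integral_tendsto] at hlim
  have hint : ∀ (f : X × Y →ᵇ ℝ) n, ∫ q, f q ∂(μ n : Measure (X × Y)) = ∫ p, f (p, U n p) ∂Q := by
    intro f n
    exact integral_map (hgraph n).aemeasurable f.continuous.aestronglyMeasurable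
  have hfst : (ν : Measure (X × Y)).fst = Q := by
    refine ext_of_forall_integral_eq_of_IsFiniteMeasure fun f => ?_
    set F₁ : X × Y →ᵇ ℝ := f.compContinuous ⟨Prod.fst, continuous_fst⟩ with hF₁
    have h1 := hlim F₁
    have h3 : ∀ n, ∫ q, F₁ q ∂(μ n : Measure (X × Y)) = ∫ p, f p ∂Q := fun n => hint F₁ n
    simp only [Function.comp_apply, h3] at h1
    have h2 : ∫ q, F₁ q ∂(ν : Measure (X × Y)) = ∫ p, f p ∂Q :=
      tendsto_nhds_unique h1 tendsto_const_nhds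
    rw [Measure.fst, integral_map measurable_fst.aemeasurable f.continuous.aestronglyMeasurable]
    exact h2
  set V : Kernel X Y := (ν : Measure (X × Y)).condKernel with hV
  have hgm : ∀ g : Y →ᵇ ℝ, StronglyMeasurable fun p => ∫ y, g y ∂(V p) := fun g =>
    (g.continuous.stronglyMeasurable.comp_measurable measurable_snd).integral_kernel_prod_right'
  have hgb : ∀ (g : Y →ᵇ ℝ) p, |∫ y, g y ∂(V p)| ≤ ‖g‖ := fun g p => by
    have := norm_integral_le_of_norm_le_const (μ := V p) (f := g) (C := ‖g‖)
      (.of_forall fun y => g.norm_coe_le_norm y)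
    simpa using this
  refine ⟨sub, V, hsub, inferInstance, fun g w hw => ?_⟩
  have hcont : ∀ w' : X →ᵇ ℝ, Tendsto (fun n => ∫ p, w' p * g (U (sub n) p) ∂m) atTop
      (𝓝 (∫ p, w' p * ∫ y, g y ∂(V p) ∂m)) := by
    intro w'
    set F₁ : X × Y →ᵇ ℝ := w'.compContinuous ⟨Prod.fst, continuous_fst⟩ with hF₁
    set F₂ : X × Y →ᵇ ℝ := g.compContinuous ⟨Prod.snd, continuous_snd⟩ with hF₂
    have h1 := hlim (F₁ * F₂)
    have h3 : ∀ n, ∫ q, (F₁ * F₂) q ∂(μ n : Measure (X × Y)) = ∫ p, w' p * g (U n p) ∂Q :=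
      fun n => hint (F₁ * F₂) n
    simp only [Function.comp_apply, h3] at h1
    have h2 : ∫ q, (F₁ * F₂) q ∂(ν : Measure (X × Y)) = ∫ p, w' p * ∫ y, g y ∂(V p) ∂Q := by
      rw [← Measure.integral_condKernel ((F₁ * F₂).integrable _), hfst]
      refine integral_congr_ae (.of_forall fun p => ?_)
      exact integral_const_mul (w' p) fun y => g y
    rw [h2] at h1
    rw [hmQ]
    simp only [integral_smul_measure, smul_eq_mul]
    exact h1.const_mul _
  have hdiff : ∀ {w' φ : X → ℝ}, Integrable w' m → AEStronglyMeasurable φ m → (∀ p, |φ p| ≤ ‖g‖) →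
      |∫ p, w p * φ p ∂m - ∫ p, w' p * φ p ∂m| ≤ ‖g‖ * ∫ p, ‖w p - w' p‖ ∂m := by
    intro w' φ hw' hφ hb
    rw [← integral_sub (integrable_mul_of_bound hw _ hφ (.of_forall hb))
      (integrable_mul_of_bound hw' _ hφ (.of_forall hb))]
    simp only [← sub_mul]
    exact abs_integral_mul_le (hw.sub hw') (.of_forall hb)
  refine tendsto_of_forall_approx fun η hη => ?_
  obtain ⟨w', hw', hw'i⟩ := hw.exists_boundedContinuous_integral_sub_le
    (ε := η / (‖g‖ + 1)) (by positivity)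
  have hsmall : ‖g‖ * ∫ x, ‖w x - w' x‖ ∂m ≤ η :=
    (mul_le_mul (by linarith) hw' (integral_nonneg fun _ => norm_nonneg _) (by positivity)).trans
      (mul_div_cancel₀ η (by positivity : ‖g‖ + 1 ≠ 0)).le
  exact ⟨_, _, hcont w', (hdiff hw'i (hgm g).aestronglyMeasurable (hgb g)).trans hsmall,
    .of_forall fun n => (hdiff hw'i (g.continuous.measurable.comp (hU _)).aestronglyMeasurable
      fun p => g.norm_coe_le_norm _).trans hsmall⟩

end Young

/-! ### Weak convergence of functions of the generating sequence -/

section WeakConv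

variable {X : Type*} [MeasurableSpace X]

/-- Convergence of the integrals against all bounded measurable functions, for a sequence bounded
in `L¹`. -/
structure WeakConv (m : Measure X) (f : ℕ → X → ℝ) (F : X → ℝ) : Prop where
  integrable : ∀ n, Integrable (f n) m
  integrable_lim : Integrable F m
  bound : ∃ C, ∀ n, ∫ p, |f n p| ∂m ≤ C
  tendsto : ∀ w : X → ℝ, AEStronglyMeasurable w m → (∃ C, ∀ᵐ p ∂m, |w p| ≤ C) →
    Tendsto (fun n => ∫ p, f n p * w p ∂m) atTop (𝓝 (∫ p, F p * w p ∂m))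

namespace WeakConv

variable {m : Measure X} {f g : ℕ → X → ℝ} {F H : X → ℝ}

lemma congr_lim (h : WeakConv m f F) (hFH : F =ᵐ[m] H) : WeakConv m f H where
  integrable := h.integrable
  integrable_lim := h.integrable_lim.congr hFH
  bound := h.bound
  tendsto w hw hb := by
    have : ∫ p, H p * w p ∂m = ∫ p, F p * w p ∂m :=
      integral_congr_ae (by filter_upwards [hFH] with p hp; rw [hp])
    rw [this]
    exact h.tendsto w hw hb

/-- Perturbations that vanish in `L¹` do not change weak limits. -/
lemma of_sub_tendsto (h : WeakConv m f F) (hg : ∀ n, Integrable (g n) m)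
    (hfg : Tendsto (fun n => ∫ p, |f n p - g n p| ∂m) atTop (𝓝 0)) : WeakConv m g F where
  integrable := hg
  integrable_lim := h.integrable_lim
  bound := by
    obtain ⟨C, hC⟩ := h.bound
    obtain ⟨D, hD⟩ := hfg.bddAbove_range
    have hd : ∀ n, Integrable (fun p => f n p - g n p) m := fun n => (h.integrable n).sub (hg n)
    refine ⟨C + D, fun n => ?_⟩
    have h1 : ∫ p, |g n p| ∂m ≤ ∫ p, (|f n p| + |f n p - g n p|) ∂m := by
      refine integral_mono (hg n).abs ((h.integrable n).abs.add
        (hd n).abs) fun p => ?_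
      have := abs_sub_abs_le_abs_sub (g n p) (f n p)
      rw [abs_sub_comm] at this
      simp only
      linarith
    rw [integral_add (h.integrable n).abs (hd n).abs] at h1
    exact h1.trans (add_le_add (hC n) (hD ⟨n, rfl⟩))
  tendsto w hw hb := by
    obtain ⟨C, hC⟩ := hb
    have hd : ∀ n, Integrable (fun p => f n p - g n p) m := fun n => (h.integrable n).sub (hg n)
    have h1 := h.tendsto w hw ⟨C, hC⟩
    have h2 : Tendsto (fun n => ∫ p, (f n p - g n p) * w p ∂m) atTop (𝓝 0) := by
      refine squeeze_zero_norm (fun n => ?_) (by simpa using hfg.const_mul C)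
      exact abs_integral_mul_le (hd n) hC
    have h3 := h1.sub h2
    rw [sub_zero] at h3
    refine h3.congr fun n => ?_
    rw [← integral_sub (integrable_mul_of_bound (h.integrable n) C hw hC)
      (integrable_mul_of_bound (hd n) C hw hC)]
    refine integral_congr_ae (.of_forall fun p => ?_)
    simp only
    ring

/-- Weak convergence against uniformly convergent weights. -/
lemma tendsto_of_uniform (h : WeakConv m f F) {w : ℕ → X → ℝ} {W : X → ℝ}
    (hw : ∀ n, AEStronglyMeasurable (w n) m) (hwb : ∀ n, ∃ C, ∀ᵐ p ∂m, |w n p| ≤ C)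
    (hW : AEStronglyMeasurable W m) (hWb : ∃ C, ∀ᵐ p ∂m, |W p| ≤ C)
    (hwW : ∀ η > 0, ∀ᶠ n in atTop, ∀ᵐ p ∂m, |w n p - W p| ≤ η) :
    Tendsto (fun n => ∫ p, f n p * w n p ∂m) atTop (𝓝 (∫ p, F p * W p ∂m)) := by
  have h1 := h.tendsto W hW hWb
  have h2 : Tendsto (fun n => ∫ p, f n p * (w n p - W p) ∂m) atTop (𝓝 0) := by
    obtain ⟨C, hC⟩ := h.bound
    have hC0 : 0 ≤ C := (integral_nonneg fun p => abs_nonneg _).trans (hC 0)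
    refine tendsto_of_forall_approx fun η hη =>
      ⟨fun _ => 0, 0, tendsto_const_nhds, by simpa using hη.le, ?_⟩
    filter_upwards [hwW (η / (C + 1)) (by positivity)] with n hn
    rw [sub_zero]
    calc |∫ p, f n p * (w n p - W p) ∂m| ≤ η / (C + 1) * ∫ p, |f n p| ∂m :=
          abs_integral_mul_le (h.integrable n) hn
      _ ≤ η / (C + 1) * (C + 1) := mul_le_mul_of_nonneg_left (by linarith [hC n]) (by positivity)
      _ = η := div_mul_cancel₀ η (by positivity)
  have h3 := h1.add h2
  rw [add_zero] at h3
  refine h3.congr fun n => ?_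
  obtain ⟨C, hC⟩ := hwb n
  obtain ⟨D, hD⟩ := hWb
  have hi1 := integrable_mul_of_bound (h.integrable n) C (hw n) hC
  have hi2 := integrable_mul_of_bound (h.integrable n) D hW hD
  have hi3 : Integrable (fun p => f n p * (w n p - W p)) m :=
    (hi1.sub hi2).congr (.of_forall fun p => (mul_sub _ _ _).symm)
  rw [← integral_add hi2 hi3]
  refine integral_congr_ae (.of_forall fun p => ?_)
  simp only
  ring

end WeakConv

open ProbabilityTheory BoundedContinuousFunction
open scoped ENNReal

variable {Y : Type*} [TopologicalSpace Y]

/-- Truncation of a continuous function, as a bounded continuous function. -/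
noncomputable def truncate (R : ℝ) (F : Y → ℝ) (hF : Continuous F) : Y →ᵇ ℝ :=
  BoundedContinuousFunction.ofNormedAddCommGroup (fun y => max (-|R|) (min (F y) |R|))
    (continuous_const.max (hF.min continuous_const)) |R| fun y => by
      rw [Real.norm_eq_abs, abs_le]
      exact ⟨le_max_left _ _, max_le (by linarith [abs_nonneg R]) (min_le_right _ _)⟩

lemma abs_sub_truncate (R : ℝ) (hR : 0 ≤ R) (F : Y → ℝ) (hF : Continuous F) (y : Y) :
    |F y - truncate R F hF y| = max (|F y| - R) 0 := by
  change |F y - max (-|R|) (min (F y) |R|)| = _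
  rw [abs_of_nonneg hR]
  rcases le_total (F y) R with h1 | h1
  · rcases le_total (-R) (F y) with h2 | h2
    · rw [min_eq_left h1, max_eq_right h2, sub_self, abs_zero, max_eq_right]
      linarith [abs_le.2 ⟨h2, h1⟩]
    · rw [min_eq_left h1, max_eq_left h2, abs_of_nonpos (by linarith : F y ≤ 0), max_eq_left
        (by linarith), abs_of_nonpos (by linarith)]
      ring
  · rw [min_eq_right h1, max_eq_right (by linarith), abs_of_nonneg (by linarith : 0 ≤ F y),
      max_eq_left (by linarith), abs_of_nonneg (by linarith)]

variable [MeasurableSpace Y] [OpensMeasurableSpace Y]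

/-- The convergence of `g ∘ U n` to `⟨V; g⟩` for all bounded continuous functions `g`. -/
def GeneratesBounded (m : Measure X) (U : ℕ → X → Y) (V : Kernel X Y) : Prop :=
  ∀ (g : Y →ᵇ ℝ) (w : X → ℝ), Integrable w m →
    Tendsto (fun n => ∫ p, w p * g (U n p) ∂m) atTop (𝓝 (∫ p, w p * ∫ y, g y ∂(V p) ∂m))

lemma integrable_integral_compProd {X Y : Type*} [MeasurableSpace X] [MeasurableSpace Y]
    {m : Measure X} [SFinite m] {V : Kernel X Y} [IsSFiniteKernel V] {f : X × Y → ℝ}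
    (h : Integrable f (m ⊗ₘ V)) : Integrable (fun p => ∫ y, f (p, y) ∂(V p)) m :=
  Integrable.integral_compProd (κ := Kernel.const Unit m) (η := Kernel.prodMkLeft Unit V)
    (a := ()) h

variable {m : Measure X} [IsFiniteMeasure m] {U : ℕ → X → Y} {V : Kernel X Y} [IsMarkovKernel V]

/-- A continuous function that is bounded in `L¹` along the sequence is integrable with respect to
the Young measure. -/
lemma GeneratesBounded.integrable_of_bound (hgen : GeneratesBounded m U V)
    {F : Y → ℝ} (hF : Continuous F) {C : ℝ}
    (hint : ∀ n, Integrable (fun p => F (U n p)) m) (hC : ∀ n, ∫ p, |F (U n p)| ∂m ≤ C) :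
    Integrable (fun q : X × Y => F q.2) (m ⊗ₘ V) := by
  have hFm : Measurable fun q : X × Y => F q.2 := hF.measurable.comp measurable_snd
  refine ⟨hFm.aestronglyMeasurable, ?_⟩
  set t : ℕ → Y →ᵇ ℝ := fun R => truncate R (fun y => |F y|) hF.abs with ht
  have ht0 : ∀ R y, 0 ≤ t R y := fun R y =>
    le_max_of_le_right (le_min (abs_nonneg _) (abs_nonneg _))
  have htle : ∀ R y, t R y ≤ |F y| := fun R y =>
    max_le ((neg_nonpos.2 (abs_nonneg _)).trans (abs_nonneg _)) (min_le_left _ _)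
  have h1 : ∀ R, ∫ q : X × Y, t R q.2 ∂(m ⊗ₘ V) ≤ C := by
    intro R
    have hi : Integrable (fun q : X × Y => t R q.2) (m ⊗ₘ V) :=
      Integrable.of_bound ((t R).continuous.measurable.comp measurable_snd).aestronglyMeasurable
        ‖t R‖ (.of_forall fun q => (t R).norm_coe_le_norm _)
    rw [Measure.integral_compProd hi]
    have h2 := hgen (t R) (fun _ => 1) (integrable_const 1)
    simp only [one_mul] at h2
    refine le_of_tendsto h2 (.of_forall fun n => le_trans ?_ (hC n))
    exact integral_mono_of_nonneg (.of_forall fun p => ht0 _ _) (hint n).abs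
      (.of_forall fun p => htle _ _)
  have h3 : ∀ R, ∫⁻ q : X × Y, ENNReal.ofReal (t R q.2) ∂(m ⊗ₘ V) ≤ ENNReal.ofReal C := by
    intro R
    rw [← ofReal_integral_eq_lintegral_ofReal]
    · exact ENNReal.ofReal_le_ofReal (h1 R)
    · exact Integrable.of_bound
        ((t R).continuous.measurable.comp measurable_snd).aestronglyMeasurable
        ‖t R‖ (.of_forall fun q => (t R).norm_coe_le_norm _)
    · exact .of_forall fun q => ht0 _ _
  have h4 : ∫⁻ q : X × Y, ‖F q.2‖ₑ ∂(m ⊗ₘ V)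
      ≤ liminf (fun R => ∫⁻ q : X × Y, ENNReal.ofReal (t R q.2) ∂(m ⊗ₘ V)) atTop := by
    refine le_trans (le_of_eq ?_) (lintegral_liminf_le fun R =>
      ENNReal.measurable_ofReal.comp ((t R).continuous.measurable.comp measurable_snd))
    refine lintegral_congr fun q => ?_
    have : Tendsto (fun R => ENNReal.ofReal (t R q.2)) atTop (𝓝 ‖F q.2‖ₑ) := by
      refine tendsto_const_nhds.congr' ?_
      filter_upwards [eventually_ge_atTop ⌈|F q.2|⌉₊] with R hR
      rw [← ofReal_norm, Real.norm_eq_abs]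
      congr 1
      have h5 : |F q.2| ≤ |(R : ℝ)| := (Nat.le_ceil _).trans
        ((by exact_mod_cast hR : ((⌈|F q.2|⌉₊ : ℕ) : ℝ) ≤ R).trans (le_abs_self _))
      change |F q.2| = max (-|(R : ℝ)|) (min |F q.2| |(R : ℝ)|)
      rw [min_eq_left h5, max_eq_right]
      linarith [abs_nonneg (F q.2), abs_nonneg (R : ℝ)]
    exact this.liminf_eq.symm
  refine lt_of_le_of_lt (b := ENNReal.ofReal C) (h4.trans (liminf_le_of_le (h := fun b hb => ?_)))
    ENNReal.ofReal_lt_top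
  obtain ⟨R, hR⟩ := hb.exists
  exact hR.trans (h3 R)

/-- Weak convergence of `F (U n)` to `⟨V; F⟩` for continuous `F` such that `F (U n)` is
equi-integrable. -/
lemma GeneratesBounded.weakConv (hgen : GeneratesBounded m U V)
    (hU : ∀ n, Measurable (U n)) {F : Y → ℝ} (hF : Continuous F) {C : ℝ}
    (hint : ∀ n, Integrable (fun p => F (U n p)) m) (hC : ∀ n, ∫ p, |F (U n p)| ∂m ≤ C)
    (hUI : ∀ η > 0, ∃ R, ∀ᶠ n in atTop, ∫ p, max (|F (U n p)| - R) 0 ∂m ≤ η) :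
    WeakConv m (fun n p => F (U n p)) (fun p => ∫ y, F y ∂(V p)) := by
  have hI := hgen.integrable_of_bound hF hint hC
  refine ⟨hint, integrable_integral_compProd hI, ⟨C, hC⟩, fun w hw hb => ?_⟩
  obtain ⟨D, hD⟩ := hb
  have hD' : ∀ᵐ p ∂m, |w p| ≤ |D| := hD.mono fun p hp => hp.trans (le_abs_self D)
  have hwi : Integrable w m := Integrable.of_bound hw D hD
  have htailm : ∀ R : ℝ, Measurable fun q : X × Y => max (|F q.2| - R) 0 := fun R =>
    ((hF.abs.measurable.comp measurable_snd).sub_const R).max measurable_const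
  -- the tails of an integrable function vanish
  have htail : Tendsto (fun R : ℕ => ∫ q : X × Y, max (|F q.2| - R) 0 ∂(m ⊗ₘ V)) atTop (𝓝 0) := by
    rw [show (𝓝 (0 : ℝ)) = 𝓝 (∫ _ : X × Y, (0 : ℝ) ∂(m ⊗ₘ V)) by simp]
    refine tendsto_integral_of_dominated_convergence (fun q => |F q.2|)
      (fun R => (htailm R).aestronglyMeasurable) hI.abs
      (fun R => .of_forall fun q => ?_) (.of_forall fun q => ?_)
    · rw [Real.norm_eq_abs, abs_of_nonneg (le_max_right _ _)]
      exact max_le (by linarith [Nat.cast_nonneg (α := ℝ) R]) (abs_nonneg _)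
    · refine tendsto_const_nhds.congr' ?_
      filter_upwards [eventually_ge_atTop ⌈|F q.2|⌉₊] with R hR
      have h5 : |F q.2| ≤ (R : ℝ) := (Nat.le_ceil _).trans (by exact_mod_cast hR)
      rw [max_eq_right (by linarith)]
  have hdiff : ∀ {f g : X → ℝ}, Integrable f m → Integrable g m →
      |∫ p, f p * w p ∂m - ∫ p, w p * g p ∂m| ≤ |D| * ∫ p, |f p - g p| ∂m := by
    intro f g hf hg
    simp only [mul_comm (w _)]
    rw [← integral_sub (integrable_mul_of_bound hf D hw hD) (integrable_mul_of_bound hg D hw hD)]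
    simp only [← sub_mul]
    exact abs_integral_mul_le (hf.sub hg) hD'
  refine tendsto_of_forall_approx fun η hη => ?_
  have hη'0 : 0 < η / (|D| + 1) := by positivity
  have hDη : ∀ {x}, x ≤ η / (|D| + 1) → |D| * x ≤ η := fun hx =>
    (mul_le_mul_of_nonneg_left hx (abs_nonneg D)).trans <|
      (mul_le_mul_of_nonneg_right (by linarith) hη'0.le).trans
        (mul_div_cancel₀ η (by positivity : |D| + 1 ≠ 0)).le
  obtain ⟨R₁, hR₁⟩ := hUI _ hη'0
  obtain ⟨R₂, hR₂⟩ := ((htail.eventually (gt_mem_nhds hη'0)).and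
    (eventually_ge_atTop ⌈|R₁|⌉₊)).exists
  have hRR : R₁ ≤ (R₂ : ℝ) := (le_abs_self _).trans ((Nat.le_ceil _).trans
    (by exact_mod_cast hR₂.2))
  set G := truncate R₂ F hF with hG
  have hFG : ∀ y, |F y - G y| = max (|F y| - R₂) 0 := abs_sub_truncate R₂ (Nat.cast_nonneg _) F hF
  have hGi : ∀ n, Integrable (fun p => G (U n p)) m := fun n =>
    Integrable.of_bound (G.continuous.measurable.comp (hU n)).aestronglyMeasurable ‖G‖
      (.of_forall fun p => G.norm_coe_le_norm _)
  have hGV : Integrable (fun q : X × Y => G q.2) (m ⊗ₘ V) :=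
    Integrable.of_bound (G.continuous.measurable.comp measurable_snd).aestronglyMeasurable ‖G‖
      (.of_forall fun p => G.norm_coe_le_norm _)
  refine ⟨_, _, hgen G w hwi, ?_, ?_⟩
  · have hFp := integrable_integral_compProd hI
    have hGp := integrable_integral_compProd hGV
    refine (hdiff hFp hGp).trans (hDη (le_trans ?_ hR₂.1.le))
    have hdi : Integrable (fun q : X × Y => max (|F q.2| - R₂) 0) (m ⊗ₘ V) :=
      (hI.sub hGV).abs.congr (.of_forall fun q => hFG q.2)
    rw [Measure.integral_compProd hdi]
    refine integral_mono_ae (hFp.sub hGp).abs (integrable_integral_compProd hdi) ?_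
    filter_upwards [((Measure.integrable_compProd_iff hI.aestronglyMeasurable).1 hI).1,
      ((Measure.integrable_compProd_iff hGV.aestronglyMeasurable).1 hGV).1] with p h1 h2
    rw [← integral_sub h1 h2]
    exact abs_integral_le_integral_abs.trans (integral_congr_ae (.of_forall hFG)).le
  · filter_upwards [hR₁] with n hn1
    refine (hdiff (hint n) (hGi n)).trans (hDη (le_trans ?_ hn1))
    refine integral_mono ((hint n).sub (hGi n)).abs
      (((hint n).abs.sub (integrable_const R₁)).sup (integrable_const 0)) fun p => ?_
    simp only [hFG]
    exact max_le_max (by linarith) le_rfl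

end WeakConv

/-! ### Test functions and their difference quotients -/

/-- Difference quotients of a `C¹` function converge locally uniformly. -/
lemma eventually_abs_difference_le {E : Type*} [NormedAddCommGroup E] [NormedSpace ℝ E]
    {f : E → ℝ} (hf : ContDiff ℝ 1 f) {K : Set E} (hK : IsCompact K) (v : E) {η : ℝ}
    (hη : 0 < η) :
    ∀ᶠ c : ℝ in 𝓝 0, ∀ p ∈ K, |f (p + c • v) - f p - c * fderiv ℝ f p v| ≤ η * |c| := by
  refine hK.eventually_forall_of_forall_eventually fun p hp => ?_
  have h1 := ((hf.contDiffAt (x := p)).hasStrictFDerivAt one_ne_zero).isLittleO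
  set δ := η / (2 * (‖v‖ + 1)) with hδ
  have hδ0 : 0 < δ := by positivity
  have hδv : δ * ‖v‖ ≤ η / 2 := by
    rw [hδ, div_mul_eq_mul_div, div_le_div_iff₀ (by positivity) (by norm_num)]
    nlinarith [norm_nonneg v]
  have h2 := h1.bound hδ0
  have hc : Tendsto (fun z : ℝ × E => (z.2 + z.1 • v, z.2)) (𝓝 (0, p)) (𝓝 (p, p)) := by
    have : Continuous fun z : ℝ × E => (z.2 + z.1 • v, z.2) := by fun_prop
    simpa using this.tendsto (0, p)
  have hd : Tendsto (fun z : ℝ × E => fderiv ℝ f z.2 v) (𝓝 (0, p)) (𝓝 (fderiv ℝ f p v)) := by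
    have : Continuous fun z : ℝ × E => fderiv ℝ f z.2 v :=
      ((hf.continuous_fderiv one_ne_zero).comp continuous_snd).clm_apply continuous_const
    exact this.tendsto (0, p)
  filter_upwards [hc.eventually h2, Metric.tendsto_nhds.1 hd (η / 2) (by positivity)]
    with z hz1 hz2
  rw [Real.dist_eq] at hz2
  simp only [add_sub_cancel_left, map_smul, smul_eq_mul, Real.norm_eq_abs, norm_smul] at hz1
  have e1 : f (z.2 + z.1 • v) - f z.2 - z.1 * fderiv ℝ f z.2 v
      = (f (z.2 + z.1 • v) - f z.2 - z.1 * fderiv ℝ f p v)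
        - z.1 * (fderiv ℝ f z.2 v - fderiv ℝ f p v) := by ring
  rw [e1]
  refine (abs_sub _ _).trans ?_
  rw [abs_mul]
  have h3 := abs_nonneg z.1
  nlinarith [mul_le_mul_of_nonneg_left hz2.le h3, mul_le_mul_of_nonneg_right hδv h3]

section Test

/-- Closure of `(0, T) × Ω`. -/
def closedBox (L : ℝᵈ) (T : ℝ) : Set (ℝ × ℝᵈ) := Icc 0 T ×ˢ Icc 0 L

lemma isCompact_closedBox (L : ℝᵈ) (T : ℝ) : IsCompact (closedBox L T) :=
  isCompact_Icc.prod isCompact_Icc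

lemma torus_subset_Icc (L : ℝᵈ) : torus L ⊆ Icc 0 L := fun x hx => by
  rw [torus, Set.mem_univ_pi] at hx
  exact ⟨fun i => (hx i).1, fun i => (hx i).2.le⟩

lemma ae_spaceTime_mem_closedBox (L : ℝᵈ) (T : ℝ) : ∀ᵐ p ∂(spaceTime L T), p ∈ closedBox L T := by
  have := ae_restrict_mem (μ := volume) ((measurableSet_Ioo (a := (0 : ℝ)) (b := T)).prod
    (measurableSet_torus L))
  filter_upwards [this] with p hp
  exact ⟨Ioo_subset_Icc_self hp.1, torus_subset_Icc L hp.2⟩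

lemma admissible_of_continuous (hL : ∀ i, 0 < L i) {f : ℝ × ℝᵈ → ℝ} (hf : Continuous f)
    (hper : ∀ t, TorusPeriodic L fun x => f (t, x)) : Admissible L T f := by
  refine ⟨hf.measurable, fun t _ => hper t, ?_⟩
  obtain ⟨C, hC⟩ := (isCompact_closedBox L T).exists_bound_of_continuousOn hf.continuousOn
  refine ⟨C, fun t ht x => ?_⟩
  have h1 : f (t, wrap L x) = f (t, x) := (hper t).wrap x
  rw [← h1, ← Real.norm_eq_abs]
  exact hC _ ⟨Ioo_subset_Icc_self ht, torus_subset_Icc L (wrap_mem hL x)⟩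

namespace IsTest

variable {φ ψ : ℝ → (Fin d → ℝ) → ℝ}

lemma hasFDerivAt_uncurry (hφ : IsTest L φ) (p : ℝ × ℝᵈ) : HasFDerivAt (fun p : ℝ × ℝᵈ => φ p.1 p.2)
      (fderiv ℝ (fun p : ℝ × ℝᵈ => φ p.1 p.2) p) p :=
  ((hφ.1.differentiable one_ne_zero) p).hasFDerivAt

lemma dt_eq (hφ : IsTest L φ) (t : ℝ) (x : ℝᵈ) :
    dt φ t x = fderiv ℝ (fun p : ℝ × ℝᵈ => φ p.1 p.2) (t, x) (1, 0) := by
  have h1 : HasFDerivAt (fun s : ℝ => (s, x)) (ContinuousLinearMap.inl ℝ ℝ ℝᵈ) t :=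
    hasFDerivAt_prodMk_left t x
  have h2 := ((hφ.hasFDerivAt_uncurry (t, x)).comp t h1).hasDerivAt.deriv
  simpa [dt, Function.comp_def] using h2

lemma dx_eq (hφ : IsTest L φ) (i : Fin d) (t : ℝ) (x : ℝᵈ) : dx i φ t x
      = fderiv ℝ (fun p : ℝ × ℝᵈ => φ p.1 p.2) (t, x) (0, Pi.single i 1) := by
  have h1 : HasFDerivAt (fun y : ℝᵈ => (t, y)) (ContinuousLinearMap.inr ℝ ℝ ℝᵈ) x :=
    hasFDerivAt_prodMk_right t x
  have h2 := ((hφ.hasFDerivAt_uncurry (t, x)).comp x h1).fderiv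
  simp only [Function.comp_def] at h2
  simp only [dx]
  rw [show φ t = fun y => φ t y from rfl, h2]
  simp

lemma continuous_uncurry (hφ : IsTest L φ) : Continuous fun p : ℝ × ℝᵈ => φ p.1 p.2 :=
  hφ.1.continuous

lemma continuous_dt (hφ : IsTest L φ) : Continuous fun p : ℝ × ℝᵈ => dt φ p.1 p.2 := by
  simp only [hφ.dt_eq]
  exact (hφ.1.continuous_fderiv one_ne_zero).clm_apply continuous_const

lemma continuous_dx (hφ : IsTest L φ) (i : Fin d) :
    Continuous fun p : ℝ × ℝᵈ => dx i φ p.1 p.2 := by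
  simp only [hφ.dx_eq]
  exact (hφ.1.continuous_fderiv one_ne_zero).clm_apply continuous_const

lemma dt_periodic (hφ : IsTest L φ) (t : ℝ) : TorusPeriodic L fun x => dt φ t x := fun x i => by
  simp only [dt, hφ.2]

lemma dx_periodic (hφ : IsTest L φ) (j : Fin d) (t : ℝ) :
    TorusPeriodic L fun x => dx j φ t x := fun x i => by
  simp only [dx]
  rw [← fderiv_comp_add_right]
  congr 2
  funext y
  exact hφ.2 t y i

lemma admissible (hL : ∀ i, 0 < L i) (hφ : IsTest L φ) : Admissible L T fun p => φ p.1 p.2 :=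
  admissible_of_continuous hL hφ.continuous_uncurry fun t x i => hφ.2 t x i

lemma admissible_dt (hL : ∀ i, 0 < L i) (hφ : IsTest L φ) : Admissible L T fun p => dt φ p.1 p.2 :=
  admissible_of_continuous hL hφ.continuous_dt fun t x i => hφ.dt_periodic t x i

lemma admissible_dx (hL : ∀ i, 0 < L i) (hφ : IsTest L φ) (j : Fin d) :
    Admissible L T fun p => dx j φ p.1 p.2 :=
  admissible_of_continuous hL (hφ.continuous_dx j) fun t x i => hφ.dx_periodic j t x i

lemma admissible_shift (hL : ∀ i, 0 < L i) (hφ : IsTest L φ) (c : ℝ) :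
    Admissible L T fun p => φ (p.1 + c) p.2 :=
  admissible_of_continuous hL (hφ.continuous_uncurry.comp
    (f := fun p : ℝ × ℝᵈ => (p.1 + c, p.2)) (by fun_prop)) fun t x i => hφ.2 _ x i

/-- Time difference quotients converge uniformly. -/
lemma eventually_quotient_dt (hφ : IsTest L φ) {η : ℝ} (hη : 0 < η) :
    ∀ᶠ c : ℝ in 𝓝[>] 0, ∀ p ∈ closedBox L T,
      |(φ (p.1 + c) p.2 - φ p.1 p.2) / c - dt φ p.1 p.2| ≤ η := by
  have h := eventually_abs_difference_le hφ.1 (isCompact_closedBox L T) (1, 0) hη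
  filter_upwards [h.filter_mono nhdsWithin_le_nhds, self_mem_nhdsWithin] with c hc hc0 p hp
  have hc0' : 0 < c := hc0
  have h1 := hc p hp
  rw [← hφ.dt_eq] at h1
  simp only [Prod.fst_add, Prod.snd_add, Prod.smul_fst, Prod.smul_snd, smul_zero, add_zero,
    smul_eq_mul, mul_one, abs_of_pos hc0'] at h1
  have e1 : (φ (p.1 + c) p.2 - φ p.1 p.2) / c - dt φ p.1 p.2
      = (φ (p.1 + c) p.2 - φ p.1 p.2 - c * dt φ p.1 p.2) / c := by field_simp
  rw [e1, abs_div, abs_of_pos hc0', div_le_iff₀ hc0']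
  exact h1

/-- Spatial difference quotients, forward and backward, converge uniformly. -/
lemma eventually_quotient_dx (hφ : IsTest L φ) (i : Fin d) {η : ℝ} (hη : 0 < η) :
    ∀ᶠ c : ℝ in 𝓝[>] 0, ∀ p ∈ closedBox L T,
      |(φ p.1 (p.2 + Pi.single i c) - φ p.1 p.2) / c - dx i φ p.1 p.2| ≤ η ∧
      |(φ p.1 p.2 - φ p.1 (p.2 + -Pi.single i c)) / c - dx i φ p.1 p.2| ≤ η := by
  have h := eventually_abs_difference_le hφ.1 (isCompact_closedBox L T) (0, Pi.single i 1) hη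
  have h' : ∀ᶠ c : ℝ in 𝓝 0, ∀ p ∈ closedBox L T,
      |(fun p : ℝ × ℝᵈ => φ p.1 p.2) (p + (-c) • (0, Pi.single i 1))
        - (fun p : ℝ × ℝᵈ => φ p.1 p.2) p
        - (-c) * fderiv ℝ (fun p : ℝ × ℝᵈ => φ p.1 p.2) p (0, Pi.single i 1)|
      ≤ η * |(-c)| := by
    have : Tendsto (fun c : ℝ => -c) (𝓝 0) (𝓝 0) := by simpa using (continuous_neg.tendsto (0 : ℝ))
    exact this.eventually h
  filter_upwards [h.filter_mono nhdsWithin_le_nhds, h'.filter_mono nhdsWithin_le_nhds,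
    self_mem_nhdsWithin] with c hc hc' hc0 p hp
  have hc0' : 0 < c := hc0
  have hs : ∀ a : ℝ, a • (Pi.single i 1 : ℝᵈ) = Pi.single i a := fun a => by
    rw [← Pi.single_smul, smul_eq_mul, mul_one]
  have h1 := hc p hp
  have h2 := hc' p hp
  rw [← hφ.dx_eq] at h1 h2
  simp only [Prod.fst_add, Prod.snd_add, Prod.smul_fst, Prod.smul_snd, smul_zero, add_zero,
    hs, abs_neg, abs_of_pos hc0', Pi.single_neg] at h1 h2
  constructor
  · have e1 : (φ p.1 (p.2 + Pi.single i c) - φ p.1 p.2) / c - dx i φ p.1 p.2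
        = (φ p.1 (p.2 + Pi.single i c) - φ p.1 p.2 - c * dx i φ p.1 p.2) / c := by field_simp
    rw [e1, abs_div, abs_of_pos hc0', div_le_iff₀ hc0']
    exact h1
  · have e1 : (φ p.1 p.2 - φ p.1 (p.2 + -Pi.single i c)) / c - dx i φ p.1 p.2
        = -((φ p.1 (p.2 + -Pi.single i c) - φ p.1 p.2 - -c * dx i φ p.1 p.2) / c) := by
      field_simp; ring
    rw [e1, abs_neg, abs_div, abs_of_pos hc0', div_le_iff₀ hc0']
    exact h2

end IsTest

end Test

/-! ### Discrete integration by parts against smooth functions -/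

namespace Mesh

variable {G : Mesh d L T}

lemma late_sub (r s : ℕ → Cell d → ℝ) (p : ℝ × ℝᵈ) :
    G.late (fun k K => r k K - s k K) p = G.late r p - G.late s p := by
  simp only [late, recon]; split_ifs <;> simp

lemma late_add (r s : ℕ → Cell d → ℝ) (p : ℝ × ℝᵈ) :
    G.late (fun k K => r k K + s k K) p = G.late r p + G.late s p := by
  simp only [late, recon]; split_ifs <;> simp

lemma late_const_mul (c : ℝ) (r : ℕ → Cell d → ℝ) (p : ℝ × ℝᵈ) :
    G.late (fun k K => c * r k K) p = c * G.late r p := by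
  simp only [late, recon]; split_ifs <;> simp

lemma late_sum {ι : Type*} (s : Finset ι) (r : ι → ℕ → Cell d → ℝ) (p : ℝ × ℝᵈ) :
    G.late (fun k K => ∑ i ∈ s, r i k K) p = ∑ i ∈ s, G.late (r i) p := by
  simp only [late, recon]; split_ifs <;> simp

lemma late_sub_e (r : ℕ → Cell d → ℝ) (i : Fin d) (p : ℝ × ℝᵈ) :
    G.late (fun k K => r k (K - e i)) p = G.late r (p.1, p.2 + -Pi.single i G.h) := by
  simp only [late, recon, cellOf_sub_e G.h_pos]

lemma late_add_e (r : ℕ → Cell d → ℝ) (i : Fin d) (p : ℝ × ℝᵈ) :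
    G.late (fun k K => r k (K + e i)) p = G.late r (p.1, p.2 + Pi.single i G.h) := by
  simp only [late, recon, cellOf_add_e G.h_pos]

lemma integral_late_divFlux_mul (hL : ∀ i, 0 < L i) {F : ℕ → Fin d → Cell d → ℝ}
    (hF : ∀ k < G.N, ∀ i, G.InQ (F k i)) {g : ℝ × ℝᵈ → ℝ} (hg : Admissible L T g) :
    ∫ p, G.late (fun k => divFlux G.h (F k)) p * g p ∂𝒬
      = -∑ i, ∫ p, G.late (fun k => F k i) p * ((g (p.1, p.2 + Pi.single i G.h) - g p) / G.h)
          ∂𝒬 := by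
  have ha : ∀ i, Admissible L T (G.late fun k => F k i) := fun i =>
    admissible_late hL fun k hk => hF k hk i
  have e1 : ∀ p, G.late (fun k => divFlux G.h (F k)) p * g p
      = ∑ i, 1 / G.h * (G.late (fun k => F k i) p * g p
          - G.late (fun k => F k i) (p.1, p.2 + -Pi.single i G.h) * g p) := by
    intro p
    have : G.late (fun k => divFlux G.h (F k)) p
        = 1 / G.h * ∑ i, (G.late (fun k => F k i) p - G.late (fun k K => F k i (K - e i)) p) := by
      change G.late (fun k K => 1 / G.h * ∑ i, (F k i K - F k i (K - e i))) p = _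
      rw [late_const_mul, late_sum (r := fun i k K => F k i K - F k i (K - e i))]
      simp only [late_sub]
    rw [this]
    simp only [late_sub_e, ← sub_mul, mul_sum, sum_mul, mul_assoc]
  simp only [e1]
  have hi1 : ∀ i, Integrable (fun p => G.late (fun k => F k i) p * g p) 𝒬 :=
    fun i => ((ha i).mul hg).integrable
  have hi2 : ∀ i, Integrable (fun p => G.late (fun k => F k i) (p.1, p.2 + -Pi.single i G.h) * g p)
      𝒬 := fun i => (((ha i).translate _).mul hg).integrable
  have hi3 : ∀ i, Integrable (fun p => 1 / G.h * (G.late (fun k => F k i) p * g p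
      - G.late (fun k => F k i) (p.1, p.2 + -Pi.single i G.h) * g p)) 𝒬 :=
    fun i => ((hi1 i).sub (hi2 i)).const_mul _
  rw [integral_finsetSum _ fun i _ => hi3 i, ← sum_neg_distrib]
  refine sum_congr rfl fun i _ => ?_
  rw [integral_const_mul, integral_sub (hi1 i) (hi2 i),
    (ha i).integral_translate_mul hL hg, neg_neg, ← integral_sub (hi1 i)
      ((ha i).mul (hg.translate _)).integrable, ← integral_const_mul, ← integral_neg]
  refine integral_congr_ae (.of_forall fun p => ?_)
  simp only
  ring

lemma integral_late_gradH_mul (hL : ∀ i, 0 < L i) {r : ℕ → Cell d → ℝ}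
    (hr : ∀ k < G.N, G.InQ (r k)) (i : Fin d) {g : ℝ × ℝᵈ → ℝ} (hg : Admissible L T g) :
    ∫ p, G.late (fun k => gradH G.h (r k) i) p * g p ∂𝒬
      = -∫ p, G.late r p * ((g (p.1, p.2 + Pi.single i G.h) - g (p.1, p.2 + -Pi.single i G.h))
          / (2 * G.h)) ∂𝒬 := by
  have ha : Admissible L T (G.late r) := admissible_late hL hr
  have e1 : ∀ p, G.late (fun k => gradH G.h (r k) i) p * g p
      = 1 / (2 * G.h) * (G.late r (p.1, p.2 + Pi.single i G.h) * g p
          - G.late r (p.1, p.2 + -Pi.single i G.h) * g p) := by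
    intro p
    have : G.late (fun k => gradH G.h (r k) i) p
        = 1 / (2 * G.h) * (G.late (fun k K => r k (K + e i)) p
          - G.late (fun k K => r k (K - e i)) p) := by
      rw [← late_sub, ← late_const_mul]
      congr 1
      funext k K
      rw [gradH_eq]; ring
    rw [this, late_sub_e, late_add_e]
    ring
  simp only [e1]
  rw [integral_const_mul, integral_sub ((ha.translate _).mul hg).integrable
    ((ha.translate _).mul hg).integrable, ha.integral_translate_mul hL hg,
    ha.integral_translate_mul hL hg, neg_neg, ← integral_sub (ha.mul (hg.translate _)).integrable
      (ha.mul (hg.translate _)).integrable, ← integral_const_mul, ← integral_neg]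
  refine integral_congr_ae (.of_forall fun p => ?_)
  simp only
  ring

/-- Shift by one time step, for functions that vanish at the final time. -/
lemma integral_late_pred_mul (hL : ∀ i, 0 < L i) {r : ℕ → Cell d → ℝ}
    (hr : ∀ k < G.N, G.InQ (r k)) {g : ℝ × ℝᵈ → ℝ} (hg : Continuous g)
    (hper : ∀ t, TorusPeriodic L fun x => g (t, x)) (hg0 : ∀ t x, T ≤ t → g (t, x) = 0) :
    ∫ p, G.late (fun k => r (k - 1)) p * g p ∂𝒬
      = ∫ p, G.recon r p.1 p.2 * g (p.1 + G.Δt, p.2) ∂𝒬 := by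
  have hΔ := G.Δt_pos
  have hg1 : Admissible L T fun p => g (p.1 + G.Δt, p.2) :=
    admissible_of_continuous hL (hg.comp (f := fun p : ℝ × ℝᵈ => (p.1 + G.Δt, p.2))
      (by fun_prop)) fun t x i => hper _ x i
  have hi1 := ((admissible_late (G := G) hL (r := fun k => r (k - 1)) fun k hk =>
    hr _ ((Nat.sub_le k 1).trans_lt hk)).mul
    (admissible_of_continuous (T := T) hL hg hper)).integrable
  have hi2 := ((admissible_recon hL hr).mul hg1).integrable
  rw [spaceTime_eq_prod] at hi1 hi2 ⊢
  rw [integral_prod _ hi1, integral_prod _ hi2]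
  set a : ℝ → ℝ := fun t => ∫ x in torus L, G.recon r t x * g (t + G.Δt, x) with ha
  set b : ℝ → ℝ := (Ioo 0 (T - G.Δt)).indicator a with hb
  have h2 : ∫ t in Ioo 0 T, a t = ∫ t, b t := by
    rw [← integral_indicator measurableSet_Ioo]
    refine integral_congr_ae ?_
    have hne : ∀ᵐ t ∂(volume : Measure ℝ), t ≠ T - G.Δt := by simp [ae_iff]
    filter_upwards [hne] with t ht
    by_cases h : t ∈ Ioo 0 (T - G.Δt)
    · rw [hb, indicator_of_mem h, indicator_of_mem (show t ∈ Ioo 0 T from ⟨h.1, by linarith [h.2]⟩)]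
    · rw [hb, indicator_of_notMem h]
      by_cases h' : t ∈ Ioo 0 T
      · rw [indicator_of_mem h', ha]
        have : T ≤ t + G.Δt := by
          by_contra hlt
          exact h ⟨h'.1, by linarith⟩
        simp [hg0 _ _ this]
      · rw [indicator_of_notMem h']
  have h1 : ∫ t in Ioo 0 T, ∫ x in torus L, G.late (fun k => r (k - 1)) (t, x) * g (t, x)
      = ∫ t, b (t - G.Δt) := by
    rw [← integral_indicator measurableSet_Ioo]
    refine integral_congr_ae ?_
    have hne : ∀ᵐ t ∂(volume : Measure ℝ), t ≠ G.Δt := by simp [ae_iff]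
    filter_upwards [hne] with t ht
    by_cases h : t - G.Δt ∈ Ioo 0 (T - G.Δt)
    · have hle : G.Δt ≤ t := by linarith [h.1]
      have hmem : t ∈ Ioo 0 T := ⟨by linarith, by linarith [h.2]⟩
      rw [hb, indicator_of_mem h, indicator_of_mem hmem]
      simp only [ha, late, hle, if_true, recon]
      have hfl : ⌊(t - G.Δt) / G.Δt⌋₊ = ⌊t / G.Δt⌋₊ - 1 := by
        rw [sub_div, div_self hΔ.ne', Nat.floor_sub_one]
      rw [hfl, sub_add_cancel]
    · rw [hb, indicator_of_notMem h]
      by_cases h' : t ∈ Ioo 0 T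
      · rw [indicator_of_mem h']
        have hlt : ¬ G.Δt ≤ t := fun hle =>
          h ⟨by have := lt_of_le_of_ne hle ht.symm; linarith, by linarith [h'.2]⟩
        simp [late, hlt]
      · rw [indicator_of_notMem h']
  rw [h1, h2, integral_sub_right_eq_self]

/-- Discrete integration by parts in time. -/
lemma integral_late_timeDiff_mul (hL : ∀ i, 0 < L i) {r : ℕ → Cell d → ℝ}
    (hr : ∀ k < G.N, G.InQ (r k)) {g : ℝ × ℝᵈ → ℝ} (hg : Continuous g)
    (hper : ∀ t, TorusPeriodic L fun x => g (t, x)) (hg0 : ∀ t x, T ≤ t → g (t, x) = 0) :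
    ∫ p, G.late (fun k K => (r k K - r (k - 1) K) / G.Δt) p * g p ∂𝒬
      = -(∫ p, G.recon r p.1 p.2 * ((g (p.1 + G.Δt, p.2) - g p) / G.Δt) ∂𝒬)
        - 1 / G.Δt * ∫ p, (G.recon r p.1 p.2 - G.late r p) * g p ∂𝒬 := by
  have hga : Admissible L T g := admissible_of_continuous hL hg hper
  have hg1 : Admissible L T fun p => g (p.1 + G.Δt, p.2) :=
    admissible_of_continuous hL (hg.comp (f := fun p : ℝ × ℝᵈ => (p.1 + G.Δt, p.2))
      (by fun_prop)) fun t x i => hper _ x i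
  have hrp : ∀ k < G.N, G.InQ (r (k - 1)) := fun k hk => hr _ ((Nat.sub_le k 1).trans_lt hk)
  have h := integral_late_pred_mul hL hr hg hper hg0
  have hl := (admissible_late hL hr).mul hga
  have hl' := (admissible_late (G := G) (r := fun k => r (k - 1)) hL hrp).mul hga
  have hr1 := (admissible_recon hL hr).mul hga
  have hr2 := (admissible_recon hL hr).mul hg1
  have e1 : ∀ p, G.late (fun k K => (r k K - r (k - 1) K) / G.Δt) p * g p
      = 1 / G.Δt * (G.late r p * g p - G.late (fun k => r (k - 1)) p * g p) := by
    intro p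
    simp only [late, recon]; split_ifs <;> ring
  have e2 : ∀ p : ℝ × ℝᵈ, G.recon r p.1 p.2 * ((g (p.1 + G.Δt, p.2) - g p) / G.Δt)
      = 1 / G.Δt * (G.recon r p.1 p.2 * g (p.1 + G.Δt, p.2) - G.recon r p.1 p.2 * g p) := by
    intro p; ring
  simp only [e1, e2, sub_mul]
  rw [integral_const_mul, integral_const_mul, integral_sub hl.integrable hl'.integrable,
    integral_sub hr2.integrable hr1.integrable, integral_sub hr1.integrable hl.integrable, h]
  ring

end Mesh

/-! ### Limits of the discrete differential operators in the sense of distributions -/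

section Limits

lemma tendsto_h {G : ℕ → Mesh d L T} (hG : Tendsto (fun n => (G n).h) atTop (𝓝 0)) :
    Tendsto (fun n => (G n).h) atTop (𝓝[>] 0) :=
  tendsto_nhdsWithin_iff.2 ⟨hG, .of_forall fun n => (G n).h_pos⟩

lemma tendsto_Δt {G : ℕ → Mesh d L T} (hΔ : Tendsto (fun n => (G n).Δt) atTop (𝓝 0)) :
    Tendsto (fun n => (G n).Δt) atTop (𝓝[>] 0) :=
  tendsto_nhdsWithin_iff.2 ⟨hΔ, .of_forall fun n => (G n).Δt_pos⟩

lemma Admissible.ae_bound {f : ℝ × ℝᵈ → ℝ} (hf : Admissible L T f) : ∃ C, ∀ᵐ p ∂𝒬, |f p| ≤ C := by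
  obtain ⟨C, hC⟩ := hf.bdd
  exact ⟨C, by filter_upwards [ae_spaceTime_mem L T] with p hp using hC p.1 hp p.2⟩

/-- Convergence against admissible weights that converge uniformly. -/
lemma WeakConv.tendsto_admissible {f : ℕ → ℝ × ℝᵈ → ℝ} {F : ℝ × ℝᵈ → ℝ}
    (h : WeakConv 𝒬 f F) {w : ℕ → ℝ × ℝᵈ → ℝ} {W : ℝ × ℝᵈ → ℝ}
    (hw : ∀ n, Admissible L T (w n)) (hW : Admissible L T W)
    (hwW : ∀ η > 0, ∀ᶠ n in atTop, ∀ p ∈ closedBox L T, |w n p - W p| ≤ η) :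
    Tendsto (fun n => ∫ p, f n p * w n p ∂𝒬) atTop
      (𝓝 (∫ p, F p * W p ∂𝒬)) :=
  h.tendsto_of_uniform (fun n => (hw n).meas.aestronglyMeasurable) (fun n => (hw n).ae_bound)
    hW.meas.aestronglyMeasurable hW.ae_bound fun η hη => (hwW η hη).mono fun n hn => by
      filter_upwards [ae_spaceTime_mem_closedBox L T] with p hp using hn p hp

variable {G : ℕ → Mesh d L T}

lemma tendsto_divFlux (hL : ∀ i, 0 < L i) (hG : Tendsto (fun n => (G n).h) atTop (𝓝 0))
    {F : ℕ → ℕ → Fin d → Cell d → ℝ} (hF : ∀ n, ∀ k < (G n).N, ∀ i, (G n).InQ (F n k i))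
    {Fl : Fin d → ℝ × ℝᵈ → ℝ}
    (hconv : ∀ i, WeakConv 𝒬 (fun n => (G n).late fun k => F n k i) (Fl i))
    {φ : ℝ → ℝᵈ → ℝ} (hφ : IsTest L φ) :
    Tendsto (fun n => ∫ p, (G n).late (fun k => divFlux (G n).h (F n k)) p * φ p.1 p.2 ∂𝒬) atTop
      (𝓝 (-∑ i, ∫ p, Fl i p * dx i φ p.1 p.2 ∂𝒬)) := by
  simp only [Mesh.integral_late_divFlux_mul hL (hF _) (hφ.admissible hL)]
  refine (tendsto_finsetSum _ fun i _ => ?_).neg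
  refine (hconv i).tendsto_admissible
    (fun n => (((hφ.admissible hL).translate _).sub (hφ.admissible hL)).div_const _)
    (hφ.admissible_dx hL i) fun η hη => ?_
  filter_upwards [(tendsto_h hG).eventually (hφ.eventually_quotient_dx i hη)] with n hn p hp
  exact (hn p hp).1

/-- The discrete gradient converges to the distributional gradient. -/
lemma tendsto_gradH (hL : ∀ i, 0 < L i) (hG : Tendsto (fun n => (G n).h) atTop (𝓝 0))
    {r : ℕ → ℕ → Cell d → ℝ} (hr : ∀ n, ∀ k < (G n).N, (G n).InQ (r n k))
    {R : ℝ × ℝᵈ → ℝ} (hconv : WeakConv 𝒬 (fun n => (G n).late (r n)) R)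
    (i : Fin d) {φ : ℝ → ℝᵈ → ℝ} (hφ : IsTest L φ) :
    Tendsto (fun n => ∫ p, (G n).late (fun k => gradH (G n).h (r n k) i) p * φ p.1 p.2
        ∂𝒬) atTop (𝓝 (-∫ p, R p * dx i φ p.1 p.2 ∂𝒬)) := by
  simp only [Mesh.integral_late_gradH_mul hL (hr _) i (hφ.admissible hL)]
  refine (hconv.tendsto_admissible
    (fun n => (((hφ.admissible hL).translate _).sub ((hφ.admissible hL).translate _)).div_const _)
    (hφ.admissible_dx hL i) fun η hη => ?_).neg
  filter_upwards [(tendsto_h hG).eventually (hφ.eventually_quotient_dx i hη)] with n hn p hp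
  obtain ⟨h1, h2⟩ := hn p hp
  have h0 := (G n).h_pos
  have e1 : (φ p.1 (p.2 + Pi.single i (G n).h) - φ p.1 (p.2 + -Pi.single i (G n).h))
        / (2 * (G n).h) - dx i φ p.1 p.2
      = (((φ p.1 (p.2 + Pi.single i (G n).h) - φ p.1 p.2) / (G n).h - dx i φ p.1 p.2)
        + ((φ p.1 p.2 - φ p.1 (p.2 + -Pi.single i (G n).h)) / (G n).h - dx i φ p.1 p.2)) / 2 := by
    field_simp; ring
  rw [e1, abs_div, abs_two, div_le_iff₀ two_pos]
  exact (abs_add_le _ _).trans (by linarith)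

lemma Mesh.Δt_le (G : Mesh d L T) (hT : 0 < T) : G.Δt ≤ T := by
  have hN : 1 ≤ G.N := by
    by_contra h
    have h0 : G.N = 0 := by omega
    have := G.steps_fit
    rw [h0] at this
    simp only [Nat.cast_zero, zero_mul] at this
    linarith
  calc G.Δt = 1 * G.Δt := (one_mul _).symm
    _ ≤ G.N * G.Δt := by exact mul_le_mul_of_nonneg_right (by exact_mod_cast hN) G.Δt_pos.le
    _ = T := G.steps_fit

/-- The part of the initial time layer in the discrete integration by parts converges to the
integral over the initial time. -/
lemma tendsto_initial_layer (hL : ∀ i, 0 < L i) (hT : 0 < T)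
    (hΔ : Tendsto (fun n => (G n).Δt) atTop (𝓝 0))
    {r : ℕ → ℕ → Cell d → ℝ} (hr : ∀ n, ∀ k < (G n).N, (G n).InQ (r n k))
    {r₀ : ℝᵈ → ℝ} (hr₀ : IntegrableOn r₀ (torus L))
    (hinit : Tendsto (fun n => ∫ x in torus L, |r n 0 (cellOf (G n).h x) - r₀ x|) atTop (𝓝 0))
    {φ : ℝ → ℝᵈ → ℝ} (hφ : IsTest L φ) :
    Tendsto (fun n => 1 / (G n).Δt * ∫ p, ((G n).recon (r n) p.1 p.2 - (G n).late (r n) p)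
        * φ p.1 p.2 ∂𝒬) atTop (𝓝 (∫ x in torus L, r₀ x * φ 0 x)) := by
  obtain ⟨C, hC⟩ := (isCompact_closedBox L T).exists_bound_of_continuousOn
    hφ.continuous_uncurry.continuousOn
  have huc := (isCompact_closedBox L T).uniformContinuousOn_of_continuous
    hφ.continuous_uncurry.continuousOn
  rw [Metric.uniformContinuousOn_iff] at huc
  rw [Metric.tendsto_nhds]
  intro η hη
  set A := ∫ x in torus L, |r₀ x| with hA
  have hA0 : 0 ≤ A := integral_nonneg fun x => abs_nonneg _
  obtain ⟨δ, hδ, hδ'⟩ := huc (η / (4 * (A + 1))) (by positivity)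
  have hev1 : ∀ᶠ n in atTop, |C| * ∫ x in torus L, |r n 0 (cellOf (G n).h x) - r₀ x| < η / 4 :=
    (hinit.const_mul |C|).eventually (gt_mem_nhds (by rw [mul_zero]; positivity))
  filter_upwards [hev1, hΔ.eventually (gt_mem_nhds hδ)] with n hn1 hn2
  have hΔ0 := (G n).Δt_pos
  have hΔT := (G n).Δt_le hT
  have hφs : ∀ t, AEStronglyMeasurable (fun x => φ t x) (volume.restrict (torus L)) := fun t =>
    (hφ.continuous_uncurry.comp (f := fun x : ℝᵈ => (t, x))
      (by fun_prop)).aestronglyMeasurable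
  have hφC : ∀ t ∈ Icc 0 T, ∀ᵐ x ∂(volume.restrict (torus L)), |φ t x| ≤ |C| := by
    intro t ht
    filter_upwards [ae_torus_mem L] with x hx
    exact (hC (t, x) ⟨ht, torus_subset_Icc L hx⟩).trans (le_abs_self C)
  set c : ℝ → ℝ := fun t => ∫ x in torus L, r n 0 (cellOf (G n).h x) * φ t x with hc
  set c₀ := ∫ x in torus L, r₀ x * φ 0 x with hc₀
  have hri : Integrable (fun x => r n 0 (cellOf (G n).h x)) (volume.restrict (torus L)) :=
    (G n).integrableOn_cellOf _
  have hclose : ∀ t ∈ Ioo 0 (G n).Δt, |c t - c₀| ≤ η / 2 := by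
    intro t ht
    have htT : t ∈ Icc 0 T := ⟨ht.1.le, ht.2.le.trans hΔT⟩
    have h0T : (0 : ℝ) ∈ Icc 0 T := ⟨le_rfl, hT.le⟩
    have hd1 : Integrable (fun x => (r n 0 (cellOf (G n).h x) - r₀ x))
        (volume.restrict (torus L)) :=
      hri.sub hr₀
    have hd2 : AEStronglyMeasurable (fun x => φ t x - φ 0 x) (volume.restrict (torus L)) :=
      (hφs t).sub (hφs 0)
    have hd3 : ∀ᵐ x ∂(volume.restrict (torus L)), |φ t x - φ 0 x| ≤ η / (4 * (A + 1)) := by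
      filter_upwards [ae_torus_mem L] with x hx
      refine (hδ' (t, x) ⟨htT, torus_subset_Icc L hx⟩ (0, x) ⟨h0T, torus_subset_Icc L hx⟩ ?_).le
      rw [Prod.dist_eq, dist_self, Real.dist_eq, sub_zero, abs_of_pos ht.1]
      exact max_lt (ht.2.trans hn2) hδ
    have e1 : c t - c₀ = (∫ x in torus L, (r n 0 (cellOf (G n).h x) - r₀ x) * φ t x)
        + ∫ x in torus L, r₀ x * (φ t x - φ 0 x) := by
      rw [hc, hc₀, ← integral_sub (integrable_mul_of_bound hri _ (hφs t) (hφC t htT))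
        (integrable_mul_of_bound hr₀ _ (hφs 0) (hφC 0 h0T)),
        ← integral_add (integrable_mul_of_bound hd1 _ (hφs t) (hφC t htT))
        (integrable_mul_of_bound hr₀ _ hd2 hd3)]
      refine integral_congr_ae (.of_forall fun x => ?_)
      simp only
      ring
    rw [e1]
    refine (abs_add_le _ _).trans ?_
    have h1 := abs_integral_mul_le hd1 (hφC t htT)
    have h2 := abs_integral_mul_le hr₀ hd3
    have h3 : η / (4 * (A + 1)) * A ≤ η / 4 := by
      rw [div_mul_eq_mul_div, div_le_div_iff₀ (by positivity) (by norm_num)]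
      nlinarith
    linarith
  have hfa := (((Mesh.admissible_recon hL (hr n)).sub (Mesh.admissible_late hL (hr n))).mul
    (hφ.admissible (T := T) hL)).integrable
  rw [spaceTime_eq_prod] at hfa ⊢
  rw [integral_prod _ hfa]
  have hslice : ∀ t ∈ Ioo 0 T, ∫ x in torus L, ((G n).recon (r n) t x - (G n).late (r n) (t, x))
      * φ t x = (Ioo 0 (G n).Δt).indicator c t := by
    intro t ht
    by_cases h : t < (G n).Δt
    · have hfl : ⌊t / (G n).Δt⌋₊ = 0 := by rw [Nat.floor_eq_zero, div_lt_iff₀ hΔ0, one_mul]; exact h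
      rw [indicator_of_mem (show t ∈ Ioo 0 (G n).Δt from ⟨ht.1, h⟩)]
      simp only [Mesh.late, not_le.2 h, if_false, sub_zero, Mesh.recon, hfl, hc]
    · rw [indicator_of_notMem fun h' => h h'.2]
      simp [Mesh.late, not_lt.1 h]
  have hci : IntegrableOn c (Ioo 0 (G n).Δt) := by
    have h1 := hfa.integral_prod_left
    have h2 : IntegrableOn ((Ioo 0 (G n).Δt).indicator c) (Ioo 0 T) :=
      IntegrableOn.congr_fun h1 hslice measurableSet_Ioo
    have h3 : IntegrableOn ((Ioo 0 (G n).Δt).indicator c) (Ioo 0 (G n).Δt) :=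
      h2.mono_set (Ioo_subset_Ioo_right hΔT)
    exact h3.congr_fun (fun t ht => indicator_of_mem ht c) measurableSet_Ioo
  rw [setIntegral_congr_fun measurableSet_Ioo hslice, setIntegral_indicator measurableSet_Ioo,
    inter_eq_self_of_subset_right (Ioo_subset_Ioo_right hΔT), Real.dist_eq]
  have hvol : volume.real (Ioo 0 (G n).Δt) = (G n).Δt := by
    rw [Measure.real, Real.volume_Ioo, sub_zero, ENNReal.toReal_ofReal hΔ0.le]
  have e2 : 1 / (G n).Δt * (∫ t in Ioo 0 (G n).Δt, c t) - c₀
      = 1 / (G n).Δt * ∫ t in Ioo 0 (G n).Δt, (c t - c₀) := by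
    have hk : IntegrableOn (fun _ : ℝ => c₀) (Ioo 0 (G n).Δt) := integrableOn_const (by simp)
    rw [integral_sub hci hk, setIntegral_const, hvol, smul_eq_mul]
    field_simp
  rw [e2, abs_mul, abs_of_pos (by positivity)]
  have h4 := norm_setIntegral_le_of_norm_le_const (μ := volume) (s := Ioo 0 (G n).Δt)
    (f := fun t => c t - c₀) (C := η / 2) (by simp) hclose
  rw [hvol, Real.norm_eq_abs] at h4
  calc 1 / (G n).Δt * |∫ t in Ioo 0 (G n).Δt, (c t - c₀)|
      ≤ 1 / (G n).Δt * (η / 2 * (G n).Δt) := mul_le_mul_of_nonneg_left h4 (by positivity)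
    _ = η / 2 := by field_simp
    _ < η := by linarith

/-- The discrete time derivative converges to the distributional one. Test functions vanish at the
final time, so that the only boundary term is at the initial time. -/
lemma tendsto_timeDiff (hL : ∀ i, 0 < L i) (hT : 0 < T)
    (hΔ : Tendsto (fun n => (G n).Δt) atTop (𝓝 0))
    {r : ℕ → ℕ → Cell d → ℝ} (hr : ∀ n, ∀ k < (G n).N, (G n).InQ (r n k))
    {R : ℝ × ℝᵈ → ℝ}
    (hconv : WeakConv 𝒬 (fun n p => (G n).recon (r n) p.1 p.2) R)
    {r₀ : ℝᵈ → ℝ} (hr₀ : IntegrableOn r₀ (torus L))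
    (hinit : Tendsto (fun n => ∫ x in torus L, |r n 0 (cellOf (G n).h x) - r₀ x|) atTop (𝓝 0))
    {φ : ℝ → ℝᵈ → ℝ} (hφ : IsTest L φ) (hφT : ∀ t x, T ≤ t → φ t x = 0) :
    Tendsto (fun n => ∫ p, (G n).late (fun k K => (r n k K - r n (k - 1) K) / (G n).Δt) p
        * φ p.1 p.2 ∂𝒬) atTop
      (𝓝 (-(∫ p, R p * dt φ p.1 p.2 ∂𝒬) - ∫ x in torus L, r₀ x * φ 0 x)) := by
  have e1 := fun n => Mesh.integral_late_timeDiff_mul hL (hr n) hφ.continuous_uncurry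
    (fun t x i => hφ.2 t x i) hφT
  simp only [e1]
  refine Tendsto.sub (Tendsto.neg ?_) (tendsto_initial_layer hL hT hΔ hr hr₀ hinit hφ)
  refine hconv.tendsto_admissible
    (fun n => ((hφ.admissible_shift hL _).sub (hφ.admissible hL)).div_const _)
    (hφ.admissible_dt hL) fun η hη => ?_
  filter_upwards [(tendsto_Δt hΔ).eventually (hφ.eventually_quotient_dt hη)] with n hn p hp
  exact hn p hp

/-- The initial time step is negligible. -/
lemma tendsto_recon_sub_late (hL : ∀ i, 0 < L i) (hT : 0 < T)
    (hΔ : Tendsto (fun n => (G n).Δt) atTop (𝓝 0))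
    {r : ℕ → ℕ → Cell d → ℝ} (hr : ∀ n, ∀ k < (G n).N, (G n).InQ (r n k)) {C : ℝ}
    (hC : ∀ n, (G n).intCells (fun K => |r n 0 K|) ≤ C) :
    Tendsto (fun n => ∫ p, |(G n).recon (r n) p.1 p.2 - (G n).late (r n) p| ∂𝒬)
      atTop (𝓝 0) := by
  have hle : ∀ n, ∫ p, |(G n).recon (r n) p.1 p.2 - (G n).late (r n) p| ∂𝒬 ≤ C * (G n).Δt := by
    intro n
    have hΔ0 := (G n).Δt_pos
    have hΔT := (G n).Δt_le hT
    have hfa := ((Mesh.admissible_recon hL (hr n)).sub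
      (Mesh.admissible_late hL (hr n))).abs.integrable
    rw [spaceTime_eq_prod] at hfa ⊢
    rw [integral_prod _ hfa]
    have hslice : ∀ t ∈ Ioo 0 T, ∫ x in torus L, |(G n).recon (r n) t x - (G n).late (r n) (t, x)|
        = (Ioo 0 (G n).Δt).indicator (fun _ => (G n).intCells (fun K => |r n 0 K|)) t := by
      intro t ht
      by_cases h : t < (G n).Δt
      · have hfl : ⌊t / (G n).Δt⌋₊ = 0 := by
          rw [Nat.floor_eq_zero, div_lt_iff₀ hΔ0, one_mul]; exact h
        rw [indicator_of_mem (show t ∈ Ioo 0 (G n).Δt from ⟨ht.1, h⟩)]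
        simp only [Mesh.late, not_le.2 h, if_false, sub_zero, Mesh.recon, hfl]
        exact (G n).integral_cellOf fun K => |r n 0 K|
      · rw [indicator_of_notMem fun h' => h h'.2]
        simp [Mesh.late, not_lt.1 h]
    have hvol : volume.real (Ioo 0 (G n).Δt) = (G n).Δt := by
      rw [Measure.real, Real.volume_Ioo, sub_zero, ENNReal.toReal_ofReal hΔ0.le]
    rw [setIntegral_congr_fun measurableSet_Ioo hslice, setIntegral_indicator measurableSet_Ioo,
      inter_eq_self_of_subset_right (Ioo_subset_Ioo_right hΔT), setIntegral_const, hvol,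
      smul_eq_mul, mul_comm]
    exact mul_le_mul_of_nonneg_right (hC n) hΔ0.le
  refine squeeze_zero (fun n => integral_nonneg fun p => abs_nonneg _) hle ?_
  simpa using hΔ.const_mul C

end Limits

/-! ### Convergence of the discrete initial data -/

/-- A sequence that is bounded in `L²` and converges to zero almost everywhere converges to zero
in `L¹`. -/
lemma tendsto_integral_abs_of_sq_bound {X : Type*} [MeasurableSpace X] {m : Measure X}
    [IsFiniteMeasure m] {f : ℕ → X → ℝ} (hm : ∀ n, AEStronglyMeasurable (f n) m)
    (hi : ∀ n, Integrable (fun x => f n x ^ 2) m) {C : ℝ} (hC : ∀ n, ∫ x, f n x ^ 2 ∂m ≤ C)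
    (hf : ∀ᵐ x ∂m, Tendsto (fun n => f n x) atTop (𝓝 0)) :
    Tendsto (fun n => ∫ x, |f n x| ∂m) atTop (𝓝 0) := by
  have hC0 : 0 ≤ C := (integral_nonneg fun x => sq_nonneg _).trans (hC 0)
  rw [Metric.tendsto_nhds]
  intro η hη
  set R := 2 * (C + 1) / η with hR
  have hR0 : 0 < R := by positivity
  have hmin : Tendsto (fun n => ∫ x, min |f n x| R ∂m) atTop (𝓝 (∫ _, (0 : ℝ) ∂m)) := by
    refine tendsto_integral_of_dominated_convergence (fun _ => R)
      (fun n => (hm n).norm.inf aestronglyMeasurable_const) (integrable_const R)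
      (fun n => .of_forall fun x => ?_) ?_
    · rw [Real.norm_eq_abs, abs_of_nonneg (le_min (abs_nonneg _) hR0.le)]
      exact min_le_right _ _
    · filter_upwards [hf] with x hx
      have := (hx.abs).min (tendsto_const_nhds (x := R))
      simpa [hR0.le] using this
  rw [integral_zero] at hmin
  filter_upwards [hmin.eventually (gt_mem_nhds (half_pos hη))] with n hn
  have hmi : Integrable (fun x => min |f n x| R) m :=
    Integrable.of_bound ((hm n).norm.inf aestronglyMeasurable_const) R
      (.of_forall fun x => by
        rw [Real.norm_eq_abs, abs_of_nonneg (le_min (abs_nonneg _) hR0.le)]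
        exact min_le_right _ _)
  rw [Real.dist_eq, sub_zero, abs_of_nonneg (integral_nonneg fun x => abs_nonneg _)]
  have h1 : ∫ x, |f n x| ∂m ≤ ∫ x, (min |f n x| R + 1 / R * f n x ^ 2) ∂m := by
    refine integral_mono_of_nonneg (.of_forall fun x => abs_nonneg _)
      (hmi.add ((hi n).const_mul _)) (.of_forall fun x => ?_)
    simp only
    rcases le_total |f n x| R with h | h
    · rw [min_eq_left h]
      have : 0 ≤ 1 / R * f n x ^ 2 := by positivity
      linarith
    · rw [min_eq_right h, ← sq_abs, one_div, inv_mul_eq_div]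
      have : |f n x| ≤ |f n x| ^ 2 / R := by
        rw [le_div_iff₀ hR0, sq]
        exact mul_le_mul_of_nonneg_left h (abs_nonneg _)
      linarith
  rw [integral_add hmi ((hi n).const_mul _), integral_const_mul] at h1
  have h2 : 1 / R * ∫ x, f n x ^ 2 ∂m ≤ 1 / R * C :=
    mul_le_mul_of_nonneg_left (hC n) (by positivity)
  have h3 : 1 / R * C < η / 2 := by
    rw [hR, one_div_div, div_mul_eq_mul_div, div_lt_div_iff₀ (by positivity) two_pos]
    nlinarith
  linarith

section Initial

namespace Mesh

variable {G : Mesh d L T}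

lemma cellSet_subset_torus {K : Cell d} (hK : K ∈ G.cells) : cellSet G.h K ⊆ torus L := by
  rw [G.torus_eq_biUnion]
  exact Set.subset_biUnion_of_mem (u := fun K => cellSet G.h K) hK

lemma integral_cellSet {f : ℝᵈ → ℝ} (K : Cell d) :
    ∫ x in cellSet G.h K, f x = G.h ^ d * G.proj f K := by
  have := G.h_pos
  rw [proj]
  field_simp

/-- Jensen's inequality for the cell averages, weighted by a cellwise constant function. -/
lemma integral_mul_proj_sq_le {a : Cell d → ℝ} (ha : ∀ K ∈ G.cells, 0 ≤ a K)
    {f : ℝᵈ → ℝ} (hf : IntegrableOn f (torus L))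
    (hf2 : IntegrableOn (fun x => f x ^ 2) (torus L)) :
    G.intCells (fun K => a K * G.proj f K ^ 2) ≤ ∫ x in torus L, a (cellOf G.h x) * f x ^ 2 := by
  have hi : IntegrableOn (fun x => a (cellOf G.h x) * f x ^ 2) (torus L) := by
    have h1 : ∀ᵐ x ∂(volume.restrict (torus L)), |a (cellOf G.h x)| ≤ ∑ K ∈ G.cells, |a K| := by
      filter_upwards [ae_torus_mem L] with x hx
      exact single_le_sum (f := fun K => |a K|) (fun J _ => abs_nonneg _)
        (cellOf_mem_cells.2 hx)
    have h2 := integrable_mul_of_bound hf2 _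
      ((measurable_of_countable a).comp (measurable_cellOf G.h)).aestronglyMeasurable h1
    exact h2.congr (.of_forall fun x => mul_comm _ _)
  rw [integral_torus_eq_sum hi, intCells, mul_sum]
  refine sum_le_sum fun K hK => ?_
  have hsub := cellSet_subset_torus hK
  have e1 : ∫ x in cellSet G.h K, a (cellOf G.h x) * f x ^ 2
      = a K * ∫ x in cellSet G.h K, f x ^ 2 := by
    rw [← integral_const_mul]
    refine setIntegral_congr_fun (measurableSet_cellSet _ _) fun x hx => ?_
    simp only [(mem_cellSet G.h_pos).1 hx]
  rw [e1]
  set c := G.proj f K with hc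
  have hfK := hf.mono_set hsub
  have hf2K := hf2.mono_set hsub
  have hconst : IntegrableOn (fun _ : ℝᵈ => c ^ 2) (cellSet G.h K) :=
    integrableOn_const (by rw [volume_cellSet]; exact ENNReal.ofReal_ne_top)
  have h0 : 0 ≤ ∫ x in cellSet G.h K, (f x - c) ^ 2 := integral_nonneg fun x => sq_nonneg _
  have e2 : ∫ x in cellSet G.h K, (f x - c) ^ 2
      = (∫ x in cellSet G.h K, f x ^ 2) - 2 * c * (∫ x in cellSet G.h K, f x)
        + ∫ _ in cellSet G.h K, c ^ 2 := by
    have h1 : Integrable (fun x => f x ^ 2 - 2 * c * f x) (volume.restrict (cellSet G.h K)) :=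
      hf2K.sub (hfK.const_mul _)
    rw [← integral_const_mul, ← integral_sub hf2K (hfK.const_mul _), ← integral_add h1 hconst]
    refine integral_congr_ae (.of_forall fun x => ?_)
    simp only
    ring
  rw [e2, integral_cellSet (f := f), integral_cellSet_const, ← hc] at h0
  have h3 : G.h ^ d * c ^ 2 ≤ ∫ x in cellSet G.h K, f x ^ 2 := by nlinarith
  have := mul_le_mul_of_nonneg_left h3 (ha K hK)
  linarith

lemma measurable_comp_cellOf (r : Cell d → ℝ) : Measurable fun x : ℝᵈ => r (cellOf G.h x) :=
  (measurable_of_countable r).comp (measurable_cellOf G.h)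

end Mesh

variable {G : ℕ → Mesh d L T}

/-- Lebesgue's differentiation theorem for the cell averages. -/
lemma ae_tendsto_proj (hG : Tendsto (fun n => (G n).h) atTop (𝓝 0)) {f : ℝᵈ → ℝ}
    (hf : IntegrableOn f (torus L)) :
    ∀ᵐ x ∂(volume.restrict (torus L)),
      Tendsto (fun n => (G n).proj f (cellOf (G n).h x)) atTop (𝓝 (f x)) := by
  set F := (torus L).indicator f with hF
  have hFi : Integrable F := (integrable_indicator_iff (measurableSet_torus L)).2 hf
  have h := IsUnifLocDoublingMeasure.ae_tendsto_average volume hFi.locallyIntegrable 1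
  rw [ae_restrict_iff' (measurableSet_torus L)]
  filter_upwards [h] with x hx hxt
  have hx' := hx (l := atTop)
    (fun n (i : Fin d) => ((cellOf (G n).h x i : ℝ) + 1 / 2) * (G n).h) (fun n => (G n).h / 2) ?_ ?_
  · have e1 : F x = f x := indicator_of_mem hxt f
    rw [e1] at hx'
    refine hx'.congr fun n => ?_
    have h0 := (G n).h_pos
    set K := cellOf (G n).h x with hK
    have hball : Metric.closedBall (fun i : Fin d => ((K i : ℝ) + 1 / 2) * (G n).h) ((G n).h / 2)
        =ᵐ[volume] cellSet (G n).h K := by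
      rw [closedBall_pi _ (by positivity)]
      have : ∀ i : Fin d, Metric.closedBall (((K i : ℝ) + 1 / 2) * (G n).h) ((G n).h / 2)
          = Icc ((K i : ℝ) * (G n).h) (((K i : ℝ) + 1) * (G n).h) := fun i => by
        rw [Real.closedBall_eq_Icc]; congr 1 <;> ring
      simp only [this]
      rw [Set.pi_univ_Icc]
      exact Measure.univ_pi_Ico_ae_eq_Icc.symm
    rw [setAverage_congr hball, setAverage_eq, Measure.real, Mesh.volume_cellSet,
      ENNReal.toReal_ofReal (by positivity), smul_eq_mul, Mesh.proj, one_div]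
    congr 1
    refine setIntegral_congr_fun (Mesh.measurableSet_cellSet _ _) fun y hy => ?_
    exact indicator_of_mem (Mesh.cellSet_subset_torus (Mesh.cellOf_mem_cells.2 hxt) hy) f
  · refine tendsto_nhdsWithin_iff.2 ⟨by simpa using hG.div_const 2, .of_forall fun n => ?_⟩
    exact half_pos (G n).h_pos
  · refine .of_forall fun n => ?_
    have h0 := (G n).h_pos
    rw [one_mul, closedBall_pi _ (by positivity), Set.mem_univ_pi]
    intro i
    have h1 := Int.floor_le (x i / (G n).h)
    have h2 := Int.lt_floor_add_one (x i / (G n).h)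
    rw [le_div_iff₀ h0] at h1
    rw [div_lt_iff₀ h0] at h2
    rw [Real.closedBall_eq_Icc]
    constructor
    · change (((⌊x i / (G n).h⌋ : ℤ) : ℝ) + 1 / 2) * (G n).h - (G n).h / 2 ≤ x i
      linarith
    · change x i ≤ (((⌊x i / (G n).h⌋ : ℤ) : ℝ) + 1 / 2) * (G n).h + (G n).h / 2
      linarith

/-- Cellwise bounds on the averages are inherited by the function. -/
lemma ae_bounds_of_proj (hG : Tendsto (fun n => (G n).h) atTop (𝓝 0)) {f : ℝᵈ → ℝ}
    (hf : IntegrableOn f (torus L)) {a b : ℝ}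
    (hab : ∀ n, ∀ K ∈ (G n).cells, a ≤ (G n).proj f K ∧ (G n).proj f K ≤ b) :
    ∀ᵐ x ∂(volume.restrict (torus L)), a ≤ f x ∧ f x ≤ b := by
  filter_upwards [ae_tendsto_proj hG hf, ae_torus_mem L] with x hx hxt
  exact ⟨ge_of_tendsto hx (.of_forall fun n => (hab n _ (Mesh.cellOf_mem_cells.2 hxt)).1),
    le_of_tendsto hx (.of_forall fun n => (hab n _ (Mesh.cellOf_mem_cells.2 hxt)).2)⟩

/-- A bound on the `L²` norms of the averages is inherited by the function. -/
lemma integrableOn_sq_of_proj (hG : Tendsto (fun n => (G n).h) atTop (𝓝 0)) {f : ℝᵈ → ℝ}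
    (hf : IntegrableOn f (torus L)) {C : ℝ}
    (hC : ∀ n, (G n).intCells (fun K => (G n).proj f K ^ 2) ≤ C) :
    IntegrableOn (fun x => f x ^ 2) (torus L) := by
  refine ⟨hf.aestronglyMeasurable.pow 2, ?_⟩
  set g : ℕ → ℝᵈ → ENNReal := fun n x =>
    ENNReal.ofReal ((G n).proj f (cellOf (G n).h x) ^ 2) with hg
  have h1 : ∀ n, ∫⁻ x in torus L, g n x ≤ ENNReal.ofReal C := by
    intro n
    rw [hg, ← ofReal_integral_eq_lintegral_ofReal
      ((G n).integrableOn_cellOf fun K => (G n).proj f K ^ 2)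
      (.of_forall fun x => sq_nonneg _)]
    refine ENNReal.ofReal_le_ofReal ?_
    rw [(G n).integral_cellOf fun K => (G n).proj f K ^ 2]
    exact hC n
  have h2 : ∫⁻ x in torus L, ‖f x ^ 2‖ₑ ≤ liminf (fun n => ∫⁻ x in torus L, g n x) atTop := by
    refine le_trans (le_of_eq ?_) (lintegral_liminf_le fun n =>
      ENNReal.measurable_ofReal.comp ((Mesh.measurable_comp_cellOf (G := G n) _).pow_const 2))
    refine lintegral_congr_ae ?_
    filter_upwards [ae_tendsto_proj hG hf] with x hx
    have : Tendsto (fun n => g n x) atTop (𝓝 ‖f x ^ 2‖ₑ) := by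
      rw [← ofReal_norm, Real.norm_eq_abs, abs_of_nonneg (sq_nonneg _)]
      exact ENNReal.tendsto_ofReal (hx.pow 2)
    exact this.liminf_eq.symm
  refine lt_of_le_of_lt (b := ENNReal.ofReal C) (h2.trans (liminf_le_of_le (h := fun b hb => ?_)))
    ENNReal.ofReal_lt_top
  obtain ⟨n, hn⟩ := hb.exists
  exact hn.trans (h1 n)

/-- Convergence of bounded continuous functions of the averages. -/
lemma tendsto_integral_comp_proj (hG : Tendsto (fun n => (G n).h) atTop (𝓝 0))
    {ρ₀ θ₀ : ℝᵈ → ℝ} (hρ₀ : IntegrableOn ρ₀ (torus L)) (hθ₀ : IntegrableOn θ₀ (torus L))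
    {ρlo ρhi θlo θhi : ℝ}
    (hρ : ∀ n, ∀ K ∈ (G n).cells, ρlo ≤ (G n).proj ρ₀ K ∧ (G n).proj ρ₀ K ≤ ρhi)
    (hθ : ∀ n, ∀ K ∈ (G n).cells, θlo ≤ (G n).proj θ₀ K ∧ (G n).proj θ₀ K ≤ θhi)
    {H : ℝ → ℝ → ℝ}
    (hH : ContinuousOn (fun z : ℝ × ℝ => H z.1 z.2) (Icc ρlo ρhi ×ˢ Icc θlo θhi)) {C : ℝ}
    (hC : ∀ r ∈ Icc ρlo ρhi, ∀ t ∈ Icc θlo θhi, |H r t| ≤ C) :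
    IntegrableOn (fun x => H (ρ₀ x) (θ₀ x)) (torus L) ∧
    Tendsto (fun n => ∫ x in torus L, |H ((G n).proj ρ₀ (cellOf (G n).h x))
      ((G n).proj θ₀ (cellOf (G n).h x)) - H (ρ₀ x) (θ₀ x)|) atTop (𝓝 0) := by
  have hbρ := ae_bounds_of_proj hG hρ₀ hρ
  have hbθ := ae_bounds_of_proj hG hθ₀ hθ
  have hconv : ∀ᵐ x ∂(volume.restrict (torus L)),
      Tendsto (fun n => H ((G n).proj ρ₀ (cellOf (G n).h x))
        ((G n).proj θ₀ (cellOf (G n).h x))) atTop (𝓝 (H (ρ₀ x) (θ₀ x))) := by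
    filter_upwards [ae_tendsto_proj hG hρ₀, ae_tendsto_proj hG hθ₀, hbρ, hbθ,
      ae_torus_mem L] with x h1 h2 h3 h4 hx
    have h5 := hH (ρ₀ x, θ₀ x) ⟨h3, h4⟩
    refine h5.tendsto.comp (tendsto_nhdsWithin_iff.2 ⟨h1.prodMk_nhds h2,
      .of_forall fun n => ⟨hρ n _ (Mesh.cellOf_mem_cells.2 hx),
        hθ n _ (Mesh.cellOf_mem_cells.2 hx)⟩⟩)
  have hmeas : ∀ n, AEStronglyMeasurable (fun x => H ((G n).proj ρ₀ (cellOf (G n).h x))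
      ((G n).proj θ₀ (cellOf (G n).h x))) (volume.restrict (torus L)) := fun n =>
    (Mesh.measurable_comp_cellOf (G := G n)
      fun K => H ((G n).proj ρ₀ K) ((G n).proj θ₀ K)).aestronglyMeasurable
  have hlim : AEStronglyMeasurable (fun x => H (ρ₀ x) (θ₀ x)) (volume.restrict (torus L)) :=
    aestronglyMeasurable_of_tendsto_ae atTop hmeas hconv
  have hb : ∀ᵐ x ∂(volume.restrict (torus L)), |H (ρ₀ x) (θ₀ x)| ≤ C := by
    filter_upwards [hbρ, hbθ] with x h3 h4 using hC _ h3 _ h4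
  refine ⟨Integrable.of_bound hlim C hb, ?_⟩
  rw [show 𝓝 (0 : ℝ) = 𝓝 (∫ _ in torus L, (0 : ℝ)) by simp]
  refine tendsto_integral_of_dominated_convergence (fun _ => C + C)
    (fun n => ((hmeas n).sub hlim).norm) (integrable_const _) (fun n => ?_) ?_
  · filter_upwards [hb, ae_torus_mem L] with x h1 hx
    rw [Real.norm_eq_abs, abs_abs]
    exact (abs_sub _ _).trans (add_le_add (hC _ (hρ n _ (Mesh.cellOf_mem_cells.2 hx)) _
      (hθ n _ (Mesh.cellOf_mem_cells.2 hx))) h1)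
  · filter_upwards [hconv] with x hx
    simpa using (hx.sub_const (H (ρ₀ x) (θ₀ x))).abs

/-- Convergence of the initial momentum. -/
lemma tendsto_integral_momentum_proj (hG : Tendsto (fun n => (G n).h) atTop (𝓝 0))
    {ρ₀ v₀ : ℝᵈ → ℝ} (hρ₀ : IntegrableOn ρ₀ (torus L)) (hv₀ : IntegrableOn v₀ (torus L))
    {ρlo ρhi : ℝ} (hρlo : 0 < ρlo)
    (hρ : ∀ n, ∀ K ∈ (G n).cells, ρlo ≤ (G n).proj ρ₀ K ∧ (G n).proj ρ₀ K ≤ ρhi) {C : ℝ}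
    (hC : ∀ n, (G n).intCells (fun K => (G n).proj v₀ K ^ 2) ≤ C) :
    IntegrableOn (fun x => ρ₀ x * v₀ x) (torus L) ∧
    Tendsto (fun n => ∫ x in torus L, |(G n).proj ρ₀ (cellOf (G n).h x)
      * (G n).proj v₀ (cellOf (G n).h x) - ρ₀ x * v₀ x|) atTop (𝓝 0) := by
  have hbρ := ae_bounds_of_proj hG hρ₀ hρ
  have hbρ' : ∀ᵐ x ∂(volume.restrict (torus L)), |ρ₀ x| ≤ ρhi := by
    filter_upwards [hbρ] with x hx
    rw [abs_of_pos (hρlo.trans_le hx.1)]; exact hx.2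
  have hv2 := integrableOn_sq_of_proj hG hv₀ hC
  have hρv : IntegrableOn (fun x => ρ₀ x * v₀ x) (torus L) :=
    (integrable_mul_of_bound hv₀ ρhi hρ₀.aestronglyMeasurable hbρ').congr
      (.of_forall fun x => mul_comm _ _)
  refine ⟨hρv, ?_⟩
  have hm : ∀ n, AEStronglyMeasurable (fun x => (G n).proj ρ₀ (cellOf (G n).h x)
      * (G n).proj v₀ (cellOf (G n).h x) - ρ₀ x * v₀ x) (volume.restrict (torus L)) := fun n =>
    (Mesh.measurable_comp_cellOf (G := G n)
      fun K => (G n).proj ρ₀ K * (G n).proj v₀ K).aestronglyMeasurable.sub hρv.aestronglyMeasurable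
  have hdom : ∀ n, Integrable (fun x => 2 * ρhi ^ 2 * ((G n).proj v₀ (cellOf (G n).h x) ^ 2
      + v₀ x ^ 2)) (volume.restrict (torus L)) := fun n =>
    (((G n).integrableOn_cellOf fun K => (G n).proj v₀ K ^ 2).add hv2).const_mul _
  have hle : ∀ n, ∀ᵐ x ∂(volume.restrict (torus L)), ((G n).proj ρ₀ (cellOf (G n).h x)
      * (G n).proj v₀ (cellOf (G n).h x) - ρ₀ x * v₀ x) ^ 2
      ≤ 2 * ρhi ^ 2 * ((G n).proj v₀ (cellOf (G n).h x) ^ 2 + v₀ x ^ 2) := by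
    intro n
    filter_upwards [hbρ, ae_torus_mem L] with x hx hxt
    have h1 := hρ n _ (Mesh.cellOf_mem_cells.2 hxt)
    set a := (G n).proj ρ₀ (cellOf (G n).h x)
    set v := (G n).proj v₀ (cellOf (G n).h x)
    have ha : a ^ 2 ≤ ρhi ^ 2 := pow_le_pow_left₀ (hρlo.le.trans h1.1) h1.2 2
    have hb : ρ₀ x ^ 2 ≤ ρhi ^ 2 := pow_le_pow_left₀ (hρlo.le.trans hx.1) hx.2 2
    have h2 := mul_le_mul_of_nonneg_right ha (sq_nonneg v)
    have h3 := mul_le_mul_of_nonneg_right hb (sq_nonneg (v₀ x))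
    nlinarith [sq_nonneg (a * v + ρ₀ x * v₀ x)]
  refine tendsto_integral_abs_of_sq_bound hm (fun n => ?_)
    (C := 2 * ρhi ^ 2 * (C + ∫ x in torus L, v₀ x ^ 2)) (fun n => ?_) ?_
  · refine (hdom n).mono' ((hm n).pow 2) ?_
    filter_upwards [hle n] with x hx
    rwa [Real.norm_eq_abs, abs_of_nonneg (sq_nonneg _)]
  · refine (integral_mono_of_nonneg (.of_forall fun x => sq_nonneg _) (hdom n)
      (hle n)).trans ?_
    rw [integral_const_mul, integral_add ((G n).integrableOn_cellOf fun K => (G n).proj v₀ K ^ 2)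
      hv2, (G n).integral_cellOf fun K => (G n).proj v₀ K ^ 2]
    exact mul_le_mul_of_nonneg_left (by linarith [hC n]) (by positivity)
  · filter_upwards [ae_tendsto_proj hG hρ₀, ae_tendsto_proj hG hv₀] with x h1 h2
    simpa using (h1.mul h2).sub_const (ρ₀ x * v₀ x)

/-- The kinetic energy of the averages does not exceed the kinetic energy in the limit. -/
lemma eventually_kinetic_proj_le (hG : Tendsto (fun n => (G n).h) atTop (𝓝 0))
    {ρ₀ v₀ : ℝᵈ → ℝ} (hρ₀ : IntegrableOn ρ₀ (torus L)) (hv₀ : IntegrableOn v₀ (torus L))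
    {ρlo ρhi : ℝ} (hρlo : 0 < ρlo)
    (hρ : ∀ n, ∀ K ∈ (G n).cells, ρlo ≤ (G n).proj ρ₀ K ∧ (G n).proj ρ₀ K ≤ ρhi) {C : ℝ}
    (hC : ∀ n, (G n).intCells (fun K => (G n).proj v₀ K ^ 2) ≤ C) :
    IntegrableOn (fun x => ρ₀ x * v₀ x ^ 2) (torus L) ∧
    ∀ η > 0, ∀ᶠ n in atTop, (G n).intCells (fun K => (G n).proj ρ₀ K * (G n).proj v₀ K ^ 2)
      ≤ (∫ x in torus L, ρ₀ x * v₀ x ^ 2) + η := by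
  have hbρ := ae_bounds_of_proj hG hρ₀ hρ
  have hbρ' : ∀ᵐ x ∂(volume.restrict (torus L)), |ρ₀ x| ≤ ρhi := by
    filter_upwards [hbρ] with x hx
    rw [abs_of_pos (hρlo.trans_le hx.1)]; exact hx.2
  have hv2 := integrableOn_sq_of_proj hG hv₀ hC
  refine ⟨(integrable_mul_of_bound hv2 ρhi hρ₀.aestronglyMeasurable hbρ').congr
      (.of_forall fun x => mul_comm _ _), fun η hη => ?_⟩
  have hlim : Tendsto (fun n => ∫ x in torus L, (G n).proj ρ₀ (cellOf (G n).h x) * v₀ x ^ 2) atTop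
      (𝓝 (∫ x in torus L, ρ₀ x * v₀ x ^ 2)) := by
    refine tendsto_integral_of_dominated_convergence (fun x => ρhi * v₀ x ^ 2)
      (fun n => (Mesh.measurable_comp_cellOf (G := G n) _).aestronglyMeasurable.mul
        hv2.aestronglyMeasurable) (hv2.const_mul _) (fun n => ?_) ?_
    · filter_upwards [ae_torus_mem L] with x hxt
      have h1 := hρ n _ (Mesh.cellOf_mem_cells.2 hxt)
      rw [Real.norm_eq_abs, abs_mul, abs_of_pos (hρlo.trans_le h1.1), abs_of_nonneg (sq_nonneg _)]
      exact mul_le_mul_of_nonneg_right h1.2 (sq_nonneg _)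
    · filter_upwards [ae_tendsto_proj hG hρ₀] with x hx
      exact hx.mul_const _
  filter_upwards [hlim.eventually (gt_mem_nhds (lt_add_of_pos_right _ hη))] with n hn
  exact (Mesh.integral_mul_proj_sq_le (fun K hK => hρlo.le.trans (hρ n K hK).1) hv₀ hv2).trans hn.le

end Initial

/-! ### From weak formulations in space-time to almost every time -/

/-- A function whose integrals against all nonnegative continuous functions supported in an
interval are nonnegative is nonnegative almost everywhere. -/
lemma ae_nonneg_of_forall_integral_mul {f : ℝ → ℝ} (hf : IntegrableOn f (Ioo 0 T))
    (h : ∀ w : ℝ → ℝ, Continuous w → (∀ t, 0 ≤ w t) → (∀ t, t ∉ Ioo 0 T → w t = 0) →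
      0 ≤ ∫ t in Ioo 0 T, w t * f t) :
    ∀ᵐ t ∂(volume.restrict (Ioo 0 T)), 0 ≤ f t := by
  have hFi : Integrable ((Ioo 0 T).indicator f) := (integrable_indicator_iff measurableSet_Ioo).2 hf
  have hr : ∀ n : ℕ, 0 < 1 / ((n : ℝ) + 1) := fun n => by positivity
  -- mollifiers
  let b : ℕ → ContDiffBump (0 : ℝ) := fun n =>
    { rIn := 1 / ((n : ℝ) + 1), rOut := 2 * (1 / ((n : ℝ) + 1)), rIn_pos := hr n
      rIn_lt_rOut := by linarith [hr n] }
  have hlim : Tendsto (fun n => (b n).rOut) atTop (𝓝 0) := by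
    have := (tendsto_one_div_add_atTop_nhds_zero_nat (𝕜 := ℝ)).const_mul 2
    rwa [mul_zero] at this
  rw [ae_restrict_iff' measurableSet_Ioo]
  filter_upwards [ContDiffBump.ae_convolution_tendsto_right_of_locallyIntegrable (K := 2) hlim
    (.of_forall fun n => le_rfl) hFi.locallyIntegrable] with τ hτ hmem
  rw [← indicator_of_mem hmem f]
  refine ge_of_tendsto hτ ?_
  filter_upwards [hlim.eventually (gt_mem_nhds (lt_min hmem.1 (sub_pos.2 hmem.2)))] with n hn
  have h1 := h (fun t => (b n).normed volume (τ - t)) ((b n).continuous_normed.comp (by fun_prop))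
    (fun t => (b n).nonneg_normed _) fun t ht => by
      by_contra hc
      have h2 : τ - t ∈ Function.support ((b n).normed volume) := hc
      rw [(b n).support_normed_eq, mem_ball_zero_iff, Real.norm_eq_abs, abs_lt] at h2
      have h3 := hn.trans_le (min_le_left _ _)
      have h4 := hn.trans_le (min_le_right _ _)
      exact ht ⟨by linarith, by linarith⟩
  rw [← integral_indicator measurableSet_Ioo] at h1
  rw [convolution_eq_swap]
  refine h1.trans_eq (integral_congr_ae (.of_forall fun t => ?_))
  by_cases ht : t ∈ Ioo 0 T <;> simp [ht]

section Balance

/-- The integrand of a balance law tested with `φ`. -/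
noncomputable def balanceDensity (R S : ℝ × ℝᵈ → ℝ) (F : Fin d → ℝ × ℝᵈ → ℝ)
    (φ : ℝ → ℝᵈ → ℝ) (t : ℝ) (x : ℝᵈ) : ℝ :=
  R (t, x) * dt φ t x + ∑ i, F i (t, x) * dx i φ t x + S (t, x) * φ t x

variable {R S : ℝ × (Fin d → ℝ) → ℝ} {F : Fin d → ℝ × (Fin d → ℝ) → ℝ}
  {φ : ℝ → (Fin d → ℝ) → ℝ}

lemma Admissible.integrable_mul {f w : ℝ × ℝᵈ → ℝ} (hw : Admissible L T w)
    (hf : Integrable f 𝒬) : Integrable (fun p => f p * w p) 𝒬 := by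
  obtain ⟨C, hC⟩ := hw.ae_bound
  exact integrable_mul_of_bound hf C hw.meas.aestronglyMeasurable hC

lemma integrable_balanceDensity (hL : ∀ i, 0 < L i) (hR : Integrable R 𝒬)
    (hS : Integrable S 𝒬) (hF : ∀ i, Integrable (F i) 𝒬)
    (hφ : IsTest L φ) :
    Integrable (fun p => balanceDensity R S F φ p.1 p.2) 𝒬 :=
  (((hφ.admissible_dt hL).integrable_mul hR).add
    (integrable_finsetSum _ fun i _ => (hφ.admissible_dx hL i).integrable_mul (hF i))).add
    ((hφ.admissible hL).integrable_mul hS)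

lemma integral_spaceTime {f : ℝ × ℝᵈ → ℝ} (hf : Integrable f 𝒬) :
    ∫ p, f p ∂𝒬 = ∫ t in Ioo 0 T, ∫ x in torus L, f (t, x) := by
  rw [spaceTime_eq_prod] at hf ⊢
  exact integral_prod _ hf

lemma spaceTime_mono {τ : ℝ} (hτ : τ ≤ T) : spaceTime L τ ≤ 𝒬 :=
  Measure.restrict_mono (prod_mono (Ioo_subset_Ioo_right hτ) le_rfl) le_rfl

lemma intervalIntegral_torus {f : ℝ × ℝᵈ → ℝ} (hf : Integrable f 𝒬) {τ : ℝ} (hτ : τ ∈ Icc 0 T) :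
    ∫ t in (0 : ℝ)..τ, ∫ x in torus L, f (t, x) = ∫ p, f p ∂(spaceTime L τ) := by
  rw [integral_spaceTime (hf.mono_measure (spaceTime_mono hτ.2)),
    intervalIntegral.integral_of_le hτ.1, integral_Ioc_eq_integral_Ioo]

/-- Products of integrable functions and test functions on a time slice are integrable. -/
lemma IsTest.integrableOn_mul (hφ : IsTest L φ) (t : ℝ) {f : ℝᵈ → ℝ}
    (hf : IntegrableOn f (torus L)) : IntegrableOn (fun x => f x * φ t x) (torus L) := by
  have hc : Continuous (φ t) := hφ.continuous_uncurry.comp (f := fun x : ℝᵈ => (t, x))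
    (by fun_prop)
  obtain ⟨C, hC⟩ := (isCompact_Icc (a := (0 : ℝᵈ)) (b := L)).exists_bound_of_continuousOn
    hc.continuousOn
  refine integrable_mul_of_bound hf C hc.aestronglyMeasurable ?_
  filter_upwards [ae_torus_mem L] with x hx using hC x (torus_subset_Icc L hx)

lemma integrableOn_slice {f : ℝ × ℝᵈ → ℝ} (hf : Integrable f 𝒬) :
    IntegrableOn (fun t => ∫ x in torus L, f (t, x)) (Ioo 0 T) := by
  rw [spaceTime_eq_prod] at hf
  exact hf.integral_prod_left

lemma ae_integrable_slice {f : ℝ × ℝᵈ → ℝ} (hf : Integrable f 𝒬) :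
    ∀ᵐ t ∂(volume.restrict (Ioo 0 T)), IntegrableOn (fun x => f (t, x)) (torus L) := by
  rw [spaceTime_eq_prod] at hf
  exact hf.prod_right_ae

/-- Multiplication of a test function with a function of time. -/
lemma IsTest.time_mul {ψ : ℝ → ℝ} (hψ : ContDiff ℝ 1 ψ) (hφ : IsTest L φ) :
    IsTest L (fun t x => ψ t * φ t x) ∧
      (∀ t x, dt (fun t x => ψ t * φ t x) t x = deriv ψ t * φ t x + ψ t * dt φ t x) ∧
      ∀ i t x, dx i (fun t x => ψ t * φ t x) t x = ψ t * dx i φ t x := by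
  refine ⟨⟨(hψ.comp contDiff_fst).mul hφ.1, fun t x i => by simp only [hφ.2]⟩, fun t x => ?_,
    fun i t x => ?_⟩
  · have h1 : DifferentiableAt ℝ (fun s => φ s x) t :=
      (hφ.1.comp (contDiff_id.prodMk contDiff_const)).differentiable one_ne_zero t
    exact ((hψ.differentiable one_ne_zero t).hasDerivAt.mul h1.hasDerivAt).deriv
  · have h1 : DifferentiableAt ℝ (φ t) x :=
      (hφ.1.comp (contDiff_const.prodMk contDiff_id)).differentiable one_ne_zero x
    simp only [dx]
    rw [fderiv_const_mul h1]
    simp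

/-- A balance inequality against all test functions vanishing at the final time holds up to almost
every time, for a fixed test function. -/
lemma ae_balance (hL : ∀ i, 0 < L i) (hT : 0 < T) (hR : Integrable R 𝒬)
    (hS : Integrable S 𝒬) (hF : ∀ i, Integrable (F i) 𝒬)
    {r₀ : ℝᵈ → ℝ} (pos : Prop)
    (h : ∀ φ, IsTest L φ → (pos → ∀ t ∈ Icc 0 T, ∀ x, 0 ≤ φ t x) → (∀ t x, T ≤ t → φ t x = 0) →
      ∫ p, balanceDensity R S F φ p.1 p.2 ∂𝒬 + ∫ x in torus L, r₀ x * φ 0 x ≤ 0)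
    (hφ : IsTest L φ) (hpos : pos → ∀ t ∈ Icc 0 T, ∀ x, 0 ≤ φ t x) :
    ∀ᵐ τ ∂(volume.restrict (Ioo 0 T)), (∫ x in torus L, r₀ x * φ 0 x)
        + ∫ t in (0 : ℝ)..τ, ∫ x in torus L, balanceDensity R S F φ t x
      ≤ ∫ x in torus L, R (τ, x) * φ τ x := by
  set c := ∫ x in torus L, r₀ x * φ 0 x with hc
  set b : ℝ → ℝ := fun t => ∫ x in torus L, balanceDensity R S F φ t x with hb
  set a : ℝ → ℝ := fun t => ∫ x in torus L, R (t, x) * φ t x with ha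
  have hbd := integrable_balanceDensity hL hR hS hF hφ
  have hRφ := (hφ.admissible hL).integrable_mul hR
  have hI : ∀ {f : ℝ → ℝ}, IntegrableOn f (Ioo 0 T) ↔ IntervalIntegrable f volume 0 T :=
    (intervalIntegrable_iff_integrableOn_Ioo_of_le hT.le).symm
  have hII : ∀ f : ℝ → ℝ, ∫ t in Ioo 0 T, f t = ∫ t in (0 : ℝ)..T, f t := fun f => by
    rw [intervalIntegral.integral_of_le hT.le, integral_Ioc_eq_integral_Ioo]
  have hbi : IntervalIntegrable b volume 0 T := hI.1 (integrableOn_slice hbd)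
  have hai : IntervalIntegrable a volume 0 T := hI.1 (integrableOn_slice hRφ)
  set B : ℝ → ℝ := fun τ => c + ∫ t in (0 : ℝ)..τ, b t with hB
  have hBac : AbsolutelyContinuousOnInterval B 0 T :=
    (contDiff_const (c := c)).contDiffOn.absolutelyContinuousOnInterval.fun_add
      (hbi.absolutelyContinuousOnInterval_intervalIntegral left_mem_uIcc)
  have hBi : IntervalIntegrable B volume 0 T := hBac.continuousOn.intervalIntegrable
  have key : ∀ᵐ τ ∂(volume.restrict (Ioo 0 T)), 0 ≤ a τ - B τ := by
    refine ae_nonneg_of_forall_integral_mul (hI.2 (hai.sub hBi)) fun w hw hw0 hwT => ?_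
    set ψ : ℝ → ℝ := fun t => ∫ s in t..T, w s with hψ
    have hψd : ∀ t, HasDerivAt ψ (-w t) t := fun t =>
      intervalIntegral.integral_hasDerivAt_left (hw.intervalIntegrable _ _)
        (hw.stronglyMeasurableAtFilter _ _) hw.continuousAt
    have hψ1 : ContDiff ℝ 1 ψ := contDiff_one_iff_deriv.2 ⟨fun t => (hψd t).differentiableAt, by
      rw [show deriv ψ = fun t => -w t from funext fun t => (hψd t).deriv]; exact hw.neg⟩
    obtain ⟨hψφ, hdt, hdx⟩ := hφ.time_mul hψ1
    have hψ0 : ∀ t ≤ T, 0 ≤ ψ t := fun t ht =>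
      intervalIntegral.integral_nonneg ht fun s _ => hw0 s
    have hψT : ∀ t, T ≤ t → ψ t = 0 := fun t ht => intervalIntegral.integral_zero_ae
      (.of_forall fun s hs => hwT s fun h' => absurd h'.2 (not_lt.2 (by
        rw [uIoc_of_ge ht] at hs; exact hs.1.le)))
    have hin := h _ hψφ (fun hp t ht x => mul_nonneg (hψ0 t ht.2) (hpos hp t ht x))
      (fun t x ht => by rw [hψT t ht, zero_mul])
    rw [integral_spaceTime (integrable_balanceDensity hL hR hS hF hψφ)] at hin
    have e1 : ∫ t in Ioo 0 T, ∫ x in torus L, balanceDensity R S F (fun t x => ψ t * φ t x) t x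
        = ∫ t in Ioo 0 T, (ψ t * b t - w t * a t) := by
      refine integral_congr_ae ?_
      filter_upwards [ae_integrable_slice hbd, ae_integrable_slice hRφ] with t h1 h2
      rw [ha, hb]
      simp only
      rw [← integral_const_mul, ← integral_const_mul,
        ← integral_sub (h1.const_mul _) (h2.const_mul _)]
      refine integral_congr_ae (.of_forall fun x => ?_)
      simp only [balanceDensity, hdt, hdx, (hψd _).deriv, mul_left_comm _ (ψ t), ← mul_sum]
      ring
    have e2 : ∫ x in torus L, r₀ x * (ψ 0 * φ 0 x) = ψ 0 * c := by
      simp only [hc, mul_left_comm _ (ψ 0), integral_const_mul]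
    have e3 : ∫ t in (0 : ℝ)..T, ψ t * b t = (∫ t in (0 : ℝ)..T, w t * B t) - ψ 0 * c := by
      have h1 := hψ1.contDiffOn.absolutelyContinuousOnInterval.integral_mul_deriv_eq_deriv_mul hBac
      simp only [(hψd _).deriv, hψT T le_rfl, hB, intervalIntegral.integral_same, add_zero,
        zero_mul, neg_mul, intervalIntegral.integral_neg] at h1
      rw [← intervalIntegral.integral_congr_ae (f := fun t => ψ t * deriv B t), h1]
      · ring
      · filter_upwards [hbi.ae_hasDerivAt_integral] with t ht hmem
        rw [((ht (uIoc_subset_uIcc hmem) 0 left_mem_uIcc).const_add c).deriv]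
    have iw : ∀ {f : ℝ → ℝ}, IntervalIntegrable f volume 0 T →
        IntervalIntegrable (fun t => w t * f t) volume 0 T := fun hf =>
      hf.continuousOn_mul hw.continuousOn
    rw [e1, e2, hII, intervalIntegral.integral_sub
      (hbi.continuousOn_mul hψ1.continuous.continuousOn)
      (iw hai), e3] at hin
    simp only [hII, mul_sub]
    rw [intervalIntegral.integral_sub (iw hai) (iw hBi)]
    linarith
  filter_upwards [key] with τ hτ using sub_nonneg.1 hτ

/-- The values of a test function and of its first derivatives on the closure of `(0, T) × Ω`. -/
noncomputable def IsTest.jet (T : ℝ) (hφ : IsTest L φ) : C(closedBox L T, ℝ × ℝ × ℝᵈ) where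
  toFun p := (φ p.1.1 p.1.2, dt φ p.1.1 p.1.2, fun i => dx i φ p.1.1 p.1.2)
  continuous_toFun := (hφ.continuous_uncurry.comp continuous_subtype_val).prodMk
    ((hφ.continuous_dt.comp continuous_subtype_val).prodMk
      (continuous_pi fun i => (hφ.continuous_dx i).comp continuous_subtype_val))

/-- A balance inequality against all test functions vanishing at the final time holds up to almost
every time, for all test functions simultaneously. The space of jets of test functions is
separable, so that countably many test functions suffice. -/
lemma ae_forall_balance (hL : ∀ i, 0 < L i) (hT : 0 < T) (hR : Integrable R 𝒬)
    (hS : Integrable S 𝒬) (hF : ∀ i, Integrable (F i) 𝒬)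
    {r₀ : ℝᵈ → ℝ} (hr₀ : IntegrableOn r₀ (torus L)) (pos : Prop)
    (h : ∀ φ, IsTest L φ → (pos → ∀ t ∈ Icc 0 T, ∀ x, 0 ≤ φ t x) → (∀ t x, T ≤ t → φ t x = 0) →
      ∫ p, balanceDensity R S F φ p.1 p.2 ∂𝒬 + ∫ x in torus L, r₀ x * φ 0 x ≤ 0) :
    ∀ᵐ τ ∂(volume.restrict (Icc 0 T)), ∀ φ, IsTest L φ →
      (pos → ∀ t ∈ Icc 0 T, ∀ x, 0 ≤ φ t x) →
      (∫ x in torus L, r₀ x * φ 0 x) + ∫ t in (0 : ℝ)..τ, ∫ x in torus L, balanceDensity R S F φ t x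
      ≤ ∫ x in torus L, R (τ, x) * φ τ x := by
  have : CompactSpace (closedBox L T) := isCompact_iff_compactSpace.1 (isCompact_closedBox L T)
  set A : Set C(closedBox L T, ℝ × ℝ × ℝᵈ) :=
    {J | ∃ (φ : ℝ → ℝᵈ → ℝ) (hφ : IsTest L φ),
      (pos → ∀ t ∈ Icc 0 T, ∀ x, 0 ≤ φ t x) ∧ J = hφ.jet T} with hA
  obtain ⟨D, hDA, hDc, hAD⟩ :=
    (TopologicalSpace.IsSeparable.of_separableSpace A).exists_countable_dense_subset
  have hsel : ∀ J ∈ D, ∃ (φ : ℝ → ℝᵈ → ℝ) (hφ : IsTest L φ),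
      (pos → ∀ t ∈ Icc 0 T, ∀ x, 0 ≤ φ t x) ∧ J = hφ.jet T := fun J hJ => hDA hJ
  choose! Φ hΦ hΦpos hΦJ using hsel
  have hae : ∀ᵐ τ ∂(volume.restrict (Ioo 0 T)), ∀ J ∈ D, (∫ x in torus L, r₀ x * Φ J 0 x)
        + ∫ t in (0 : ℝ)..τ, ∫ x in torus L, balanceDensity R S F (Φ J) t x
      ≤ ∫ x in torus L, R (τ, x) * Φ J τ x :=
    (ae_ball_iff hDc).2 fun J hJ => ae_balance hL hT hR hS hF pos h (hΦ J hJ) (hΦpos J hJ)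
  rw [← restrict_Ioo_eq_restrict_Icc]
  filter_upwards [hae, ae_integrable_slice hR, ae_restrict_mem measurableSet_Ioo]
    with τ hτ hRτ hmem φ hφ hpos
  set B : ℝ × ℝᵈ → ℝ := fun p => |R p| + ∑ i, |F i p| + |S p| with hB
  have hB0 : ∀ p, 0 ≤ B p := fun p =>
    add_nonneg (add_nonneg (abs_nonneg _) (sum_nonneg fun i _ => abs_nonneg _)) (abs_nonneg _)
  have hBi : Integrable B 𝒬 :=
    (hR.abs.add (integrable_finsetSum _ fun i _ => (hF i).abs)).add hS.abs
  set M := (∫ x in torus L, |r₀ x|) + (∫ p, B p ∂𝒬) + (∫ x in torus L, |R (τ, x)|) + 1 with hM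
  have hM0 : 0 < M := by
    have h1 : 0 ≤ ∫ x in torus L, |r₀ x| := integral_nonneg fun x => abs_nonneg _
    have h2 : 0 ≤ ∫ p, B p ∂𝒬 := integral_nonneg hB0
    have h3 : 0 ≤ ∫ x in torus L, |R (τ, x)| := integral_nonneg fun x => abs_nonneg _
    positivity
  refine le_of_forall_pos_le_add fun η hη => ?_
  set δ := η / M with hδdef
  have hδ : 0 < δ := by positivity
  have hcl : hφ.jet T ∈ closure D := hAD ⟨φ, hφ, hpos, rfl⟩
  obtain ⟨J, hJD, hJ⟩ := Metric.mem_closure_iff.1 hcl _ hδ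
  have hχ := hΦ J hJD
  set χ := Φ J with hχdef
  have hpt : ∀ p ∈ closedBox L T, |φ p.1 p.2 - χ p.1 p.2| ≤ δ ∧ |dt φ p.1 p.2 - dt χ p.1 p.2| ≤ δ ∧
      ∀ i, |dx i φ p.1 p.2 - dx i χ p.1 p.2| ≤ δ := by
    intro p hp
    have h1 : dist (hφ.jet T ⟨p, hp⟩) (J ⟨p, hp⟩) ≤ δ :=
      (ContinuousMap.dist_apply_le_dist _).trans hJ.le
    rw [hΦJ J hJD] at h1
    have h2 : dist (φ p.1 p.2, dt φ p.1 p.2, fun i => dx i φ p.1 p.2)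
      (χ p.1 p.2, dt χ p.1 p.2, fun i => dx i χ p.1 p.2) ≤ δ := h1
    rwa [Prod.dist_eq, Prod.dist_eq, max_le_iff, max_le_iff, dist_pi_le_iff hδ.le] at h2
  have hslice : ∀ t ∈ Icc 0 T, ∀ {f : ℝᵈ → ℝ}, IntegrableOn f (torus L) →
      |(∫ x in torus L, f x * φ t x) - ∫ x in torus L, f x * χ t x|
        ≤ δ * ∫ x in torus L, |f x| := by
    intro t ht f hf
    rw [← integral_sub (hφ.integrableOn_mul t hf) (hχ.integrableOn_mul t hf)]
    simp only [← mul_sub]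
    refine abs_integral_mul_le hf ?_
    filter_upwards [ae_torus_mem L] with x hx using (hpt (t, x) ⟨ht, torus_subset_Icc L hx⟩).1
  have h0 := hslice 0 ⟨le_rfl, hT.le⟩ hr₀
  have h1 := hslice τ (Ioo_subset_Icc_self hmem) hRτ
  have hbφ := integrable_balanceDensity hL hR hS hF hφ
  have hbχ := integrable_balanceDensity hL hR hS hF hχ
  have h2 : |(∫ t in (0 : ℝ)..τ, ∫ x in torus L, balanceDensity R S F φ t x)
      - ∫ t in (0 : ℝ)..τ, ∫ x in torus L, balanceDensity R S F χ t x| ≤ δ * ∫ p, B p ∂𝒬 := by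
    have hle := spaceTime_mono (L := L) hmem.2.le
    rw [intervalIntegral_torus hbφ (Ioo_subset_Icc_self hmem),
      intervalIntegral_torus hbχ (Ioo_subset_Icc_self hmem),
      ← integral_sub (hbφ.mono_measure hle) (hbχ.mono_measure hle)]
    refine (norm_integral_le_of_norm_le (G := ℝ) ((hBi.const_mul δ).mono_measure hle)
      (ae_mono hle ?_)).trans ?_
    swap
    · rw [integral_const_mul]
      exact mul_le_mul_of_nonneg_left (integral_mono_measure hle (.of_forall hB0) hBi) hδ.le
    filter_upwards [ae_spaceTime_mem_closedBox L T] with p hp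
    obtain ⟨n1, n2, n3⟩ := hpt p hp
    have hm : ∀ {x y : ℝ}, |y| ≤ δ → |x * y| ≤ δ * |x| := fun {x y} hy => by
      rw [abs_mul, mul_comm]
      exact mul_le_mul_of_nonneg_right hy (abs_nonneg _)
    have e1 : balanceDensity R S F φ p.1 p.2 - balanceDensity R S F χ p.1 p.2
        = R p * (dt φ p.1 p.2 - dt χ p.1 p.2) + ∑ i, F i p * (dx i φ p.1 p.2 - dx i χ p.1 p.2)
          + S p * (φ p.1 p.2 - χ p.1 p.2) := by
      simp only [balanceDensity, mul_sub, sum_sub_distrib]; ring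
    rw [e1, Real.norm_eq_abs]
    refine (abs_add_three _ _ _).trans ?_
    simp only [hB, mul_add, mul_sum]
    exact add_le_add (add_le_add (hm n2) ((abs_sum_le_sum_abs _ _).trans
      (sum_le_sum fun i _ => hm (n3 i)))) (hm n1)
  have h3 := hτ J hJD
  have h4 : δ * M = η := div_mul_cancel₀ _ hM0.ne'
  rw [hM] at h4
  rw [abs_le] at h0 h1 h2
  linarith [h0.1, h0.2, h1.1, h1.2, h2.1, h2.2]

end Balance

lemma integral_balanceDensity {R S : ℝ × ℝᵈ → ℝ}
    {F : Fin d → ℝ × ℝᵈ → ℝ} {φ : ℝ → ℝᵈ → ℝ} (hL : ∀ i, 0 < L i)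
    (hR : Integrable R 𝒬) (hS : Integrable S 𝒬)
    (hF : ∀ i, Integrable (F i) 𝒬) (hφ : IsTest L φ) :
    ∫ p, balanceDensity R S F φ p.1 p.2 ∂𝒬 = (∫ p, R p * dt φ p.1 p.2 ∂𝒬)
        + (∑ i, ∫ p, F i p * dx i φ p.1 p.2 ∂𝒬)
        + ∫ p, S p * φ p.1 p.2 ∂𝒬 := by
  have iR := (hφ.admissible_dt hL).integrable_mul hR
  have iF := fun i => (hφ.admissible_dx hL i).integrable_mul (hF i)
  have iFs := integrable_finsetSum Finset.univ fun i _ => iF i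
  have iS := (hφ.admissible hL).integrable_mul hS
  rw [← integral_finsetSum _ fun i _ => iF i, ← integral_add' iR iFs,
    ← integral_add' (iR.add iFs) iS]
  rfl

/-! ### The approximate solutions as functions of space and time -/

namespace Mesh

variable {G : Mesh d L T}

lemma late_pow (r : ℕ → Cell d → ℝ) (m : ℕ) (hm : m ≠ 0) (p : ℝ × ℝᵈ) :
    G.late (fun k K => r k K ^ m) p = G.late r p ^ m := by
  simp only [late, recon]; split_ifs <;> simp [hm]

lemma integral_recon (hL : ∀ i, 0 < L i) {r : ℕ → Cell d → ℝ} (hr : ∀ k < G.N, G.InQ (r k)) :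
    ∫ p, G.recon r p.1 p.2 ∂𝒬 = ∑ k ∈ Finset.range G.N, G.Δt * G.intCells (r k) := by
  rw [integral_spaceTime (admissible_recon hL hr).integrable]
  have h1 : ∀ t ∈ Ioo 0 T, ∫ x in torus L, G.recon r t x
      = (fun k => G.intCells (r k)) ⌊t / G.Δt⌋₊ := fun t _ => G.integral_cellOf _
  have hT : (G.N : ℝ) * G.Δt = T := G.steps_fit
  have hΔ := G.Δt_pos
  have hT0 : 0 ≤ T := by rw [← hT]; positivity
  have h2 := (integral_steps hΔ (fun k => G.intCells (r k)) G.N).2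
  rw [hT, intervalIntegral.integral_of_le hT0, integral_Ioc_eq_integral_Ioo] at h2
  rw [← h2]
  exact setIntegral_congr_fun measurableSet_Ioo h1

/-- The approximate solution as a function with values in the phase space; the gradients are
replaced by zero in the first time step, where the scheme does not control them. -/
noncomputable def state (G : Mesh d L T) (ρ θ : ℕ → Cell d → ℝ) (u : ℕ → Cell d → ℝᵈ)
    (p : ℝ × ℝᵈ) : Phase d :=
  (G.recon ρ p.1 p.2, G.recon θ p.1 p.2, fun i => G.recon (fun k K => u k K i) p.1 p.2,
    fun i j => G.late (fun k K => symGradH G.h (u k) K i j) p,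
    fun i => G.late (fun k => gradE G.h (θ k) i) (p.1, p.2 + -Pi.single i (G.h / 2)))

lemma measurable_late (G : Mesh d L T) (r : ℕ → Cell d → ℝ) : Measurable (G.late r) :=
  Measurable.ite (measurableSet_le measurable_const measurable_fst) (G.measurable_recon r)
    measurable_const

lemma measurable_state (G : Mesh d L T) (ρ θ : ℕ → Cell d → ℝ) (u : ℕ → Cell d → ℝᵈ) :
    Measurable (G.state ρ θ u) := by
  refine (G.measurable_recon ρ).prodMk ((G.measurable_recon θ).prodMk
    ((measurable_pi_lambda _ fun i => G.measurable_recon _).prodMk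
      ((measurable_pi_lambda _ fun i => measurable_pi_lambda _ fun j =>
        G.measurable_late _).prodMk (measurable_pi_lambda _ fun i =>
          (G.measurable_late _).comp (measurable_fst.prodMk (measurable_snd.add_const _))))))

/-- After the first time step `state` is the function `approx` of the statement. -/
lemma state_eq_approx (ρ θ : ℕ → Cell d → ℝ) (u : ℕ → Cell d → ℝᵈ) {t : ℝ} (ht : G.Δt ≤ t)
    (x : ℝᵈ) : G.state ρ θ u (t, x) = G.approx ρ θ u t x := by
  simp only [state, approx, late, ht, if_true, recon, sub_eq_add_neg]

end Mesh

/-- Bound for the growth of all functions of the state that occur in the balance laws. -/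
def growth (U : Phase d) : ℝ := 1 + ∑ i, U.u i ^ 2 + ∑ i, ∑ j, |U.D i j| + ∑ i, |U.g i|

lemma max_abs_sub_le {x R : ℝ} (hR : 0 < R) : max (|x| - R) 0 ≤ 1 / R * x ^ 2 := by
  have h0 : 0 ≤ 1 / R * x ^ 2 := by positivity
  refine max_le ?_ h0
  rcases le_total |x| R with h | h
  · linarith
  · have : |x| ≤ 1 / R * x ^ 2 := by
      rw [one_div, inv_mul_eq_div, le_div_iff₀ hR, ← sq_abs, sq]
      exact mul_le_mul_of_nonneg_left h (abs_nonneg _)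
    linarith

lemma abs_le_one_add_sq (x : ℝ) : |x| ≤ 1 + x ^ 2 := by
  rw [← sq_abs]; nlinarith [sq_nonneg (|x| - 1), abs_nonneg x]

section Bounds

variable {G : Mesh d L T}
  {ρ θ : ℕ → Cell d → ℝ} {u : ℕ → Cell d → Fin d → ℝ} {C : ℝ}

namespace IsBoundedSolution

variable (hs : IsBoundedSolution P ε G ρ₀ θ₀ u₀ ρ θ u ρlo ρhi θlo θhi uhi)

include hs

lemma ρ_inQ : ∀ k < G.N, G.InQ (ρ k) := fun k hk => hs.ρ_mem k hk.le

lemma θ_inQ : ∀ k < G.N, G.InQ (θ k) := fun k hk => hs.θ_mem k hk.le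

lemma u_inQ (i : Fin d) :
    ∀ k < G.N, G.InQ (fun K => u k K i) := fun k hk => (hs.u_mem k hk.le).component i

lemma D_inQ (i j : Fin d) : ∀ k < G.N, G.InQ (fun K => symGradH G.h (u k) K i j) := fun k hk =>
  (hs.u_mem k hk.le).symGradH _ i j

lemma g_inQ (i : Fin d) :
    ∀ k < G.N, G.InQ (gradE G.h (θ k) i) := fun k hk => (hs.θ_mem k hk.le).gradE _ i

lemma state_bounds {p : ℝ × ℝᵈ} (hp : p.1 ∈ Ioo 0 T) :
    (ρlo ≤ (G.state ρ θ u p).ρ ∧ (G.state ρ θ u p).ρ ≤ ρhi) ∧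
      (θlo ≤ (G.state ρ θ u p).θ ∧ (G.state ρ θ u p).θ ≤ θhi) :=
  ⟨hs.ρ_bd _ (Mesh.L_pos_of_N hp) _, hs.θ_bd _ (Mesh.L_pos_of_N hp) _⟩

lemma admissible_u (i : Fin d) : Admissible L T fun p => (G.state ρ θ u p).u i :=
  Mesh.admissible_recon hs.L_pos (hs.u_inQ i)

lemma admissible_D (i j : Fin d) : Admissible L T fun p => (G.state ρ θ u p).D i j :=
  Mesh.admissible_late hs.L_pos (hs.D_inQ i j)

lemma admissible_g (i : Fin d) : Admissible L T fun p => (G.state ρ θ u p).g i :=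
  (Mesh.admissible_late hs.L_pos (hs.g_inQ i)).translate _

lemma integral_sq_u_le (hb : UniformBounds ε G ρ θ u C) :
    ∫ p, ∑ i, (G.state ρ θ u p).u i ^ 2 ∂𝒬 ≤ T * C := by
  have e1 : ∀ p, ∑ i, (G.state ρ θ u p).u i ^ 2 = G.recon (fun k K => ∑ i, u k K i ^ 2) p.1 p.2 :=
    fun p => rfl
  simp only [e1]
  rw [Mesh.integral_recon hs.L_pos fun k hk => Mesh.InQ.sum fun i _ => (hs.u_inQ i k hk).pow 2]
  have h1 : ∑ k ∈ Finset.range G.N, G.Δt * G.intCells (fun K => ∑ i, u k K i ^ 2)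
      ≤ ∑ _k ∈ Finset.range G.N, G.Δt * C := sum_le_sum fun k hk =>
    mul_le_mul_of_nonneg_left (hb.velocity k (Finset.mem_range.1 hk)) G.Δt_pos.le
  refine h1.trans (le_of_eq ?_)
  rw [sum_const, Finset.card_range, nsmul_eq_mul, ← mul_assoc, G.steps_fit]

lemma integral_sq_D_le (hb : UniformBounds ε G ρ θ u C) :
    ∫ p, ∑ i, ∑ j, (G.state ρ θ u p).D i j ^ 2 ∂𝒬 ≤ C := by
  have e1 : ∀ p, ∑ i, ∑ j, (G.state ρ θ u p).D i j ^ 2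
      = G.late (fun k K => 𝔇 G.h (u k) K) p := by
    intro p
    rw [Mesh.late_sum (r := fun i k K => ∑ j, symGradH G.h (u k) K i j ^ 2)]
    refine sum_congr rfl fun i _ => ?_
    rw [Mesh.late_sum (r := fun j k K => symGradH G.h (u k) K i j ^ 2)]
    refine sum_congr rfl fun j _ => ?_
    rw [Mesh.late_pow _ 2 two_ne_zero]
    rfl
  simp only [e1]
  rw [Mesh.integral_late hs.L_pos fun k hk => Mesh.InQ.sum fun i _ => Mesh.InQ.sum fun j _ =>
    (hs.D_inQ i j k hk).pow 2]
  exact hb.symGrad_u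

lemma integral_sq_g_le (hb : UniformBounds ε G ρ θ u C) :
    ∫ p, ∑ i, (G.state ρ θ u p).g i ^ 2 ∂𝒬 ≤ C := by
  rw [integral_finsetSum _ fun i _ => ((hs.admissible_g i).pow 2).integrable]
  have e1 : ∀ i, ∫ p, (G.state ρ θ u p).g i ^ 2 ∂𝒬 = ∑ k ∈ Finset.range (G.N - 1), G.Δt * G.intCells
          (fun K => gradE G.h (θ (k + 1)) i K ^ 2) := by
    intro i
    have ha := (Mesh.admissible_late (G := G) hs.L_pos (hs.g_inQ i)).pow 2
    have h1 := integral_translate hs.L_pos ha.meas ha.per (-Pi.single i (G.h / 2))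
    rw [← Mesh.integral_late hs.L_pos fun k hk => (hs.g_inQ i k hk).pow 2]
    simp only [Mesh.late_pow _ 2 two_ne_zero]
    exact h1
  simp only [e1]
  rw [sum_comm]
  refine le_of_eq_of_le (sum_congr rfl fun k _ => ?_) hb.gradE_θ
  rw [mul_sum]

/-- Uniform integrability of the squared velocity: the truncated integrals are controlled by
the length scale `δ`. -/
lemma integral_sq_u_truncated_le
    (hb : UniformBounds ε G ρ θ u C) {δ : ℝ} (hδ : 0 < δ) (hδL : ∀ i, 2 * δ ≤ L i)
    (hh : G.h ≤ δ / 2) :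
    ∫ p, ∑ i, max ((G.state ρ θ u p).u i ^ 2 - 2 * C / (δ / 2) ^ d) 0 ∂𝒬
      ≤ G.Δt * C + 8 * d * δ ^ 2 * C := by
  set R := 2 * C / (δ / 2) ^ d with hR
  have h0 := G.h_pos
  have hΔ := G.Δt_pos
  have e1 : ∀ p, ∑ i, max ((G.state ρ θ u p).u i ^ 2 - R) 0
      = G.recon (fun k K => ∑ i, max (u k K i ^ 2 - R) 0) p.1 p.2 := fun p => rfl
  simp only [e1]
  rw [Mesh.integral_recon hs.L_pos fun k hk => Mesh.InQ.sum fun i _ =>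
    (hs.u_inQ i k hk).comp fun a => max (a ^ 2 - R) 0]
  rcases Nat.eq_zero_or_pos G.N with hN | hN
  · have hC : 0 ≤ C := by
      have h1 := hb.gradE_θ
      simpa [hN] using h1
    rw [hN]
    simp only [Finset.range_zero, Finset.sum_empty]
    positivity
  have hCi : ∀ k < G.N, ∀ i, G.intCells (fun K => u k K i ^ 2) ≤ C := fun k hk i =>
    (Mesh.intCells_mono fun K => sq_le_sum_sq (u k K) i).trans (hb.velocity k hk)
  have hC : 0 ≤ C :=
    (Mesh.intCells_nonneg fun K => sum_nonneg fun i _ => sq_nonneg _).trans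
      (hb.velocity 0 hN)
  have hR0 : 0 ≤ R := by positivity
  obtain ⟨N, hN'⟩ := Nat.exists_eq_succ_of_ne_zero hN.ne'
  rw [hN', Finset.sum_range_succ', add_comm]
  refine add_le_add ?_ ?_
  · refine mul_le_mul_of_nonneg_left (le_trans (Mesh.intCells_mono fun K =>
      sum_le_sum fun i _ => ?_) (hb.velocity 0 hN)) hΔ.le
    exact max_le (by linarith) (sq_nonneg _)
  set m := ⌊δ / G.h⌋₊ with hm
  have hm1 : (m : ℝ) * G.h ≤ δ := by rw [← le_div_iff₀ h0]; exact Nat.floor_le (by positivity)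
  have hm2 : δ / 2 ≤ m * G.h := by
    have h1 := Nat.lt_floor_add_one (δ / G.h)
    rw [div_lt_iff₀ h0] at h1
    have : ((m : ℝ) + 1) * G.h = m * G.h + G.h := by ring
    rw [← hm, this] at h1
    linarith
  have hm0 : 0 < m := by
    by_contra hc
    have : m = 0 := by omega
    rw [this] at hm2
    simp only [Nat.cast_zero, zero_mul] at hm2
    linarith
  have hmM : ∀ i, 2 * m ≤ G.M i := by
    intro i
    have h1 : (2 * m : ℝ) * G.h ≤ G.M i * G.h := by
      rw [G.cells_fit i]
      calc (2 * m : ℝ) * G.h = 2 * (m * G.h) := by ring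
        _ ≤ 2 * δ := by linarith
        _ ≤ L i := hδL i
    exact_mod_cast le_of_mul_le_mul_right h1 h0
  have hRm : 2 * C / (m * G.h) ^ d ≤ R :=
    div_le_div_of_nonneg_left (by positivity) (by positivity)
      (pow_le_pow_left₀ (by positivity) hm2 d)
  have hstep : ∀ k < N, G.Δt * G.intCells (fun K => ∑ i, max (u (k + 1) K i ^ 2 - R) 0)
      ≤ 8 * d * δ ^ 2 * (G.Δt * ∑ j, ∑ i,
        G.intCells (fun K => gradH G.h (fun J => u (k + 1) J j) i K ^ 2)) := by
    intro k hk
    have hk' : k + 1 < G.N := by omega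
    rw [Mesh.intCells_sum, mul_sum, mul_sum, mul_sum]
    refine sum_le_sum fun j _ => ?_
    have h1 := Mesh.intCells_sq_truncated_le hs.L_pos (hs.u_inQ j _ hk') hm0 hmM (hCi _ hk' j) hRm
    set X := ∑ i, G.intCells (fun K => gradH G.h (fun J => u (k + 1) J j) i K ^ 2) with hX
    have hX0 : 0 ≤ X := sum_nonneg fun i _ => Mesh.intCells_nonneg fun K => sq_nonneg _
    have h2 : 2 * ((2 * (m * G.h)) ^ 2 * d) ≤ 8 * d * δ ^ 2 := by
      have : (m * G.h) ^ 2 ≤ δ ^ 2 := pow_le_pow_left₀ (by positivity) hm1 2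
      have hd : (0 : ℝ) ≤ d := Nat.cast_nonneg d
      nlinarith
    calc G.Δt * G.intCells (fun K => max (u (k + 1) K j ^ 2 - R) 0) ≤ G.Δt * (8 * d * δ ^ 2 * X) :=
          mul_le_mul_of_nonneg_left (h1.trans (mul_le_mul_of_nonneg_right h2 hX0)) hΔ.le
      _ = 8 * d * δ ^ 2 * (G.Δt * X) := by ring
  have hg := hb.grad_u
  rw [hN', Nat.succ_eq_add_one, Nat.add_sub_cancel] at hg
  calc ∑ k ∈ Finset.range N, G.Δt * G.intCells (fun K => ∑ i, max (u (k + 1) K i ^ 2 - R) 0)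
      ≤ ∑ k ∈ Finset.range N, 8 * d * δ ^ 2 * (G.Δt * ∑ j, ∑ i,
        G.intCells (fun K => gradH G.h (fun J => u (k + 1) J j) i K ^ 2)) :=
        sum_le_sum fun k hk => hstep k (Finset.mem_range.1 hk)
    _ ≤ 8 * d * δ ^ 2 * C := by
        rw [← mul_sum]
        exact mul_le_mul_of_nonneg_left hg (by positivity)

lemma admissible_growth : Admissible L T fun p => growth (G.state ρ θ u p) :=
  (((Admissible.const 1).add (Admissible.sum fun i _ => (hs.admissible_u i).pow 2)).add
    (Admissible.sum fun i _ => Admissible.sum fun j _ => (hs.admissible_D i j).abs)).add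
    (Admissible.sum fun i _ => (hs.admissible_g i).abs)

/-- The growth function is bounded in `L¹`. -/
lemma integral_growth_le (hb : UniformBounds ε G ρ θ u C) : ∫ p, growth (G.state ρ θ u p) ∂𝒬
      ≤ (1 + d * d + d) * (𝒬).real univ + T * C + C + C := by
  set m := 𝒬 with hm
  have hA := (Admissible.sum (s := Finset.univ) fun i _ => (hs.admissible_u i).pow 2).integrable
  have hB := (Admissible.sum (s := Finset.univ) fun i _ =>
    Admissible.sum (s := Finset.univ) fun j _ => (hs.admissible_D i j).pow 2).integrable
  have hD := (Admissible.sum (s := Finset.univ) fun i _ => (hs.admissible_g i).pow 2).integrable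
  have h1 : ∫ p, growth (G.state ρ θ u p) ∂m
      ≤ ∫ p, ((1 + d * d + d : ℝ) + ∑ i, (G.state ρ θ u p).u i ^ 2
        + ∑ i, ∑ j, (G.state ρ θ u p).D i j ^ 2 + ∑ i, (G.state ρ θ u p).g i ^ 2) ∂m := by
    refine integral_mono hs.admissible_growth.integrable
      ((((integrable_const _).add hA).add hB).add hD) fun p => ?_
    have h2 : ∑ i, ∑ j, |(G.state ρ θ u p).D i j|
        ≤ d * d + ∑ i, ∑ j, (G.state ρ θ u p).D i j ^ 2 := by
      calc ∑ i, ∑ j, |(G.state ρ θ u p).D i j|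
          ≤ ∑ i, ∑ j, (1 + (G.state ρ θ u p).D i j ^ 2) := sum_le_sum fun i _ =>
            sum_le_sum fun j _ => abs_le_one_add_sq _
        _ = _ := by simp [sum_add_distrib]
    have h3 : ∑ i, |(G.state ρ θ u p).g i| ≤ d + ∑ i, (G.state ρ θ u p).g i ^ 2 := by
      calc ∑ i, |(G.state ρ θ u p).g i| ≤ ∑ i, (1 + (G.state ρ θ u p).g i ^ 2) :=
            sum_le_sum fun i _ => abs_le_one_add_sq _
        _ = _ := by simp [sum_add_distrib]
    simp only [growth]
    linarith
  have i1 : Integrable (fun p => (1 + d * d + d : ℝ) + ∑ i, (G.state ρ θ u p).u i ^ 2) m :=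
    (integrable_const _).add hA
  have i2 : Integrable (fun p => (1 + d * d + d : ℝ) + ∑ i, (G.state ρ θ u p).u i ^ 2
        + ∑ i, ∑ j, (G.state ρ θ u p).D i j ^ 2) m := i1.add hB
  rw [integral_add i2 hD, integral_add i1 hB, integral_add (integrable_const _) hA,
    integral_const, smul_eq_mul, mul_comm] at h1
  linarith [hs.integral_sq_u_le hb, hs.integral_sq_D_le hb, hs.integral_sq_g_le hb]

/-- Equi-integrability of the growth function. -/
lemma integral_growth_truncated_le
    (hb : UniformBounds ε G ρ θ u C) {δ R : ℝ} (hδ : 0 < δ) (hδL : ∀ i, 2 * δ ≤ L i)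
    (hh : G.h ≤ δ / 2) (hR : 0 < R) :
    ∫ p, max (growth (G.state ρ θ u p) - (1 + d * (2 * C / (δ / 2) ^ d) + d * d * R + d * R)) 0 ∂𝒬
      ≤ G.Δt * C + 8 * d * δ ^ 2 * C + 1 / R * C + 1 / R * C := by
  set m := 𝒬 with hm
  set R₁ := 2 * C / (δ / 2) ^ d with hR₁
  have hA := (Admissible.sum (s := Finset.univ) fun i _ =>
    (((hs.admissible_u i).pow 2).sub (Admissible.const R₁)).max_const 0).integrable
  have hB := (Admissible.sum (s := Finset.univ) fun i _ =>
    Admissible.sum (s := Finset.univ) fun j _ => (hs.admissible_D i j).pow 2).integrable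
  have hD := (Admissible.sum (s := Finset.univ) fun i _ => (hs.admissible_g i).pow 2).integrable
  have h1 : ∫ p, max (growth (G.state ρ θ u p) - (1 + d * R₁ + d * d * R + d * R)) 0 ∂m
      ≤ ∫ p, ((∑ i, max ((G.state ρ θ u p).u i ^ 2 - R₁) 0)
        + 1 / R * ∑ i, ∑ j, (G.state ρ θ u p).D i j ^ 2
        + 1 / R * ∑ i, (G.state ρ θ u p).g i ^ 2) ∂m := by
    refine integral_mono
      ((hs.admissible_growth.sub (Admissible.const _)).max_const 0).integrable
      ((hA.add (hB.const_mul _)).add (hD.const_mul _)) fun p => ?_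
    have h2 : ∑ i, ∑ j, |(G.state ρ θ u p).D i j| - d * d * R
        ≤ 1 / R * ∑ i, ∑ j, (G.state ρ θ u p).D i j ^ 2 := by
      calc ∑ i, ∑ j, |(G.state ρ θ u p).D i j| - d * d * R
          = ∑ i, ∑ j, (|(G.state ρ θ u p).D i j| - R) := by simp [sum_sub_distrib]; ring
        _ ≤ ∑ i, ∑ j, 1 / R * (G.state ρ θ u p).D i j ^ 2 := sum_le_sum fun i _ =>
            sum_le_sum fun j _ => (le_max_left _ _).trans (max_abs_sub_le hR)
        _ = _ := by simp only [mul_sum]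
    have h3 : ∑ i, |(G.state ρ θ u p).g i| - d * R ≤ 1 / R * ∑ i, (G.state ρ θ u p).g i ^ 2 := by
      calc ∑ i, |(G.state ρ θ u p).g i| - d * R = ∑ i, (|(G.state ρ θ u p).g i| - R) := by
            simp [sum_sub_distrib]
        _ ≤ ∑ i, 1 / R * (G.state ρ θ u p).g i ^ 2 := sum_le_sum fun i _ =>
            (le_max_left _ _).trans (max_abs_sub_le hR)
        _ = _ := by simp only [mul_sum]
    have h4 : ∑ i, (G.state ρ θ u p).u i ^ 2 - d * R₁
        ≤ ∑ i, max ((G.state ρ θ u p).u i ^ 2 - R₁) 0 := by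
      calc ∑ i, (G.state ρ θ u p).u i ^ 2 - d * R₁
          = ∑ i, ((G.state ρ θ u p).u i ^ 2 - R₁) := by simp [sum_sub_distrib]
        _ ≤ _ := sum_le_sum fun i _ => le_max_left _ _
    refine max_le ?_ ?_
    · simp only [growth]; linarith
    · have h5 : 0 ≤ ∑ i, max ((G.state ρ θ u p).u i ^ 2 - R₁) 0 :=
        sum_nonneg fun i _ => le_max_right _ _
      have h6 : 0 ≤ 1 / R * ∑ i, ∑ j, (G.state ρ θ u p).D i j ^ 2 := by positivity
      have h7 : 0 ≤ 1 / R * ∑ i, (G.state ρ θ u p).g i ^ 2 := by positivity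
      linarith
  have i2 : Integrable (fun p => (∑ i, max ((G.state ρ θ u p).u i ^ 2 - R₁) 0)
        + 1 / R * ∑ i, ∑ j, (G.state ρ θ u p).D i j ^ 2) m := hA.add (hB.const_mul _)
  rw [integral_add i2 (hD.const_mul _), integral_add hA (hB.const_mul _), integral_const_mul,
    integral_const_mul] at h1
  have h8 := mul_le_mul_of_nonneg_left (hs.integral_sq_D_le hb) (by positivity : 0 ≤ 1 / R)
  have h9 := mul_le_mul_of_nonneg_left (hs.integral_sq_g_le hb) (by positivity : 0 ≤ 1 / R)
  linarith [hs.integral_sq_u_truncated_le hb hδ hδL hh]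

end IsBoundedSolution

end Bounds

/-! ### The generated Young measure and the limits of functions of the state -/

section Closed

open ProbabilityTheory BoundedContinuousFunction

/-- A Young measure generated by functions with values in a closed set is carried by that set. -/
lemma GeneratesBounded.ae_mem_of_isClosed {X Y : Type*} [MeasurableSpace X] [PseudoMetricSpace Y]
    [MeasurableSpace Y] [OpensMeasurableSpace Y] {m : Measure X} [IsFiniteMeasure m]
    {U : ℕ → X → Y} {V : Kernel X Y} [IsMarkovKernel V] (hgen : GeneratesBounded m U V) {B : Set Y}
    (hB : IsClosed B) (hU : ∀ n, ∀ᵐ p ∂m, U n p ∈ B) : ∀ᵐ p ∂m, ∀ᵐ y ∂(V p), y ∈ B := by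
  rcases B.eq_empty_or_nonempty with rfl | hne
  · filter_upwards [hU 0] with p hp using absurd hp (notMem_empty _)
  set f : Y →ᵇ ℝ := BoundedContinuousFunction.ofNormedAddCommGroup
    (fun y => min (Metric.infDist y B) 1) ((Metric.continuous_infDist_pt B).min continuous_const) 1
    fun y => by
      rw [Real.norm_eq_abs, abs_of_nonneg (le_min Metric.infDist_nonneg zero_le_one)]
      exact min_le_right _ _ with hf
  have hf0 : ∀ y, 0 ≤ f y := fun y => le_min Metric.infDist_nonneg zero_le_one
  have hfB : ∀ y, f y = 0 → y ∈ B := by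
    intro y hy
    have h1 : min (Metric.infDist y B) 1 = 0 := hy
    have h2 : Metric.infDist y B = 0 := by
      rcases min_choice (Metric.infDist y B) 1 with h | h <;> rw [h] at h1
      · exact h1
      · exact absurd h1 one_ne_zero
    rw [← hB.closure_eq, Metric.mem_closure_iff_infDist_zero hne]
    exact h2
  have h1 := hgen f (fun _ => 1) (integrable_const 1)
  simp only [one_mul] at h1
  have h2 : ∀ n, ∫ p, f (U n p) ∂m = 0 := fun n => by
    refine integral_eq_zero_of_ae ?_
    filter_upwards [hU n] with p hp
    change min (Metric.infDist (U n p) B) 1 = 0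
    rw [Metric.infDist_zero_of_mem hp, min_eq_left zero_le_one]
  simp only [h2] at h1
  have h3 : ∫ p, ∫ y, f y ∂(V p) ∂m = 0 := tendsto_nhds_unique h1 tendsto_const_nhds |>.symm ▸ rfl
  have hfi : ∀ p, Integrable f (V p) := fun p => f.integrable _
  have hmeas : AEStronglyMeasurable (fun p => ∫ y, f y ∂(V p)) m :=
    ((f.continuous.measurable.comp measurable_snd).stronglyMeasurable.integral_kernel_prod_right'
      (κ := V) (f := fun q : X × Y => f q.2)).aestronglyMeasurable
  have hint : Integrable (fun p => ∫ y, f y ∂(V p)) m := by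
    refine Integrable.of_bound hmeas ‖f‖ (.of_forall fun p => ?_)
    have := norm_integral_le_of_norm_le_const (μ := V p) (f := f) (C := ‖f‖)
      (.of_forall fun y => f.norm_coe_le_norm y)
    simpa using this
  rw [integral_eq_zero_iff_of_nonneg (fun p => integral_nonneg hf0) hint] at h3
  filter_upwards [h3] with p hp
  have h4 : ∫ y, f y ∂(V p) = 0 := hp
  rw [integral_eq_zero_iff_of_nonneg hf0 (hfi p)] at h4
  filter_upwards [h4] with y hy using hfB y hy

end Closed

section Growth

lemma growth_parts_nonneg (U : Phase d) :
    0 ≤ ∑ i, U.u i ^ 2 ∧ 0 ≤ ∑ i, ∑ j, |U.D i j| ∧ 0 ≤ ∑ i, |U.g i| :=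
  ⟨sum_nonneg fun _ _ => sq_nonneg _,
    sum_nonneg fun _ _ => sum_nonneg fun _ _ => abs_nonneg _,
    sum_nonneg fun _ _ => abs_nonneg _⟩

lemma one_le_growth (U : Phase d) : 1 ≤ growth U := by
  obtain ⟨h1, h2, h3⟩ := growth_parts_nonneg U
  rw [growth]; linarith

lemma sum_sq_u_le_growth (U : Phase d) : 1 + ∑ i, U.u i ^ 2 ≤ growth U := by
  obtain ⟨h1, h2, h3⟩ := growth_parts_nonneg U
  rw [growth]; linarith

lemma abs_u_le_growth (U : Phase d) (i : Fin d) : |U.u i| ≤ growth U := by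
  have h1 := sq_le_sum_sq U.u i
  linarith [abs_le_one_add_sq (U.u i), sum_sq_u_le_growth U]

lemma abs_u_mul_u_le_growth (U : Phase d) (i j : Fin d) : |U.u i * U.u j| ≤ growth U := by
  have h1 := sq_le_sum_sq U.u i
  have h2 := sq_le_sum_sq U.u j
  have h3 := sum_sq_u_le_growth U
  rw [abs_le]
  constructor <;> nlinarith [sq_nonneg (U.u i + U.u j), sq_nonneg (U.u i - U.u j)]

lemma abs_D_le_growth (U : Phase d) (i j : Fin d) : |U.D i j| ≤ growth U := by
  obtain ⟨h1, h2, h3⟩ := growth_parts_nonneg U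
  have h4 : |U.D i j| ≤ ∑ j, |U.D i j| :=
    single_le_sum (f := fun j => |U.D i j|) (fun j _ => abs_nonneg _) (Finset.mem_univ j)
  have h5 : ∑ j, |U.D i j| ≤ ∑ i, ∑ j, |U.D i j| :=
    single_le_sum (f := fun i => ∑ j, |U.D i j|)
      (fun j _ => sum_nonneg fun _ _ => abs_nonneg _) (Finset.mem_univ i)
  rw [growth]; linarith

lemma abs_g_le_growth (U : Phase d) (i : Fin d) : |U.g i| ≤ growth U := by
  obtain ⟨h1, h2, h3⟩ := growth_parts_nonneg U
  have h4 : |U.g i| ≤ ∑ i, |U.g i| :=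
    single_le_sum (f := fun j => |U.g j|) (fun j _ => abs_nonneg _) (Finset.mem_univ i)
  rw [growth]; linarith

lemma norm_le_growth (U : Phase d) : ‖U‖ ≤ |U.ρ| + |U.θ| + growth U := by
  have h0 := one_le_growth U
  have hu : ‖U.u‖ ≤ growth U := (pi_norm_le_iff_of_nonneg (by linarith)).2 (abs_u_le_growth U)
  have hD : ‖U.D‖ ≤ growth U := (pi_norm_le_iff_of_nonneg (by linarith)).2 fun i =>
    (pi_norm_le_iff_of_nonneg (by linarith)).2 (abs_D_le_growth U i)
  have hg : ‖U.g‖ ≤ growth U := (pi_norm_le_iff_of_nonneg (by linarith)).2 (abs_g_le_growth U)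
  have h1 := abs_nonneg U.ρ
  have h2 := abs_nonneg U.θ
  refine max_le ?_ (max_le ?_ (max_le ?_ (max_le ?_ ?_)))
  · change |U.ρ| ≤ _; linarith
  · change |U.θ| ≤ _; linarith
  all_goals simp only [Phase.u, Phase.D, Phase.g] at hu hD hg; linarith

end Growth

/-- The states with density and temperature between given bounds and symmetric `D`. -/
def stateBounds (d : ℕ) (ρlo ρhi θlo θhi : ℝ) : Set (Phase d) :=
  {U | ((ρlo ≤ U.ρ ∧ U.ρ ≤ ρhi) ∧ (θlo ≤ U.θ ∧ U.θ ≤ θhi)) ∧ ∀ i j, U.D i j = U.D j i}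

/-- Replaces density and temperature by the nearest values within given bounds. -/
def clamp (ρlo ρhi θlo θhi : ℝ) (U : Phase d) : Phase d :=
  (max ρlo (min U.ρ ρhi), max θlo (min U.θ θhi), U.2.2)

section Clamp

variable {ρlo ρhi θlo θhi : ℝ}

lemma isClosed_stateBounds : IsClosed (stateBounds d ρlo ρhi θlo θhi) := by
  have h1 : Continuous fun U : Phase d => U.ρ := continuous_fst
  have h2 : Continuous fun U : Phase d => U.θ := continuous_fst.comp continuous_snd
  have h3 : ∀ i j, Continuous fun U : Phase d => U.D i j := fun i j => by
    simp only [Phase.D]; fun_prop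
  have : stateBounds d ρlo ρhi θlo θhi = (({U : Phase d | ρlo ≤ U.ρ} ∩ {U | U.ρ ≤ ρhi})
      ∩ ({U : Phase d | θlo ≤ U.θ} ∩ {U | U.θ ≤ θhi})) ∩ ⋂ i, ⋂ j, {U | U.D i j = U.D j i} := by
    ext U; simp [stateBounds]
  rw [this]
  exact (((isClosed_le continuous_const h1).inter (isClosed_le h1 continuous_const)).inter
    ((isClosed_le continuous_const h2).inter (isClosed_le h2 continuous_const))).inter
    (isClosed_iInter fun i => isClosed_iInter fun j => isClosed_eq (h3 i j) (h3 j i))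

lemma clamp_eq_self {U : Phase d} (hU : U ∈ stateBounds d ρlo ρhi θlo θhi) :
    clamp ρlo ρhi θlo θhi U = U := by
  obtain ⟨⟨h1, h2⟩, -⟩ := hU
  simp only [clamp, min_eq_left h1.2, min_eq_left h2.2, max_eq_right h1.1, max_eq_right h2.1]
  rfl

lemma continuous_clamp : Continuous (clamp ρlo ρhi θlo θhi : Phase d → Phase d) := by
  exact (continuous_const.max (continuous_fst.min continuous_const)).prodMk
    ((continuous_const.max ((continuous_fst.comp continuous_snd).min continuous_const)).prodMk
      (continuous_snd.comp continuous_snd))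

lemma clamp_bounds (hρ : ρlo ≤ ρhi) (hθ : θlo ≤ θhi) (U : Phase d) :
    (ρlo ≤ (clamp ρlo ρhi θlo θhi U).ρ ∧ (clamp ρlo ρhi θlo θhi U).ρ ≤ ρhi) ∧
      (θlo ≤ (clamp ρlo ρhi θlo θhi U).θ ∧ (clamp ρlo ρhi θlo θhi U).θ ≤ θhi) :=
  ⟨⟨le_max_left _ _, max_le hρ (min_le_right _ _)⟩, ⟨le_max_left _ _, max_le hθ (min_le_right _ _)⟩⟩

end Clamp

open ProbabilityTheory in
/-- A sequence of bounded solutions of the scheme on meshes with vanishing mesh size and time step,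
the states of which generate the Young measure `V`. -/
structure IsApproximation (P : Fluid) (ε : ℝ) (G : ℕ → Mesh d L T)
    (ρ₀ θ₀ : ℝᵈ → ℝ) (u₀ : ℝᵈ → ℝᵈ)
    (ρ θ : ℕ → ℕ → Cell d → ℝ) (u : ℕ → ℕ → Cell d → ℝᵈ)
    (ρlo ρhi θlo θhi uhi C : ℝ) (V : Kernel (ℝ × ℝᵈ) (Phase d)) : Prop where
  L_pos : ∀ i, 0 < L i
  T_pos : 0 < T
  ε_pos : 0 < ε
  ε_lt : ε < 1
  ρlo_pos : 0 < ρlo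
  θlo_pos : 0 < θlo
  h_lim : Tendsto (fun n => (G n).h) atTop (𝓝 0)
  Δt_lim : Tendsto (fun n => (G n).Δt) atTop (𝓝 0)
  ρ₀_int : IntegrableOn ρ₀ (torus L)
  θ₀_int : IntegrableOn θ₀ (torus L)
  u₀_int : IntegrableOn u₀ (torus L)
  ρ₀_bd : ∀ n, ∀ K ∈ (G n).cells, ρlo ≤ (G n).proj ρ₀ K ∧ (G n).proj ρ₀ K ≤ ρhi
  θ₀_bd : ∀ n, ∀ K ∈ (G n).cells, θlo ≤ (G n).proj θ₀ K ∧ (G n).proj θ₀ K ≤ θhi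
  u₀_bd : ∀ n, ∀ i, (G n).intCells (fun K => (G n).proj (fun x => u₀ x i) K ^ 2) ≤ uhi ^ 2
  sol : ∀ n, IsBoundedSolution P ε (G n) ρ₀ θ₀ u₀ (ρ n) (θ n) (u n) ρlo ρhi θlo θhi uhi
  bounds : ∀ n, UniformBounds ε (G n) (ρ n) (θ n) (u n) C
  markov : IsMarkovKernel V
  generates : GeneratesBounded 𝒬 (fun n => (G n).state (ρ n) (θ n) (u n)) V

open ProbabilityTheory

variable {G : ℕ → Mesh d L T} {ρ θ : ℕ → ℕ → Cell d → ℝ} {u : ℕ → ℕ → Cell d → Fin d → ℝ} {C : ℝ}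
  {V : Kernel (ℝ × (Fin d → ℝ)) (Phase d)}
  (ha : IsApproximation P ε G ρ₀ θ₀ u₀ ρ θ u ρlo ρhi θlo θhi uhi C V)

/-- The state of the approximate solution with the given index. -/
local notation:max "𝒰" n:max => Mesh.state (G n) (ρ n) (θ n) (u n)

namespace IsApproximation

include ha

lemma C_nonneg : 0 ≤ C := by
  refine le_trans (sum_nonneg fun k _ => ?_) (ha.bounds 0).gradE_θ
  exact mul_nonneg (G 0).Δt_pos.le
    (sum_nonneg fun i _ => Mesh.intCells_nonneg fun K => sq_nonneg _)

lemma ρlo_le : ρlo ≤ ρhi ∧ θlo ≤ θhi := by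
  have hN : 0 < (G 0).N := Mesh.L_pos_of_N (G := G 0) (t := T / 2)
    ⟨half_pos ha.T_pos, half_lt_self ha.T_pos⟩ |>.pos
  exact ⟨((ha.sol 0).ρ_bd 0 hN 0).1.trans ((ha.sol 0).ρ_bd 0 hN 0).2,
    ((ha.sol 0).θ_bd 0 hN 0).1.trans ((ha.sol 0).θ_bd 0 hN 0).2⟩

lemma ae_state_mem (n : ℕ) : ∀ᵐ p ∂𝒬, 𝒰 n p ∈ stateBounds d ρlo ρhi θlo θhi := by
  filter_upwards [ae_spaceTime_mem L T] with p hp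
  refine ⟨(ha.sol n).state_bounds hp, fun i j => ?_⟩
  change (G n).late _ p = (G n).late _ p
  congr 1
  funext k K
  simp only [symGradH, add_comm]

lemma ae_young_mem : ∀ᵐ p ∂𝒬, ∀ᵐ U ∂(V p), U ∈ stateBounds d ρlo ρhi θlo θhi :=
  have := ha.markov
  ha.generates.ae_mem_of_isClosed isClosed_stateBounds ha.ae_state_mem

/-- Equi-integrability of the growth function along the sequence. -/
lemma growth_truncated {η : ℝ} (hη : 0 < η) : ∃ R, 0 ≤ R ∧ ∀ᶠ n in atTop,
      ∫ p, max (growth (𝒰 n p) - R) 0 ∂𝒬 ≤ η := by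
  have hC := ha.C_nonneg
  have h1 : ∀ᶠ δ : ℝ in 𝓝[>] 0, 8 * d * δ ^ 2 * C < η / 4 := by
    have : Tendsto (fun δ : ℝ => 8 * d * δ ^ 2 * C) (𝓝 0) (𝓝 (8 * d * 0 ^ 2 * C)) := by
      have : Continuous fun δ : ℝ => 8 * d * δ ^ 2 * C := by fun_prop
      exact this.tendsto 0
    exact (this.eventually (gt_mem_nhds (by norm_num; positivity))).filter_mono nhdsWithin_le_nhds
  have h2 : ∀ᶠ δ : ℝ in 𝓝[>] 0, ∀ i, 2 * δ ≤ L i := by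
    rw [eventually_all]
    intro i
    have : Tendsto (fun δ : ℝ => 2 * δ) (𝓝 0) (𝓝 (2 * 0)) :=
      (continuous_const.mul continuous_id).tendsto 0
    exact ((this.eventually (gt_mem_nhds (by simpa using ha.L_pos i))).mono
      fun δ h => h.le).filter_mono nhdsWithin_le_nhds
  obtain ⟨δ, ⟨hδ1, hδ2⟩, hδ0⟩ := ((h1.and h2).and self_mem_nhdsWithin).exists
  have hδ : 0 < δ := hδ0
  set R := 4 * (C + 1) / η with hR
  have hR0 : 0 < R := by positivity
  have hRC : 1 / R * C ≤ η / 4 := by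
    rw [hR, one_div_div, div_mul_eq_mul_div, div_le_div_iff₀ (by positivity) (by norm_num)]
    nlinarith
  have h3 : ∀ᶠ n in atTop, (G n).Δt * C < η / 4 := by
    have := ha.Δt_lim.mul_const C
    rw [zero_mul] at this
    exact this.eventually (gt_mem_nhds (by positivity))
  refine ⟨1 + d * (2 * C / (δ / 2) ^ d) + d * d * R + d * R, by positivity, ?_⟩
  filter_upwards [h3, ha.h_lim.eventually (gt_mem_nhds (half_pos hδ))] with n hn1 hn2
  have := (ha.sol n).integral_growth_truncated_le (ha.bounds n) hδ hδ2 hn2.le hR0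
  linarith

/-- `F ∘ clamp` is continuous everywhere, and agrees with `F` on the states that occur. -/
lemma continuous_comp_clamp {F : Phase d → ℝ} (hF : ContinuousOn F {U | 0 < U.ρ ∧ 0 < U.θ}) :
    Continuous (F ∘ clamp ρlo ρhi θlo θhi) := by
  have hcb := fun U : Phase d => clamp_bounds (d := d) ha.ρlo_le.1 ha.ρlo_le.2 U
  rw [← continuousOn_univ]
  exact hF.comp continuous_clamp.continuousOn fun U _ =>
    ⟨ha.ρlo_pos.trans_le (hcb U).1.1, ha.θlo_pos.trans_le (hcb U).2.1⟩

lemma aestronglyMeasurable_state {F : Phase d → ℝ}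
    (hF : ContinuousOn F {U | 0 < U.ρ ∧ 0 < U.θ}) (n : ℕ) :
    AEStronglyMeasurable (fun p => F (𝒰 n p)) 𝒬 := by
  refine ((ha.continuous_comp_clamp hF).measurable.comp
    ((G n).measurable_state (ρ n) (θ n) (u n))).aestronglyMeasurable.congr ?_
  filter_upwards [ha.ae_state_mem n] with p hp
  rw [Function.comp_apply, Function.comp_apply, clamp_eq_self hp]

/-- A function that is continuous away from vacuum and zero temperature can be paired with the
Young measure if its values along the sequence are bounded in `L¹`; they converge to the pairing if
they are equi-integrable. -/
lemma pairs_and_weakConv {F : Phase d → ℝ} (hF : ContinuousOn F {U | 0 < U.ρ ∧ 0 < U.θ}) {B : ℝ}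
    (hint : ∀ n, Integrable (fun p => F (𝒰 n p)) 𝒬) (hbd : ∀ n, ∫ p, |F (𝒰 n p)| ∂𝒬 ≤ B) :
    Pairs 𝒬 V F ∧
      ((∀ η > 0, ∃ R, ∀ᶠ n in atTop, ∫ p, max (|F (𝒰 n p)| - R) 0 ∂𝒬 ≤ η) →
        WeakConv 𝒬 (fun n p => F (𝒰 n p)) (fun p => ∫ U, F U ∂(V p))) := by
  have hm := ha.markov
  set m := 𝒬
  set c : Phase d → Phase d := clamp ρlo ρhi θlo θhi with hc
  have hFc := ha.continuous_comp_clamp hF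
  have heqn : ∀ n, ∀ᵐ p ∂m, F (𝒰 n p) = (F ∘ c) (𝒰 n p) := fun n => by
    filter_upwards [ha.ae_state_mem n] with p hp
    rw [Function.comp_apply, hc, clamp_eq_self hp]
  have hint' : ∀ n, Integrable (fun p => (F ∘ c) (𝒰 n p)) m := fun n => (hint n).congr (heqn n)
  have hbd' : ∀ n, ∫ p, |(F ∘ c) (𝒰 n p)| ∂m ≤ B := fun n =>
    (integral_congr_ae ((heqn n).mono fun p hp => by rw [hp])).symm.trans_le (hbd n)
  have hI := ha.generates.integrable_of_bound hFc hint' hbd'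
  have heq : ∀ᵐ p ∂m, (F ∘ c) =ᵐ[V p] F := by
    filter_upwards [ha.ae_young_mem] with p hp
    filter_upwards [hp] with U hU
    rw [Function.comp_apply, hc, clamp_eq_self hU]
  have heq' : (fun p => ∫ U, (F ∘ c) U ∂(V p)) =ᵐ[m] fun p => ∫ U, F U ∂(V p) :=
    heq.mono fun p hp => integral_congr_ae hp
  refine ⟨⟨?_, (integrable_integral_compProd hI).congr heq'⟩, fun hUI => ?_⟩
  · filter_upwards [((Measure.integrable_compProd_iff hI.aestronglyMeasurable).1 hI).1, heq]
      with p h1 h2 using h1.congr h2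
  · refine ((ha.generates.weakConv (fun n => (G n).measurable_state _ _ _) hFc hint' hbd'
      fun η hη => ?_).congr_lim heq').of_sub_tendsto hint (tendsto_const_nhds.congr fun n => ?_)
    · obtain ⟨R, hR⟩ := hUI η hη
      exact ⟨R, hR.mono fun n hn =>
        (integral_congr_ae ((heqn n).mono fun p hp => by rw [hp])).symm.trans_le hn⟩
    · refine (integral_eq_zero_of_ae ((heqn n).mono fun p hp => ?_)).symm
      change |(F ∘ c) (𝒰 n p) - F (𝒰 n p)| = 0
      rw [← hp, sub_self, abs_zero]

/-- Weak limits of continuous functions of the state of at most the growth of `growth`. -/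
lemma weakConv {F : Phase d → ℝ} (hF : ContinuousOn F {U | 0 < U.ρ ∧ 0 < U.θ}) (K : ℝ)
    (hK : ∀ U : Phase d, (ρlo ≤ U.ρ ∧ U.ρ ≤ ρhi) → (θlo ≤ U.θ ∧ U.θ ≤ θhi) →
      |F U| ≤ K * growth U) :
    Pairs 𝒬 V F ∧ WeakConv 𝒬 (fun n p => F (𝒰 n p)) (fun p => ∫ U, F U ∂(V p)) := by
  have hgr : ∀ n, ∀ᵐ p ∂𝒬, |F (𝒰 n p)| ≤ (|K| + 1) * growth (𝒰 n p) := fun n => by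
    filter_upwards [ha.ae_state_mem n] with p hp
    refine (hK _ hp.1.1 hp.1.2).trans (mul_le_mul_of_nonneg_right ?_ ?_)
    exacts [by linarith [le_abs_self K], by linarith [one_le_growth (𝒰 n p)]]
  have hgi : ∀ n, Integrable (fun p => growth (𝒰 n p)) 𝒬 := fun n =>
    (ha.sol n).admissible_growth.integrable
  have hint : ∀ n, Integrable (fun p => F (𝒰 n p)) 𝒬 := fun n =>
    ((hgi n).const_mul (|K| + 1)).mono' (ha.aestronglyMeasurable_state hF n) (hgr n)
  have h := ha.pairs_and_weakConv hF hint fun n => by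
    have h1 := integral_mono_ae (hint n).abs ((hgi n).const_mul _) (hgr n)
    rw [integral_const_mul] at h1
    exact h1.trans (mul_le_mul_of_nonneg_left ((ha.sol n).integral_growth_le (ha.bounds n))
      (by positivity))
  refine ⟨h.1, h.2 fun η hη => ?_⟩
  obtain ⟨R, -, hR⟩ := ha.growth_truncated (η := η / (|K| + 1)) (by positivity)
  refine ⟨(|K| + 1) * R, hR.mono fun n hn => ?_⟩
  have h1 : ∫ p, max (|F (𝒰 n p)| - (|K| + 1) * R) 0 ∂𝒬
      ≤ ∫ p, (|K| + 1) * max (growth (𝒰 n p) - R) 0 ∂𝒬 := by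
    refine integral_mono_ae (((hint n).abs.sub (integrable_const _)).sup (integrable_const 0))
      ((((hgi n).sub (integrable_const R)).sup (integrable_const 0)).const_mul _) ?_
    filter_upwards [hgr n] with p h2
    refine max_le ?_ (by positivity)
    have h3 := mul_le_mul_of_nonneg_left (le_max_left (growth (𝒰 n p) - R) 0)
      (by positivity : 0 ≤ |K| + 1)
    linarith
  rw [integral_const_mul] at h1
  exact h1.trans ((mul_le_mul_of_nonneg_left hn (by positivity)).trans
    (mul_div_cancel₀ η (by positivity)).le)

end IsApproximation

/-! ### Consistency of the numerical fluxes -/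

/-- Young's inequality for the flux error. Here `a` stands for the speed, `b` and `c` for the jumps
of the velocity and of density and temperature. The product `(1 + a)² c` is the delicate one, as no
more than `a²` is integrable: where `a² ≤ R`, a square of `c` suffices; elsewhere `c ≤ D` and the
truncated square is left. -/
lemma flux_error_le {a b c η R D c₀ : ℝ} (ha : 0 ≤ a) (hb : 0 ≤ b) (hc : 0 ≤ c) (hη : 0 < η)
    (hη1 : η ≤ 1) (hR : 0 ≤ R) (hcD : c ≤ D) (hc₀ : 0 ≤ c₀) :
    c₀ * (1 + a) * (b / 2) + c₀ * (b + (1 + a) * c) * (1 + a + b / 2)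
      ≤ 4 * c₀ * (2 + D) * (η * (1 + a ^ 2) + b ^ 2 / η + (1 + R) ^ 2 * c ^ 2 / η
        + max (a ^ 2 - R) 0) := by
  have hD : 0 ≤ D := hc.trans hcD
  set M := max (a ^ 2 - R) 0 with hM
  have hM0 : 0 ≤ M := le_max_right _ _
  have hM1 : a ^ 2 ≤ R + M := by linarith [le_max_left (a ^ 2 - R) 0]
  set X := b ^ 2 / η with hX
  set Y := (1 + R) ^ 2 * c ^ 2 / η with hY
  have hX0 : 0 ≤ X := by positivity
  have hY0 : 0 ≤ Y := by positivity
  have hbX : b ^ 2 ≤ X := by rw [hX, le_div_iff₀ hη]; nlinarith [sq_nonneg b]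
  have h1 : (1 + a) * b ≤ 2 * η * (1 + a ^ 2) + X := by
    have e1 : η * X = b ^ 2 := by rw [hX]; field_simp
    have e2 : 0 ≤ (2 * η * (1 + a) - b) ^ 2 := sq_nonneg _
    have e3 : η * ((1 + a) * b) ≤ η * (2 * η * (1 + a ^ 2) + X) := by
      have : (1 + a) ^ 2 ≤ 2 * (1 + a ^ 2) := by nlinarith [sq_nonneg (a - 1)]
      have : η ^ 2 * (1 + a) ^ 2 ≤ η ^ 2 * (2 * (1 + a ^ 2)) :=
        mul_le_mul_of_nonneg_left this (sq_nonneg η)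
      nlinarith [sq_nonneg b]
    exact le_of_mul_le_mul_left e3 hη
  have h2 : (1 + R) * c ≤ η + Y := by
    have e1 : η * Y = ((1 + R) * c) ^ 2 := by rw [hY]; field_simp
    have e3 : η * ((1 + R) * c) ≤ η * (η + Y) := by
      nlinarith [sq_nonneg (η - (1 + R) * c), sq_nonneg ((1 + R) * c), sq_nonneg η]
    exact le_of_mul_le_mul_left e3 hη
  have h3 : (1 + a) ^ 2 * c ≤ 2 * (η + Y) + 2 * D * M := by
    have e1 : (1 + a) ^ 2 ≤ 2 * (1 + R) + 2 * M := by nlinarith [sq_nonneg (a - 1)]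
    have e2 := mul_le_mul_of_nonneg_right e1 hc
    have e3 : M * c ≤ M * D := mul_le_mul_of_nonneg_left hcD hM0
    nlinarith
  have h4 : (1 + a) * b * c ≤ (1 + a) * b * D := mul_le_mul_of_nonneg_left hcD (by positivity)
  have h5 : (1 + a) * (b / 2) + (b + (1 + a) * c) * (1 + a + b / 2)
      ≤ (3 / 2 + D / 2) * ((1 + a) * b) + b ^ 2 / 2 + (1 + a) ^ 2 * c := by nlinarith
  have h6 : (3 / 2 + D / 2) * ((1 + a) * b) ≤ (3 / 2 + D / 2) * (2 * η * (1 + a ^ 2) + X) :=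
    mul_le_mul_of_nonneg_left h1 (by positivity)
  have h7 : (1 + a) * (b / 2) + (b + (1 + a) * c) * (1 + a + b / 2)
      ≤ 4 * (2 + D) * (η * (1 + a ^ 2) + X + Y + M) := by
    have h8 : 0 ≤ η * a ^ 2 := by positivity
    have h9 : 0 ≤ D * X := by positivity
    have h10 : 0 ≤ D * Y := by positivity
    have h11 : 0 ≤ D * M := by positivity
    have h12 : 0 ≤ D * η := by positivity
    have h13 : 0 ≤ D * (η * a ^ 2) := by positivity
    nlinarith
  calc c₀ * (1 + a) * (b / 2) + c₀ * (b + (1 + a) * c) * (1 + a + b / 2)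
      = c₀ * ((1 + a) * (b / 2) + (b + (1 + a) * c) * (1 + a + b / 2)) := by ring
    _ ≤ c₀ * (4 * (2 + D) * (η * (1 + a ^ 2) + X + Y + M)) := mul_le_mul_of_nonneg_left h7 hc₀
    _ = _ := by ring

section Flux

/-- Squared speed. -/
def velSq (u : Cell d → ℝᵈ) (K : Cell d) : ℝ := ∑ j, u K j ^ 2

/-- Squared size of the jumps of the velocity. -/
def velJumpSq (u : Cell d → ℝᵈ) (K : Cell d) : ℝ := ∑ j, ∑ i, jump (fun J => u J j) i K ^ 2

/-- Squared size of the jumps of density and temperature. -/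
def stateJumpSq (ρ θ : Cell d → ℝ) (K : Cell d) : ℝ := ∑ i, jump ρ i K ^ 2 + ∑ i, jump θ i K ^ 2

lemma velSq_nonneg (u : Cell d → ℝᵈ) (K : Cell d) : 0 ≤ velSq u K :=
  sum_nonneg fun _ _ => sq_nonneg _

lemma velJumpSq_nonneg (u : Cell d → ℝᵈ) (K : Cell d) : 0 ≤ velJumpSq u K :=
  sum_nonneg fun _ _ => sum_nonneg fun _ _ => sq_nonneg _

lemma stateJumpSq_nonneg (ρ θ : Cell d → ℝ) (K : Cell d) : 0 ≤ stateJumpSq ρ θ K :=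
  add_nonneg (sum_nonneg fun _ _ => sq_nonneg _) (sum_nonneg fun _ _ => sq_nonneg _)

lemma abs_vel_le (u : Cell d → ℝᵈ) (K : Cell d) (i : Fin d) :
    |u K i| ≤ Real.sqrt (velSq u K) :=
  Real.abs_le_sqrt (sq_le_sum_sq (u K) i)

lemma abs_velJump_le (u : Cell d → ℝᵈ) (K : Cell d) (j i : Fin d) :
    |jump (fun J => u J j) i K| ≤ Real.sqrt (velJumpSq u K) := by
  refine Real.abs_le_sqrt ((sq_le_sum_sq (fun i => jump (fun J => u J j) i K) i).trans ?_)
  exact single_le_sum (f := fun j => ∑ i, jump (fun J => u J j) i K ^ 2)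
    (fun _ _ => sum_nonneg fun _ _ => sq_nonneg _) (Finset.mem_univ j)

lemma abs_stateJump_le (ρ θ : Cell d → ℝ) (K : Cell d) (i : Fin d) :
    |jump ρ i K| ≤ Real.sqrt (stateJumpSq ρ θ K) ∧
      |jump θ i K| ≤ Real.sqrt (stateJumpSq ρ θ K) := by
  have h3 : ∀ r : Cell d → ℝ, 0 ≤ ∑ i, jump r i K ^ 2 := fun r => sum_nonneg fun _ _ => sq_nonneg _
  exact ⟨Real.abs_le_sqrt ((sq_le_sum_sq (fun i => jump ρ i K) i).trans
      (le_add_of_nonneg_right (h3 θ))),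
    Real.abs_le_sqrt ((sq_le_sum_sq (fun i => jump θ i K) i).trans
      (le_add_of_nonneg_left (h3 ρ)))⟩

/-- The difference between the numerical flux and the flux `r u` is controlled by the jumps. -/
lemma abs_flux_sub_le {h ε : ℝ} (hh : 0 < h) (hh1 : h ≤ 1) (hε : 0 < ε) {r ρ θ : Cell d → ℝ}
    {u : Cell d → ℝᵈ} {K : Cell d} {i : Fin d} {c₀ η R D g : ℝ} (hη : 0 < η) (hη1 : η ≤ 1)
    (hR : 0 ≤ R) (hc₀ : 0 ≤ c₀) (hD : Real.sqrt (stateJumpSq ρ θ K) ≤ D) (hg : velSq u K ≤ g)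
    (h1 : |r K| ≤ c₀ * (1 + Real.sqrt (velSq u K)))
    (h2 : |jump r i K| ≤ c₀ * (Real.sqrt (velJumpSq u K)
      + (1 + Real.sqrt (velSq u K)) * Real.sqrt (stateJumpSq ρ θ K))) :
    |flux h ε r u i K - r K * u K i| ≤ 4 * c₀ * (2 + D) * (η * (1 + g)
      + 1 / η * velJumpSq u K + (1 + R) ^ 2 / η * stateJumpSq ρ θ K + max (g - R) 0) := by
  set a := Real.sqrt (velSq u K)
  set b := Real.sqrt (velJumpSq u K)
  set c := Real.sqrt (stateJumpSq ρ θ K)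
  have ea : a ^ 2 = velSq u K := Real.sq_sqrt (velSq_nonneg u K)
  have eb : b ^ 2 = velJumpSq u K := Real.sq_sqrt (velJumpSq_nonneg u K)
  have ec : c ^ 2 = stateJumpSq ρ θ K := Real.sq_sqrt (stateJumpSq_nonneg ρ θ K)
  have ha0 : 0 ≤ a := Real.sqrt_nonneg _
  have hb0 : 0 ≤ b := Real.sqrt_nonneg _
  have hc0 : 0 ≤ c := Real.sqrt_nonneg _
  have hD0 := hc0.trans hD
  have key := flux_error_le ha0 hb0 hc0 hη hη1 hR hD hc₀
  rw [ea, eb, ec, mul_div_right_comm, ← one_div_mul_eq_div η] at key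
  refine le_trans ?_ (key.trans (by gcongr))
  set ub := avg (fun J => u J i) i K with hub
  have hju : |jump (fun J => u J i) i K| ≤ b := abs_velJump_le u K i i
  have hui : |u K i| ≤ a := abs_vel_le u K i
  have hubK : ub - u K i = jump (fun J => u J i) i K / 2 := by rw [hub, avg, jump]; ring
  have hub1 : |ub - u K i| ≤ b / 2 := by rw [hubK, abs_div, abs_two]; linarith
  have hub2 : |ub| ≤ a + b / 2 := by
    have := abs_add_le (ub - u K i) (u K i)
    rw [sub_add_cancel] at this
    linarith
  have hhε : h ^ ε ≤ 1 := Real.rpow_le_one hh.le hh1 hε.le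
  have hhε0 : 0 ≤ h ^ ε := Real.rpow_nonneg hh.le _
  have hneg : |(ub - |ub|) / 2 - h ^ ε| ≤ 1 + a + b / 2 := by
    have h3 := abs_nonneg ub
    have h4 := le_abs_self ub
    have h5 := neg_abs_le ub
    rw [abs_le]
    constructor <;> linarith
  have e1 : flux h ε r u i K - r K * u K i
      = r K * (ub - u K i) + jump r i K * ((ub - |ub|) / 2 - h ^ ε) := by
    rw [flux, upwind, ← hub]
    have : r (K + e i) = r K + jump r i K := by rw [jump]; ring
    rw [this]; ring
  rw [e1]
  refine (abs_add_le _ _).trans (add_le_add ?_ ?_)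
  · rw [abs_mul]
    exact mul_le_mul h1 hub1 (abs_nonneg _) (by positivity)
  · rw [abs_mul]
    exact mul_le_mul h2 hneg (abs_nonneg _) (by positivity)

end Flux

lemma tendsto_h_div_rpow {L : ℝᵈ} {T ε : ℝ} {G : ℕ → Mesh d L T} (hε : ε < 1)
    (hG : Tendsto (fun n => (G n).h) atTop (𝓝 0)) :
    Tendsto (fun n => (G n).h / (G n).h ^ ε) atTop (𝓝 0) := by
  have h1 : ∀ n, (G n).h / (G n).h ^ ε = (G n).h ^ (1 - ε) := fun n => by
    rw [Real.rpow_sub (G n).h_pos, Real.rpow_one]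
  simp only [h1]
  have := hG.rpow_const (p := 1 - ε) (Or.inr (by linarith))
  rwa [Real.zero_rpow (by linarith)] at this

namespace IsApproximation

include ha

lemma weakConv_late {r : ℕ → ℕ → Cell d → ℝ} (hr : ∀ n, ∀ k < (G n).N, (G n).InQ (r n k))
    {R : ℝ × ℝᵈ → ℝ}
    (hconv : WeakConv 𝒬 (fun n p => (G n).recon (r n) p.1 p.2) R) {D : ℝ}
    (hD : ∀ n, (G n).intCells (fun K => |r n 0 K|) ≤ D) :
    WeakConv 𝒬 (fun n => (G n).late (r n)) R :=
  hconv.of_sub_tendsto (fun n => (Mesh.admissible_late ha.L_pos (hr n)).integrable)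
    (tendsto_recon_sub_late ha.L_pos ha.T_pos ha.Δt_lim hr hD)

lemma N_pos (n : ℕ) : 0 < (G n).N :=
  (Mesh.L_pos_of_N (G := G n) (t := T / 2) ⟨half_pos ha.T_pos, half_lt_self ha.T_pos⟩).pos

lemma integral_velJumpSq_le (n : ℕ) : ∫ p, (G n).late (fun k => velJumpSq (u n k)) p ∂𝒬
      ≤ C * ((G n).h / (G n).h ^ ε) := by
  unfold velJumpSq
  rw [Mesh.integral_late ha.L_pos fun k hk => Mesh.InQ.sum fun j _ => Mesh.InQ.sum fun i _ =>
    (((ha.sol n).u_inQ j k hk).jump i).pow 2]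
  refine le_of_eq_of_le (sum_congr rfl fun k _ => ?_) (ha.bounds n).jump_u
  rw [Mesh.intCells_sum]
  simp only [Mesh.intCells_sum]

lemma integral_stateJumpSq_le (n : ℕ) : ∫ p, (G n).late (fun k => stateJumpSq (ρ n k) (θ n k)) p ∂𝒬
      ≤ C * ((G n).h / (G n).h ^ ε) + (G n).h ^ 2 * C := by
  have h0 := (G n).h_pos
  unfold stateJumpSq
  rw [Mesh.integral_late ha.L_pos fun k hk => (Mesh.InQ.sum fun i _ =>
    (((ha.sol n).ρ_inQ k hk).jump i).pow 2).add (Mesh.InQ.sum fun i _ =>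
    (((ha.sol n).θ_inQ k hk).jump i).pow 2)]
  have e1 : ∀ k, (G n).Δt * (G n).intCells (fun K => ∑ i, jump (ρ n (k + 1)) i K ^ 2
        + ∑ i, jump (θ n (k + 1)) i K ^ 2)
      = (G n).Δt * ∑ i, (G n).intCells (fun K => jump (ρ n (k + 1)) i K ^ 2)
        + (G n).h ^ 2 * ((G n).Δt * ∑ i, (G n).intCells
          (fun K => gradE (G n).h (θ n (k + 1)) i K ^ 2)) := by
    intro k
    rw [Mesh.intCells_add, Mesh.intCells_sum, Mesh.intCells_sum, mul_add]
    congr 1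
    rw [mul_left_comm]
    congr 1
    rw [mul_sum]
    refine sum_congr rfl fun i _ => ?_
    rw [← Mesh.intCells_const_mul]
    congr 1
    funext K
    rw [gradE]; field_simp
  simp only [e1]
  rw [sum_add_distrib]
  refine add_le_add (ha.bounds n).jump_ρ ?_
  rw [← mul_sum]
  exact mul_le_mul_of_nonneg_left (ha.bounds n).gradE_θ (sq_nonneg _)

lemma sqrt_stateJumpSq_le (n : ℕ) {k : ℕ} (hk : k < (G n).N) (K : Cell d) :
    Real.sqrt (stateJumpSq (ρ n k) (θ n k) K) ≤ Real.sqrt (d * (ρhi ^ 2 + θhi ^ 2)) := by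
  refine Real.sqrt_le_sqrt ?_
  have h1 : ∀ i, jump (ρ n k) i K ^ 2 ≤ ρhi ^ 2 := fun i => by
    have a1 := (ha.sol n).ρ_bd k hk K
    have a2 := (ha.sol n).ρ_bd k hk (K + e i)
    have a3 := ha.ρlo_pos
    exact sq_le_sq' (by rw [jump]; linarith) (by rw [jump]; linarith)
  have h2 : ∀ i, jump (θ n k) i K ^ 2 ≤ θhi ^ 2 := fun i => by
    have a1 := (ha.sol n).θ_bd k hk K
    have a2 := (ha.sol n).θ_bd k hk (K + e i)
    have a3 := ha.θlo_pos
    exact sq_le_sq' (by rw [jump]; linarith) (by rw [jump]; linarith)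
  rw [stateJumpSq, ← sum_add_distrib]
  calc ∑ i, (jump (ρ n k) i K ^ 2 + jump (θ n k) i K ^ 2)
      ≤ ∑ _i : Fin d, (ρhi ^ 2 + θhi ^ 2) := sum_le_sum fun i _ => add_le_add (h1 i) (h2 i)
    _ = _ := by simp; ring

/-- The numerical flux of `r` has the same weak limit as `r u`. -/
lemma weakConv_flux
    {r : ℕ → ℕ → Cell d → ℝ} (hr : ∀ n, ∀ k < (G n).N, (G n).InQ (r n k)) {c₀ : ℝ} (hc₀ : 0 ≤ c₀)
    (h1 : ∀ n, ∀ k < (G n).N, ∀ K, |r n k K| ≤ c₀ * (1 + Real.sqrt (velSq (u n k) K)))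
    (h2 : ∀ n, ∀ k < (G n).N, ∀ K i, |jump (r n k) i K| ≤ c₀ * (Real.sqrt (velJumpSq (u n k) K)
      + (1 + Real.sqrt (velSq (u n k) K)) * Real.sqrt (stateJumpSq (ρ n k) (θ n k) K)))
    (i : Fin d) {Fl : ℝ × ℝᵈ → ℝ}
    (hconv : WeakConv 𝒬
      (fun n p => (G n).recon (fun k K => r n k K * u n k K i) p.1 p.2) Fl) :
    WeakConv 𝒬 (fun n => (G n).late fun k => flux (G n).h ε (r n k) (u n k) i) Fl := by
  have hC := ha.C_nonneg
  have hru : ∀ n, ∀ k < (G n).N, (G n).InQ (fun K => r n k K * u n k K i) := fun n k hk =>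
    (hr n k hk).fmul ((ha.sol n).u_inQ i k hk)
  have afl := fun n => Mesh.admissible_late ha.L_pos fun k hk =>
    (hr n k hk).flux ((ha.sol n).u_mem k hk.le) (G n).h ε i
  -- the first time step is negligible
  have hlate : WeakConv 𝒬 (fun n => (G n).late fun k K => r n k K * u n k K i) Fl := by
    refine ha.weakConv_late hru hconv (D := 2 * c₀ * (1 * ∏ i, L i + C)) fun n => ?_
    have hle : ∀ K, |r n 0 K * u n 0 K i| ≤ 2 * c₀ * (1 + ∑ j, u n 0 K j ^ 2) := by
      intro K
      rw [abs_mul, show ∑ j, u n 0 K j ^ 2 = Real.sqrt (velSq (u n 0) K) ^ 2 from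
        (Real.sq_sqrt (velSq_nonneg _ _)).symm]
      have e4 := Real.sqrt_nonneg (velSq (u n 0) K)
      refine (mul_le_mul (h1 n 0 (ha.N_pos n) K) (abs_vel_le (u n 0) K i) (abs_nonneg _)
        (by positivity)).trans ?_
      nlinarith [mul_nonneg hc₀ (sq_nonneg (Real.sqrt (velSq (u n 0) K) - 1)),
        mul_nonneg hc₀ (sq_nonneg (Real.sqrt (velSq (u n 0) K)))]
    refine (Mesh.intCells_mono hle).trans ?_
    rw [Mesh.intCells_const_mul, Mesh.intCells_add, Mesh.intCells_const]
    exact mul_le_mul_of_nonneg_left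
      (add_le_add le_rfl ((ha.bounds n).velocity 0 (ha.N_pos n))) (by positivity)
  refine hlate.of_sub_tendsto (fun n => (afl n).integrable) ?_
  set err : ℕ → ℝ × ℝᵈ → ℝ := fun n p => |(G n).late (fun k K => r n k K * u n k K i) p
    - (G n).late (fun k => flux (G n).h ε (r n k) (u n k) i) p| with herr
  set B := fun n => (G n).late fun k => velJumpSq (u n k)
  set S := fun n => (G n).late fun k => stateJumpSq (ρ n k) (θ n k)
  have aB : ∀ n, Admissible L T (B n) := fun n =>
    Mesh.admissible_late ha.L_pos fun k hk => Mesh.InQ.sum fun j _ => Mesh.InQ.sum fun i _ =>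
      (((ha.sol n).u_inQ j k hk).jump i).pow 2
  have aS : ∀ n, Admissible L T (S n) := fun n =>
    Mesh.admissible_late ha.L_pos fun k hk => (Mesh.InQ.sum fun i _ =>
      (((ha.sol n).ρ_inQ k hk).jump i).pow 2).add (Mesh.InQ.sum fun i _ =>
      (((ha.sol n).θ_inQ k hk).jump i).pow 2)
  set c₁ := 4 * c₀ * (2 + Real.sqrt (d * (ρhi ^ 2 + θhi ^ 2))) + 1
  have hc₁ : 0 < c₁ := by positivity
  set A₀ := (𝒬).real univ + ((1 + d * d + d) * (𝒬).real univ + T * C + C + C) + 1 with hA₀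
  have hA₀0 : 0 < A₀ := by have := ha.T_pos; positivity
  -- the error is small in `L¹` up to the choice of two parameters
  have hsmall : ∀ η, 0 < η → η ≤ 1 → ∀ R, 0 ≤ R → ∀ᶠ n in atTop, ∫ p, err n p ∂𝒬
      ≤ c₁ * (η * A₀ + 1 / η * (C * ((G n).h / (G n).h ^ ε))
        + (1 + R) ^ 2 / η * (C * ((G n).h / (G n).h ^ ε) + (G n).h ^ 2 * C)
        + ∫ p, max (growth (𝒰 n p) - R) 0 ∂𝒬) := by
    intro η hη hη1 R hR
    filter_upwards [ha.h_lim.eventually (gt_mem_nhds one_pos)] with n hn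
    have agr := (ha.sol n).admissible_growth
    have agR := (agr.sub (Admissible.const R)).max_const 0
    have hpt : ∀ᵐ p ∂𝒬, err n p ≤ c₁ * (η * (1 + growth (𝒰 n p)) + 1 / η * B n p
        + (1 + R) ^ 2 / η * S n p + max (growth (𝒰 n p) - R) 0) := by
      filter_upwards [ae_spaceTime_mem L T] with p hp
      have hg := sum_sq_u_le_growth (𝒰 n p)
      have hm := le_max_right (growth (𝒰 n p) - R) 0
      by_cases hle : (G n).Δt ≤ p.1
      · simp only [herr, B, S, Mesh.late, hle, if_true, Mesh.recon]
        have hk : ⌊p.1 / (G n).Δt⌋₊ < (G n).N := Mesh.L_pos_of_N hp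
        have hv := velJumpSq_nonneg (u n ⌊p.1 / (G n).Δt⌋₊) (cellOf (G n).h p.2)
        have hj := stateJumpSq_nonneg (ρ n ⌊p.1 / (G n).Δt⌋₊) (θ n ⌊p.1 / (G n).Δt⌋₊)
          (cellOf (G n).h p.2)
        have hg1 := one_le_growth (𝒰 n p)
        rw [abs_sub_comm]
        refine (abs_flux_sub_le (G n).h_pos hn.le ha.ε_pos hη hη1 hR hc₀
          (ha.sqrt_stateJumpSq_le n hk _) ((le_add_of_nonneg_left zero_le_one).trans hg)
          (h1 n _ hk _) (h2 n _ hk _ i)).trans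
          (mul_le_mul_of_nonneg_right (le_add_of_nonneg_right zero_le_one) (by positivity))
      · simp only [herr, B, S, Mesh.late, hle, if_false, sub_zero, abs_zero, mul_zero, add_zero]
        have hg1 := one_le_growth (𝒰 n p)
        positivity
    have i1 := (((Admissible.const (L := L) (T := T) 1).add agr).const_mul η)
    have i2 := (aB n).const_mul (1 / η)
    have i3 := (aS n).const_mul ((1 + R) ^ 2 / η)
    refine (integral_mono_ae
      (((Mesh.admissible_late ha.L_pos (hru n)).sub (afl n)).abs).integrable
      ((((i1.add i2).add i3).add agR).const_mul c₁).integrable hpt).trans ?_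
    rw [integral_const_mul, integral_add ((i1.add i2).add i3).integrable agR.integrable,
      integral_add (i1.add i2).integrable i3.integrable, integral_add i1.integrable i2.integrable,
      integral_const_mul, integral_const_mul, integral_const_mul,
      integral_add (Admissible.const (L := L) (T := T) 1).integrable agr.integrable,
      integral_const, smul_eq_mul, mul_one]
    have h7 := (ha.sol n).integral_growth_le (ha.bounds n)
    have h8 := ha.integral_velJumpSq_le n
    have h9 := ha.integral_stateJumpSq_le n
    gcongr
    linarith
  -- `R` is taken from equi-integrability, and both parameters are fixed before `n → ∞`
  rw [Metric.tendsto_nhds]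
  intro ζ hζ
  set η := min 1 (ζ / 4 / (c₁ * A₀)) with hη
  have hη0 : 0 < η := lt_min one_pos (by positivity)
  obtain ⟨R, hR0, hR⟩ := ha.growth_truncated (η := ζ / 4 / c₁) (by positivity)
  have hhε := (tendsto_h_div_rpow ha.ε_lt ha.h_lim).const_mul C
  have hlim := ((hhε.const_mul (1 / η)).add ((hhε.add
    ((ha.h_lim.pow 2).mul_const C)).const_mul ((1 + R) ^ 2 / η))).const_mul c₁
  simp only [mul_zero, add_zero, ne_eq, OfNat.ofNat_ne_zero, not_false_eq_true, zero_pow,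
    zero_mul] at hlim
  filter_upwards [hsmall η hη0 (min_le_left _ _) R hR0, hR,
    hlim.eventually (gt_mem_nhds (by positivity : 0 < ζ / 4))] with n hn1 hn2 hn3
  rw [Real.dist_eq, sub_zero, abs_of_nonneg (integral_nonneg fun p => abs_nonneg _)]
  have h3 : η * (c₁ * A₀) ≤ ζ / 4 := (le_div_iff₀ (by positivity)).1 (min_le_right _ _)
  have h5 := (le_div_iff₀' hc₁).1 hn2
  linarith

end IsApproximation

/-! ### The pairings of the balance laws -/

section Continuity

lemma Phase.continuous_ρ : Continuous (Phase.ρ : Phase d → ℝ) := continuous_fst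

lemma Phase.continuous_θ : Continuous (Phase.θ : Phase d → ℝ) := continuous_fst.comp continuous_snd

lemma Phase.continuous_u (i : Fin d) : Continuous fun U : Phase d => U.u i := by
  simp only [Phase.u]; fun_prop

lemma Phase.continuous_D (i j : Fin d) : Continuous fun U : Phase d => U.D i j := by
  simp only [Phase.D]; fun_prop

lemma Phase.continuous_g (i : Fin d) : Continuous fun U : Phase d => U.g i := by
  simp only [Phase.g]; fun_prop

lemma continuousOn_entropy (P : Fluid) :
    ContinuousOn (fun z : ℝ × ℝ => z.1 * entropy P z.1 z.2) {z | 0 < z.1 ∧ 0 < z.2} := by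
  refine ContinuousOn.congr (f := fun z : ℝ × ℝ => z.1 * (P.cv * Real.log z.2 - Real.log z.1))
    ?_ fun z hz => by simp only [entropy_eq P hz.1 hz.2]
  exact continuousOn_fst.mul ((continuousOn_const.mul
    (continuousOn_snd.log fun z hz => hz.2.ne')).sub (continuousOn_fst.log fun z hz => hz.1.ne'))

lemma Phase.continuousOn_entropy (P : Fluid) :
    ContinuousOn (fun U : Phase d => U.ρ * entropy P U.ρ U.θ) {U | 0 < U.ρ ∧ 0 < U.θ} :=
  (NSF.continuousOn_entropy P).comp
    (Phase.continuous_ρ.prodMk Phase.continuous_θ).continuousOn fun _ hU => hU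

lemma abs_log_sub_log_le {a x y : ℝ} (ha : 0 < a) (hx : a ≤ x) (hy : a ≤ y) :
    |Real.log x - Real.log y| ≤ |x - y| / a := by
  have key : ∀ {x y : ℝ}, a ≤ x → a ≤ y → Real.log x - Real.log y ≤ |x - y| / a := by
    intro x y hx hy
    have hx0 := ha.trans_le hx
    have hy0 := ha.trans_le hy
    rw [← Real.log_div hx0.ne' hy0.ne']
    have h1 := Real.log_le_sub_one_of_pos (div_pos hx0 hy0)
    have h2 : x / y - 1 = (x - y) / y := by field_simp
    rw [h2] at h1
    calc Real.log (x / y) ≤ (x - y) / y := h1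
      _ ≤ |x - y| / y := div_le_div_of_nonneg_right (le_abs_self _) hy0.le
      _ ≤ |x - y| / a := div_le_div_of_nonneg_left (abs_nonneg _) ha hy
  rw [abs_le]
  constructor
  · have := key hy hx
    rw [abs_sub_comm] at this
    linarith
  · exact key hx hy

/-- Lipschitz continuity of the entropy density `ρ s` away from vacuum and zero temperature. -/
lemma abs_entropy_sub_le (P : Fluid) {ρlo ρhi θlo θhi r t r' t' : ℝ} (hρ : 0 < ρlo) (hθ : 0 < θlo)
    (hr : ρlo ≤ r ∧ r ≤ ρhi) (ht : θlo ≤ t ∧ t ≤ θhi)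
    (hr' : ρlo ≤ r' ∧ r' ≤ ρhi) (ht' : θlo ≤ t' ∧ t' ≤ θhi) :
    |r' * entropy P r' t' - r * entropy P r t|
      ≤ (entropyBound P ρlo ρhi θlo θhi / ρlo + ρhi / ρlo) * |r' - r|
        + ρhi * P.cv / θlo * |t' - t| := by
  have hr0 := hρ.trans_le hr.1
  have hr0' := hρ.trans_le hr'.1
  have ht0 := hθ.trans_le ht.1
  have ht0' := hθ.trans_le ht'.1
  have h1 := abs_entropy_le P hρ hθ hr ht
  have h2 : |entropy P r t| ≤ entropyBound P ρlo ρhi θlo θhi / ρlo := by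
    rw [le_div_iff₀ hρ]
    rw [abs_mul, abs_of_pos hr0] at h1
    have := mul_le_mul_of_nonneg_right hr.1 (abs_nonneg (entropy P r t))
    linarith
  have h3 : |entropy P r' t' - entropy P r t| ≤ P.cv / θlo * |t' - t| + 1 / ρlo * |r' - r| := by
    rw [entropy_eq P hr0 ht0, entropy_eq P hr0' ht0']
    have e1 : P.cv * Real.log t' - Real.log r' - (P.cv * Real.log t - Real.log r)
        = P.cv * (Real.log t' - Real.log t) - (Real.log r' - Real.log r) := by ring
    rw [e1]
    refine (abs_sub _ _).trans (add_le_add ?_ ?_)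
    · rw [abs_mul, abs_of_pos P.cv_pos, div_mul_eq_mul_div, mul_div_assoc]
      exact mul_le_mul_of_nonneg_left (abs_log_sub_log_le hθ ht'.1 ht.1) P.cv_pos.le
    · rw [one_div_mul_eq_div]
      exact abs_log_sub_log_le hρ hr'.1 hr.1
  have e2 : r' * entropy P r' t' - r * entropy P r t
      = r' * (entropy P r' t' - entropy P r t) + (r' - r) * entropy P r t := by ring
  rw [e2]
  refine (abs_add_le _ _).trans ?_
  rw [abs_mul, abs_mul, abs_of_pos hr0']
  have h4 := mul_le_mul hr'.2 h3 (abs_nonneg _) (hr0'.le.trans hr'.2)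
  have h5 := mul_le_mul_of_nonneg_left h2 (abs_nonneg (r' - r))
  refine (add_le_add h4 h5).trans (le_of_eq ?_)
  ring

lemma entropyBound_nonneg (P : Fluid) {ρlo ρhi θlo θhi : ℝ} (h : 0 ≤ ρhi) :
    0 ≤ entropyBound P ρlo ρhi θlo θhi := by
  have := P.cv_pos.le
  rw [entropyBound]; positivity

end Continuity

namespace IsApproximation

include ha

lemma ρhi_pos : 0 < ρhi := ha.ρlo_pos.trans_le ha.ρlo_le.1

lemma θhi_pos : 0 < θhi := ha.θlo_pos.trans_le ha.ρlo_le.2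

/-- A continuous function of density and temperature has bounded, hence weakly convergent,
values along the sequence. -/
lemma weakConv_ρ : Pairs 𝒬 V (fun U => U.ρ) ∧
      WeakConv 𝒬 (fun n p => (𝒰 n p).ρ)
        (fun p => ∫ U, U.ρ ∂(V p)) := by
  refine ha.weakConv Phase.continuous_ρ.continuousOn ρhi fun U hU _ => ?_
  rw [abs_of_pos (ha.ρlo_pos.trans_le hU.1)]
  nlinarith [one_le_growth U, ha.ρhi_pos]

lemma weakConv_θ : Pairs 𝒬 V (fun U => U.θ) ∧
      WeakConv 𝒬 (fun n p => (𝒰 n p).θ)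
        (fun p => ∫ U, U.θ ∂(V p)) := by
  refine ha.weakConv Phase.continuous_θ.continuousOn θhi fun U _ hU => ?_
  rw [abs_of_pos (ha.θlo_pos.trans_le hU.1)]
  nlinarith [one_le_growth U, ha.θhi_pos]

lemma weakConv_u (i : Fin d) : Pairs 𝒬 V (fun U => U.u i) ∧
      WeakConv 𝒬 (fun n p => (𝒰 n p).u i)
        (fun p => ∫ U, U.u i ∂(V p)) :=
  ha.weakConv (Phase.continuous_u i).continuousOn 1 fun U _ _ => by
    rw [one_mul]; exact abs_u_le_growth U i

lemma weakConv_D (i j : Fin d) : Pairs 𝒬 V (fun U => U.D i j) ∧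
      WeakConv 𝒬 (fun n p => (𝒰 n p).D i j)
        (fun p => ∫ U, U.D i j ∂(V p)) :=
  ha.weakConv (Phase.continuous_D i j).continuousOn 1 fun U _ _ => by
    rw [one_mul]; exact abs_D_le_growth U i j

lemma weakConv_g (i : Fin d) : Pairs 𝒬 V (fun U => U.g i) ∧
      WeakConv 𝒬 (fun n p => (𝒰 n p).g i)
        (fun p => ∫ U, U.g i ∂(V p)) :=
  ha.weakConv (Phase.continuous_g i).continuousOn 1 fun U _ _ => by
    rw [one_mul]; exact abs_g_le_growth U i

lemma weakConv_ρu (i : Fin d) : Pairs 𝒬 V (fun U => U.ρ * U.u i) ∧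
      WeakConv 𝒬 (fun n p => (𝒰 n p).ρ * (𝒰 n p).u i) (fun p => ∫ U, U.ρ * U.u i ∂(V p)) := by
  refine ha.weakConv (F := fun U => U.ρ * U.u i)
    (Phase.continuous_ρ.mul (Phase.continuous_u i)).continuousOn ρhi fun U hU _ => ?_
  rw [abs_mul, abs_of_pos (ha.ρlo_pos.trans_le hU.1)]
  exact mul_le_mul hU.2 (abs_u_le_growth U i) (abs_nonneg _) ha.ρhi_pos.le

lemma weakConv_ρuu (i j : Fin d) : Pairs 𝒬 V (fun U => U.ρ * U.u i * U.u j) ∧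
      WeakConv 𝒬 (fun n p => (𝒰 n p).ρ * (𝒰 n p).u i * (𝒰 n p).u j)
        (fun p => ∫ U, U.ρ * U.u i * U.u j ∂(V p)) := by
  refine ha.weakConv (F := fun U => U.ρ * U.u i * U.u j)
    ((Phase.continuous_ρ.mul (Phase.continuous_u i)).mul (Phase.continuous_u j)).continuousOn
    ρhi fun U hU _ => ?_
  rw [mul_assoc, abs_mul, abs_of_pos (ha.ρlo_pos.trans_le hU.1)]
  exact mul_le_mul hU.2 (abs_u_mul_u_le_growth U i j) (abs_nonneg _) ha.ρhi_pos.le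

lemma weakConv_pressure : Pairs 𝒬 V (fun U => pressure U.ρ U.θ) ∧
      WeakConv 𝒬 (fun n p => pressure (𝒰 n p).ρ
        (𝒰 n p).θ) (fun p => ∫ U, pressure U.ρ U.θ ∂(V p)) := by
  refine ha.weakConv (F := fun U => pressure U.ρ U.θ)
    (Phase.continuous_ρ.mul Phase.continuous_θ).continuousOn (ρhi * θhi) fun U h1 h2 => ?_
  have h3 := ha.ρlo_pos.trans_le h1.1
  have h4 := ha.θlo_pos.trans_le h2.1
  rw [pressure, abs_of_pos (mul_pos h3 h4)]
  have h5 := mul_le_mul h1.2 h2.2 h4.le ha.ρhi_pos.le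
  have h6 := mul_pos ha.ρhi_pos ha.θhi_pos
  nlinarith [one_le_growth U]

lemma weakConv_stress (i j : Fin d) : Pairs 𝒬 V (fun U => stress P U.D i j) ∧
      WeakConv 𝒬 (fun n p => stress P (𝒰 n p).D i j)
        (fun p => ∫ U, stress P U.D i j ∂(V p)) := by
  refine ha.weakConv (F := fun U => stress P U.D i j) (Continuous.continuousOn ?_)
    (2 * P.μ + P.lam * d) fun U _ _ => ?_
  · refine (continuous_const.mul (Phase.continuous_D i j)).add ?_
    by_cases h : i = j
    · simp only [h, if_true]
      exact continuous_const.mul (continuous_finsetSum _ fun k _ => Phase.continuous_D k k)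
    · simp only [h, if_false]; exact continuous_const
  · have hg := one_le_growth U
    have h1 : |2 * P.μ * U.D i j| ≤ 2 * P.μ * growth U := by
      rw [abs_mul, abs_of_pos (by linarith [P.μ_pos])]
      exact mul_le_mul_of_nonneg_left (abs_D_le_growth U i j) (by linarith [P.μ_pos])
    have h2 : |if i = j then P.lam * ∑ k, U.D k k else 0| ≤ P.lam * (d * growth U) := by
      split_ifs
      · rw [abs_mul, abs_of_nonneg P.lam_nonneg]
        refine mul_le_mul_of_nonneg_left ((abs_sum_le_sum_abs _ _).trans
          ((sum_le_sum fun k _ => abs_D_le_growth U k k).trans (by simp))) P.lam_nonneg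
      · rw [abs_zero]
        exact mul_nonneg P.lam_nonneg (by positivity)
    rw [stress]
    refine (abs_add_le _ _).trans ((add_le_add h1 h2).trans (le_of_eq (by ring)))

lemma weakConv_energy : Pairs 𝒬 V (fun U => energyDensity P U.ρ U.θ U.u) ∧
      WeakConv 𝒬 (fun n p => energyDensity P (𝒰 n p).ρ
        (𝒰 n p).θ (𝒰 n p).u)
        (fun p => ∫ U, energyDensity P U.ρ U.θ U.u ∂(V p)) := by
  refine ha.weakConv (F := fun U => energyDensity P U.ρ U.θ U.u) (Continuous.continuousOn ?_)
    (ρhi + ρhi * (P.cv * θhi)) fun U h1 h2 => ?_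
  · exact ((continuous_const.mul Phase.continuous_ρ).mul
      (continuous_finsetSum _ fun i _ => (Phase.continuous_u i).pow 2)).add
      (Phase.continuous_ρ.mul (continuous_const.mul Phase.continuous_θ))
  · have h3 := ha.ρlo_pos.trans_le h1.1
    have h4 := ha.θlo_pos.trans_le h2.1
    have hcv := P.cv_pos
    have hs : 0 ≤ ∑ i, U.u i ^ 2 := sum_nonneg fun _ _ => sq_nonneg _
    have h5 := sum_sq_u_le_growth U
    have hg := one_le_growth U
    have hρ := ha.ρhi_pos
    have hθ := ha.θhi_pos
    rw [energyDensity, internalEnergy, abs_of_nonneg (by positivity)]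
    have h6 : 1 / 2 * U.ρ * ∑ i, U.u i ^ 2 ≤ ρhi * growth U :=
      mul_le_mul (by linarith [h1.2]) (by linarith) hs hρ.le
    have h7 : U.ρ * (P.cv * U.θ) ≤ ρhi * (P.cv * θhi) :=
      mul_le_mul h1.2 (mul_le_mul_of_nonneg_left h2.2 hcv.le) (by positivity) hρ.le
    have h8 : ρhi * (P.cv * θhi) ≤ ρhi * (P.cv * θhi) * growth U :=
      le_mul_of_one_le_right (by positivity) hg
    linarith

lemma weakConv_ρs : Pairs 𝒬 V (fun U => U.ρ * entropy P U.ρ U.θ) ∧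
      WeakConv 𝒬 (fun n p => (𝒰 n p).ρ * entropy P (𝒰 n p).ρ (𝒰 n p).θ)
        (fun p => ∫ U, U.ρ * entropy P U.ρ U.θ ∂(V p)) := by
  refine ha.weakConv (F := fun U => U.ρ * entropy P U.ρ U.θ) (Phase.continuousOn_entropy P)
    (entropyBound P ρlo ρhi θlo θhi) fun U h1 h2 => ?_
  exact (abs_entropy_le P ha.ρlo_pos ha.θlo_pos h1 h2).trans
    (le_mul_of_one_le_right (entropyBound_nonneg P ha.ρhi_pos.le) (one_le_growth U))

lemma weakConv_ρsu (i : Fin d) : Pairs 𝒬 V (fun U => U.ρ * entropy P U.ρ U.θ * U.u i) ∧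
      WeakConv 𝒬 (fun n p => (𝒰 n p).ρ * entropy P (𝒰 n p).ρ (𝒰 n p).θ * (𝒰 n p).u i)
        (fun p => ∫ U, U.ρ * entropy P U.ρ U.θ * U.u i ∂(V p)) := by
  refine ha.weakConv (F := fun U => U.ρ * entropy P U.ρ U.θ * U.u i)
    ((Phase.continuousOn_entropy P).mul (Phase.continuous_u i).continuousOn)
    (entropyBound P ρlo ρhi θlo θhi) fun U h1 h2 => ?_
  rw [abs_mul]
  exact mul_le_mul (abs_entropy_le P ha.ρlo_pos ha.θlo_pos h1 h2) (abs_u_le_growth U i)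
    (abs_nonneg _) (entropyBound_nonneg P ha.ρhi_pos.le)

lemma weakConv_g_div_θ (i : Fin d) : Pairs 𝒬 V (fun U => U.g i / U.θ) ∧
      WeakConv 𝒬 (fun n p => (𝒰 n p).g i / (𝒰 n p).θ)
        (fun p => ∫ U, U.g i / U.θ ∂(V p)) := by
  refine ha.weakConv (F := fun U => U.g i / U.θ)
    ((Phase.continuous_g i).continuousOn.div Phase.continuous_θ.continuousOn fun U hU => hU.2.ne')
    (1 / θlo) fun U _ h2 => ?_
  have h4 := ha.θlo_pos.trans_le h2.1
  rw [abs_div, abs_of_pos h4, one_div_mul_eq_div]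
  exact div_le_div₀ (by linarith [one_le_growth U]) (abs_g_le_growth U i) ha.θlo_pos h2.1

lemma pairs_entropyFlux (i : Fin d) :
    Pairs 𝒬 V (fun U => U.ρ * entropy P U.ρ U.θ * U.u i - P.κ * U.g i / U.θ) ∧
      (fun p => ∫ U, (U.ρ * entropy P U.ρ U.θ * U.u i - P.κ * U.g i / U.θ) ∂(V p))
        =ᵐ[𝒬] fun p => (∫ U, U.ρ * entropy P U.ρ U.θ * U.u i ∂(V p))
          - P.κ * ∫ U, U.g i / U.θ ∂(V p) := by
  obtain ⟨h1, h1'⟩ := (ha.weakConv_ρsu i).1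
  obtain ⟨h2, h2'⟩ := (ha.weakConv_g_div_θ i).1
  have heq : (fun p => ∫ U, (U.ρ * entropy P U.ρ U.θ * U.u i - P.κ * U.g i / U.θ) ∂(V p))
        =ᵐ[𝒬] fun p => (∫ U, U.ρ * entropy P U.ρ U.θ * U.u i ∂(V p))
          - P.κ * ∫ U, U.g i / U.θ ∂(V p) := by
    filter_upwards [h1, h2] with p k1 k2
    simp only [mul_div_assoc]
    rw [integral_sub k1 (k2.const_mul _), integral_const_mul]
  refine ⟨⟨?_, (h1'.sub (h2'.const_mul _)).congr heq.symm⟩, heq⟩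
  filter_upwards [h1, h2] with p k1 k2
  simp only [mul_div_assoc]
  exact k1.sub (k2.const_mul _)

/-! ### Weak limits of the numerical fluxes -/

lemma abs_ρ_le {n k : ℕ} (hk : k < (G n).N) (K : Cell d) : |ρ n k K| ≤ ρhi := by
  have h := (ha.sol n).ρ_bd k hk K
  rw [abs_of_pos (ha.ρlo_pos.trans_le h.1)]; exact h.2

lemma weakConv_flux_ρ (i : Fin d) :
    WeakConv 𝒬 (fun n => (G n).late fun k => flux (G n).h ε (ρ n k) (u n k) i)
      (fun p => ∫ U, U.ρ * U.u i ∂(V p)) := by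
  have h0 := ha.ρhi_pos
  refine ha.weakConv_flux (c₀ := ρhi + 1) (fun n => (ha.sol n).ρ_inQ) (by positivity)
    (fun n k hk K => ?_) (fun n k hk K i => ?_) i (ha.weakConv_ρu i).2
  · have h1 := ha.abs_ρ_le hk K
    have h2 := Real.sqrt_nonneg (velSq (u n k) K)
    nlinarith
  · have h1 := (abs_stateJump_le (ρ n k) (θ n k) K i).1
    have h2 := Real.sqrt_nonneg (velSq (u n k) K)
    have h3 := Real.sqrt_nonneg (velJumpSq (u n k) K)
    have h4 := Real.sqrt_nonneg (stateJumpSq (ρ n k) (θ n k) K)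
    have h5 := mul_nonneg h2 h4
    nlinarith [mul_nonneg h0.le h3, mul_nonneg h0.le h4, mul_nonneg h0.le h5]

lemma weakConv_flux_ρu (i j : Fin d) : WeakConv 𝒬 (fun n => (G n).late fun k =>
        flux (G n).h ε (fun J => ρ n k J * u n k J j) (u n k) i)
      (fun p => ∫ U, U.ρ * U.u j * U.u i ∂(V p)) := by
  have h0 := ha.ρhi_pos
  refine ha.weakConv_flux (r := fun n k J => ρ n k J * u n k J j) (c₀ := ρhi + 1)
    (fun n k hk => ((ha.sol n).ρ_inQ k hk).fmul ((ha.sol n).u_inQ j k hk)) (by positivity)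
    (fun n k hk K => ?_) (fun n k hk K i => ?_) i (ha.weakConv_ρuu j i).2
  · have h1 := ha.abs_ρ_le hk K
    have h2 := Real.sqrt_nonneg (velSq (u n k) K)
    have h3 := mul_le_mul h1 (abs_vel_le (u n k) K j) (abs_nonneg _) h0.le
    rw [abs_mul]
    nlinarith
  · have h1 := (abs_stateJump_le (ρ n k) (θ n k) K i).1
    have h2 := Real.sqrt_nonneg (velSq (u n k) K)
    have h3 := Real.sqrt_nonneg (velJumpSq (u n k) K)
    have h4 := Real.sqrt_nonneg (stateJumpSq (ρ n k) (θ n k) K)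
    have h5 := mul_nonneg h2 h4
    have e1 : jump (fun J => ρ n k J * u n k J j) i K
        = ρ n k (K + e i) * jump (fun J => u n k J j) i K + u n k K j * jump (ρ n k) i K := by
      simp only [jump]; ring
    rw [e1]
    have k1 := mul_le_mul (ha.abs_ρ_le hk (K + e i)) (abs_velJump_le (u n k) K j i) (abs_nonneg _)
      h0.le
    have k2 := mul_le_mul (abs_vel_le (u n k) K j) h1 (abs_nonneg _) h2
    refine (abs_add_le _ _).trans ?_
    rw [abs_mul, abs_mul]
    nlinarith [mul_nonneg h0.le h3, mul_nonneg h0.le h4, mul_nonneg h0.le h5]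

lemma weakConv_flux_ρs (i : Fin d) : WeakConv 𝒬 (fun n => (G n).late fun k =>
        flux (G n).h ε (fun J => ρ n k J * entropy P (ρ n k J) (θ n k J)) (u n k) i)
      (fun p => ∫ U, U.ρ * entropy P U.ρ U.θ * U.u i ∂(V p)) := by
  have h0 := ha.ρhi_pos
  have hS := entropyBound_nonneg P (ρlo := ρlo) (θlo := θlo) (θhi := θhi) h0.le
  have hρ := ha.ρlo_pos
  have hθ := ha.θlo_pos
  have hcv := P.cv_pos
  set S := entropyBound P ρlo ρhi θlo θhi with hSdef
  set c₁ := S / ρlo + ρhi / ρlo with hc₁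
  set c₂ := ρhi * P.cv / θlo with hc₂
  have hc₁0 : 0 ≤ c₁ := by positivity
  have hc₂0 : 0 ≤ c₂ := by positivity
  refine ha.weakConv_flux (r := fun n k J => ρ n k J * entropy P (ρ n k J) (θ n k J))
    (c₀ := S + c₁ + c₂) (fun n k hk K i => ?_) (by positivity)
    (fun n k hk K => ?_) (fun n k hk K i => ?_) i (ha.weakConv_ρsu i).2
  · simp only [(ha.sol n).ρ_inQ k hk K i, (ha.sol n).θ_inQ k hk K i]
  · have h1 := abs_entropy_le P ha.ρlo_pos ha.θlo_pos ((ha.sol n).ρ_bd k hk K)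
      ((ha.sol n).θ_bd k hk K)
    have h2 := Real.sqrt_nonneg (velSq (u n k) K)
    rw [← hSdef] at h1
    refine h1.trans ?_
    nlinarith [mul_nonneg hS h2, mul_nonneg hc₁0 h2, mul_nonneg hc₂0 h2]
  · have h1 := abs_stateJump_le (ρ n k) (θ n k) K i
    have h2 := Real.sqrt_nonneg (velSq (u n k) K)
    have h3 := Real.sqrt_nonneg (velJumpSq (u n k) K)
    have h4 := Real.sqrt_nonneg (stateJumpSq (ρ n k) (θ n k) K)
    have h6 := abs_entropy_sub_le P ha.ρlo_pos ha.θlo_pos ((ha.sol n).ρ_bd k hk K)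
      ((ha.sol n).θ_bd k hk K) ((ha.sol n).ρ_bd k hk (K + e i)) ((ha.sol n).θ_bd k hk (K + e i))
    rw [← hSdef, ← hc₁, ← hc₂] at h6
    have k1 := mul_le_mul_of_nonneg_left h1.1 hc₁0
    have k2 := mul_le_mul_of_nonneg_left h1.2 hc₂0
    simp only [jump] at k1 k2 ⊢
    refine h6.trans ((add_le_add k1 k2).trans ?_)
    set a := Real.sqrt (velSq (u n k) K)
    set b := Real.sqrt (velJumpSq (u n k) K)
    set c := Real.sqrt (stateJumpSq (ρ n k) (θ n k) K)
    have k3 : c ≤ b + (1 + a) * c := by nlinarith [mul_nonneg h2 h4]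
    calc c₁ * c + c₂ * c = (c₁ + c₂) * c := by ring
      _ ≤ (S + c₁ + c₂) * c := mul_le_mul_of_nonneg_right (by linarith) h4
      _ ≤ _ := mul_le_mul_of_nonneg_left k3 (by positivity)

lemma weakConv_late_u (i : Fin d) : WeakConv 𝒬 (fun n => (G n).late fun k K => u n k K i)
      (fun p => ∫ U, U.u i ∂(V p)) := by
  refine ha.weakConv_late (fun n => (ha.sol n).u_inQ i) (ha.weakConv_u i).2
    (D := 1 * ∏ i, L i + C) fun n => ?_
  refine (Mesh.intCells_mono (g := fun K => 1 + ∑ j, u n 0 K j ^ 2) fun K => ?_).trans ?_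
  · have := sq_le_sum_sq (u n 0 K) i
    exact (abs_le_one_add_sq _).trans (by linarith)
  · rw [Mesh.intCells_add, Mesh.intCells_const]
    exact add_le_add le_rfl ((ha.bounds n).velocity 0 (ha.N_pos n))

lemma weakConv_late_pressure :
    WeakConv 𝒬 (fun n => (G n).late fun k K => pressure (ρ n k K) (θ n k K))
      (fun p => ∫ U, pressure U.ρ U.θ ∂(V p)) := by
  refine ha.weakConv_late (fun n k hk => ((ha.sol n).ρ_inQ k hk).fmul ((ha.sol n).θ_inQ k hk))
    ha.weakConv_pressure.2 (D := ρhi * θhi * ∏ i, L i) fun n => ?_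
  rw [← Mesh.intCells_const (G := G n)]
  refine Mesh.intCells_mono fun K => ?_
  have h := (ha.sol n).θ_bd 0 (ha.N_pos n) K
  have h1 := ha.θlo_pos.trans_le h.1
  change |ρ n 0 K * θ n 0 K| ≤ ρhi * θhi
  rw [abs_mul, abs_of_pos h1]
  exact mul_le_mul (ha.abs_ρ_le (ha.N_pos n) K) h.2 h1.le ha.ρhi_pos.le

lemma weakConv_late_θ : WeakConv 𝒬 (fun n => (G n).late (θ n)) (fun p => ∫ U, U.θ ∂(V p)) := by
  refine ha.weakConv_late (fun n => (ha.sol n).θ_inQ) ha.weakConv_θ.2 (D := θhi * ∏ i, L i)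
    fun n => ?_
  rw [← Mesh.intCells_const (G := G n)]
  refine Mesh.intCells_mono fun K => ?_
  have h := (ha.sol n).θ_bd 0 (ha.N_pos n) K
  rw [abs_of_pos (ha.θlo_pos.trans_le h.1)]
  exact h.2

end IsApproximation

/-! ### The balances of mass and momentum, and the compatibility of the gradients -/

lemma Mesh.late_eq_zero_or {G : Mesh d L T} (r : ℕ → Cell d → ℝ) {p : ℝ × ℝᵈ}
    (hp : p.1 ∈ Ioo 0 T) : G.late r p = 0 ∨ ∃ k K, k + 1 < G.N ∧ G.late r p = r (k + 1) K := by
  rw [late]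
  split_ifs with hle
  · have h1 : 1 ≤ ⌊p.1 / G.Δt⌋₊ := by rw [Nat.one_le_floor_iff, one_le_div G.Δt_pos]; exact hle
    obtain ⟨k, hk⟩ := Nat.exists_eq_add_of_le' h1
    have h2 := L_pos_of_N (G := G) hp
    exact Or.inr ⟨k, _, by omega, by rw [recon, hk]⟩
  · exact Or.inl rfl

lemma Mesh.late_eq_zero {G : Mesh d L T} {r : ℕ → Cell d → ℝ}
    (h : ∀ k, k + 1 < G.N → ∀ K, r (k + 1) K = 0) {p : ℝ × ℝᵈ} (hp : p.1 ∈ Ioo 0 T) :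
    G.late r p = 0 := by
  obtain h1 | ⟨k, K, hk, h1⟩ := late_eq_zero_or r hp
  exacts [h1, h1.trans (h k hk K)]

lemma Mesh.late_nonneg {G : Mesh d L T} {r : ℕ → Cell d → ℝ}
    (h : ∀ k, k + 1 < G.N → ∀ K, 0 ≤ r (k + 1) K) {p : ℝ × ℝᵈ} (hp : p.1 ∈ Ioo 0 T) :
    0 ≤ G.late r p := by
  obtain h1 | ⟨k, K, hk, h1⟩ := late_eq_zero_or r hp
  exacts [h1.ge, h1 ▸ h k hk K]

/-- Summation by parts for the edge gradient, which lives on the shifted cells. -/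
lemma Mesh.integral_late_gradE_mul {G : Mesh d L T}
    (hL : ∀ i, 0 < L i) {r : ℕ → Cell d → ℝ} (hr : ∀ k < G.N, G.InQ (r k)) (i : Fin d)
    {g : ℝ × ℝᵈ → ℝ} (hg : Admissible L T g) :
    ∫ p, G.late (fun k => gradE G.h (r k) i) (p.1, p.2 + -Pi.single i (G.h / 2)) * g p ∂𝒬
      = -∫ p, G.late r p * ((g (p.1, p.2 + Pi.single i (G.h / 2))
          - g (p.1, p.2 + -Pi.single i (G.h / 2))) / G.h) ∂𝒬 := by
  have ar := admissible_late (G := G) hL hr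
  have ag : Admissible L T (G.late fun k => gradE G.h (r k) i) :=
    admissible_late hL fun k hk => (hr k hk).gradE _ i
  have h0 := G.h_pos
  rw [ag.integral_translate_mul hL hg, neg_neg]
  have e1 : ∀ p, G.late (fun k => gradE G.h (r k) i) p * g (p.1, p.2 + Pi.single i (G.h / 2))
      = 1 / G.h * (G.late r (p.1, p.2 + Pi.single i G.h) * g (p.1, p.2 + Pi.single i (G.h / 2))
        - G.late r p * g (p.1, p.2 + Pi.single i (G.h / 2))) := by
    intro p
    have : G.late (fun k => gradE G.h (r k) i) p
        = 1 / G.h * (G.late r (p.1, p.2 + Pi.single i G.h) - G.late r p) := by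
      rw [← late_add_e, ← late_sub, ← late_const_mul]
      congr 1
      funext k K
      rw [gradE, jump, one_div_mul_eq_div]
    rw [this]; ring
  simp only [e1]
  rw [integral_const_mul, integral_sub ((ar.translate _).mul (hg.translate _)).integrable
    (ar.mul (hg.translate _)).integrable,
    ar.integral_translate_mul hL (hg.translate (Pi.single i (G.h / 2))),
    ← integral_sub (ar.mul ((hg.translate _).translate _)).integrable
      (ar.mul (hg.translate _)).integrable, ← integral_const_mul, ← integral_neg]
  refine integral_congr_ae (.of_forall fun p => ?_)
  have e2 : p.2 + -Pi.single i G.h + Pi.single i (G.h / 2) = p.2 + -Pi.single i (G.h / 2) := by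
    rw [add_assoc, ← Pi.single_neg, ← Pi.single_add, ← Pi.single_neg]
    congr 2; ring
  simp only [e2]
  ring

lemma tendsto_half : Tendsto (fun c : ℝ => c / 2) (𝓝[>] 0) (𝓝[>] 0) := by
  refine tendsto_nhdsWithin_iff.2 ⟨?_, ?_⟩
  · have : Tendsto (fun c : ℝ => c / 2) (𝓝 0) (𝓝 (0 / 2)) := (continuous_id.div_const 2).tendsto 0
    rw [zero_div] at this
    exact this.mono_left nhdsWithin_le_nhds
  · filter_upwards [self_mem_nhdsWithin] with c hc using half_pos (mem_Ioi.1 hc)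

/-- The symmetric difference quotients in space converge uniformly. -/
lemma IsTest.eventually_symm_quotient_dx
    {φ : ℝ → ℝᵈ → ℝ} (hφ : IsTest L φ) (i : Fin d) {η : ℝ} (hη : 0 < η) :
    ∀ᶠ c : ℝ in 𝓝[>] 0, ∀ p ∈ closedBox L T,
      |(φ p.1 (p.2 + Pi.single i (c / 2)) - φ p.1 (p.2 + -Pi.single i (c / 2))) / c
        - dx i φ p.1 p.2| ≤ η := by
  filter_upwards [tendsto_half.eventually (hφ.eventually_quotient_dx (T := T) i hη),
    self_mem_nhdsWithin]
    with c hc hc0 p hp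
  have hc0' : 0 < c := hc0
  obtain ⟨h1, h2⟩ := hc p hp
  have e1 : (φ p.1 (p.2 + Pi.single i (c / 2)) - φ p.1 (p.2 + -Pi.single i (c / 2))) / c
        - dx i φ p.1 p.2
      = (((φ p.1 (p.2 + Pi.single i (c / 2)) - φ p.1 p.2) / (c / 2) - dx i φ p.1 p.2)
        + ((φ p.1 p.2 - φ p.1 (p.2 + -Pi.single i (c / 2))) / (c / 2) - dx i φ p.1 p.2)) / 2 := by
    field_simp; ring
  rw [e1, abs_div, abs_two, div_le_iff₀ two_pos]
  exact (abs_add_le _ _).trans (by linarith)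

namespace IsApproximation

variable {φ : ℝ → (Fin d → ℝ) → ℝ}

include ha

lemma compat_u (hφ : IsTest L φ) (i j : Fin d) : ∫ p, (∫ U, U.D i j ∂(V p)) * φ p.1 p.2 ∂𝒬
      = -(1 / 2 * ((∫ p, (∫ U, U.u i ∂(V p)) * dx j φ p.1 p.2 ∂𝒬)
        + ∫ p, (∫ U, U.u j ∂(V p)) * dx i φ p.1 p.2 ∂𝒬)) := by
  have aφ := hφ.admissible (T := T) ha.L_pos
  have h1 := (ha.weakConv_D i j).2.tendsto _ aφ.meas.aestronglyMeasurable aφ.ae_bound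
  have h2 := tendsto_gradH ha.L_pos ha.h_lim (fun n => (ha.sol n).u_inQ i)
    (ha.weakConv_late_u i) j hφ
  have h3 := tendsto_gradH ha.L_pos ha.h_lim (fun n => (ha.sol n).u_inQ j)
    (ha.weakConv_late_u j) i hφ
  have h4 := (h2.add h3).const_mul (1 / 2)
  refine (tendsto_nhds_unique h1 (h4.congr fun n => ?_)).trans (by ring)
  have i2 : ∀ a b, Integrable (fun p => (G n).late (fun k => gradH (G n).h (fun K => u n k K a) b) p
      * φ p.1 p.2) 𝒬 := fun a b =>
    ((Mesh.admissible_late ha.L_pos fun k hk => ((ha.sol n).u_inQ a k hk).gradH _ b).mul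
      aφ).integrable
  rw [← integral_add (i2 i j) (i2 j i), ← integral_const_mul]
  refine integral_congr_ae (.of_forall fun p => ?_)
  change 1 / 2 * _ = (G n).late (fun k K => symGradH (G n).h (u n k) K i j) p * φ p.1 p.2
  have e1 : (G n).late (fun k K => symGradH (G n).h (u n k) K i j) p
      = 1 / 2 * ((G n).late (fun k => gradH (G n).h (fun K => u n k K i) j) p
        + (G n).late (fun k => gradH (G n).h (fun K => u n k K j) i) p) := by
    rw [← Mesh.late_add, ← Mesh.late_const_mul]
    congr 1
    funext k K
    rw [symGradH]; ring
  rw [e1]; ring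

lemma compat_θ (hφ : IsTest L φ) (i : Fin d) : ∫ p, (∫ U, U.g i ∂(V p)) * φ p.1 p.2 ∂𝒬
      = -∫ p, (∫ U, U.θ ∂(V p)) * dx i φ p.1 p.2 ∂𝒬 := by
  have aφ := hφ.admissible (T := T) ha.L_pos
  have h1 := (ha.weakConv_g i).2.tendsto _ aφ.meas.aestronglyMeasurable aφ.ae_bound
  have h2 := ha.weakConv_late_θ.tendsto_admissible
    (w := fun n p => (φ p.1 (p.2 + Pi.single i ((G n).h / 2))
      - φ p.1 (p.2 + -Pi.single i ((G n).h / 2))) / (G n).h)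
    (fun n => ((aφ.translate _).sub (aφ.translate _)).div_const _)
    (hφ.admissible_dx ha.L_pos i)
    fun η hη => by
      filter_upwards [(tendsto_h ha.h_lim).eventually
        (hφ.eventually_symm_quotient_dx i hη)] with n hn p hp using hn p hp
  refine tendsto_nhds_unique h1 (h2.neg.congr fun n => ?_)
  exact (Mesh.integral_late_gradE_mul ha.L_pos (ha.sol n).θ_inQ i aφ).symm

lemma tendsto_init {H : ℝ → ℝ → ℝ}
    (hH : ContinuousOn (fun z : ℝ × ℝ => H z.1 z.2) {z | 0 < z.1 ∧ 0 < z.2}) {D : ℝ}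
    (hD : ∀ r t, (ρlo ≤ r ∧ r ≤ ρhi) → (θlo ≤ t ∧ t ≤ θhi) → |H r t| ≤ D) :
    IntegrableOn (fun x => H (ρ₀ x) (θ₀ x)) (torus L) ∧
    Tendsto (fun n => ∫ x in torus L, |H (ρ n 0 (cellOf (G n).h x)) (θ n 0 (cellOf (G n).h x))
      - H (ρ₀ x) (θ₀ x)|) atTop (𝓝 0) := by
  obtain ⟨h1, h2⟩ := tendsto_integral_comp_proj ha.h_lim ha.ρ₀_int ha.θ₀_int ha.ρ₀_bd ha.θ₀_bd
    (hH.mono fun z hz => ⟨ha.ρlo_pos.trans_le hz.1.1, ha.θlo_pos.trans_le hz.2.1⟩)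
    fun r hr t ht => hD r t hr ht
  refine ⟨h1, h2.congr fun n => setIntegral_congr_fun (measurableSet_torus L) fun x hx => ?_⟩
  have hx' := (Mesh.cellOf_mem_cells (G := G n)).2 hx
  simp only [(ha.sol n).ρ_init _ hx', (ha.sol n).θ_init _ hx']

lemma tendsto_init_ρu (j : Fin d) : IntegrableOn (fun x => ρ₀ x * u₀ x j) (torus L) ∧
    Tendsto (fun n => ∫ x in torus L, |ρ n 0 (cellOf (G n).h x) * u n 0 (cellOf (G n).h x) j
      - ρ₀ x * u₀ x j|) atTop (𝓝 0) := by
  obtain ⟨h1, h2⟩ := tendsto_integral_momentum_proj ha.h_lim ha.ρ₀_int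
    (Integrable.eval ha.u₀_int j) ha.ρlo_pos ha.ρ₀_bd (fun n => ha.u₀_bd n j)
  refine ⟨h1, h2.congr fun n => setIntegral_congr_fun (measurableSet_torus L) fun x hx => ?_⟩
  have hx' := (Mesh.cellOf_mem_cells (G := G n)).2 hx
  simp only [(ha.sol n).ρ_init _ hx', (ha.sol n).u_init _ hx']

/-- The balance of mass, for test functions that vanish at the final time. -/
lemma mass_balance (hφ : IsTest L φ) (hφT : ∀ t x, T ≤ t → φ t x = 0) :
    ∫ p, balanceDensity (fun p => ∫ U, U.ρ ∂(V p)) (fun _ => 0)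
        (fun i p => ∫ U, U.ρ * U.u i ∂(V p)) φ p.1 p.2 ∂𝒬
      + ∫ x in torus L, ρ₀ x * φ 0 x = 0 := by
  have aφ := hφ.admissible (T := T) ha.L_pos
  obtain ⟨i0, hi0⟩ := ha.tendsto_init (H := fun r _ => r) continuousOn_fst (D := ρhi)
    fun r t hr _ => by rw [abs_of_pos (ha.ρlo_pos.trans_le hr.1)]; exact hr.2
  have h1 := tendsto_timeDiff ha.L_pos ha.T_pos ha.Δt_lim (fun n => (ha.sol n).ρ_inQ)
    ha.weakConv_ρ.2 i0 hi0 hφ hφT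
  have hfl : ∀ n, ∀ k < (G n).N, ∀ i, (G n).InQ (flux (G n).h ε (ρ n k) (u n k) i) :=
    fun n k hk i => ((ha.sol n).ρ_inQ k hk).flux ((ha.sol n).u_mem k hk.le) _ _ i
  have h2 := tendsto_divFlux ha.L_pos ha.h_lim hfl ha.weakConv_flux_ρ hφ
  have h3 : Tendsto (fun _ : ℕ => (0 : ℝ)) atTop (𝓝 0) := tendsto_const_nhds
  have h4 := tendsto_nhds_unique h3 ((h1.add h2).congr fun n => ?_)
  · rw [integral_balanceDensity (S := fun _ => 0) ha.L_pos ha.weakConv_ρ.2.integrable_lim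
      (integrable_zero _ _ _) (fun i => (ha.weakConv_ρu i).2.integrable_lim) hφ]
    simp only [zero_mul, integral_zero]
    linarith
  · have a1 : Admissible L T ((G n).late fun k K => (ρ n k K - ρ n (k - 1) K) / (G n).Δt) :=
      Mesh.admissible_late ha.L_pos fun k hk =>
        fun K i => by simp only [(ha.sol n).ρ_inQ k hk K i, (ha.sol n).ρ_inQ (k - 1) (by omega) K i]
    have a2 : Admissible L T ((G n).late fun k =>
        divFlux (G n).h (flux (G n).h ε (ρ n k) (u n k))) :=
      Mesh.admissible_late ha.L_pos fun k hk => Mesh.InQ.divFlux (hfl n k hk) _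
    rw [← integral_add (a1.mul aφ).integrable (a2.mul aφ).integrable]
    refine integral_eq_zero_of_ae ?_
    filter_upwards [ae_spaceTime_mem L T] with p hp
    rw [← add_mul, ← Mesh.late_add, Mesh.late_eq_zero _ hp, zero_mul]
    · rfl
    · intro k hk K
      exact (ha.sol n).continuity_cell (ha.sol n).dim_ne ha.L_pos (by omega) K

/-- The balance of a component of the momentum, for test functions that vanish at the final time. -/
lemma momentum_balance (hφ : IsTest L φ) (hφT : ∀ t x, T ≤ t → φ t x = 0) (j : Fin d) :
    ∫ p, balanceDensity (fun p => ∫ U, U.ρ * U.u j ∂(V p)) (fun _ => 0)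
        (fun i p => (∫ U, U.ρ * U.u j * U.u i ∂(V p)) + (if i = j then ∫ U, pressure U.ρ U.θ ∂(V p)
          else 0) - ∫ U, stress P U.D j i ∂(V p)) φ p.1 p.2 ∂𝒬
      + ∫ x in torus L, ρ₀ x * u₀ x j * φ 0 x = 0 := by
  have aφ := hφ.admissible (T := T) ha.L_pos
  obtain ⟨i0, hi0⟩ := ha.tendsto_init_ρu j
  have hρu : ∀ n, ∀ k < (G n).N, (G n).InQ fun K => ρ n k K * u n k K j := fun n k hk =>
    ((ha.sol n).ρ_inQ k hk).fmul ((ha.sol n).u_inQ j k hk)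
  have h1 := tendsto_timeDiff (r := fun n k K => ρ n k K * u n k K j) ha.L_pos ha.T_pos ha.Δt_lim
    hρu (ha.weakConv_ρu j).2 i0 hi0 hφ hφT
  have hfl : ∀ n, ∀ k < (G n).N, ∀ i, (G n).InQ (flux (G n).h ε (fun J => ρ n k J * u n k J j)
      (u n k) i) := fun n k hk i => (hρu n k hk).flux ((ha.sol n).u_mem k hk.le) _ _ i
  have h2 := tendsto_divFlux ha.L_pos ha.h_lim hfl (fun i => ha.weakConv_flux_ρu i j) hφ
  have hp : ∀ n, ∀ k < (G n).N, (G n).InQ fun K => pressure (ρ n k K) (θ n k K) := fun n k hk =>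
    ((ha.sol n).ρ_inQ k hk).fmul ((ha.sol n).θ_inQ k hk)
  have h3 := tendsto_gradH ha.L_pos ha.h_lim hp ha.weakConv_late_pressure j hφ
  -- the viscous stress, acting through the discrete gradients of its components
  have hst : ∀ n, ∀ k < (G n).N, ∀ i,
      (G n).InQ fun K => stress P (symGradH (G n).h (u n k) K) j i := by
    intro n k hk i
    refine ((((ha.sol n).D_inQ j i k hk).const_mul (2 * P.μ))).add (s := fun K =>
      if j = i then P.lam * ∑ l, symGradH (G n).h (u n k) K l l else 0) ?_
    by_cases h : j = i
    · simp only [h, if_true]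
      exact (Mesh.InQ.sum fun l _ => (ha.sol n).D_inQ l l k hk).const_mul P.lam
    · simp only [h, if_false]; exact fun _ _ => rfl
  have hstlate : ∀ n p, ∀ i, stress P (𝒰 n p).D j i
      = (G n).late (fun k K => stress P (symGradH (G n).h (u n k) K) j i) p := by
    intro n p i
    simp only [stress, Phase.D, Mesh.state, Mesh.late, Mesh.recon]
    split_ifs <;> simp
  have h4 : ∀ i, Tendsto (fun n => ∫ p, (G n).late (fun k => gradH (G n).h
        (fun K => stress P (symGradH (G n).h (u n k) K) j i) i) p * φ p.1 p.2 ∂𝒬)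
      atTop (𝓝 (-∫ p, (∫ U, stress P U.D j i ∂(V p)) * dx i φ p.1 p.2 ∂𝒬)) := by
    intro i
    refine tendsto_gradH (r := fun n k K => stress P (symGradH (G n).h (u n k) K) j i)
      ha.L_pos ha.h_lim (fun n k hk => hst n k hk i) ?_ i hφ
    have := (ha.weakConv_stress j i).2
    simp only [hstlate] at this
    exact this
  have h5 : Tendsto (fun _ : ℕ => (0 : ℝ)) atTop (𝓝 0) := tendsto_const_nhds
  have h6 := tendsto_nhds_unique h5 ((((h1.add h2).add h3).sub
    (tendsto_finsetSum Finset.univ fun i _ => h4 i)).congr fun n => ?_)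
  · have hA := fun i => (ha.weakConv_ρuu j i).2.integrable_lim
    have hP := ha.weakConv_pressure.2.integrable_lim
    have hS := fun i => (ha.weakConv_stress j i).2.integrable_lim
    have hP' : ∀ i, Integrable (fun p : ℝ × ℝᵈ => if i = j then ∫ U, pressure U.ρ U.θ ∂(V p) else 0)
        𝒬 := fun i => by split_ifs; exacts [hP, integrable_zero _ _ _]
    have hAP : ∀ i, Integrable (fun p : ℝ × ℝᵈ => (∫ U, U.ρ * U.u j * U.u i ∂(V p))
        + if i = j then ∫ U, pressure U.ρ U.θ ∂(V p) else 0) 𝒬 := fun i => (hA i).add (hP' i)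
    have ax := fun i {f : ℝ × ℝᵈ → ℝ} =>
      (hφ.admissible_dx (T := T) ha.L_pos i).integrable_mul (f := f)
    have hF : ∀ i, ∫ p, ((∫ U, U.ρ * U.u j * U.u i ∂(V p)) + (if i = j then
          ∫ U, pressure U.ρ U.θ ∂(V p) else 0) - ∫ U, stress P U.D j i ∂(V p)) * dx i φ p.1 p.2 ∂𝒬
        = (∫ p, (∫ U, U.ρ * U.u j * U.u i ∂(V p)) * dx i φ p.1 p.2 ∂𝒬)
          + (if i = j then ∫ p, (∫ U, pressure U.ρ U.θ ∂(V p)) * dx j φ p.1 p.2 ∂𝒬 else 0)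
          - ∫ p, (∫ U, stress P U.D j i ∂(V p)) * dx i φ p.1 p.2 ∂𝒬 := by
      intro i
      simp only [sub_mul]
      rw [integral_sub (ax i (hAP i)) (ax i (hS i))]
      simp only [add_mul]
      rw [integral_add (ax i (hA i)) (ax i (hP' i))]
      congr 2
      by_cases h : i = j
      · simp only [h, if_true]
      · simp only [h, if_false, zero_mul, integral_zero]
    have := integral_balanceDensity ha.L_pos (ha.weakConv_ρu j).2.integrable_lim
      (integrable_zero _ ℝ _) (fun i => (hAP i).sub (hS i)) hφ
    refine (congrArg (· + _) this).trans ?_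
    rw [sum_neg_distrib] at h6
    simp only [hF, sum_sub_distrib, sum_add_distrib, Finset.sum_ite_eq', Finset.mem_univ, if_true,
      zero_mul, integral_zero, Pi.sub_apply, Pi.zero_apply]
    linarith
  · have a1 : Admissible L T ((G n).late fun k K => (ρ n k K * u n k K j
        - ρ n (k - 1) K * u n (k - 1) K j) / (G n).Δt) :=
      Mesh.admissible_late ha.L_pos fun k hk =>
        fun K i => by
          have h1 := hρu n k hk K i
          have h2 := hρu n (k - 1) (by omega) K i
          simp only at h1 h2 ⊢
          rw [h1, h2]
    have a2 : Admissible L T ((G n).late fun k => divFlux (G n).h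
        (flux (G n).h ε (fun J => ρ n k J * u n k J j) (u n k))) :=
      Mesh.admissible_late ha.L_pos fun k hk => Mesh.InQ.divFlux (hfl n k hk) _
    have a3 : Admissible L T ((G n).late fun k => gradH (G n).h
        (fun K => pressure (ρ n k K) (θ n k K)) j) :=
      Mesh.admissible_late ha.L_pos fun k hk => (hp n k hk).gradH _ j
    have a4 : ∀ i, Admissible L T ((G n).late fun k => gradH (G n).h
        (fun K => stress P (symGradH (G n).h (u n k) K) j i) i) := fun i =>
      Mesh.admissible_late ha.L_pos fun k hk => (hst n k hk i).gradH _ i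
    rw [← integral_finsetSum _ fun i _ => ((a4 i).mul aφ).integrable,
      ← integral_add (a1.mul aφ).integrable (a2.mul aφ).integrable,
      ← integral_add ((a1.mul aφ).add (a2.mul aφ)).integrable (a3.mul aφ).integrable,
      ← integral_sub (((a1.mul aφ).add (a2.mul aφ)).add (a3.mul aφ)).integrable
        (Admissible.sum fun i _ => (a4 i).mul aφ).integrable]
    refine integral_eq_zero_of_ae ?_
    filter_upwards [ae_spaceTime_mem L T] with p hp
    rw [← sum_mul, ← add_mul, ← add_mul, ← sub_mul, ← Mesh.late_add, ← Mesh.late_add,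
      ← Mesh.late_sum Finset.univ (fun i k => gradH (G n).h
        (fun K => stress P (symGradH (G n).h (u n k) K) j i) i), ← Mesh.late_sub,
      Mesh.late_eq_zero _ hp, zero_mul]
    · rfl
    · intro k hk K
      have hm := (ha.sol n).momentum_cell (ha.sol n).dim_ne ha.L_pos (by omega : k < (G n).N) j K
      have hgrad : ∑ i, gradH (G n).h
          (fun K => stress P (symGradH (G n).h (u n (k + 1)) K) j i) i K
          = 2 * P.μ * ∑ i, gradH (G n).h (fun J => symGradH (G n).h (u n (k + 1)) J i j) i K
            + P.lam * gradH (G n).h (divH (G n).h (u n (k + 1))) j K := by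
        have e5 : ∀ i, gradH (G n).h
            (fun K => stress P (symGradH (G n).h (u n (k + 1)) K) j i) i K
            = 2 * P.μ * gradH (G n).h (fun J => symGradH (G n).h (u n (k + 1)) J i j) i K
              + if j = i then P.lam * gradH (G n).h (divH (G n).h (u n (k + 1))) j K else 0 := by
          intro i
          by_cases h : j = i
          · subst h
            simp only [stress, gradH, avg, symGradH, divH, add_self_div_two, if_true]; ring
          · simp only [stress, gradH, avg, symGradH, h, if_false]; ring
        simp only [e5, sum_add_distrib, ← mul_sum, sum_ite_eq,
          Finset.mem_univ, if_true]
      simp only [Nat.add_sub_cancel]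
      rw [hgrad]
      linarith

end IsApproximation

/-! ### The entropy inequality -/

section Production

/-- Discrete product rule for the entropy flux and the entropy production of heat conduction. -/
lemma one_div_mul_divFlux_gradE {h : ℝ} {θ : Cell d → ℝ} (hθ : ∀ K, 0 < θ K) (K : Cell d) :
    1 / θ K * divFlux h (gradE h θ) K = divFlux h (fun i K => gradE h θ i K / θ (K + e i)) K
        + ∑ i, gradE h θ i K ^ 2 / (θ K * θ (K + e i)) := by
  simp only [divFlux]
  rw [mul_left_comm, mul_sum, mul_sum, mul_sum, ← sum_add_distrib]
  refine sum_congr rfl fun i _ => ?_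
  have h1 := gradE_inv_mul (h := h) (hθ K) (hθ (K + e i))
  simp only [sub_add_cancel]
  have h2 : gradE h θ i K = (θ (K + e i) - θ K) / h := rfl
  rw [h2]
  have h3 : (θ (K + e i) - θ K) / h * ((1 / θ (K + e i) - 1 / θ K) / h)
      = 1 / h * ((θ (K + e i) - θ K) / h / θ (K + e i)) - 1 / h * ((θ (K + e i) - θ K) / h
        * (1 / θ K)) := by ring
  rw [h3] at h1
  linear_combination -h1

/-- A point of the dual cell lies in one of the two adjacent cells. -/
lemma cellOf_sub_half {h : ℝ} (hh : 0 < h) (x : ℝᵈ) (i : Fin d) :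
    cellOf h x = cellOf h (x + -Pi.single i (h / 2)) ∨
      cellOf h x = cellOf h (x + -Pi.single i (h / 2)) + e i := by
  have hne : ∀ j, j ≠ i → cellOf h (x + -Pi.single i (h / 2)) j = cellOf h x j := fun j hj => by
    simp [cellOf, hj]
  have h1 : cellOf h (x + -Pi.single i (h / 2)) i = ⌊x i / h - 1 / 2⌋ := by
    simp only [cellOf, Pi.add_apply, Pi.neg_apply, Pi.single_eq_same]
    congr 1
    field_simp; ring
  rcases le_or_gt (1 / 2) (Int.fract (x i / h)) with hf | hf
  · left
    funext j
    by_cases hj : j = i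
    · subst hj
      rw [h1]
      change ⌊x j / h⌋ = _
      symm
      rw [Int.floor_eq_iff]
      have := Int.self_sub_floor (x j / h)
      have h2 := Int.fract_lt_one (x j / h)
      constructor <;> linarith
    · rw [hne j hj]
  · right
    funext j
    by_cases hj : j = i
    · subst hj
      rw [Pi.add_apply, h1]
      change ⌊x j / h⌋ = _ + (Pi.single j 1 : Cell d) j
      rw [Pi.single_eq_same, ← sub_eq_iff_eq_add]
      symm
      rw [Int.floor_eq_iff]
      have := Int.self_sub_floor (x j / h)
      have h2 := Int.fract_nonneg (x j / h)
      push_cast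
      constructor <;> linarith
    · rw [Pi.add_apply, hne j hj]
      simp [e, hj]

/-- Comparison of the values of the temperature in two adjacent cells with the value `t` in one of
them, in terms of the difference quotient. -/
lemma adjacent_temperature_bounds {a b t h lo : ℝ} (hh : 0 < h) (hlo : 0 < lo) (ha : lo ≤ a)
    (hb : lo ≤ b) (ht : t = a ∨ t = b) :
    |(b - a) / h / b - (b - a) / h / t| ≤ h / lo ^ 2 * ((b - a) / h) ^ 2 ∧
    (1 - h * |(b - a) / h| / lo) * (((b - a) / h) ^ 2 / t ^ 2) ≤ ((b - a) / h) ^ 2 / (a * b) ∧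
    ((b - a) / h) ^ 2 / (a * b) ≤ 1 / lo ^ 2 * ((b - a) / h) ^ 2 := by
  have ha0 := hlo.trans_le ha
  have hb0 := hlo.trans_le hb
  have hab : lo ^ 2 ≤ a * b := by nlinarith
  have hg : h * |(b - a) / h| = |b - a| := by rw [abs_div, abs_of_pos hh]; field_simp
  set g := (b - a) / h with hgdef
  have hga : b - a = h * g := by rw [hgdef]; field_simp
  refine ⟨?_, ?_, ?_⟩
  · rcases ht with rfl | rfl
    · have e1 : g / b - g / t = -(h * g ^ 2 / (t * b)) := by
        have : t = b - h * g := by linarith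
        field_simp
        rw [this]; ring
      rw [e1, abs_neg, abs_of_nonneg (by positivity), div_mul_eq_mul_div]
      exact div_le_div_of_nonneg_left (by positivity) (by positivity) hab
    · rw [sub_self, abs_zero]; positivity
  · rw [hg]
    have key : ∀ {t s : ℝ}, lo ≤ t → lo ≤ s → |b - a| = |t - s| →
        (1 - |b - a| / lo) * (g ^ 2 / t ^ 2) ≤ g ^ 2 / (t * s) := by
      intro t s ht hs hts
      have ht0 := hlo.trans_le ht
      have hs0 := hlo.trans_le hs
      have e1 : g ^ 2 / (t * s) = t / s * (g ^ 2 / t ^ 2) := by field_simp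
      rw [e1]
      refine mul_le_mul_of_nonneg_right ?_ (by positivity)
      have h2 : |b - a| / s ≤ |b - a| / lo := div_le_div_of_nonneg_left (abs_nonneg _) hlo hs
      have h3 : -(t - s) / s ≤ |b - a| / s := by
        rw [hts]
        exact div_le_div_of_nonneg_right (neg_le_abs _) hs0.le
      have h4 : t / s = 1 - -(t - s) / s := by field_simp; ring
      rw [h4]; linarith
    rcases ht with rfl | rfl
    · exact key ha hb (abs_sub_comm _ _)
    · rw [mul_comm a t]; exact key hb ha rfl
  · rw [one_div_mul_eq_div]
    exact div_le_div_of_nonneg_left (sq_nonneg _) (by positivity) hab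

/-- The entropy production by friction. -/
noncomputable def frictionProduction (P : Fluid) (θ : ℝ) (D : Fin d → ℝᵈ) : ℝ :=
  1 / θ * (2 * P.μ * (∑ i, ∑ j, D i j ^ 2) + P.lam * (∑ k, D k k) ^ 2)

lemma frictionProduction_nonneg (P : Fluid) {θ : ℝ} (hθ : 0 < θ) (D : Fin d → ℝᵈ) :
    0 ≤ frictionProduction P θ D := by
  have h1 := P.μ_pos
  have h2 := P.lam_nonneg
  have h3 : 0 ≤ ∑ i, ∑ j, D i j ^ 2 :=
    sum_nonneg fun _ _ => sum_nonneg fun _ _ => sq_nonneg _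
  rw [frictionProduction]; positivity

lemma entropyProduction_eq (P : Fluid) {θ : ℝ} (hθ : 0 < θ) (D : Fin d → ℝᵈ) (g : ℝᵈ) :
    entropyProduction P θ D g = frictionProduction P θ D + P.κ * ∑ i, g i ^ 2 / θ ^ 2 := by
  have h1 : ∑ i, ∑ j, stress P D i j * D i j
      = 2 * P.μ * (∑ i, ∑ j, D i j ^ 2) + P.lam * (∑ k, D k k) ^ 2 := by
    simp only [stress, add_mul, ite_mul, zero_mul, sum_add_distrib, sum_ite_eq,
      Finset.mem_univ, if_true]
    rw [← mul_sum, mul_sum]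
    congr 1
    · simp only [mul_sum]
      refine sum_congr rfl fun i _ => sum_congr rfl fun j _ => ?_
      ring
    · rw [← mul_sum]; ring
  rw [entropyProduction, h1, frictionProduction, ← sum_div]
  field_simp

lemma entropyProduction_nonneg (P : Fluid) {θ : ℝ} (hθ : 0 < θ) (D : Fin d → ℝᵈ)
    (g : ℝᵈ) : 0 ≤ entropyProduction P θ D g := by
  rw [entropyProduction_eq P hθ]
  have := P.κ_pos.le
  exact add_nonneg (frictionProduction_nonneg P hθ D)
    (mul_nonneg this (sum_nonneg fun i _ => by positivity))

lemma entropyProduction_le (P : Fluid) {θ lo : ℝ} (hlo : 0 < lo) (hθ : lo ≤ θ)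
    (D : Fin d → ℝᵈ) (g : ℝᵈ) :
    entropyProduction P θ D g ≤ (2 * P.μ + P.lam * d) / lo * (∑ i, ∑ j, D i j ^ 2)
      + P.κ / lo ^ 2 * ∑ i, g i ^ 2 := by
  have hθ0 := hlo.trans_le hθ
  have hμ := P.μ_pos
  have hlam := P.lam_nonneg
  have hκ := P.κ_pos
  rw [entropyProduction_eq P hθ0]
  have hD : 0 ≤ ∑ i, ∑ j, D i j ^ 2 :=
    sum_nonneg fun _ _ => sum_nonneg fun _ _ => sq_nonneg _
  have h1 : (∑ k, D k k) ^ 2 ≤ d * ∑ i, ∑ j, D i j ^ 2 := by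
    refine sq_sum_le_card_mul_sum_sq.trans ?_
    rw [Finset.card_univ, Fintype.card_fin]
    refine mul_le_mul_of_nonneg_left (sum_le_sum fun k _ => ?_) (Nat.cast_nonneg d)
    exact sq_le_sum_sq (D k) k
  refine add_le_add ?_ ?_
  · have h2 := mul_le_mul_of_nonneg_left h1 hlam
    calc frictionProduction P θ D
        ≤ 1 / lo * (2 * P.μ * (∑ i, ∑ j, D i j ^ 2) + P.lam * (d * ∑ i, ∑ j, D i j ^ 2)) :=
          mul_le_mul (one_div_le_one_div_of_le hlo hθ) (by linarith) (by positivity) (by positivity)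
      _ = _ := by ring
  · rw [← sum_div, div_mul_eq_mul_div, ← mul_div_assoc]
    exact div_le_div_of_nonneg_left (mul_nonneg hκ.le (sum_nonneg fun _ _ => sq_nonneg _))
      (by positivity) (pow_le_pow_left₀ hlo.le hθ 2)

lemma Phase.continuousOn_entropyProduction (P : Fluid) :
    ContinuousOn (fun U : Phase d => entropyProduction P U.θ U.D U.g) {U | 0 < U.ρ ∧ 0 < U.θ} := by
  have hθ : ∀ U ∈ {U : Phase d | 0 < U.ρ ∧ 0 < U.θ}, U.θ ≠ 0 := fun U hU => hU.2.ne'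
  have hs : ∀ i j, Continuous fun U : Phase d => stress P U.D i j := by
    intro i j
    refine (continuous_const.mul (Phase.continuous_D i j)).add ?_
    by_cases h : i = j
    · simp only [h, if_true]
      exact continuous_const.mul (continuous_finsetSum _ fun k _ => Phase.continuous_D k k)
    · simp only [h, if_false]; exact continuous_const
  refine (continuousOn_const.div Phase.continuous_θ.continuousOn hθ).mul (ContinuousOn.add ?_ ?_)
  · exact (continuous_finsetSum _ fun i _ => continuous_finsetSum _ fun j _ =>
      (hs i j).mul (Phase.continuous_D i j)).continuousOn
  · exact (continuous_const.mul (continuous_finsetSum _ fun i _ =>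
      (Phase.continuous_g i).pow 2)).continuousOn.div Phase.continuous_θ.continuousOn hθ

/-- Truncation makes the production stable under the perturbation of the temperature. -/
lemma min_production_le {A B Q κ δ R : ℝ} (hA : 0 ≤ A) (hκ : 0 ≤ κ) (hQ : 0 ≤ Q)
    (hδ : 0 ≤ δ) (hR : 0 ≤ R) (hQB : (1 - δ) * B ≤ Q) :
    min (A + κ * B) R - R * δ ≤ A + κ * Q := by
  have h1 := mul_nonneg hκ hQ
  rcases le_or_gt 1 δ with h | h
  · have h2 := min_le_right (A + κ * B) R
    nlinarith
  · have h2 := mul_le_mul_of_nonneg_left hQB hκ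
    have h3 := min_le_right (A + κ * B) R
    have h4 := min_le_left (A + κ * B) R
    have h5 := mul_le_mul_of_nonneg_left h4 (by linarith : 0 ≤ 1 - δ)
    have h6 := mul_le_mul_of_nonneg_left h3 hδ
    nlinarith

end Production

lemma IsTest.eventually_abs_shift_le {φ : ℝ → ℝᵈ → ℝ}
    (hφ : IsTest L φ) (i : Fin d) {η : ℝ} (hη : 0 < η) :
    ∀ᶠ c : ℝ in 𝓝[>] 0, ∀ p ∈ closedBox L T,
      |φ p.1 (p.2 + -Pi.single i (c / 2)) - φ p.1 p.2| ≤ η := by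
  obtain ⟨M, hM⟩ := (isCompact_closedBox L T).exists_bound_of_continuousOn
    (hφ.continuous_dx i).continuousOn
  have hsmall : ∀ᶠ c : ℝ in 𝓝[>] 0, c / 2 * (|M| + 1) ≤ η := by
    have : Tendsto (fun c : ℝ => c / 2 * (|M| + 1)) (𝓝 0) (𝓝 (0 / 2 * (|M| + 1))) :=
      ((continuous_id.div_const 2).mul continuous_const).tendsto 0
    rw [zero_div, zero_mul] at this
    exact (this.mono_left nhdsWithin_le_nhds).eventually (ge_mem_nhds hη)
  filter_upwards [tendsto_half.eventually (hφ.eventually_quotient_dx (T := T) i one_pos),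
    self_mem_nhdsWithin, hsmall] with c hc hc0 hcη p hp
  have hc0' : 0 < c / 2 := half_pos (mem_Ioi.1 hc0)
  have h1 := (hc p hp).2
  have h2 := hM p hp
  rw [Real.norm_eq_abs] at h2
  have h3 : |(φ p.1 p.2 - φ p.1 (p.2 + -Pi.single i (c / 2))) / (c / 2)| ≤ |M| + 1 := by
    have := abs_add_le ((φ p.1 p.2 - φ p.1 (p.2 + -Pi.single i (c / 2))) / (c / 2)
      - dx i φ p.1 p.2) (dx i φ p.1 p.2)
    rw [sub_add_cancel] at this
    linarith [le_abs_self M]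
  rw [abs_div, abs_of_pos hc0', div_le_iff₀ hc0'] at h3
  rw [abs_sub_comm]
  linarith

namespace IsBoundedSolution

variable {G : Mesh d L T}
  {ρ θ : ℕ → Cell d → ℝ} {u : ℕ → Cell d → Fin d → ℝ} {C : ℝ}
  (hs : IsBoundedSolution P ε G ρ₀ θ₀ u₀ ρ θ u ρlo ρhi θlo θhi uhi)

lemma late_friction (p : ℝ × ℝᵈ) :
    G.late (fun k K => 1 / θ k K * (2 * P.μ * 𝔇 G.h (u k) K
        + P.lam * divH G.h (u k) K ^ 2)) p
      = frictionProduction P (G.state ρ θ u p).θ (G.state ρ θ u p).D := by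
  have e4 : ∀ (v : Cell d → ℝᵈ) J, divH G.h v J = ∑ l, symGradH G.h v J l l := by
    intro v J
    simp only [symGradH, divH, add_self_div_two]
  simp only [Mesh.late, Mesh.state, Phase.D, Phase.θ, frictionProduction, Mesh.recon, e4]
  split_ifs <;> simp

include hs

lemma θ_pos {k : ℕ}
    (hk : k < G.N) (K : Cell d) : 0 < θ k K := hs.θlo_pos.trans_le (hs.θ_bd k hk K).1

/-- The discrete heat flux divided by the temperature and the discrete entropy production by heat
conduction, compared with the corresponding functions of the state. -/
lemma heat_terms_bounds {p : ℝ × ℝᵈ} (hp : p.1 ∈ Ioo 0 T) (i : Fin d) :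
    |G.late (fun k K => gradE G.h (θ k) i K / θ k (K + e i)) (p.1, p.2 + -Pi.single i (G.h / 2))
        - (G.state ρ θ u p).g i / (G.state ρ θ u p).θ|
      ≤ G.h / θlo ^ 2 * (G.state ρ θ u p).g i ^ 2 ∧
    (1 - G.h * |(G.state ρ θ u p).g i| / θlo)
        * ((G.state ρ θ u p).g i ^ 2 / (G.state ρ θ u p).θ ^ 2)
      ≤ G.late (fun k K => gradE G.h (θ k) i K ^ 2 / (θ k K * θ k (K + e i)))
          (p.1, p.2 + -Pi.single i (G.h / 2)) ∧
    G.late (fun k K => gradE G.h (θ k) i K ^ 2 / (θ k K * θ k (K + e i)))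
        (p.1, p.2 + -Pi.single i (G.h / 2))
      ≤ 1 / θlo ^ 2 * (G.state ρ θ u p).g i ^ 2 := by
  by_cases hle : G.Δt ≤ p.1
  · have hk := Mesh.L_pos_of_N (G := G) hp
    simp only [Mesh.late, Mesh.state, Phase.g, Phase.θ, hle, if_true, Mesh.recon]
    refine adjacent_temperature_bounds G.h_pos hs.θlo_pos (hs.θ_bd _ hk _).1 (hs.θ_bd _ hk _).1 ?_
    rcases cellOf_sub_half G.h_pos p.2 i with h | h
    · left; rw [← h]
    · right; rw [← h]
  · simp [Mesh.late, Mesh.state, Phase.g, hle]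

lemma admissible_production :
    Admissible L T fun p => (2 * P.μ + P.lam * d) / θlo * (∑ i, ∑ j, (G.state ρ θ u p).D i j ^ 2)
      + P.κ / θlo ^ 2 * ∑ i, (G.state ρ θ u p).g i ^ 2 :=
  ((Admissible.sum fun i _ => Admissible.sum fun j _ => (hs.admissible_D i j).pow 2).const_mul
    _).add ((Admissible.sum fun i _ => (hs.admissible_g i).pow 2).const_mul _)

end IsBoundedSolution

namespace IsBoundedSolution

variable {G : Mesh d L T}
  {ρ θ : ℕ → Cell d → ℝ} {u : ℕ → Cell d → Fin d → ℝ} {C : ℝ}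
  {f : ℝ × (Fin d → ℝ) → ℝ}
  (hs : IsBoundedSolution P ε G ρ₀ θ₀ u₀ ρ θ u ρlo ρhi θlo θhi uhi)

include hs

lemma friction_inQ :
    ∀ k < G.N, G.InQ fun K => 1 / θ k K * (2 * P.μ * 𝔇 G.h (u k) K
      + P.lam * divH G.h (u k) K ^ 2) := fun k hk =>
  Mesh.InQ.comp₂ (hs.θ_inQ k hk)
    (r' := fun K => 2 * P.μ * 𝔇 G.h (u k) K + P.lam * divH G.h (u k) K ^ 2)
    (((Mesh.InQ.sum fun i _ => Mesh.InQ.sum fun j _ => (hs.D_inQ i j k hk).pow 2).const_mul _).add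
      ((((hs.u_mem k hk.le).divH _).pow 2).const_mul _)) fun a b => 1 / a * b

lemma heatProduction_inQ (i : Fin d) :
    ∀ k < G.N, G.InQ fun K => gradE G.h (θ k) i K ^ 2 / (θ k K * θ k (K + e i)) := fun k hk =>
  ((hs.g_inQ i k hk).pow 2).comp₂ ((hs.θ_inQ k hk).fmul ((hs.θ_inQ k hk).shift (e i)))
    fun a b => a / b

lemma admissible_friction :
    Admissible L T fun p => frictionProduction P (G.state ρ θ u p).θ (G.state ρ θ u p).D := by
  have h := Mesh.admissible_late hs.L_pos hs.friction_inQ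
  rwa [show G.late (fun k K => 1 / θ k K * (2 * P.μ * 𝔇 G.h (u k) K
      + P.lam * divH G.h (u k) K ^ 2)) = fun p => frictionProduction P (G.state ρ θ u p).θ
        (G.state ρ θ u p).D from funext (late_friction (ρ := ρ))] at h

/-- The production by heat conduction, integrated over the shifted cells of the gradient. -/
lemma integral_heatProduction (hf : Admissible L T f) :
    ∫ p, G.late (fun k K => ∑ i, gradE G.h (θ k) i K ^ 2 / (θ k K * θ k (K + e i))) p * f p ∂𝒬
      = ∫ p, ∑ i, G.late (fun k K => gradE G.h (θ k) i K ^ 2 / (θ k K * θ k (K + e i)))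
          (p.1, p.2 + -Pi.single i (G.h / 2)) * f (p.1, p.2 + -Pi.single i (G.h / 2))
          ∂𝒬 := by
  have aQ := fun i => Mesh.admissible_late hs.L_pos (hs.heatProduction_inQ i)
  have e1 : ∀ p, G.late (fun k K => ∑ i, gradE G.h (θ k) i K ^ 2 / (θ k K * θ k (K + e i))) p * f p
      = ∑ i, G.late (fun k K => gradE G.h (θ k) i K ^ 2 / (θ k K * θ k (K + e i))) p * f p := by
    intro p
    rw [Mesh.late_sum Finset.univ (fun i k K => gradE G.h (θ k) i K ^ 2
        / (θ k K * θ k (K + e i))), sum_mul]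
  simp only [e1]
  rw [integral_finsetSum _ fun i _ => ((aQ i).mul hf).integrable,
    integral_finsetSum _ fun i _ => (((aQ i).mul hf).translate _).integrable]
  refine sum_congr rfl fun i _ => ?_
  exact (integral_translate hs.L_pos ((aQ i).mul hf).meas ((aQ i).mul hf).per _).symm

/-- The truncated production of the state is at most the discrete production, up to terms that
vanish with the mesh size. -/
lemma min_production_mul_le {p : ℝ × ℝᵈ} (hp : p.1 ∈ Ioo 0 T) {R M η : ℝ} (hR : 0 ≤ R) (hη : 0 ≤ η)
    (hf0 : 0 ≤ f p) (hfM : f p ≤ M)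
    (hfη : ∀ i, f p - f (p.1, p.2 + -Pi.single i (G.h / 2)) ≤ η) :
    min (entropyProduction P (G.state ρ θ u p).θ (G.state ρ θ u p).D (G.state ρ θ u p).g) R * f p
      ≤ frictionProduction P (G.state ρ θ u p).θ (G.state ρ θ u p).D * f p
        + P.κ * ∑ i, G.late (fun k K => gradE G.h (θ k) i K ^ 2 / (θ k K * θ k (K + e i)))
          (p.1, p.2 + -Pi.single i (G.h / 2)) * f (p.1, p.2 + -Pi.single i (G.h / 2))
        + (R * M / θlo * G.h * growth (G.state ρ θ u p)
          + P.κ / θlo ^ 2 * η * ∑ i, (G.state ρ θ u p).g i ^ 2) := by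
  have hκ := P.κ_pos
  have hθ := hs.θlo_pos
  have h0 := G.h_pos
  have hθp : 0 < (G.state ρ θ u p).θ := hθ.trans_le (hs.state_bounds hp).2.1
  have hbd := fun i => hs.heat_terms_bounds hp i
  have hq0 : ∀ i, 0 ≤ G.late (fun k K => gradE G.h (θ k) i K ^ 2 / (θ k K * θ k (K + e i)))
      (p.1, p.2 + -Pi.single i (G.h / 2)) := fun i =>
    Mesh.late_nonneg (fun k hk K => div_nonneg (sq_nonneg _)
      (mul_nonneg (hs.θ_pos hk K).le (hs.θ_pos hk _).le)) hp
  generalize G.state ρ θ u p = S at *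
  generalize hq : (fun i => G.late (fun k K => gradE G.h (θ k) i K ^ 2
    / (θ k K * θ k (K + e i))) (p.1, p.2 + -Pi.single i (G.h / 2))) = q
  have hq' : ∀ i, G.late (fun k K => gradE G.h (θ k) i K ^ 2
    / (θ k K * θ k (K + e i))) (p.1, p.2 + -Pi.single i (G.h / 2)) = q i := fun i => congrFun hq i
  simp only [hq'] at hbd hq0 ⊢
  set δ := G.h * (∑ i, |S.g i|) / θlo with hδ
  have hδ0 : 0 ≤ δ := by
    have : 0 ≤ ∑ i, |S.g i| := sum_nonneg fun _ _ => abs_nonneg _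
    positivity
  have hqB : (1 - δ) * ∑ i, S.g i ^ 2 / S.θ ^ 2 ≤ ∑ i, q i := by
    rw [mul_sum]
    refine sum_le_sum fun i _ => le_trans ?_ (hbd i).2.1
    refine mul_le_mul_of_nonneg_right ?_ (by positivity)
    have : G.h * |S.g i| / θlo ≤ δ := by
      refine div_le_div_of_nonneg_right (mul_le_mul_of_nonneg_left ?_ h0.le) hθ.le
      exact single_le_sum (f := fun i => |S.g i|) (fun _ _ => abs_nonneg _)
        (Finset.mem_univ i)
    linarith
  have h1 := min_production_le (frictionProduction_nonneg P hθp S.D) hκ.le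
    (sum_nonneg fun i _ => hq0 i) hδ0 hR hqB
  rw [← entropyProduction_eq P hθp] at h1
  have h2 := mul_le_mul_of_nonneg_right h1 hf0
  have h3 : R * δ * f p ≤ R * M / θlo * G.h * growth S := by
    have k1 : ∑ i, |S.g i| ≤ growth S := by
      obtain ⟨j1, j2, j3⟩ := growth_parts_nonneg S
      rw [growth]; linarith
    have k3 : δ ≤ G.h * growth S / θlo :=
      div_le_div_of_nonneg_right (mul_le_mul_of_nonneg_left k1 h0.le) hθ.le
    have k4 : R * δ * f p ≤ R * (G.h * growth S / θlo) * M :=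
      mul_le_mul (mul_le_mul_of_nonneg_left k3 hR) hfM hf0 (mul_nonneg hR (hδ0.trans k3))
    exact k4.trans (le_of_eq (by ring))
  have h4 : ∑ i, q i * f p - ∑ i, q i * f (p.1, p.2 + -Pi.single i (G.h / 2))
      ≤ 1 / θlo ^ 2 * η * ∑ i, S.g i ^ 2 := by
    rw [← sum_sub_distrib, mul_sum]
    refine sum_le_sum fun i _ => ?_
    calc q i * f p - q i * f (p.1, p.2 + -Pi.single i (G.h / 2))
        = q i * (f p - f (p.1, p.2 + -Pi.single i (G.h / 2))) := by ring
      _ ≤ q i * η := mul_le_mul_of_nonneg_left (hfη i) (hq0 i)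
      _ ≤ (1 / θlo ^ 2 * S.g i ^ 2) * η := mul_le_mul_of_nonneg_right (hbd i).2.2 hη
      _ = _ := by ring
  have h5 := mul_le_mul_of_nonneg_left h4 hκ.le
  rw [← sum_mul] at h5
  have h6 : P.κ / θlo ^ 2 * η * ∑ i, S.g i ^ 2 = P.κ * (1 / θlo ^ 2 * η * ∑ i, S.g i ^ 2) := by ring
  rw [h6]
  rw [sub_mul, add_mul, mul_assoc P.κ] at h2
  rw [mul_sub] at h5
  linarith

/-- The truncated production of the states, tested with a nonnegative function, does not exceed the
production of the scheme up to terms that vanish with the mesh size. -/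
lemma integral_min_production_le
    (hb : UniformBounds ε G ρ θ u C) (hf : Admissible L T f) {R M η : ℝ} (hR : 0 ≤ R)
    (hM : 0 ≤ M) (hη : 0 ≤ η) (hf0 : ∀ᵐ p ∂𝒬, 0 ≤ f p)
    (hfM : ∀ᵐ p ∂𝒬, f p ≤ M)
    (hfη : ∀ᵐ p ∂𝒬, ∀ i, f p - f (p.1, p.2 + -Pi.single i (G.h / 2)) ≤ η)
    (hi : Integrable (fun p => min (entropyProduction P (G.state ρ θ u p).θ (G.state ρ θ u p).D
      (G.state ρ θ u p).g) R * f p) 𝒬) :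
    ∫ p, min (entropyProduction P (G.state ρ θ u p).θ (G.state ρ θ u p).D (G.state ρ θ u p).g) R
        * f p ∂𝒬
      ≤ (∫ p, G.late (fun k K => 1 / θ k K * (2 * P.μ * 𝔇 G.h (u k) K
          + P.lam * divH G.h (u k) K ^ 2)) p * f p ∂𝒬)
        + P.κ * (∫ p, G.late (fun k K => ∑ i, gradE G.h (θ k) i K ^ 2
            / (θ k K * θ k (K + e i))) p * f p ∂𝒬)
        + (R * M / θlo * G.h * ((1 + d * d + d) * (𝒬).real univ + T * C + C + C)
          + P.κ / θlo ^ 2 * η * C) := by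
  have hκ := P.κ_pos
  have hθ := hs.θlo_pos
  have h0 := G.h_pos
  rw [hs.integral_heatProduction hf]
  simp only [late_friction (ρ := ρ)]
  have aQ := fun i => Mesh.admissible_late hs.L_pos (hs.heatProduction_inQ i)
  have i1 := (hs.admissible_friction.mul hf).integrable
  have i2 : Integrable (fun p : ℝ × ℝᵈ => ∑ i, G.late (fun k K => gradE G.h (θ k) i K ^ 2
      / (θ k K * θ k (K + e i))) (p.1, p.2 + -Pi.single i (G.h / 2))
      * f (p.1, p.2 + -Pi.single i (G.h / 2))) 𝒬 :=
    integrable_finsetSum _ fun i _ => (((aQ i).mul hf).translate _).integrable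
  have ig := hs.admissible_growth.integrable
  have i5 : Integrable (fun p => ∑ i, (G.state ρ θ u p).g i ^ 2) 𝒬 :=
    (Admissible.sum fun i _ => (hs.admissible_g i).pow 2).integrable
  have h1 := (ig.const_mul (R * M / θlo * G.h)).add (i5.const_mul (P.κ / θlo ^ 2 * η))
  have h2 := i1.add (i2.const_mul P.κ)
  refine (integral_mono_ae hi (h2.add h1) ?_).trans ?_
  · filter_upwards [ae_spaceTime_mem L T, hf0, hfM, hfη] with p hp k1 k2 k3
    exact hs.min_production_mul_le hp hR hη k1 k2 k3
  · rw [integral_add' h2 h1, integral_add' i1 (i2.const_mul P.κ),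
      integral_add' (ig.const_mul (R * M / θlo * G.h)) (i5.const_mul (P.κ / θlo ^ 2 * η)),
      integral_const_mul, integral_const_mul, integral_const_mul]
    exact add_le_add le_rfl (add_le_add
      (mul_le_mul_of_nonneg_left (hs.integral_growth_le hb) (by positivity))
      (mul_le_mul_of_nonneg_left (hs.integral_sq_g_le hb) (by positivity)))

/-- The entropy inequality of the scheme, tested with a nonnegative function. -/
lemma integral_entropy_le (hf : Admissible L T f) (hf0 : ∀ᵐ p ∂𝒬, 0 ≤ f p) :
    P.κ * (∫ p, G.late (fun k => divFlux G.h (fun i K => gradE G.h (θ k) i K / θ k (K + e i))) p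
          * f p ∂𝒬)
        + ((∫ p, G.late (fun k K => 1 / θ k K * (2 * P.μ * 𝔇 G.h (u k) K
          + P.lam * divH G.h (u k) K ^ 2)) p * f p ∂𝒬)
        + P.κ * (∫ p, G.late (fun k K => ∑ i, gradE G.h (θ k) i K ^ 2
            / (θ k K * θ k (K + e i))) p * f p ∂𝒬))
      ≤ (∫ p, G.late (fun k K => (ρ k K * entropy P (ρ k K) (θ k K)
            - ρ (k - 1) K * entropy P (ρ (k - 1) K) (θ (k - 1) K)) / G.Δt) p * f p
            ∂𝒬)
        + ∫ p, G.late (fun k => divFlux G.h (flux G.h ε (fun J => ρ k J * entropy P (ρ k J) (θ k J))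
            (u k))) p * f p ∂𝒬 := by
  have a1 : Admissible L T (G.late fun k =>
      divFlux G.h (fun i K => gradE G.h (θ k) i K / θ k (K + e i))) :=
    Mesh.admissible_late hs.L_pos fun k hk => Mesh.InQ.divFlux (fun i =>
      (hs.g_inQ i k hk).comp₂ ((hs.θ_inQ k hk).shift (e i)) fun a b => a / b) _
  have a2 := Mesh.admissible_late hs.L_pos hs.friction_inQ
  have a3 : Admissible L T (G.late fun k K => ∑ i, gradE G.h (θ k) i K ^ 2
      / (θ k K * θ k (K + e i))) :=
    Mesh.admissible_late hs.L_pos fun k hk => Mesh.InQ.sum fun i _ => hs.heatProduction_inQ i k hk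
  have hρs : ∀ k < G.N, G.InQ fun K => ρ k K * entropy P (ρ k K) (θ k K) := fun k hk =>
    (hs.ρ_inQ k hk).comp₂ (hs.θ_inQ k hk) fun a b => a * entropy P a b
  have a4 : Admissible L T (G.late fun k K => (ρ k K * entropy P (ρ k K) (θ k K)
      - ρ (k - 1) K * entropy P (ρ (k - 1) K) (θ (k - 1) K)) / G.Δt) :=
    Mesh.admissible_late hs.L_pos fun k hk => (hρs k hk).comp₂ (hρs (k - 1) (by omega))
      fun a b => (a - b) / G.Δt
  have a5 : Admissible L T (G.late fun k =>
      divFlux G.h (flux G.h ε (fun J => ρ k J * entropy P (ρ k J) (θ k J)) (u k))) :=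
    Mesh.admissible_late hs.L_pos fun k hk => Mesh.InQ.divFlux (fun i =>
      (hρs k hk).flux (hs.u_mem k hk.le) _ _ i) _
  have i1 := ((a1.mul hf).integrable).const_mul P.κ
  have i2 := (a2.mul hf).integrable
  have i3 := ((a3.mul hf).integrable).const_mul P.κ
  have i4 := (a4.mul hf).integrable
  have i5 := (a5.mul hf).integrable
  rw [← integral_const_mul, ← integral_const_mul, ← integral_add' i2 i3,
    ← integral_add' i1 (i2.add i3), ← integral_add' i4 i5]
  refine integral_mono_ae (i1.add (i2.add i3)) (i4.add i5) ?_
  filter_upwards [ae_spaceTime_mem L T, hf0] with p hp hfp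
  have key : 0 ≤ (G.late (fun k K => (ρ k K * entropy P (ρ k K) (θ k K)
      - ρ (k - 1) K * entropy P (ρ (k - 1) K) (θ (k - 1) K)) / G.Δt) p
    + G.late (fun k => divFlux G.h (flux G.h ε (fun J => ρ k J * entropy P (ρ k J) (θ k J))
        (u k))) p)
    - (P.κ * G.late (fun k => divFlux G.h (fun i K => gradE G.h (θ k) i K / θ k (K + e i))) p
      + (G.late (fun k K => 1 / θ k K * (2 * P.μ * 𝔇 G.h (u k) K
          + P.lam * divH G.h (u k) K ^ 2)) p
        + P.κ * G.late (fun k K => ∑ i, gradE G.h (θ k) i K ^ 2 / (θ k K * θ k (K + e i))) p)) := by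
    rw [← Mesh.late_add, ← Mesh.late_const_mul, ← Mesh.late_const_mul, ← Mesh.late_add,
      ← Mesh.late_add, ← Mesh.late_sub]
    refine Mesh.late_nonneg (fun k hk K => ?_) hp
    have h1 := hs.entropy_cell hk K
    have h2 := one_div_mul_divFlux_gradE (h := G.h) (hs.θ_pos hk) K
    rw [mul_add, mul_left_comm, h2] at h1
    simp only [Nat.add_sub_cancel]
    linarith
  have := mul_nonneg key hfp
  simp only [Pi.add_apply]
  linarith

end IsBoundedSolution

namespace IsApproximation

variable {φ : ℝ → (Fin d → ℝ) → ℝ}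

include ha

/-- The entropy production is only bounded in `L¹` along the sequence. This is enough for its
pairing with the Young measure, but not for weak convergence to the pairing. -/
lemma pairs_production : Pairs 𝒬 V (fun U => entropyProduction P U.θ U.D U.g) := by
  have hF := Phase.continuousOn_entropyProduction (d := d) P
  have hle : ∀ n, ∀ᵐ p ∂𝒬, |entropyProduction P (𝒰 n p).θ (𝒰 n p).D (𝒰 n p).g|
      ≤ (2 * P.μ + P.lam * d) / θlo * (∑ i, ∑ j, (𝒰 n p).D i j ^ 2)
        + P.κ / θlo ^ 2 * ∑ i, (𝒰 n p).g i ^ 2 := fun n => by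
    filter_upwards [ha.ae_state_mem n] with p hp
    have h1 := hp.1.2.1
    rw [abs_of_nonneg (entropyProduction_nonneg P (ha.θlo_pos.trans_le h1) _ _)]
    exact entropyProduction_le P ha.θlo_pos h1 _ _
  have hint : ∀ n, Integrable (fun p => entropyProduction P (𝒰 n p).θ (𝒰 n p).D (𝒰 n p).g) 𝒬 :=
    fun n => (ha.sol n).admissible_production.integrable.mono'
      (ha.aestronglyMeasurable_state hF n) (hle n)
  refine (ha.pairs_and_weakConv hF hint
    (B := (2 * P.μ + P.lam * d) / θlo * C + P.κ / θlo ^ 2 * C) fun n => ?_).1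
  have h1 := integral_mono_ae (hint n).abs (ha.sol n).admissible_production.integrable (hle n)
  have iD := (Admissible.sum (s := Finset.univ) fun i _ => Admissible.sum (s := Finset.univ)
    fun j _ => ((ha.sol n).admissible_D i j).pow 2).integrable
  have ig := (Admissible.sum (s := Finset.univ) fun i _ =>
    ((ha.sol n).admissible_g i).pow 2).integrable
  rw [integral_add (iD.const_mul _) (ig.const_mul _), integral_const_mul, integral_const_mul]
    at h1
  have hμ := P.μ_pos
  have hlam := P.lam_nonneg
  have hκ := P.κ_pos
  have hθ := ha.θlo_pos
  exact h1.trans (add_le_add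
    (mul_le_mul_of_nonneg_left ((ha.sol n).integral_sq_D_le (ha.bounds n)) (by positivity))
    (mul_le_mul_of_nonneg_left ((ha.sol n).integral_sq_g_le (ha.bounds n)) (by positivity)))

/-- The truncated production is a bounded function of the state. -/
lemma weakConv_min_production {R : ℝ} (hR : 0 ≤ R) :
    Pairs 𝒬 V (fun U => min (entropyProduction P U.θ U.D U.g) R) ∧
      WeakConv 𝒬 (fun n p =>
        min (entropyProduction P (𝒰 n p).θ
          (𝒰 n p).D (𝒰 n p).g) R)
        (fun p => ∫ U, min (entropyProduction P U.θ U.D U.g) R ∂(V p)) := by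
  refine ha.weakConv (F := fun U => min (entropyProduction P U.θ U.D U.g) R)
    ((Phase.continuousOn_entropyProduction P).inf continuousOn_const) R fun U _ hU => ?_
  rw [abs_of_nonneg (le_min (entropyProduction_nonneg P (ha.θlo_pos.trans_le hU.1) _ _) hR)]
  exact (min_le_right _ _).trans (le_mul_of_one_le_right hR (one_le_growth U))

/-- The discrete heat flux divided by the temperature, shifted to the cells of the gradient. -/
lemma weakConv_heat (i : Fin d) :
    WeakConv 𝒬 (fun n p => (G n).late (fun k K => gradE (G n).h (θ n k) i K
        / θ n k (K + e i)) (p.1, p.2 + -Pi.single i ((G n).h / 2)))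
      (fun p => ∫ U, U.g i / U.θ ∂(V p)) := by
  have hF : ∀ n, ∀ k < (G n).N, (G n).InQ fun K => gradE (G n).h (θ n k) i K / θ n k (K + e i) :=
    fun n k hk => ((ha.sol n).g_inQ i k hk).comp₂ (((ha.sol n).θ_inQ k hk).shift (e i))
      fun a b => a / b
  have aF := fun n => (Mesh.admissible_late ha.L_pos (hF n)).translate
    (-Pi.single i ((G n).h / 2))
  refine (ha.weakConv_g_div_θ i).2.of_sub_tendsto (fun n => (aF n).integrable) ?_
  have hθ := ha.θlo_pos
  have hlim : Tendsto (fun n => (G n).h / θlo ^ 2 * C) atTop (𝓝 0) := by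
    have := (ha.h_lim.div_const (θlo ^ 2)).mul_const C
    simpa using this
  refine squeeze_zero (fun n => integral_nonneg fun p => abs_nonneg _) (fun n => ?_) hlim
  have h0 := (G n).h_pos
  have ag := ((ha.sol n).admissible_g i).pow 2
  refine (integral_mono_ae (g := fun p => (G n).h / θlo ^ 2 * (𝒰 n p).g i ^ 2)
    (((ha.weakConv_g_div_θ i).2.integrable n).sub (aF n).integrable).abs
    (ag.const_mul _).integrable ?_).trans ?_
  · filter_upwards [ae_spaceTime_mem L T] with p hp
    rw [Pi.sub_apply, abs_sub_comm]
    exact ((ha.sol n).heat_terms_bounds hp i).1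
  · rw [integral_const_mul]
    refine mul_le_mul_of_nonneg_left (le_trans ?_ ((ha.sol n).integral_sq_g_le (ha.bounds n)))
      (by positivity)
    refine integral_mono ag.integrable
      (Admissible.sum fun i _ => ((ha.sol n).admissible_g i).pow 2).integrable fun p => ?_
    exact sq_le_sum_sq (𝒰 n p).g i

/-- The discrete heat flux divided by the temperature. The gradient lives on the dual mesh, so that
the flux is translated by half a cell before it is compared with the states. -/
lemma tendsto_heatFlux (hφ : IsTest L φ) :
    Tendsto (fun n => ∫ p, (G n).late (fun k => divFlux (G n).h
        (fun i K => gradE (G n).h (θ n k) i K / θ n k (K + e i))) p * φ p.1 p.2 ∂𝒬)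
      atTop (𝓝 (-∑ i, ∫ p, (∫ U, U.g i / U.θ ∂(V p)) * dx i φ p.1 p.2 ∂𝒬)) := by
  have aφ := hφ.admissible (T := T) ha.L_pos
  have hF : ∀ n, ∀ k < (G n).N, ∀ i,
      (G n).InQ fun K => gradE (G n).h (θ n k) i K / θ n k (K + e i) :=
    fun n k hk i => ((ha.sol n).g_inQ i k hk).comp₂ (((ha.sol n).θ_inQ k hk).shift (e i))
      fun a b => a / b
  simp only [Mesh.integral_late_divFlux_mul (F := fun k i K => gradE (G _).h (θ _ k) i K
    / θ _ k (K + e i)) ha.L_pos (hF _) aφ]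
  refine (tendsto_finsetSum _ fun i _ => ?_).neg
  have h2 := (ha.weakConv_heat i).tendsto_admissible
    (w := fun n p => (φ p.1 (p.2 + Pi.single i ((G n).h / 2))
      - φ p.1 (p.2 + -Pi.single i ((G n).h / 2))) / (G n).h)
    (fun n => ((aφ.translate _).sub (aφ.translate _)).div_const _)
    (hφ.admissible_dx ha.L_pos i)
    fun η hη => by
      filter_upwards [(tendsto_h ha.h_lim).eventually
        (hφ.eventually_symm_quotient_dx i hη)] with n hn p hp using hn p hp
  refine h2.congr fun n => ?_
  have aF := Mesh.admissible_late ha.L_pos fun k hk => hF n k hk i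
  rw [aF.integral_translate_mul ha.L_pos
    (((aφ.translate (Pi.single i ((G n).h / 2))).sub
      (aφ.translate (-Pi.single i ((G n).h / 2)))).div_const (G n).h)]
  refine integral_congr_ae (.of_forall fun p => ?_)
  have e2 : p.2 + - -Pi.single i ((G n).h / 2) + Pi.single i ((G n).h / 2)
      = p.2 + Pi.single i (G n).h := by
    rw [neg_neg, add_assoc, ← Pi.single_add, add_halves]
  have e3 : p.2 + - -Pi.single i ((G n).h / 2) + -Pi.single i ((G n).h / 2) = p.2 := by
    rw [add_assoc, neg_add_cancel, add_zero]
  simp only [e2, e3]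

/-- The limit of the entropy inequality with the production truncated at height `R`. -/
lemma entropy_balance_min
    (hφ : IsTest L φ) (hφT : ∀ t x, T ≤ t → φ t x = 0) (hφ0 : ∀ t ∈ Icc 0 T, ∀ x, 0 ≤ φ t x)
    {R : ℝ} (hR : 0 ≤ R) :
    ∫ p, (∫ U, min (entropyProduction P U.θ U.D U.g) R ∂(V p)) * φ p.1 p.2 ∂𝒬
      ≤ -(∫ p, (∫ U, U.ρ * entropy P U.ρ U.θ ∂(V p)) * dt φ p.1 p.2 ∂𝒬)
        - (∫ x in torus L, ρ₀ x * entropy P (ρ₀ x) (θ₀ x) * φ 0 x)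
        - (∑ i, ∫ p, (∫ U, U.ρ * entropy P U.ρ U.θ * U.u i ∂(V p)) * dx i φ p.1 p.2 ∂𝒬)
        + P.κ * ∑ i, ∫ p, (∫ U, U.g i / U.θ ∂(V p)) * dx i φ p.1 p.2 ∂𝒬 := by
  have aφ := hφ.admissible (T := T) ha.L_pos
  obtain ⟨i0, hi0⟩ := ha.tendsto_init (H := fun r t => r * entropy P r t) (continuousOn_entropy P)
    (D := entropyBound P ρlo ρhi θlo θhi)
    fun r t hr ht => abs_entropy_le P ha.ρlo_pos ha.θlo_pos hr ht
  have hρs : ∀ n, ∀ k < (G n).N, (G n).InQ fun K => ρ n k K * entropy P (ρ n k K) (θ n k K) :=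
    fun n k hk => ((ha.sol n).ρ_inQ k hk).comp₂ ((ha.sol n).θ_inQ k hk)
      fun a b => a * entropy P a b
  have h1 := tendsto_timeDiff (r := fun n k K => ρ n k K * entropy P (ρ n k K) (θ n k K))
    ha.L_pos ha.T_pos ha.Δt_lim hρs ha.weakConv_ρs.2 i0 hi0 hφ hφT
  have h2 := tendsto_divFlux ha.L_pos ha.h_lim (fun n k hk i =>
    (hρs n k hk).flux ((ha.sol n).u_mem k hk.le) (G n).h ε i) ha.weakConv_flux_ρs hφ
  have h3 := (ha.tendsto_heatFlux hφ).const_mul P.κ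
  have h4 := (ha.weakConv_min_production hR).2.tendsto _ aφ.meas.aestronglyMeasurable aφ.ae_bound
  obtain ⟨M, hM⟩ := (isCompact_closedBox L T).exists_bound_of_continuousOn
    hφ.continuous_uncurry.continuousOn
  have hκ := P.κ_pos
  have hθ := ha.θlo_pos
  have hC := ha.C_nonneg
  refine le_of_forall_pos_le_add fun δ hδ => ?_
  set η := δ / (P.κ / θlo ^ 2 * (C + 1)) with hη
  have hη0 : 0 < η := by positivity
  have hηδ : P.κ / θlo ^ 2 * η * C ≤ δ := by
    have e1 : P.κ / θlo ^ 2 * η * (C + 1) = δ := by rw [hη]; field_simp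
    nlinarith [mul_nonneg (div_nonneg hκ.le (sq_nonneg θlo)) hη0.le]
  set B := (1 + d * d + d) * (𝒬).real univ + T * C + C + C with hB
  have h5 : Tendsto (fun n => R * |M| / θlo * (G n).h * B + P.κ / θlo ^ 2 * η * C) atTop
      (𝓝 (R * |M| / θlo * 0 * B + P.κ / θlo ^ 2 * η * C)) :=
    ((ha.h_lim.const_mul _).mul_const _).add_const _
  rw [mul_zero, zero_mul, zero_add] at h5
  have h6 := le_of_tendsto_of_tendsto h4 (((h1.add h2).sub h3).add h5) ?_
  · linarith
  have hshift : ∀ i, ∀ᶠ n in atTop, ∀ p ∈ closedBox L T,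
      |φ p.1 (p.2 + -Pi.single i ((G n).h / 2)) - φ p.1 p.2| ≤ η := fun i =>
    (tendsto_h ha.h_lim).eventually (hφ.eventually_abs_shift_le i hη0)
  filter_upwards [eventually_all.2 hshift] with n hn
  have hpos : ∀ᵐ p ∂𝒬, 0 ≤ φ p.1 p.2 := by
    filter_upwards [ae_spaceTime_mem L T] with p hp using hφ0 _ (Ioo_subset_Icc_self hp) _
  have k1 := (ha.sol n).integral_entropy_le aφ hpos
  have k2 := (ha.sol n).integral_min_production_le (ha.bounds n) aφ hR (abs_nonneg M) hη0.le hpos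
    (by
      filter_upwards [ae_spaceTime_mem_closedBox L T] with p hp
      exact (le_abs_self _).trans ((hM p hp).trans (le_abs_self M)))
    (by
      filter_upwards [ae_spaceTime_mem_closedBox L T] with p hp i
      refine (le_abs_self _).trans ?_
      rw [abs_sub_comm]
      exact hn i p hp)
    (aφ.integrable_mul ((ha.weakConv_min_production hR).2.integrable n))
  rw [← hB] at k2
  linarith

/-- The entropy inequality, for nonnegative test functions that vanish at the final time. -/
lemma entropy_balance
    (hφ : IsTest L φ) (hφT : ∀ t x, T ≤ t → φ t x = 0) (hφ0 : ∀ t ∈ Icc 0 T, ∀ x, 0 ≤ φ t x) :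
    ∫ p, balanceDensity (fun p => ∫ U, U.ρ * entropy P U.ρ U.θ ∂(V p))
        (fun p => ∫ U, entropyProduction P U.θ U.D U.g ∂(V p))
        (fun i p => ∫ U, (U.ρ * entropy P U.ρ U.θ * U.u i - P.κ * U.g i / U.θ) ∂(V p))
        φ p.1 p.2 ∂𝒬
      + ∫ x in torus L, ρ₀ x * entropy P (ρ₀ x) (θ₀ x) * φ 0 x ≤ 0 := by
  have aφ := hφ.admissible (T := T) ha.L_pos
  obtain ⟨hS1, hS2⟩ := ha.pairs_production
  have hm := ha.markov
  -- the truncation is removed by dominated convergence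
  have hlim : Tendsto (fun N : ℕ => ∫ p, (∫ U, min (entropyProduction P U.θ U.D U.g) N ∂(V p))
      * φ p.1 p.2 ∂𝒬) atTop
      (𝓝 (∫ p, (∫ U, entropyProduction P U.θ U.D U.g ∂(V p)) * φ p.1 p.2 ∂𝒬)) := by
    have hpos : ∀ᵐ p ∂𝒬, ∀ᵐ U ∂(V p), 0 ≤ entropyProduction P U.θ U.D U.g := by
      filter_upwards [ha.ae_young_mem] with p hp
      filter_upwards [hp] with U hU
      exact entropyProduction_nonneg P (ha.θlo_pos.trans_le hU.1.2.1) _ _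
    have hmeas : ∀ N : ℕ, AEStronglyMeasurable (fun p =>
        (∫ U, min (entropyProduction P U.θ U.D U.g) N ∂(V p)) * φ p.1 p.2) 𝒬 :=
      fun N => (ha.weakConv_min_production (Nat.cast_nonneg N)).1.2.aestronglyMeasurable.mul
        aφ.meas.aestronglyMeasurable
    refine tendsto_integral_of_dominated_convergence
      (fun p => ‖(∫ U, entropyProduction P U.θ U.D U.g ∂(V p)) * φ p.1 p.2‖) hmeas
      (aφ.integrable_mul hS2).norm (fun N => ?_) ?_
    · filter_upwards [hpos, hS1] with p h1 h2
      rw [norm_mul, norm_mul]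
      refine mul_le_mul_of_nonneg_right ?_ (norm_nonneg _)
      rw [Real.norm_of_nonneg (integral_nonneg_of_ae h1)]
      refine norm_integral_le_of_norm_le h2 ?_
      filter_upwards [h1] with U hU
      rw [Real.norm_of_nonneg (le_min hU (Nat.cast_nonneg N))]
      exact min_le_left _ _
    · filter_upwards [hpos, hS1] with p h1 h2
      refine Tendsto.mul_const _ ?_
      refine tendsto_integral_of_dominated_convergence
        (fun U => entropyProduction P U.θ U.D U.g)
        (fun N => h2.aestronglyMeasurable.inf aestronglyMeasurable_const) h2 (fun N => ?_) ?_
      · filter_upwards [h1] with U hU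
        rw [Real.norm_of_nonneg (le_min hU (Nat.cast_nonneg N))]
        exact min_le_left _ _
      · refine .of_forall fun U => tendsto_const_nhds.congr' ?_
        filter_upwards [eventually_ge_atTop ⌈entropyProduction P U.θ U.D U.g⌉₊] with N hN
        rw [min_eq_left ((Nat.le_ceil _).trans (by exact_mod_cast hN))]
  have h1 := le_of_tendsto' hlim fun N =>
    ha.entropy_balance_min hφ hφT hφ0 (Nat.cast_nonneg N)
  have iA : ∀ i, Integrable (fun p : ℝ × ℝᵈ =>
      (∫ U, U.ρ * entropy P U.ρ U.θ * U.u i ∂(V p)) * dx i φ p.1 p.2) 𝒬 := fun i =>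
    (hφ.admissible_dx ha.L_pos i).integrable_mul (ha.weakConv_ρsu i).2.integrable_lim
  have iB : ∀ i, Integrable (fun p : ℝ × ℝᵈ =>
      (∫ U, U.g i / U.θ ∂(V p)) * dx i φ p.1 p.2) 𝒬 := fun i =>
    (hφ.admissible_dx ha.L_pos i).integrable_mul (ha.weakConv_g_div_θ i).2.integrable_lim
  have eF : ∀ i, ∫ p, (∫ U, (U.ρ * entropy P U.ρ U.θ * U.u i - P.κ * U.g i / U.θ) ∂(V p))
        * dx i φ p.1 p.2 ∂𝒬
      = (∫ p, (∫ U, U.ρ * entropy P U.ρ U.θ * U.u i ∂(V p)) * dx i φ p.1 p.2 ∂𝒬)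
        - P.κ * ∫ p, (∫ U, U.g i / U.θ ∂(V p)) * dx i φ p.1 p.2 ∂𝒬 := by
    intro i
    rw [← integral_const_mul, ← integral_sub (iA i) ((iB i).const_mul _)]
    refine integral_congr_ae ?_
    filter_upwards [(ha.pairs_entropyFlux i).2] with p hp
    rw [hp]; ring
  rw [integral_balanceDensity ha.L_pos ha.weakConv_ρs.2.integrable_lim hS2
    (fun i => (ha.pairs_entropyFlux i).1.2) hφ]
  simp only [eF, sum_sub_distrib, ← mul_sum]
  linarith

end IsApproximation

/-! ### The energy inequality -/

lemma IsBoundedSolution.energy_le {G : Mesh d L T} {ρ θ : ℕ → Cell d → ℝ} {u : ℕ → Cell d → ℝᵈ}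
    (hs : IsBoundedSolution P ε G ρ₀ θ₀ u₀ ρ θ u ρlo ρhi θlo θhi uhi) :
    ∀ k < G.N, G.intCells (fun K => energyDensity P (ρ k K) (θ k K) (u k K))
      ≤ G.intCells (fun K => energyDensity P (ρ 0 K) (θ 0 K) (u 0 K))
  | 0, _ => le_rfl
  | k + 1, hk => by
    refine le_trans ?_ ((hs.energy_step hk).trans (hs.energy_le k (by omega)))
    have h1 := G.Δt_pos
    have h2 := Real.rpow_pos_of_pos G.h_pos ε
    have h3 := G.h_pos
    have h4 := hs.ρlo_pos
    have h5 : 0 ≤ ∑ j, ∑ i, G.intCells (fun K => jump (fun J => u (k + 1) J j) i K ^ 2) :=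
      sum_nonneg fun j _ => sum_nonneg fun i _ =>
        Mesh.intCells_nonneg fun K => sq_nonneg _
    exact le_add_of_nonneg_right (by positivity)

namespace IsApproximation

include ha

/-- The energy of the discrete initial data does not exceed that of the initial data in the limit:
the kinetic energy by Jensen's inequality, the internal energy converges. -/
lemma eventually_energy_init_le :
    IntegrableOn (fun x => energyDensity P (ρ₀ x) (θ₀ x) (u₀ x)) (torus L) ∧
    ∀ η > 0, ∀ᶠ n in atTop, (G n).intCells (fun K => energyDensity P (ρ n 0 K) (θ n 0 K) (u n 0 K))
        ≤ (∫ x in torus L, energyDensity P (ρ₀ x) (θ₀ x) (u₀ x)) + η := by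
  have hcv := P.cv_pos
  obtain ⟨i1, h1⟩ := ha.tendsto_init (H := fun r t => r * internalEnergy P t)
    (continuousOn_fst.mul (continuousOn_const.mul continuousOn_snd)) (D := ρhi * (P.cv * θhi))
    fun r t hr ht => by
      have hr0 := ha.ρlo_pos.trans_le hr.1
      have ht0 := ha.θlo_pos.trans_le ht.1
      rw [internalEnergy, abs_of_pos (by positivity)]
      have := ha.ρhi_pos
      gcongr
      exacts [hr.2, ht.2]
  have hk := fun i => eventually_kinetic_proj_le ha.h_lim ha.ρ₀_int (Integrable.eval ha.u₀_int i)
    ha.ρlo_pos ha.ρ₀_bd (fun n => ha.u₀_bd n i)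
  have i2 : IntegrableOn (fun x => ∑ i, 1 / 2 * (ρ₀ x * u₀ x i ^ 2)) (torus L) :=
    integrable_finsetSum _ fun i _ => (hk i).1.const_mul _
  have e1 : ∀ r t (v : ℝᵈ), energyDensity P r t v
      = (∑ i, 1 / 2 * (r * v i ^ 2)) + r * internalEnergy P t := fun r t v => by
    simp only [energyDensity, mul_sum, mul_assoc]
  simp only [e1]
  refine ⟨i2.add i1, fun η hη => ?_⟩
  have h2 : ∀ᶠ n in atTop, ∀ i,
      (G n).intCells (fun K => (G n).proj ρ₀ K * (G n).proj (fun x => u₀ x i) K ^ 2)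
        ≤ (∫ x in torus L, ρ₀ x * u₀ x i ^ 2) + η / (d + 1) :=
    eventually_all.2 fun i => (hk i).2 _ (by positivity)
  filter_upwards [h2, h1.eventually (gt_mem_nhds (half_pos hη))] with n hn1 hn2
  rw [integral_add i2 i1, integral_finsetSum _ fun i _ => (hk i).1.const_mul _,
    Mesh.intCells_add, Mesh.intCells_sum]
  simp only [integral_const_mul, Mesh.intCells_const_mul]
  have h3 : ∀ i, (G n).intCells (fun K => ρ n 0 K * u n 0 K i ^ 2)
      = (G n).intCells (fun K => (G n).proj ρ₀ K * (G n).proj (fun x => u₀ x i) K ^ 2) :=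
      fun i => by
    rw [Mesh.intCells, Mesh.intCells]
    congr 1
    refine sum_congr rfl fun K hK => ?_
    rw [(ha.sol n).ρ_init K hK, (ha.sol n).u_init K hK]
  have h4 : ∑ i, 1 / 2 * (G n).intCells (fun K => ρ n 0 K * u n 0 K i ^ 2)
      ≤ (∑ i, 1 / 2 * ∫ x in torus L, ρ₀ x * u₀ x i ^ 2) + η / 2 := by
    have : ∑ i, 1 / 2 * (G n).intCells (fun K => ρ n 0 K * u n 0 K i ^ 2)
        ≤ ∑ i : Fin d, (1 / 2 * (∫ x in torus L, ρ₀ x * u₀ x i ^ 2) + 1 / 2 * (η / (d + 1))) := by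
      refine sum_le_sum fun i _ => ?_
      rw [h3]
      linarith [hn1 i]
    rw [sum_add_distrib, sum_const, Finset.card_univ, Fintype.card_fin,
      nsmul_eq_mul] at this
    have h5 : (d : ℝ) * (1 / 2 * (η / (d + 1))) ≤ η / 2 := by
      rw [mul_left_comm, ← mul_div_assoc, one_div_mul_eq_div]
      refine div_le_div_of_nonneg_right ?_ two_pos.le
      rw [div_le_iff₀ (by positivity)]
      nlinarith
    linarith
  have h5 := abs_integral_le_integral_abs (μ := volume.restrict (torus L)) (f := fun x =>
    ρ n 0 (cellOf (G n).h x) * internalEnergy P (θ n 0 (cellOf (G n).h x))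
      - ρ₀ x * internalEnergy P (θ₀ x))
  rw [integral_sub ((G n).integrableOn_cellOf fun K => ρ n 0 K * internalEnergy P (θ n 0 K)) i1,
    (G n).integral_cellOf fun K => ρ n 0 K * internalEnergy P (θ n 0 K), abs_le] at h5
  linarith [h5.2]

/-- The energy at almost every time does not exceed the initial energy: the inequality passes to the
limit when averaged in time against nonnegative weights. -/
lemma ae_energy_le : ∀ᵐ τ ∂(volume.restrict (Icc 0 T)),
      (∫ x in torus L, ∫ U, energyDensity P U.ρ U.θ U.u ∂(V (τ, x)))
        ≤ ∫ x in torus L, energyDensity P (ρ₀ x) (θ₀ x) (u₀ x) := by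
  obtain ⟨-, hW⟩ := ha.weakConv_energy
  obtain ⟨-, hinit⟩ := ha.eventually_energy_init_le
  set E₀ := ∫ x in torus L, energyDensity P (ρ₀ x) (θ₀ x) (u₀ x) with hE₀
  have hs := integrableOn_slice hW.integrable_lim
  have hE₀i : IntegrableOn (fun _ : ℝ => E₀) (Ioo 0 T) := integrable_const _
  rw [← restrict_Ioo_eq_restrict_Icc]
  have key := ae_nonneg_of_forall_integral_mul (T := T)
    (f := fun t => E₀ - ∫ x in torus L, ∫ U, energyDensity P U.ρ U.θ U.u ∂(V (t, x)))
    (hE₀i.sub hs) fun w hw hw0 hwT => ?_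
  · filter_upwards [key] with τ hτ using sub_nonneg.1 hτ
  have hwm : AEStronglyMeasurable (fun p : ℝ × ℝᵈ => w p.1) 𝒬 :=
    (hw.comp continuous_fst).aestronglyMeasurable
  obtain ⟨B, hB⟩ := isCompact_Icc.exists_bound_of_continuousOn (s := Icc 0 T) hw.continuousOn
  have hwb : ∀ᵐ p ∂𝒬, |w p.1| ≤ B := by
    filter_upwards [ae_spaceTime_mem L T] with p hp using hB _ (Ioo_subset_Icc_self hp)
  have hwi : IntegrableOn w (Ioo 0 T) :=
    (hw.integrableOn_Icc (a := 0) (b := T)).mono_set Ioo_subset_Icc_self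
  have hlim := hW.tendsto _ hwm ⟨B, hwb⟩
  have hslice : ∀ {f : ℝ × ℝᵈ → ℝ}, Integrable f 𝒬 →
      ∫ p, f p * w p.1 ∂𝒬 = ∫ t in Ioo 0 T, w t * ∫ x in torus L, f (t, x) := by
    intro f hf
    rw [integral_spaceTime (integrable_mul_of_bound hf B hwm hwb)]
    refine setIntegral_congr_fun measurableSet_Ioo fun t _ => ?_
    simp only [integral_mul_const]
    ring
  have hws : ∀ {f : ℝ → ℝ}, IntegrableOn f (Ioo 0 T) →
      IntegrableOn (fun t => w t * f t) (Ioo 0 T) := by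
    intro f hf
    simp only [mul_comm (w _)]
    refine integrable_mul_of_bound hf B hw.aestronglyMeasurable ?_
    filter_upwards [ae_restrict_mem measurableSet_Ioo] with t ht using hB t (Ioo_subset_Icc_self ht)
  have hle : ∀ η > 0, ∫ p, (∫ U, energyDensity P U.ρ U.θ U.u ∂(V p)) * w p.1 ∂𝒬
      ≤ (E₀ + η) * ∫ t in Ioo 0 T, w t := by
    intro η hη
    refine le_of_tendsto hlim ?_
    filter_upwards [hinit η hη] with n hn
    have hi := hW.integrable n
    rw [hslice hi, ← integral_const_mul]
    refine setIntegral_mono_on (hws (integrableOn_slice hi)) (hwi.const_mul _) measurableSet_Ioo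
      fun t ht => ?_
    rw [mul_comm]
    refine mul_le_mul_of_nonneg_right (le_trans (le_of_eq ?_)
      (((ha.sol n).energy_le _ (Mesh.L_pos_of_N ht)).trans hn)) (hw0 t)
    exact (G n).integral_cellOf fun K => energyDensity P (ρ n ⌊t / (G n).Δt⌋₊ K)
      (θ n ⌊t / (G n).Δt⌋₊ K) (u n ⌊t / (G n).Δt⌋₊ K)
  have hfin : ∫ p, (∫ U, energyDensity P U.ρ U.θ U.u ∂(V p)) * w p.1 ∂𝒬
      ≤ E₀ * ∫ t in Ioo 0 T, w t := by
    have h1 : Tendsto (fun η : ℝ => (E₀ + η) * ∫ t in Ioo 0 T, w t) (𝓝[>] 0)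
        (𝓝 ((E₀ + 0) * ∫ t in Ioo 0 T, w t)) :=
      (((continuous_const.add continuous_id).mul continuous_const).tendsto 0).mono_left
        nhdsWithin_le_nhds
    rw [add_zero] at h1
    exact ge_of_tendsto h1 (by filter_upwards [self_mem_nhdsWithin] with η hη using hle η hη)
  rw [hslice hW.integrable_lim] at hfin
  simp only [mul_sub]
  rw [integral_sub (hwi.mul_const _) (hws hs), integral_mul_const]
  linarith

end IsApproximation

/-! ### Balance laws up to almost every time -/

section Balance

lemma IsTest.component {φ : ℝ → ℝᵈ → ℝᵈ} (hφ : IsTest L φ) (i : Fin d) :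
    IsTest L fun t x => φ t x i :=
  ⟨contDiff_pi.1 hφ.1 i, fun t x j => congrFun (hφ.2 t x j) i⟩

lemma balanceDensity_neg (R S : ℝ × ℝᵈ → ℝ) (F : Fin d → ℝ × ℝᵈ → ℝ)
    (φ : ℝ → ℝᵈ → ℝ) (t : ℝ) (x : ℝᵈ) :
    balanceDensity R S F (fun t x => -φ t x) t x = -balanceDensity R S F φ t x := by
  have h1 : dt (fun t x => -φ t x) t x = -dt φ t x := deriv.fun_neg
  have h2 : ∀ i, dx i (fun t x => -φ t x) t x = -dx i φ t x := fun i => by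
    have : fderiv ℝ (fun x => -φ t x) x = -fderiv ℝ (φ t) x := fderiv_fun_neg
    simp only [dx, this, neg_apply]
  simp only [balanceDensity, h1, h2, mul_neg, sum_neg_distrib]
  ring

/-- The version of `ae_forall_balance` for equations. -/
lemma ae_forall_balance_eq {R S : ℝ × ℝᵈ → ℝ} {F : Fin d → ℝ × ℝᵈ → ℝ}
    (hL : ∀ i, 0 < L i) (hT : 0 < T) (hR : Integrable R 𝒬)
    (hS : Integrable S 𝒬) (hF : ∀ i, Integrable (F i) 𝒬)
    {r₀ : ℝᵈ → ℝ} (hr₀ : IntegrableOn r₀ (torus L))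
    (h : ∀ φ, IsTest L φ → (∀ t x, T ≤ t → φ t x = 0) →
      ∫ p, balanceDensity R S F φ p.1 p.2 ∂𝒬 + ∫ x in torus L, r₀ x * φ 0 x = 0) :
    ∀ᵐ τ ∂(volume.restrict (Icc 0 T)), ∀ φ, IsTest L φ →
      (∫ x in torus L, R (τ, x) * φ τ x) - ∫ x in torus L, r₀ x * φ 0 x
        = ∫ t in (0 : ℝ)..τ, ∫ x in torus L, balanceDensity R S F φ t x := by
  filter_upwards [ae_forall_balance hL hT hR hS hF hr₀ False fun φ h1 _ h2 => (h φ h1 h2).le]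
    with τ hτ φ hφ
  have h1 := hτ φ hφ False.elim
  have h2 := hτ (fun t x => -φ t x) ⟨hφ.1.neg, fun t x i => by simp only [hφ.2]⟩ False.elim
  simp only [balanceDensity_neg, mul_neg, integral_neg, intervalIntegral.integral_neg] at h2
  linarith

end Balance

namespace IsApproximation

include ha

lemma ae_mass : ∀ᵐ τ ∂(volume.restrict (Icc 0 T)), ∀ φ : ℝ → ℝᵈ → ℝ, IsTest L φ →
      (∫ x in torus L, (∫ U, U.ρ ∂(V (τ, x))) * φ τ x) - (∫ x in torus L, ρ₀ x * φ 0 x)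
        = ∫ t in (0 : ℝ)..τ, ∫ x in torus L, ((∫ U, U.ρ ∂(V (t, x))) * dt φ t x
            + ∑ i, (∫ U, U.ρ * U.u i ∂(V (t, x))) * dx i φ t x) := by
  have := ae_forall_balance_eq ha.L_pos ha.T_pos ha.weakConv_ρ.2.integrable_lim
    (S := fun _ => 0) (integrable_zero _ _ _) (fun i => (ha.weakConv_ρu i).2.integrable_lim)
    ha.ρ₀_int
    fun φ h1 h2 => ha.mass_balance h1 h2
  simpa only [balanceDensity, zero_mul, add_zero] using this

/-- The balance of momentum, summed over the components. -/
lemma ae_momentum : ∀ᵐ τ ∂(volume.restrict (Icc 0 T)), ∀ φ : ℝ → ℝᵈ → ℝᵈ, IsTest L φ →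
      (∫ x in torus L, ∑ i, (∫ U, U.ρ * U.u i ∂(V (τ, x))) * φ τ x i)
          - (∫ x in torus L, ∑ i, ρ₀ x * u₀ x i * φ 0 x i)
        = (∫ t in (0 : ℝ)..τ, ∫ x in torus L,
            ((∑ i, (∫ U, U.ρ * U.u i ∂(V (t, x))) * dt (fun t x => φ t x i) t x)
              + (∑ i, ∑ j, (∫ U, U.ρ * U.u i * U.u j ∂(V (t, x))) * dx j (fun t x => φ t x i) t x)
              + (∫ U, pressure U.ρ U.θ ∂(V (t, x))) * ∑ i, dx i (fun t x => φ t x i) t x))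
          - ∫ t in (0 : ℝ)..τ, ∫ x in torus L,
              ∑ i, ∑ j, (∫ U, stress P U.D i j ∂(V (t, x))) * dx j (fun t x => φ t x i) t x := by
  have iR := fun i => (ha.weakConv_ρu i).2.integrable_lim
  have iF := fun i j => (ha.weakConv_ρuu i j).2.integrable_lim
  have iP := ha.weakConv_pressure.2.integrable_lim
  have iS := fun i j => (ha.weakConv_stress i j).2.integrable_lim
  have iZ : Integrable (fun _ => (0 : ℝ)) 𝒬 := integrable_zero _ _ _
  have iFl : ∀ j i, Integrable (fun p => (∫ U, U.ρ * U.u j * U.u i ∂(V p))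
      + (if i = j then ∫ U, pressure U.ρ U.θ ∂(V p) else 0) - ∫ U, stress P U.D j i ∂(V p))
      𝒬 := by
    intro j i
    refine Integrable.sub (Integrable.add (iF j i) ?_) (iS j i)
    split_ifs
    exacts [iP, iZ]
  have i₀ := fun i => (ha.tendsto_init_ρu i).1
  have hall := ae_all_iff.2 fun j => ae_forall_balance_eq ha.L_pos ha.T_pos (iR j) iZ (iFl j) (i₀ j)
    fun φ h1 h2 => ha.momentum_balance h1 h2 j
  have hsl := ae_all_iff.2 fun i => ae_integrable_slice (iR i)
  rw [restrict_Ioo_eq_restrict_Icc] at hsl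
  filter_upwards [hall, hsl, ae_restrict_mem measurableSet_Icc] with τ hτ hslτ hmem φ hφ
  have m := fun {f : ℝ × ℝᵈ → ℝ} (hf : Integrable f 𝒬) =>
    hf.mono_measure (spaceTime_mono (L := L) hmem.2)
  have jb := fun j => integrable_balanceDensity ha.L_pos (iR j) iZ (iFl j) (hφ.component j)
  have jR := fun i => ((hφ.component i).admissible_dt ha.L_pos).integrable_mul (iR i)
  have jF := fun i j => ((hφ.component i).admissible_dx ha.L_pos j).integrable_mul (iF i j)
  have jP := (Admissible.sum (s := Finset.univ) fun i _ =>
    (hφ.component i).admissible_dx (T := T) ha.L_pos i).integrable_mul iP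
  have jS := fun i j => ((hφ.component i).admissible_dx ha.L_pos j).integrable_mul (iS i j)
  have jA := ((integrable_finsetSum Finset.univ fun i _ => jR i).add
    (integrable_finsetSum Finset.univ fun i _ =>
      integrable_finsetSum Finset.univ fun j _ => jF i j)).add jP
  have jB := integrable_finsetSum Finset.univ fun i _ =>
    integrable_finsetSum Finset.univ fun j _ => jS i j
  have e1 := intervalIntegral_torus jA hmem
  have e2 := intervalIntegral_torus jB hmem
  simp only [Pi.add_apply] at e1
  rw [integral_finsetSum _ fun i _ => (hφ.component i).integrableOn_mul τ (hslτ i),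
    integral_finsetSum _ fun i _ => (hφ.component i).integrableOn_mul 0 (i₀ i),
    ← sum_sub_distrib, e1, e2]
  refine (sum_congr rfl fun j _ => hτ j _ (hφ.component j)).trans ?_
  refine (sum_congr rfl fun j _ => intervalIntegral_torus (jb j) hmem).trans ?_
  rw [← integral_finsetSum _ fun j _ => m (jb j)]
  refine Eq.trans ?_ (integral_sub' (m jA) (m jB))
  refine integral_congr_ae (.of_forall fun p => ?_)
  simp only [balanceDensity, add_mul, sub_mul, ite_mul, zero_mul, add_zero, Pi.sub_apply,
    sum_add_distrib, sum_sub_distrib, Finset.sum_ite_eq',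
    Finset.mem_univ, if_true, mul_sum]
  ring

/-- The entropy inequality for almost every time and all nonnegative test functions. -/
lemma ae_entropy : IntegrableOn (fun x => ρ₀ x * entropy P (ρ₀ x) (θ₀ x)) (torus L) ∧
    ∀ᵐ τ ∂(volume.restrict (Icc 0 T)), ∀ φ : ℝ → ℝᵈ → ℝ, IsTest L φ →
      (∀ t ∈ Icc 0 T, ∀ x, 0 ≤ φ t x) →
      (∫ t in (0 : ℝ)..τ, ∫ x in torus L, ((∫ U, U.ρ * entropy P U.ρ U.θ ∂(V (t, x))) * dt φ t x
            + ∑ i, (∫ U, (U.ρ * entropy P U.ρ U.θ * U.u i - P.κ * U.g i / U.θ) ∂(V (t, x)))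
                * dx i φ t x))
        + (∫ t in (0 : ℝ)..τ, ∫ x in torus L,
            (∫ U, entropyProduction P U.θ U.D U.g ∂(V (t, x))) * φ t x)
        ≤ (∫ x in torus L, (∫ U, U.ρ * entropy P U.ρ U.θ ∂(V (τ, x))) * φ τ x)
          - ∫ x in torus L, ρ₀ x * entropy P (ρ₀ x) (θ₀ x) * φ 0 x := by
  have i₀ := (ha.tendsto_init (H := fun r t => r * entropy P r t) (continuousOn_entropy P)
    fun r t hr ht => abs_entropy_le P ha.ρlo_pos ha.θlo_pos hr ht).1
  have iR := ha.weakConv_ρs.2.integrable_lim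
  have iS := ha.pairs_production.2
  have iF := fun i => (ha.pairs_entropyFlux i).1.2
  refine ⟨i₀, ?_⟩
  filter_upwards [ae_forall_balance ha.L_pos ha.T_pos iR iS iF i₀ True fun φ h1 h2 h3 =>
    ha.entropy_balance h1 h3 (h2 trivial), ae_restrict_mem measurableSet_Icc] with τ hτ hmem φ hφ h0
  have m := fun {f : ℝ × ℝᵈ → ℝ} (hf : Integrable f 𝒬) =>
    hf.mono_measure (spaceTime_mono (L := L) hmem.2)
  have jA := ((hφ.admissible_dt ha.L_pos).integrable_mul iR).add
    (integrable_finsetSum Finset.univ fun i _ =>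
      (hφ.admissible_dx ha.L_pos i).integrable_mul (iF i))
  have jB := (hφ.admissible ha.L_pos).integrable_mul iS
  have h1 := hτ φ hφ fun _ => h0
  have e1 := intervalIntegral_torus jA hmem
  have e2 := intervalIntegral_torus jB hmem
  have e3 := intervalIntegral_torus (jA.add jB) hmem
  rw [integral_add' (m jA) (m jB), ← e1, ← e2] at e3
  simp only [Pi.add_apply] at e3
  simp only [balanceDensity] at h1
  linarith

lemma compat_u_sum {S : ℝ → ℝᵈ → Fin d → ℝᵈ} (hS : IsTest L S)
    (hsym : ∀ t x i j, S t x i j = S t x j i) :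
    - (∫ t in (0 : ℝ)..T, ∫ x in torus L,
        ∑ i, (∫ U, U.u i ∂(V (t, x))) * ∑ j, dx j (fun t x => S t x i j) t x)
      = ∫ t in (0 : ℝ)..T, ∫ x in torus L, ∑ i, ∑ j, (∫ U, U.D i j ∂(V (t, x))) * S t x i j := by
  have hT : T ∈ Icc 0 T := ⟨ha.T_pos.le, le_rfl⟩
  have hSij : ∀ i j, IsTest L fun t x => S t x i j := fun i j =>
    ⟨contDiff_pi.1 (contDiff_pi.1 hS.1 i) j, fun t x k => congrFun (congrFun (hS.2 t x k) i) j⟩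
  have iu := fun i j => ((hSij i j).admissible_dx ha.L_pos j).integrable_mul
    (ha.weakConv_u i).2.integrable_lim
  have iD := fun i j => ((hSij i j).admissible ha.L_pos).integrable_mul
    (ha.weakConv_D i j).2.integrable_lim
  have e1 := intervalIntegral_torus (integrable_finsetSum Finset.univ fun i _ =>
    integrable_finsetSum Finset.univ fun j _ => iu i j) hT
  have e2 := intervalIntegral_torus (integrable_finsetSum Finset.univ fun i _ =>
    integrable_finsetSum Finset.univ fun j _ => iD i j) hT
  simp only [mul_sum]
  rw [e1, e2, integral_finsetSum _ fun i _ => integrable_finsetSum _ fun j _ => iu i j,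
    integral_finsetSum _ fun i _ => integrable_finsetSum _ fun j _ => iD i j]
  simp only [fun i => integral_finsetSum Finset.univ fun j _ => iu i j,
    fun i => integral_finsetSum Finset.univ fun j _ => iD i j]
  simp only [fun i j => ha.compat_u (hSij i j) i j, sum_neg_distrib, ← mul_sum,
    sum_add_distrib]
  -- the two halves of the symmetric gradient contribute equally to the symmetric tensor
  rw [sum_comm (f := fun i j => ∫ p, (∫ U, U.u j ∂(V p)) * dx i (fun t x => S t x i j) p.1 p.2
    ∂𝒬)]
  simp only [fun i j => (funext₂ fun t x => hsym t x j i : (fun t x => S t x j i)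
    = fun t x => S t x i j)]
  ring

lemma compat_θ_sum {φ : ℝ → ℝᵈ → ℝᵈ} (hφ : IsTest L φ) : - (∫ t in (0 : ℝ)..T, ∫ x in torus L,
        (∫ U, U.θ ∂(V (t, x))) * ∑ i, dx i (fun t x => φ t x i) t x)
      = ∫ t in (0 : ℝ)..T, ∫ x in torus L, ∑ i, (∫ U, U.g i ∂(V (t, x))) * φ t x i := by
  have hT : T ∈ Icc 0 T := ⟨ha.T_pos.le, le_rfl⟩
  have iθ := fun i => ((hφ.component i).admissible_dx ha.L_pos i).integrable_mul
    ha.weakConv_θ.2.integrable_lim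
  have ig := fun i => ((hφ.component i).admissible ha.L_pos).integrable_mul
    (ha.weakConv_g i).2.integrable_lim
  have e1 := intervalIntegral_torus (integrable_finsetSum Finset.univ fun i _ => iθ i) hT
  have e2 := intervalIntegral_torus (integrable_finsetSum Finset.univ fun i _ => ig i) hT
  simp only [mul_sum]
  rw [e1, e2, integral_finsetSum _ fun i _ => iθ i, integral_finsetSum _ fun i _ => ig i]
  simp only [fun i => ha.compat_θ (hφ.component i) i, sum_neg_distrib]

end IsApproximation

/-! ### Convergence to a dissipative measure-valued solution -/

/-- Bounds for the reconstructed functions of time and space are bounds for the cell values. -/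
lemma IsSchemeSolution.isBoundedSolution {G : Mesh d L T}
    {ρ θ : ℕ → Cell d → ℝ} {u : ℕ → Cell d → ℝᵈ}
    (hs : IsSchemeSolution P ε G ρ₀ θ₀ u₀ ρ θ u) (hd : d ≠ 0) (hL : ∀ i, 0 < L i)
    (hρlo : 0 < ρlo) (hθlo : 0 < θlo)
    (hu : Real.sqrt (G.intCells fun K => ∑ i, G.proj (fun x => u₀ x i) K ^ 2) ≤ uhi)
    (hρ : ∀ t ∈ Ioo 0 T, ∀ x, ρlo ≤ G.recon ρ t x ∧ G.recon ρ t x ≤ ρhi)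
    (hθ : ∀ t ∈ Ioo 0 T, ∀ x, θlo ≤ G.recon θ t x ∧ G.recon θ t x ≤ θhi) :
    IsBoundedSolution P ε G ρ₀ θ₀ u₀ ρ θ u ρlo ρhi θlo θhi uhi := by
  have hΔ := G.Δt_pos
  -- every cell and every time level before `T` is seen by the reconstruction
  have hpt : ∀ k < G.N, ∀ K : Cell d, ∃ t ∈ Ioo 0 T, ∃ x, ∀ r : ℕ → Cell d → ℝ,
      G.recon r t x = r k K := by
    intro k hk K
    have hkN : (k : ℝ) + 1 ≤ G.N := by exact_mod_cast hk
    have hT := G.steps_fit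
    have hk0 : (0 : ℝ) ≤ k := k.cast_nonneg
    refine ⟨(k + 1 / 2) * G.Δt, ⟨by positivity, by nlinarith⟩, fun i => K i * G.h, fun r => ?_⟩
    have h1 : cellOf G.h (fun i => (K i : ℝ) * G.h) = K := funext fun i => by
      simp [cellOf, mul_div_assoc, div_self G.h_pos.ne']
    rw [Mesh.recon, h1, Mesh.floor_eq_of_mem hΔ (k := k) ⟨by nlinarith, by nlinarith⟩]
  refine { hs with
    dim_ne := hd
    L_pos := hL
    ρlo_pos := hρlo
    θlo_pos := hθlo
    ρ_bd := fun k hk K => ?_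
    θ_bd := fun k hk K => ?_
    u_bd := ?_ }
  · obtain ⟨t, ht, x, h⟩ := hpt k hk K
    rw [← h ρ]; exact hρ t ht x
  · obtain ⟨t, ht, x, h⟩ := hpt k hk K
    rw [← h θ]; exact hθ t ht x
  · refine le_trans (le_of_eq ?_) (Real.sqrt_le_iff.1 hu).2
    rw [Mesh.intCells, Mesh.intCells]
    congr 1
    refine sum_congr rfl fun K hK => sum_congr rfl fun i _ => ?_
    rw [hs.u_init K hK]

lemma Mesh.measurable_approx (G : Mesh d L T) (ρ θ : ℕ → Cell d → ℝ) (u : ℕ → Cell d → ℝᵈ) :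
    Measurable fun p : ℝ × ℝᵈ => G.approx ρ θ u p.1 p.2 := by
  have hu : Measurable fun p : ℝ × ℝᵈ => G.recon u p.1 p.2 :=
    measurable_pi_lambda _ fun i => G.measurable_recon fun k K => u k K i
  have hD : Measurable fun p : ℝ × ℝᵈ => G.recon (fun k => symGradH G.h (u k)) p.1 p.2 :=
    measurable_pi_lambda _ fun i => measurable_pi_lambda _ fun j =>
      G.measurable_recon fun k K => symGradH G.h (u k) K i j
  have hg : Measurable fun p : ℝ × ℝᵈ => fun i => G.recon (fun k => gradE G.h (θ k) i) p.1
      (p.2 - Pi.single i (G.h / 2)) := by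
    refine measurable_pi_lambda _ fun i => ?_
    have : Measurable fun p : ℝ × ℝᵈ => (p.1, p.2 - Pi.single i (G.h / 2)) := by fun_prop
    exact (G.measurable_recon fun k => gradE G.h (θ k) i).comp this
  exact (G.measurable_recon ρ).prodMk ((G.measurable_recon θ).prodMk (hu.prodMk (hD.prodMk hg)))

open ProbabilityTheory in
/-- A subsequence of bounded solutions on refining meshes generates a Young measure. -/
lemma exists_isApproximation {G : ℕ → Mesh d L T}
    {ρ θ : ℕ → ℕ → Cell d → ℝ} {u : ℕ → ℕ → Cell d → ℝᵈ}
    (hL : ∀ i, 0 < L i) (hT : 0 < T) (hε₀ : 0 < ε) (hε₁ : ε < 1)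
    (hρlo : 0 < ρlo) (hθlo : 0 < θlo)
    (hG : Tendsto (fun n => (G n).h) atTop (𝓝 0)) (hΔ : Tendsto (fun n => (G n).Δt) atTop (𝓝 0))
    (hρ₀ : IntegrableOn ρ₀ (torus L)) (hθ₀ : IntegrableOn θ₀ (torus L))
    (hu₀ : IntegrableOn u₀ (torus L))
    (hρ_init : ∀ n, ∀ K ∈ (G n).cells, ρlo ≤ (G n).proj ρ₀ K ∧ (G n).proj ρ₀ K ≤ ρhi)
    (hθ_init : ∀ n, ∀ K ∈ (G n).cells, θlo ≤ (G n).proj θ₀ K ∧ (G n).proj θ₀ K ≤ θhi)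
    (hu_init : ∀ n, ∀ i, (G n).intCells (fun K => (G n).proj (fun x => u₀ x i) K ^ 2) ≤ uhi ^ 2)
    (hsol : ∀ n, IsBoundedSolution P ε (G n) ρ₀ θ₀ u₀ (ρ n) (θ n) (u n) ρlo ρhi θlo θhi uhi) :
    ∃ (C : ℝ) (sub : ℕ → ℕ) (V : Kernel (ℝ × ℝᵈ) (Phase d)), StrictMono sub ∧
      IsApproximation P ε (G ∘ sub) ρ₀ θ₀ u₀ (ρ ∘ sub) (θ ∘ sub) (u ∘ sub) ρlo ρhi θlo θhi uhi C
        V := by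
  obtain ⟨C, hC⟩ := exists_uniformBounds P ε L T ρ₀ θ₀ u₀ ρlo ρhi θlo θhi uhi
  have hb := fun n => hC _ _ _ _ (hsol n)
  set m := 𝒬 with hm
  have hbd : ∀ n, ∫⁻ p, ‖(G n).state (ρ n) (θ n) (u n) p‖ₑ ∂m ≤ ENNReal.ofReal
      ((ρhi + θhi) * m.real univ + ((1 + d * d + d) * m.real univ + T * C + C + C)) := by
    intro n
    have hg := (hsol n).admissible_growth.integrable
    have h1 : ∀ᵐ p ∂m, ‖(G n).state (ρ n) (θ n) (u n) p‖
        ≤ ρhi + θhi + growth ((G n).state (ρ n) (θ n) (u n) p) := by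
      filter_upwards [ae_spaceTime_mem L T] with p hp
      obtain ⟨h2, h3⟩ := (hsol n).state_bounds hp
      refine (norm_le_growth _).trans ?_
      rw [abs_of_pos (hρlo.trans_le h2.1), abs_of_pos (hθlo.trans_le h3.1)]
      linarith [h2.2, h3.2]
    have hi := (integrable_const (ρhi + θhi)).add hg
    have h4 : Integrable (fun p => (G n).state (ρ n) (θ n) (u n) p) m :=
      hi.mono' ((G n).measurable_state _ _ _).aestronglyMeasurable h1
    rw [← ofReal_integral_norm_eq_lintegral_enorm h4]
    refine ENNReal.ofReal_le_ofReal ((integral_mono_ae h4.norm hi h1).trans ?_)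
    rw [integral_add' (integrable_const _) hg, integral_const, smul_eq_mul, mul_comm]
    exact add_le_add le_rfl ((hsol n).integral_growth_le (hb n))
  obtain ⟨sub, V, hsub, hV, hgen⟩ := exists_young_measure m
    (fun n => (G n).state (ρ n) (θ n) (u n)) (fun n => (G n).measurable_state _ _ _) _
    ENNReal.ofReal_ne_top hbd
  exact ⟨C, sub, V, hsub, {
    L_pos := hL, T_pos := hT, ε_pos := hε₀, ε_lt := hε₁, ρlo_pos := hρlo, θlo_pos := hθlo
    h_lim := hG.comp hsub.tendsto_atTop, Δt_lim := hΔ.comp hsub.tendsto_atTop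
    ρ₀_int := hρ₀, θ₀_int := hθ₀, u₀_int := hu₀, ρ₀_bd := fun n => hρ_init (sub n)
    θ₀_bd := fun n => hθ_init (sub n), u₀_bd := fun n => hu_init (sub n)
    sol := fun n => hsol (sub n), bounds := fun n => hb (sub n), markov := hV
    generates := hgen }⟩

namespace IsApproximation

include ha

/-- The approximate solutions differ from their states only in the first time step, so that they
generate the same Young measure. -/
lemma generates_approx : Generates 𝒬 (fun n p => (G n).approx (ρ n) (θ n) (u n) p.1 p.2) V := by
  intro g hg hgs w hw
  obtain ⟨B, hB⟩ := hgs.exists_bound_of_continuous hg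
  have hi : ∀ {U : ℝ × ℝᵈ → Phase d}, Measurable U →
      Integrable (fun p => w p * g (U p)) 𝒬 := fun hU =>
    integrable_mul_of_bound hw B (hg.measurable.comp hU).aestronglyMeasurable
      (.of_forall fun p => hB _)
  have h1 := ha.generates (BoundedContinuousFunction.ofNormedAddCommGroup g hg B hB) w hw
  have hd : Tendsto (fun n => ∫ p, (w p * g ((G n).approx (ρ n) (θ n) (u n) p.1 p.2)
      - w p * g (𝒰 n p)) ∂𝒬) atTop (𝓝 0) := by
    rw [← integral_zero (ℝ × ℝᵈ) ℝ (μ := 𝒬)]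
    refine tendsto_integral_of_dominated_convergence (fun p => |w p| * (B + B))
      (fun n => ((hi ((G n).measurable_approx _ _ _)).sub
        (hi ((G n).measurable_state _ _ _))).aestronglyMeasurable) (hw.abs.mul_const _)
      (fun n => .of_forall fun p => ?_) ?_
    · rw [← mul_sub, norm_mul, Real.norm_eq_abs]
      exact mul_le_mul_of_nonneg_left ((norm_sub_le _ _).trans (add_le_add (hB _) (hB _)))
        (abs_nonneg _)
    · filter_upwards [ae_spaceTime_mem L T] with p hp
      refine tendsto_const_nhds.congr' ?_
      filter_upwards [ha.Δt_lim.eventually (gt_mem_nhds hp.1)] with n hn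
      rw [← Mesh.state_eq_approx (ρ n) (θ n) (u n) hn.le, sub_self]
  have h2 := hd.add h1
  rw [zero_add] at h2
  refine h2.congr fun n => ?_
  rw [integral_sub (hi ((G n).measurable_approx _ _ _)) (hi ((G n).measurable_state _ _ _))]
  exact sub_add_cancel _ _

lemma ae_init_bounds : ∀ᵐ x ∂(volume.restrict (torus L)), 0 ≤ ρ₀ x ∧ 0 ≤ θ₀ x := by
  filter_upwards [ae_bounds_of_proj ha.h_lim ha.ρ₀_int ha.ρ₀_bd,
    ae_bounds_of_proj ha.h_lim ha.θ₀_int ha.θ₀_bd] with x h1 h2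
  exact ⟨ha.ρlo_pos.le.trans h1.1, ha.θlo_pos.le.trans h2.1⟩

/-- The generated Young measure is a dissipative measure-valued solution without concentration
defect. -/
lemma isDMVSolution : IsDMVSolution P L T (fun x => Measure.dirac (ρ₀ x, θ₀ x, u₀ x)) V 0 := by
  have hm := ha.markov
  have pairs_dirac : ∀ {f : State d → ℝ}, IntegrableOn (fun x => f (ρ₀ x, θ₀ x, u₀ x)) (torus L) →
      Pairs (volume.restrict (torus L)) (fun x => Measure.dirac (ρ₀ x, θ₀ x, u₀ x)) f :=
    fun hf => ⟨.of_forall fun x => integrable_dirac enorm_lt_top, by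
      simp only [integral_dirac]; exact hf⟩
  have hdef : ∀ᵐ τ ∂(volume.restrict (Icc 0 T)),
      0 ≤ dissipationDefect P L (fun x => Measure.dirac (ρ₀ x, θ₀ x, u₀ x)) V τ := by
    filter_upwards [ha.ae_energy_le] with τ hτ
    simp only [dissipationDefect, integral_dirac]
    exact sub_nonneg.2 hτ
  exact
    { young :=
        { prob := .of_forall fun p => hm.isProbabilityMeasure p
          carried := by
            filter_upwards [ha.ae_young_mem] with p hp
            refine mem_ae_iff.1 ?_
            filter_upwards [hp] with U hU
            exact ⟨ha.ρlo_pos.le.trans hU.1.1.1, ha.θlo_pos.le.trans hU.1.2.1, hU.2⟩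
          meas := fun g hg _ => ((hg.measurable.comp measurable_snd).stronglyMeasurable
            |>.integral_kernel_prod_right' (κ := V)
              (f := fun q : (ℝ × ℝᵈ) × Phase d => g q.2)).aestronglyMeasurable }
      young_init :=
        { prob := .of_forall fun x => inferInstance
          carried := by
            filter_upwards [ha.ae_init_bounds] with x hx
            refine mem_ae_iff.1 ?_
            rw [ae_dirac_eq]
            exact hx
          meas := fun g hg _ => by
            simp only [integral_dirac]
            exact hg.comp_aestronglyMeasurable (ha.ρ₀_int.aestronglyMeasurable.prodMk
              (ha.θ₀_int.aestronglyMeasurable.prodMk ha.u₀_int.aestronglyMeasurable)) }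
      pairs_u := fun i => (ha.weakConv_u i).1
      pairs_θ := ha.weakConv_θ.1
      pairs_D := fun i j => (ha.weakConv_D i j).1
      pairs_g := fun i => (ha.weakConv_g i).1
      pairs_ρ := ha.weakConv_ρ.1
      pairs_ρu := fun i => (ha.weakConv_ρu i).1
      pairs_ρuu := fun i j => (ha.weakConv_ρuu i j).1
      pairs_p := ha.weakConv_pressure.1
      pairs_stress := fun i j => (ha.weakConv_stress i j).1
      pairs_energy := ha.weakConv_energy.1
      pairs_ρs := ha.weakConv_ρs.1
      pairs_entropyFlux := fun i => (ha.pairs_entropyFlux i).1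
      pairs_production := ha.pairs_production
      pairs_init_ρ := pairs_dirac ha.ρ₀_int
      pairs_init_ρu := fun i => pairs_dirac (ha.tendsto_init_ρu i).1
      pairs_init_energy := pairs_dirac ha.eventually_energy_init_le.1
      pairs_init_ρs := pairs_dirac ha.ae_entropy.1
      compat_u := fun S hS hsym => ha.compat_u_sum hS hsym
      compat_θ := fun φ hφ => ha.compat_θ_sum hφ
      mass := by simpa only [integral_dirac] using ha.ae_mass
      momentum := by
        filter_upwards [ha.ae_momentum] with τ hτ φ hφ
        simp only [integral_dirac, hτ φ hφ, signedIntegral, Pi.zero_apply,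
          SignedMeasure.toJordanDecomposition_zero, JordanDecomposition.zero_posPart,
          JordanDecomposition.zero_negPart, Measure.restrict_zero, integral_zero_measure, sub_self,
          sum_const_zero, add_zero]
      energy := by simpa only [integral_dirac] using ha.ae_energy_le
      entropy := by simpa only [integral_dirac] using ha.ae_entropy.2
      defect_nonneg := hdef
      defect := by
        refine ⟨1, one_pos, fun ψ _ hψ => ?_⟩
        simp only [Pi.zero_apply, SignedMeasure.totalVariation_zero, Measure.restrict_zero,
          integral_zero_measure, sum_const_zero, one_mul]
        refine intervalIntegral.integral_nonneg_of_ae_restrict ha.T_pos.le ?_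
        filter_upwards [hdef, ae_restrict_mem measurableSet_Icc] with t ht hmem
        exact mul_nonneg (hψ t hmem) ht }

end IsApproximation

end NSF

theorem theorem5p1 {d : ℕ} (hd : d = 2 ∨ d = 3) (P : NSF.Fluid)
    (L : Fin d → ℝ) (hL : ∀ i, 0 < L i) (T : ℝ) (hT : 0 < T)
    (ε : ℝ) (hε₀ : 0 < ε) (hε₁ : ε < 1)
    (ρlo ρhi θlo θhi uhi : ℝ) (hρlo : 0 < ρlo) (hθlo : 0 < θlo) (huhi : 0 < uhi)
    -- initial data on the torus
    (ρ₀ θ₀ : (Fin d → ℝ) → ℝ) (u₀ : (Fin d → ℝ) → Fin d → ℝ)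
    (hρ₀ : IntegrableOn ρ₀ (NSF.torus L)) (hθ₀ : IntegrableOn θ₀ (NSF.torus L))
    (hu₀ : IntegrableOn u₀ (NSF.torus L))
    -- a sequence of meshes with `h → 0` and `Δt ≈ h`
    (G : ℕ → NSF.Mesh d L T) (hG : Tendsto (fun n => (G n).h) atTop (𝓝 0))
    (hΔt : ∃ a b : ℝ, 0 < a ∧ 0 < b ∧ ∀ n, a * (G n).h ≤ (G n).Δt ∧ (G n).Δt ≤ b * (G n).h)
    -- bounds on the discrete initial data
    (hρ_init : ∀ n, ∀ K ∈ (G n).cells, ρlo ≤ (G n).proj ρ₀ K ∧ (G n).proj ρ₀ K ≤ ρhi)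
    (hθ_init : ∀ n, ∀ K ∈ (G n).cells, θlo ≤ (G n).proj θ₀ K ∧ (G n).proj θ₀ K ≤ θhi)
    (hu_init : ∀ n,
      Real.sqrt ((G n).intCells fun K => ∑ i, (G n).proj (fun x => u₀ x i) K ^ 2) ≤ uhi)
    -- solutions of the scheme
    (ρ θ : ℕ → ℕ → NSF.Cell d → ℝ) (u : ℕ → ℕ → NSF.Cell d → Fin d → ℝ)
    (hsol : ∀ n, NSF.IsSchemeSolution P ε (G n) ρ₀ θ₀ u₀ (ρ n) (θ n) (u n))
    -- uniform bounds on the discrete density and temperature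
    (hρ : ∀ n, ∀ t ∈ Ioo 0 T, ∀ x, ρlo ≤ (G n).recon (ρ n) t x ∧ (G n).recon (ρ n) t x ≤ ρhi)
    (hθ : ∀ n, ∀ t ∈ Ioo 0 T, ∀ x, θlo ≤ (G n).recon (θ n) t x ∧ (G n).recon (θ n) t x ≤ θhi) :
    ∃ (sub : ℕ → ℕ) (V : ℝ × (Fin d → ℝ) → Measure (NSF.Phase d)), StrictMono sub ∧
      NSF.Generates (NSF.spaceTime L T)
        (fun n p => (G (sub n)).approx (ρ (sub n)) (θ (sub n)) (u (sub n)) p.1 p.2) V ∧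
      (∀ᵐ p ∂(NSF.spaceTime L T), ∀ᵐ U ∂(V p), (ρlo ≤ U.ρ ∧ U.ρ ≤ ρhi) ∧ (θlo ≤ U.θ ∧ U.θ ≤ θhi)) ∧
      NSF.IsDMVSolution P L T (fun x => Measure.dirac (ρ₀ x, θ₀ x, u₀ x)) V 0 := by
  have hd0 : d ≠ 0 := by rintro rfl; simp at hd
  have hΔ : Tendsto (fun n => (G n).Δt) atTop (𝓝 0) := by
    obtain ⟨a, b, -, -, hab⟩ := hΔt
    refine squeeze_zero (fun n => (G n).Δt_pos.le) (fun n => (hab n).2) ?_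
    simpa using hG.const_mul b
  have hu_comp : ∀ n, ∀ i,
      (G n).intCells (fun K => (G n).proj (fun x => u₀ x i) K ^ 2) ≤ uhi ^ 2 := fun n i =>
    le_trans (NSF.Mesh.intCells_mono fun K => NSF.sq_le_sum_sq
      (fun i => (G n).proj (fun x => u₀ x i) K) i) (Real.sqrt_le_iff.1 (hu_init n)).2
  obtain ⟨C, sub, V, hsub, ha⟩ := NSF.exists_isApproximation hL hT hε₀ hε₁ hρlo hθlo hG hΔ hρ₀ hθ₀
    hu₀ hρ_init hθ_init hu_comp fun n => (hsol n).isBoundedSolution hd0 hL hρlo hθlo (hu_init n)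
      (hρ n) (hθ n)
  refine ⟨sub, V, hsub, ha.generates_approx, ?_, ha.isDMVSolution⟩
  filter_upwards [ha.ae_young_mem] with p hp
  filter_upwards [hp] with U hU using hU.1
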